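/- Let $(M,g)$ be a smooth Riemannian manifold with boundary, of dimension $n\ge 3$ and with non-negative scalar curvature, and let $\partial^{c}M$ be a compact connected component of its boundary. For a boundary component with induced metric $h$ and outgoing unit normal $\varsigma$, the second fundamental form is $\Theta(v,w)=\langle\nabla_v\varsigma,w\rangle$ and the mean curvature is $\theta=\mathrm{tr}_h\Theta$. Suppose that $\theta\ge\theta_0$ on $\partial^{c}M$ for a constant $\theta_0>0$. Then for every $\varepsilon>0$ the manifold $(M,g)$ can be extended beyond $\partial^{c}M$ by adding a collar, as follows: there are a smooth manifold with boundary $\bar M$, a $C^{2}$ Riemannian metric $\bar g$ on $\bar M$ with non-negative scalar curvature, and a smooth isometric embedding $\varphi:M\to\bar M$ such that 1. $\partial\bar M=\varphi(\partial M\setminus\partial^{c}M)\cup\partial^{c}\bar M$, where $\partial^{c}\bar M$ is a connected component of $\partial\bar M$ disjoint from $\varphi(M)$, and there is a diffeomorphism $\Phi$ from $\partial^{c}M\times[0,1]$ onto $\bar M\setminus\varphi(M\setminus\partial^{c}M)$ with $\Phi(p,0)=\varphi(p)$ for $p\in\partial^{c}M$ and $\Phi(\partial^{c}M\times\{1\})=\partial^{c}\bar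 M$; 2. the second fundamental form $\bar\Theta$ of $\partial^{c}\bar M$ with respect to the outgoing unit normal and the metric $\bar h$ induced by $\bar g$ on $\partial^{c}\bar M$ satisfy $$\bar\Theta>\frac{\theta_0}{2(n-1)}\,\bar h ,$$ that is, $\bar\Theta(v,v)>\frac{\theta_0}{2(n-1)}\bar h(v,v)$ for every non-zero vector $v$ tangent to $\partial^{c}\bar M$; 3. the $\bar g$-distance between $\partial^{c}\bar M$ and $\varphi(\partial^{c}M)$ is less than $\varepsilon$; more precisely, every point of either set is at $\bar g$-distance less than $\varepsilon$ from some point of the other. -/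

import Mathlib

open scoped Manifold ContDiff Bundle

universe u

noncomputable section

/-! ## Local Riemannian geometry in coordinates

`G y` is the matrix of metric components `g_{ij}` at the point `y` of the coordinate domain, and
derivatives are taken within a set `s` (the closed half space, so that they are one-sided at
boundary points). -/

namespace LocalRiem

variable {n : ℕ}

/-- The partial derivative `∂_k f` at `y`, within `s`. -/
def partialWithin (s : Set (EuclideanSpace ℝ (Fin n))) (k : Fin n)
    (f : EuclideanSpace ℝ (Fin n) → ℝ) (y : EuclideanSpace ℝ (Fin n)) : ℝ :=
  fderivWithin ℝ f s y (EuclideanSpace.single k 1)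

/-- The Christoffel symbol `Γ^k_{ij} = ½ g^{kl} (∂_i g_{jl} + ∂_j g_{il} - ∂_l g_{ij})`. -/
def christoffel (s : Set (EuclideanSpace ℝ (Fin n)))
    (G : EuclideanSpace ℝ (Fin n) → Matrix (Fin n) (Fin n) ℝ) (k i j : Fin n)
    (y : EuclideanSpace ℝ (Fin n)) : ℝ :=
  (1 / 2) * ∑ l, (G y)⁻¹ k l *
    (partialWithin s i (fun z => G z j l) y + partialWithin s j (fun z => G z i l) y
      - partialWithin s l (fun z => G z i j) y)

/-- The Ricci curvature
`R_{ij} = ∂_k Γ^k_{ij} - ∂_j Γ^k_{ik} + Γ^k_{kl} Γ^l_{ij} - Γ^k_{jl} Γ^l_{ik}`. -/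
def ricci (s : Set (EuclideanSpace ℝ (Fin n)))
    (G : EuclideanSpace ℝ (Fin n) → Matrix (Fin n) (Fin n) ℝ) (i j : Fin n)
    (y : EuclideanSpace ℝ (Fin n)) : ℝ :=
  ∑ k, (partialWithin s k (christoffel s G k i j) y - partialWithin s j (christoffel s G k i k) y)
    + ∑ k, ∑ l, (christoffel s G k k l y * christoffel s G l i j y
      - christoffel s G k j l y * christoffel s G l i k y)

/-- The scalar curvature `R = g^{ij} R_{ij}`. -/
def scalar (s : Set (EuclideanSpace ℝ (Fin n)))
    (G : EuclideanSpace ℝ (Fin n) → Matrix (Fin n) (Fin n) ℝ)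
    (y : EuclideanSpace ℝ (Fin n)) : ℝ :=
  ∑ i, ∑ j, (G y)⁻¹ i j * ricci s G i j y

/-- The component `(∇_{∂_i} X)^k = ∂_i X^k + Γ^k_{ij} X^j` of the Levi-Civita covariant derivative
of the vector field with components `X`. -/
def covDeriv (s : Set (EuclideanSpace ℝ (Fin n)))
    (G : EuclideanSpace ℝ (Fin n) → Matrix (Fin n) (Fin n) ℝ)
    (X : EuclideanSpace ℝ (Fin n) → Fin n → ℝ) (i k : Fin n)
    (y : EuclideanSpace ℝ (Fin n)) : ℝ :=
  partialWithin s i (fun z => X z k) y + ∑ j, christoffel s G k i j y * X y j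

variable [NeZero n]

/-- The components `ς^k = -g^{k0} / √g^{00}` of `-grad x₀ / |grad x₀|`. Along the boundary
`{x₀ = 0}` of the half space `{x₀ ≥ 0}` this is the outgoing unit normal. -/
def outerNormal (G : EuclideanSpace ℝ (Fin n) → Matrix (Fin n) (Fin n) ℝ)
    (y : EuclideanSpace ℝ (Fin n)) (k : Fin n) : ℝ :=
  -(G y)⁻¹ k 0 / Real.sqrt ((G y)⁻¹ 0 0)

/-- `Θ(v, w) = ⟨∇_v ς, w⟩`, where `ς` is the outgoing unit normal. -/
def secondForm (s : Set (EuclideanSpace ℝ (Fin n)))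
    (G : EuclideanSpace ℝ (Fin n) → Matrix (Fin n) (Fin n) ℝ)
    (y v w : EuclideanSpace ℝ (Fin n)) : ℝ :=
  ∑ i, ∑ k, ∑ l, G y k l * (v i * covDeriv s G (outerNormal G) i k y) * w l

/-- `θ = tr_h Θ = h^{ab} Θ_{ab}`, where `h_{ab}`, `a, b ≠ 0`, are the components of the metric
induced on `{x₀ = 0}`. -/
def meanCurv (s : Set (EuclideanSpace ℝ (Fin n)))
    (G : EuclideanSpace ℝ (Fin n) → Matrix (Fin n) (Fin n) ℝ)
    (y : EuclideanSpace ℝ (Fin n)) : ℝ :=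
  ∑ a : {i : Fin n // i ≠ 0}, ∑ b : {i : Fin n // i ≠ 0},
    (Matrix.of fun c d : {i : Fin n // i ≠ 0} => G y c d)⁻¹ a b *
      secondForm s G y (EuclideanSpace.single a.1 1) (EuclideanSpace.single b.1 1)

end LocalRiem

/-! ## Riemannian manifolds with boundary -/

/-- A Riemannian metric of class `C^k` on a manifold with boundary of dimension `n`. -/
abbrev RMetric (n : ℕ) [NeZero n] (k : WithTop ℕ∞) (M : Type*) [TopologicalSpace M]
    [ChartedSpace (EuclideanHalfSpace n) M] [IsManifold (𝓡∂ n) ∞ M] :=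
  Bundle.ContMDiffRiemannianMetric (𝓡∂ n) k (EuclideanSpace ℝ (Fin n))
    (fun x : M => TangentSpace (𝓡∂ n) x)

namespace RMetric

variable {n : ℕ} [NeZero n] {k : WithTop ℕ∞} {M : Type*} [TopologicalSpace M]
  [ChartedSpace (EuclideanHalfSpace n) M] [IsManifold (𝓡∂ n) ∞ M]

/-- The components `g_{ij} = g(∂_i, ∂_j)` of `g` in the chart of `M` at `x`, as functions of the
coordinates. -/
def components (g : RMetric n k M) (x : M) (y : EuclideanSpace ℝ (Fin n)) :
    Matrix (Fin n) (Fin n) ℝ :=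
  Matrix.of fun i j =>
    g.inner ((extChartAt (𝓡∂ n) x).symm y)
      (mfderivWithin 𝓘(ℝ, EuclideanSpace ℝ (Fin n)) (𝓡∂ n) (extChartAt (𝓡∂ n) x).symm
        (Set.range (𝓡∂ n)) y (EuclideanSpace.single i (1 : ℝ) : EuclideanSpace ℝ (Fin n)))
      (mfderivWithin 𝓘(ℝ, EuclideanSpace ℝ (Fin n)) (𝓡∂ n) (extChartAt (𝓡∂ n) x).symm
        (Set.range (𝓡∂ n)) y (EuclideanSpace.single j (1 : ℝ) : EuclideanSpace ℝ (Fin n)))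

/-- The scalar curvature of `g` at `x`. -/
def scalarCurvature (g : RMetric n k M) (x : M) : ℝ :=
  LocalRiem.scalar (Set.range (𝓡∂ n)) (g.components x) (extChartAt (𝓡∂ n) x x)

/-- The second fundamental form of the boundary at the boundary point `x`, with respect to the
outgoing unit normal, on vectors tangent to the boundary. -/
def secondFundamentalForm (g : RMetric n k M) (x : M) (v w : TangentSpace (𝓡∂ n) x) : ℝ :=
  LocalRiem.secondForm (Set.range (𝓡∂ n)) (g.components x) (extChartAt (𝓡∂ n) x x)
    (mfderiv (𝓡∂ n) 𝓘(ℝ, EuclideanSpace ℝ (Fin n)) (extChartAt (𝓡∂ n) x) x v)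
    (mfderiv (𝓡∂ n) 𝓘(ℝ, EuclideanSpace ℝ (Fin n)) (extChartAt (𝓡∂ n) x) x w)

/-- The mean curvature of the boundary at the boundary point `x`, with respect to the outgoing
unit normal. -/
def meanCurvature (g : RMetric n k M) (x : M) : ℝ :=
  LocalRiem.meanCurv (Set.range (𝓡∂ n)) (g.components x) (extChartAt (𝓡∂ n) x x)

/-- The Riemannian distance of `g`: the infimum of the `g`-lengths of `C^1` paths. -/
def riemDist (g : RMetric n k M) (x y : M) : ENNReal :=
  letI : Bundle.RiemannianBundle (fun x : M => TangentSpace (𝓡∂ n) x) := ⟨g.toRiemannianMetric⟩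
  Manifold.riemannianEDist (𝓡∂ n) x y

end RMetric

/-- The vector `v` at the boundary point `x` is tangent to the boundary. -/
def IsTangentToBoundary {n : ℕ} [NeZero n] {M : Type*} [TopologicalSpace M]
    [ChartedSpace (EuclideanHalfSpace n) M] (x : M) (v : TangentSpace (𝓡∂ n) x) : Prop :=
  let u : EuclideanSpace ℝ (Fin n) :=
    mfderiv (𝓡∂ n) 𝓘(ℝ, EuclideanSpace ℝ (Fin n)) (extChartAt (𝓡∂ n) x) x v
  u 0 = 0

/-- `C` is a connected component of the boundary of `M`. -/
def IsBoundaryComponent (n : ℕ) [NeZero n] {M : Type*} [TopologicalSpace M]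
    [ChartedSpace (EuclideanHalfSpace n) M] (C : Set M) : Prop :=
  ∃ p ∈ (𝓡∂ n).boundary M, C = connectedComponentIn ((𝓡∂ n).boundary M) p

/-- `(M', g')` is an extension of `(M, g)` through `φ`, obtained by adding a collar beyond the
boundary component `C` of `M`, with `S` as the boundary component that replaces `C`. -/
structure IsCollarExtension {n : ℕ} [NeZero n] {k k' : WithTop ℕ∞}
    {M : Type*} [TopologicalSpace M] [ChartedSpace (EuclideanHalfSpace n) M]
    [IsManifold (𝓡∂ n) ∞ M]
    {M' : Type*} [TopologicalSpace M'] [ChartedSpace (EuclideanHalfSpace n) M']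
    [IsManifold (𝓡∂ n) ∞ M']
    (g : RMetric n k M) (C : Set M) (g' : RMetric n k' M') (φ : M → M') (S : Set M') : Prop where
  /-- `φ` is a smooth embedding: a smooth immersion that is a homeomorphism onto its image. -/
  contMDiff : ContMDiff (𝓡∂ n) (𝓡∂ n) ∞ φ
  injective_mfderiv : ∀ x, Function.Injective (mfderiv (𝓡∂ n) (𝓡∂ n) φ x)
  isEmbedding : Topology.IsEmbedding φ
  /-- `φ` is isometric. -/
  isometric : ∀ (x : M) (v w : TangentSpace (𝓡∂ n) x),
    g'.inner (φ x) (mfderiv (𝓡∂ n) (𝓡∂ n) φ x v) (mfderiv (𝓡∂ n) (𝓡∂ n) φ x w) = g.inner x v w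
  /-- The boundary of `M'` is that of `M`, with `C` replaced by the new component `S`. -/
  isBoundaryComponent : IsBoundaryComponent n S
  disjoint_range : Disjoint S (Set.range φ)
  boundary_eq : (𝓡∂ n).boundary M' = φ '' ((𝓡∂ n).boundary M \ C) ∪ S
  /-- `M' \ φ(M \ C)` is a collar `C × [0, 1]`, attached along `C × {0}`, with `S` as `C × {1}`:
  `Φ` and `Ψ` are mutually inverse smooth maps between these two subsets of `M × ℝ` and `M'`. -/
  exists_collar : ∃ (Φ : M × ℝ → M') (Ψ : M' → M × ℝ),
    ContMDiffOn ((𝓡∂ n).prod 𝓘(ℝ, ℝ)) (𝓡∂ n) ∞ Φ (C ×ˢ Set.Icc (0 : ℝ) 1) ∧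
    ContMDiffOn (𝓡∂ n) ((𝓡∂ n).prod 𝓘(ℝ, ℝ)) ∞ Ψ (φ '' Cᶜ)ᶜ ∧
    Set.MapsTo Φ (C ×ˢ Set.Icc (0 : ℝ) 1) (φ '' Cᶜ)ᶜ ∧
    Set.MapsTo Ψ (φ '' Cᶜ)ᶜ (C ×ˢ Set.Icc (0 : ℝ) 1) ∧
    Set.InvOn Ψ Φ (C ×ˢ Set.Icc (0 : ℝ) 1) (φ '' Cᶜ)ᶜ ∧
    (∀ p ∈ C, Φ (p, 0) = φ p) ∧
    S = Φ '' (C ×ˢ {(1 : ℝ)})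

end

/-!
The extended manifold can be taken to be `M` itself. The collar neighbourhood theorem
(`exists_collar`) provides a collar of `C` with parameter `t`, and the given manifold is embedded
into `M` by sliding it inward along the collar lines (`Collar.slide`), by the parameter `δ` near `C`
and not at all far from `C`. The embedded copy leaves free the region `t < δ`, which is the new
collar; `t = δ` is the seam and `t = 0` the new boundary. What remains is to extend the metric, which
is transported by the slide, over this region.

In coordinates in which `t` is the zeroth coordinate, put `r = δ - t`, so that `r = 0` is the seam.
The metric on the new collar is `Q + u(r) S` (`LocalRiem.collarFamily`), with the following data.

* `Q` is the Hestenes reflection of the given metric across the seam (`LocalRiem.reflMetric`). The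
  coefficients of the reflection are such that `Q` and the given metric fit together to a metric of
  class `C²` (`LocalRiem.contDiffAt_reflExt`). In particular `Q` has non-negative scalar curvature
  on the seam (`LocalRiem.scalar_reflMetric`), where its second fundamental form is `-Θ` with
  respect to the direction of decreasing `r`, and hence `Θ` seen from the other side.
* `S = 2 N (λ h - Θ)` is constant along the collar lines (`LocalRiem.collarTensor`), where `N` is
  the lapse and `λ = 3 θ₀ / (4 (n - 1))` lies between `θ₀ / (2 (n - 1))` and `θ₀ / (n - 1)`.
* `u(r) = r³ / (3 δ²)` for `r ≥ 0` (`LocalRiem.bump`), continued by `0`, which is of class `C²`.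

At `r = δ` the value `u(δ) = δ / 3` is small, while the derivative of `u` is `1`. So the second
fundamental form of the new boundary is close to `Θ + (λ h - Θ) = λ h`
(`LocalRiem.christoffelJet_fam`), which exceeds `θ₀ / (2 (n - 1)) h`.

The scalar curvature is affine in the second derivatives of the metric (`LocalRiem.scalar_eq_jet`).
The second derivative `2 r / δ²` of `u` is multiplied by a positive multiple of
`tr Θ - (n - 1) λ > 0` (`LocalRiem.famSymbol_pos`), whereas all other terms depend on `r`, `u` and the
first derivative of `u` only, and so differ by at most a constant times `r / δ` from their value on
the seam, which is non-negative. For small `δ` the former dominates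
(`LocalRiem.eventually_scalar_fam_nonneg`). This is an estimate near a boundary point, and it becomes
uniform by compactness of `C` (`Collar.eventually_good`).

The metric so defined does not depend on the choice of the collar chart
(`Collar.IsCollarChart.isPullbackAt_shiftedMetric`): changes of collar charts commute with the
translations along the collar lines, and `Q` and `S` are built from invariants. That scalar
curvature, second fundamental form and mean curvature can be computed in any chart rests on their
naturality under pullback (`LocalRiem.scalar_pullback`, `LocalRiem.secondForm_pullback`), which is
derived from the transformation law of the Christoffel symbols (`LocalRiem.chr_pullback`). The
collar lines have length at most `ε / 2` for small `δ` (`Collar.riemDist_slide_le`), which gives the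
estimate of the distance.
-/

noncomputable section

set_option linter.unusedSectionVars false

open Set Filter Topology

open LocalRiem

/-! ### Christoffel symbols under pullback -/

section

/-- The coordinate space `ℝⁿ`. -/
abbrev Coord (n : ℕ) := EuclideanSpace ℝ (Fin n)

/-- The `i`-th vector of the standard basis of `ℝⁿ`. -/
abbrev stdVec {n : ℕ} (i : Fin n) : Coord n := EuclideanSpace.single i (1 : ℝ)

namespace LocalRiem

variable {n : ℕ}

/-- The bilinear form on `ℝⁿ` with matrix `A`. -/
def bil (A : Matrix (Fin n) (Fin n) ℝ) (u v : Coord n) : ℝ := ∑ i, ∑ j, A i j * u i * v j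

lemma bil_add_left (A : Matrix (Fin n) (Fin n) ℝ) (u u' v : Coord n) :
    bil A (u + u') v = bil A u v + bil A u' v := by
  simp [bil, mul_add, add_mul, Finset.sum_add_distrib]

lemma bil_add_right (A : Matrix (Fin n) (Fin n) ℝ) (u v v' : Coord n) :
    bil A u (v + v') = bil A u v + bil A u v' := by
  simp [bil, mul_add, Finset.sum_add_distrib]

lemma bil_smul_left (A : Matrix (Fin n) (Fin n) ℝ) (c : ℝ) (u v : Coord n) :
    bil A (c • u) v = c * bil A u v := by
  simp only [bil, Finset.mul_sum, PiLp.smul_apply, smul_eq_mul]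
  exact Finset.sum_congr rfl fun i _ => Finset.sum_congr rfl fun j _ => by ring

lemma bil_smul_right (A : Matrix (Fin n) (Fin n) ℝ) (c : ℝ) (u v : Coord n) :
    bil A u (c • v) = c * bil A u v := by
  simp only [bil, Finset.mul_sum, PiLp.smul_apply, smul_eq_mul]
  exact Finset.sum_congr rfl fun i _ => Finset.sum_congr rfl fun j _ => by ring

lemma bil_matrix_add (A B : Matrix (Fin n) (Fin n) ℝ) (u v : Coord n) :
    bil (A + B) u v = bil A u v + bil B u v := by
  simp [bil, add_mul, Finset.sum_add_distrib]

lemma bil_matrix_smul (c : ℝ) (A : Matrix (Fin n) (Fin n) ℝ) (u v : Coord n) :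
    bil (c • A) u v = c * bil A u v := by
  simp [bil, Finset.mul_sum, mul_assoc]

lemma bil_comm {A : Matrix (Fin n) (Fin n) ℝ} (hA : A.IsSymm) (u v : Coord n) :
    bil A u v = bil A v u := by
  unfold bil
  rw [Finset.sum_comm]
  refine Finset.sum_congr rfl fun i _ => Finset.sum_congr rfl fun j _ => ?_
  rw [hA.apply]; ring

@[simp] lemma bil_stdVec (A : Matrix (Fin n) (Fin n) ℝ) (i j : Fin n) :
    bil A (stdVec i) (stdVec j) = A i j := by
  simp [bil]

lemma bil_eq_dotProduct (A : Matrix (Fin n) (Fin n) ℝ) (u v : Coord n) :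
    bil A u v = dotProduct u.ofLp (A.mulVec v.ofLp) := by
  simp only [bil, dotProduct, Matrix.mulVec, Finset.mul_sum]
  exact Finset.sum_congr rfl fun i _ => Finset.sum_congr rfl fun j _ => by ring

lemma sum_smul_stdVec (v : Coord n) : ∑ i, v i • stdVec i = v := by
  ext k; simp [Pi.single_apply]

lemma bil_sum_left {ι : Type*} (t : Finset ι) (A : Matrix (Fin n) (Fin n) ℝ) (v : Coord n)
    (f : ι → Coord n) : bil A (∑ i ∈ t, f i) v = ∑ i ∈ t, bil A (f i) v :=
  map_sum (AddMonoidHom.mk' (fun u => bil A u v) (fun _ _ => bil_add_left A _ _ v)) f t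

lemma matrix_eq_of_bil_eq {A B : Matrix (Fin n) (Fin n) ℝ} (h : ∀ u v, bil A u v = bil B u v) :
    A = B := by
  ext i j; simpa using h (stdVec i) (stdVec j)

lemma bil_congr_right {A : Matrix (Fin n) (Fin n) ℝ} (hA : A.det ≠ 0) {u u' : Coord n}
    (hs : A.IsSymm) (h : ∀ w, bil A u w = bil A u' w) : u = u' := by
  have key : A.mulVec u.ofLp = A.mulVec u'.ofLp := by
    funext k
    have := h (stdVec k)
    rw [bil_comm hs, bil_comm hs u', bil_eq_dotProduct, bil_eq_dotProduct] at this
    simpa using this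
  have hu : IsUnit A.det := isUnit_iff_ne_zero.2 hA
  have h2 := congrArg (A⁻¹.mulVec) key
  simp only [Matrix.mulVec_mulVec, Matrix.nonsing_inv_mul _ hu, Matrix.one_mulVec] at h2
  exact PiLp.ext fun k => congrFun h2 k

/-- The matrix of the derivatives, in the direction `w`, of the entries of `B`. -/
def dmat (B : Coord n → Matrix (Fin n) (Fin n) ℝ) (s : Set (Coord n)) (y w : Coord n) :
    Matrix (Fin n) (Fin n) ℝ :=
  Matrix.of fun i j => fderivWithin ℝ (fun z => B z i j) s y w

lemma dmat_add (B : Coord n → Matrix (Fin n) (Fin n) ℝ) (s : Set (Coord n)) (y w w' : Coord n) :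
    dmat B s y (w + w') = dmat B s y w + dmat B s y w' := by
  ext i j; simp [dmat]

lemma dmat_smul (B : Coord n → Matrix (Fin n) (Fin n) ℝ) (s : Set (Coord n)) (y w : Coord n)
    (c : ℝ) : dmat B s y (c • w) = c • dmat B s y w := by
  ext i j; simp [dmat]

lemma dmat_isSymm {B : Coord n → Matrix (Fin n) (Fin n) ℝ} {s : Set (Coord n)} {y : Coord n}
    (h : ∀ᶠ z in 𝓝[s] y, (B z).IsSymm) (hy : y ∈ s) (w : Coord n) : (dmat B s y w).IsSymm := by
  ext i j
  simp only [dmat, Matrix.transpose_apply, Matrix.of_apply]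
  rw [Filter.EventuallyEq.fderivWithin_eq (f₁ := fun z => B z j i) (f := fun z => B z i j)]
  · filter_upwards [h] with z hz using hz.apply i j
  · exact (h.self_of_nhdsWithin hy).apply i j

/-- The Leibniz rule for `z ↦ B_z(X_z, Y_z)`. -/
lemma fderivWithin_bil {B : Coord n → Matrix (Fin n) (Fin n) ℝ} {s : Set (Coord n)} {y : Coord n}
    {X Y : Coord n → Coord n} (hs : UniqueDiffWithinAt ℝ s y)
    (hB : ∀ i j, DifferentiableWithinAt ℝ (fun z => B z i j) s y)
    (hX : DifferentiableWithinAt ℝ X s y) (hY : DifferentiableWithinAt ℝ Y s y) (w : Coord n) :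
    fderivWithin ℝ (fun z => bil (B z) (X z) (Y z)) s y w =
      bil (dmat B s y w) (X y) (Y y) + bil (B y) (fderivWithin ℝ X s y w) (Y y)
        + bil (B y) (X y) (fderivWithin ℝ Y s y w) := by
  have hXi : ∀ i, HasFDerivWithinAt (fun z => X z i)
      ((EuclideanSpace.proj i : Coord n →L[ℝ] ℝ).comp (fderivWithin ℝ X s y)) s y := fun i =>
    (EuclideanSpace.proj i : Coord n →L[ℝ] ℝ).hasFDerivAt.comp_hasFDerivWithinAt y
      hX.hasFDerivWithinAt
  have hYi : ∀ i, HasFDerivWithinAt (fun z => Y z i)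
      ((EuclideanSpace.proj i : Coord n →L[ℝ] ℝ).comp (fderivWithin ℝ Y s y)) s y := fun i =>
    (EuclideanSpace.proj i : Coord n →L[ℝ] ℝ).hasFDerivAt.comp_hasFDerivWithinAt y
      hY.hasFDerivWithinAt
  have := HasFDerivWithinAt.fun_sum (u := Finset.univ) fun i _ =>
    HasFDerivWithinAt.fun_sum (u := Finset.univ) fun j _ =>
      (((hB i j).hasFDerivWithinAt.mul (hXi i)).mul (hYi j))
  unfold bil
  have h2 := this.fderivWithin hs
  simp only [Pi.mul_apply] at h2
  erw [h2]
  simp only [dmat, sum_apply, add_apply,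
    smul_apply, ContinuousLinearMap.comp_apply, smul_eq_mul,
    ← Finset.sum_add_distrib, Matrix.of_apply]
  have hp : ∀ (k : Fin n) (x : Coord n), (EuclideanSpace.proj k : Coord n →L[ℝ] ℝ) x = x k :=
    fun _ _ => rfl
  simp only [hp]
  exact Finset.sum_congr rfl fun i _ => Finset.sum_congr rfl fun j _ => by ring

lemma differentiableWithinAt_bil {B : Coord n → Matrix (Fin n) (Fin n) ℝ} {s : Set (Coord n)}
    {y : Coord n} {X Y : Coord n → Coord n}
    (hB : ∀ i j, DifferentiableWithinAt ℝ (fun z => B z i j) s y)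
    (hX : DifferentiableWithinAt ℝ X s y) (hY : DifferentiableWithinAt ℝ Y s y) :
    DifferentiableWithinAt ℝ (fun z => bil (B z) (X z) (Y z)) s y := by
  unfold bil
  have h1 : ∀ i, DifferentiableWithinAt ℝ (fun z => X z i) s y := fun i =>
    (EuclideanSpace.proj i : Coord n →L[ℝ] ℝ).differentiableAt.comp_differentiableWithinAt y hX
  have h2 : ∀ i, DifferentiableWithinAt ℝ (fun z => Y z i) s y := fun i =>
    (EuclideanSpace.proj i : Coord n →L[ℝ] ℝ).differentiableAt.comp_differentiableWithinAt y hY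
  exact DifferentiableWithinAt.fun_sum fun i _ => DifferentiableWithinAt.fun_sum fun j _ =>
    ((hB i j).mul (h1 i)).mul (h2 j)

/-- Half of the Koszul expression `∂_u g(v, w) + ∂_v g(u, w) - ∂_w g(u, v)`. -/
def koszul (s : Set (Coord n)) (G : Coord n → Matrix (Fin n) (Fin n) ℝ) (y u v w : Coord n) : ℝ :=
  (1 / 2) * (bil (dmat G s y u) v w + bil (dmat G s y v) u w - bil (dmat G s y w) u v)

/-- The vector `Γ(u, v)` with the components `Γ^k_{ij} u^i v^j`. -/
def chr (s : Set (Coord n)) (G : Coord n → Matrix (Fin n) (Fin n) ℝ) (y u v : Coord n) : Coord n :=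
  WithLp.toLp 2 ((G y)⁻¹.mulVec fun l => koszul s G y u v (stdVec l))

lemma chr_stdVec (s : Set (Coord n)) (G : Coord n → Matrix (Fin n) (Fin n) ℝ) (y : Coord n)
    (k i j : Fin n) : chr s G y (stdVec i) (stdVec j) k = christoffel s G k i j y := by
  simp only [chr, christoffel, Matrix.mulVec, dotProduct, koszul, bil_stdVec, Finset.mul_sum,
    partialWithin, dmat, Matrix.of_apply]
  exact Finset.sum_congr rfl fun l _ => by ring

lemma koszul_add_left (s : Set (Coord n)) (G : Coord n → Matrix (Fin n) (Fin n) ℝ)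
    (y u u' v w : Coord n) :
    koszul s G y (u + u') v w = koszul s G y u v w + koszul s G y u' v w := by
  simp only [koszul, dmat_add, bil_matrix_add, bil_add_left]; ring

lemma koszul_smul_left (s : Set (Coord n)) (G : Coord n → Matrix (Fin n) (Fin n) ℝ)
    (c : ℝ) (y u v w : Coord n) :
    koszul s G y (c • u) v w = c * koszul s G y u v w := by
  simp only [koszul, dmat_smul, bil_matrix_smul, bil_smul_left]; ring

lemma koszul_add_middle (s : Set (Coord n)) (G : Coord n → Matrix (Fin n) (Fin n) ℝ)
    (y u v v' w : Coord n) :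
    koszul s G y u (v + v') w = koszul s G y u v w + koszul s G y u v' w := by
  simp only [koszul, dmat_add, bil_matrix_add, bil_add_left, bil_add_right]; ring

lemma koszul_smul_middle (s : Set (Coord n)) (G : Coord n → Matrix (Fin n) (Fin n) ℝ)
    (c : ℝ) (y u v w : Coord n) :
    koszul s G y u (c • v) w = c * koszul s G y u v w := by
  simp only [koszul, dmat_smul, bil_matrix_smul, bil_smul_left, bil_smul_right]; ring

lemma koszul_add_right (s : Set (Coord n)) (G : Coord n → Matrix (Fin n) (Fin n) ℝ)
    (y u v w w' : Coord n) :
    koszul s G y u v (w + w') = koszul s G y u v w + koszul s G y u v w' := by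
  simp only [koszul, dmat_add, bil_matrix_add, bil_add_right]; ring

lemma koszul_smul_right (s : Set (Coord n)) (G : Coord n → Matrix (Fin n) (Fin n) ℝ)
    (c : ℝ) (y u v w : Coord n) :
    koszul s G y u v (c • w) = c * koszul s G y u v w := by
  simp only [koszul, dmat_smul, bil_matrix_smul, bil_smul_right]; ring

lemma koszul_eq_sum (s : Set (Coord n)) (G : Coord n → Matrix (Fin n) (Fin n) ℝ)
    (y u v w : Coord n) : koszul s G y u v w = ∑ l, w l * koszul s G y u v (stdVec l) := by
  conv_lhs => rw [← sum_smul_stdVec w]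
  have := map_sum (AddMonoidHom.mk' (koszul s G y u v) (koszul_add_right s G y u v))
    (fun i => w i • stdVec i) Finset.univ
  simp only [AddMonoidHom.mk'_apply] at this
  rw [this]
  exact Finset.sum_congr rfl fun l _ => koszul_smul_right ..

/-- The Koszul formula. -/
lemma bil_chr {s : Set (Coord n)} {G : Coord n → Matrix (Fin n) (Fin n) ℝ} {y : Coord n}
    (hd : (G y).det ≠ 0) (hsym : (G y).IsSymm) (u v w : Coord n) :
    bil (G y) (chr s G y u v) w = koszul s G y u v w := by
  rw [bil_comm hsym, bil_eq_dotProduct, koszul_eq_sum]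
  simp only [chr, Matrix.mulVec_mulVec]
  rw [Matrix.mul_nonsing_inv _ (isUnit_iff_ne_zero.2 hd), Matrix.one_mulVec]
  rfl

/-- `Γ` as a continuous bilinear map. -/
def chrL (s : Set (Coord n)) (G : Coord n → Matrix (Fin n) (Fin n) ℝ) (y : Coord n) :
    Coord n →L[ℝ] Coord n →L[ℝ] Coord n :=
  LinearMap.toContinuousLinearMap
    { toFun := fun u => LinearMap.toContinuousLinearMap
        { toFun := fun v => chr s G y u v
          map_add' := fun v v' => by
            ext k
            simp only [chr, koszul_add_middle, Matrix.mulVec, dotProduct, mul_add,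
              Finset.sum_add_distrib, PiLp.add_apply]
          map_smul' := fun c v => by
            ext k
            simp only [chr, koszul_smul_middle, Matrix.mulVec, dotProduct, PiLp.smul_apply,
              smul_eq_mul, Finset.mul_sum, RingHom.id_apply]
            exact Finset.sum_congr rfl fun _ _ => by ring }
      map_add' := fun u u' => by
        ext v k
        simp only [chr, koszul_add_left, Matrix.mulVec, dotProduct, mul_add,
          Finset.sum_add_distrib, PiLp.add_apply, LinearMap.coe_toContinuousLinearMap',
          LinearMap.coe_mk, AddHom.coe_mk, add_apply]
      map_smul' := fun c u => by
        ext v k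
        simp only [chr, koszul_smul_left, Matrix.mulVec, dotProduct, PiLp.smul_apply,
          smul_eq_mul, Finset.mul_sum, RingHom.id_apply, LinearMap.coe_toContinuousLinearMap',
          LinearMap.coe_mk, AddHom.coe_mk, smul_apply]
        exact Finset.sum_congr rfl fun _ _ => by ring }

@[simp] lemma chrL_apply (s : Set (Coord n)) (G : Coord n → Matrix (Fin n) (Fin n) ℝ)
    (y u v : Coord n) : chrL s G y u v = chr s G y u v := rfl

lemma chr_symm {s : Set (Coord n)} {G : Coord n → Matrix (Fin n) (Fin n) ℝ} {y : Coord n}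
    (hy : y ∈ s) (hsym : ∀ᶠ z in 𝓝[s] y, (G z).IsSymm) (u v : Coord n) :
    chr s G y u v = chr s G y v u := by
  have : ∀ w, koszul s G y u v w = koszul s G y v u w := fun w => by
    simp only [koszul]
    rw [bil_comm (dmat_isSymm hsym hy w) u v]; ring
  simp only [chr, this]

/-- The metric `A` is the pullback of `B` under `T` near `y`, within `s`. -/
def IsPullbackAt (s : Set (Coord n)) (T : Coord n → Coord n)
    (A B : Coord n → Matrix (Fin n) (Fin n) ℝ) (y : Coord n) : Prop :=
  ∀ u v, bil (A y) u v = bil (B (T y)) (fderivWithin ℝ T s y u) (fderivWithin ℝ T s y v)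

/-- The transformation law of the Christoffel symbols,
`DT(Γ_A(u, v)) = D²T(u, v) + Γ_B(DT u, DT v)` for `A = T^* B`. -/
lemma chr_pullback {s s' : Set (Coord n)} {T : Coord n → Coord n}
    {A B : Coord n → Matrix (Fin n) (Fin n) ℝ} {y : Coord n} (hs : UniqueDiffOn ℝ s) (hy : y ∈ s)
    (hcl : y ∈ closure (interior s))
    (hT : ContDiffWithinAt ℝ 2 T s y) (hmap : MapsTo T s s')
    (hAB : ∀ᶠ z in 𝓝[s] y, IsPullbackAt s T A B z)
    (hA : (A y).det ≠ 0) (hAs : ∀ᶠ z in 𝓝[s] y, (A z).IsSymm)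
    (hB : (B (T y)).det ≠ 0) (hBs : (B (T y)).IsSymm)
    (hBd : ∀ i j, DifferentiableWithinAt ℝ (fun z => B z i j) s' (T y))
    (hsurj : Function.Surjective (fderivWithin ℝ T s y)) (u v : Coord n) :
    fderivWithin ℝ T s y (chr s A y u v) =
      fderivWithin ℝ (fderivWithin ℝ T s) s y u v
        + chr s' B (T y) (fderivWithin ℝ T s y u) (fderivWithin ℝ T s y v) := by
  have hTd : DifferentiableWithinAt ℝ T s y := hT.differentiableWithinAt (by norm_num)
  have hJ : DifferentiableWithinAt ℝ (fderivWithin ℝ T s) s y :=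
    ((hT.fderivWithin_right (m := 1) hs (by norm_num) hy)).differentiableWithinAt (by norm_num)
  have hJu : ∀ u, HasFDerivWithinAt (fun z => fderivWithin ℝ T s z u)
      ((fderivWithin ℝ (fderivWithin ℝ T s) s y).flip u) s y := fun u => by
    simpa using hJ.hasFDerivWithinAt.clm_apply (hasFDerivWithinAt_const u y s)
  have hsymm : ∀ u v, fderivWithin ℝ (fderivWithin ℝ T s) s y u v
      = fderivWithin ℝ (fderivWithin ℝ T s) s y v u := fun u v =>
    (hT.isSymmSndFDerivWithinAt (by simp) hs hcl hy) u v
  have hcomp : ∀ i j, DifferentiableWithinAt ℝ (fun z => B (T z) i j) s y := fun i j =>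
    (hBd i j).comp y hTd hmap
  have hdm : ∀ w, dmat (fun z => B (T z)) s y w = dmat B s' (T y) (fderivWithin ℝ T s y w) := by
    intro w; ext i j
    simp only [dmat, Matrix.of_apply]
    have := fderivWithin_comp y (hBd i j) hTd hmap (hs y hy)
    have h2 := congrArg (fun L => L w) this
    simpa [Function.comp_def] using h2
  -- Differentiating the pullback identity in the direction `w`.
  have hder : ∀ w u v, bil (dmat A s y w) u v =
      bil (dmat B s' (T y) (fderivWithin ℝ T s y w)) (fderivWithin ℝ T s y u)
        (fderivWithin ℝ T s y v)
      + bil (B (T y)) (fderivWithin ℝ (fderivWithin ℝ T s) s y w u) (fderivWithin ℝ T s y v)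
      + bil (B (T y)) (fderivWithin ℝ T s y u)
        (fderivWithin ℝ (fderivWithin ℝ T s) s y w v) := by
    intro w u v
    have hAd : ∀ i j, DifferentiableWithinAt ℝ (fun z => A z i j) s y := fun i j => by
      refine DifferentiableWithinAt.congr_of_eventuallyEq
        (differentiableWithinAt_bil hcomp (hJu (stdVec i)).differentiableWithinAt
        (hJu (stdVec j)).differentiableWithinAt) ?_ ?_
      · filter_upwards [hAB] with z hz
        simpa using hz (stdVec i) (stdVec j)
      · simpa using (hAB.self_of_nhdsWithin hy) (stdVec i) (stdVec j)
    have h1 := fderivWithin_bil (hs y hy) hAd (differentiableWithinAt_const u)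
      (differentiableWithinAt_const v) w
    have h2 := fderivWithin_bil (hs y hy) hcomp (hJu u).differentiableWithinAt
      (hJu v).differentiableWithinAt w
    rw [(hJu u).fderivWithin (hs y hy), (hJu v).fderivWithin (hs y hy), hdm] at h2
    have h3 : fderivWithin ℝ (fun z => bil (A z) u v) s y w = fderivWithin ℝ
        (fun z => bil (B (T z)) (fderivWithin ℝ T s z u) (fderivWithin ℝ T s z v)) s y w := by
      rw [Filter.EventuallyEq.fderivWithin_eq]
      · filter_upwards [hAB] with z hz using hz u v
      · exact (hAB.self_of_nhdsWithin hy) u v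
    rw [h3, h2] at h1
    have hz : ∀ x, bil (A y) 0 x = 0 := fun x => by simpa using bil_smul_left (A y) 0 0 x
    have hz' : ∀ x, bil (A y) x 0 = 0 := fun x => by simpa using bil_smul_right (A y) 0 x 0
    simp only [fderivWithin_fun_const, Pi.zero_apply, zero_apply, hz, hz',
      add_zero, ContinuousLinearMap.flip_apply] at h1
    exact h1.symm
  -- Both sides are now tested against the vectors `DT w`, where the Koszul formula applies; the
  -- terms with `D²T` combine by the symmetry of `D²T`.
  refine bil_congr_right hB hBs fun x => ?_
  obtain ⟨w, rfl⟩ := hsurj x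
  rw [bil_add_left, bil_chr hB hBs, ← (hAB.self_of_nhdsWithin hy) _ _,
    bil_chr hA (hAs.self_of_nhdsWithin hy)]
  simp only [koszul, hder]
  rw [hsymm v u, hsymm w u, hsymm w v, bil_comm hBs _ (fderivWithin ℝ T s y v)]
  rw [bil_comm hBs (fderivWithin ℝ T s y v) (fderivWithin ℝ (fderivWithin ℝ T s) s y u w)]
  ring

end LocalRiem

end

/-! ### The curvature operator under pullback -/

section

namespace LocalRiem

variable {n : ℕ}

section Regularity

variable {E : Type*} [NormedAddCommGroup E] [NormedSpace ℝ E] {m : WithTop ℕ∞} {s : Set E} {y : E}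

lemma contDiffWithinAt_det {A : E → Matrix (Fin n) (Fin n) ℝ}
    (hA : ∀ i j, ContDiffWithinAt ℝ m (fun z => A z i j) s y) :
    ContDiffWithinAt ℝ m (fun z => (A z).det) s y := by
  simp only [Matrix.det_apply]
  exact ContDiffWithinAt.sum fun σ _ =>
    (contDiffWithinAt_prod fun i _ => hA (σ i) i).const_smul (Equiv.Perm.sign σ)

lemma contDiffWithinAt_inv {A : E → Matrix (Fin n) (Fin n) ℝ}
    (hA : ∀ i j, ContDiffWithinAt ℝ m (fun z => A z i j) s y) (hd : (A y).det ≠ 0) (i j : Fin n) :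
    ContDiffWithinAt ℝ m (fun z => (A z)⁻¹ i j) s y := by
  simp only [Matrix.inv_def, Matrix.smul_apply, smul_eq_mul, Ring.inverse_eq_inv',
    Matrix.adjugate_apply]
  refine ((contDiffWithinAt_det hA).inv hd).mul (contDiffWithinAt_det fun k l => ?_)
  simp only [Matrix.updateRow_apply]
  split_ifs
  · exact contDiffWithinAt_const
  · exact hA k l

end Regularity

section

variable {s : Set (Coord n)} {G : Coord n → Matrix (Fin n) (Fin n) ℝ} {y : Coord n}
  {m k : WithTop ℕ∞}

lemma contDiffWithinAt_partialWithin {f : Coord n → ℝ} (hs : UniqueDiffOn ℝ s) (hy : y ∈ s)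
    (hf : ContDiffWithinAt ℝ k f s y) (hmk : m + 1 ≤ k) (i : Fin n) :
    ContDiffWithinAt ℝ m (partialWithin s i f) s y :=
  (hf.fderivWithin_right hs hmk hy).clm_apply contDiffWithinAt_const

lemma contDiffWithinAt_christoffel (hs : UniqueDiffOn ℝ s) (hy : y ∈ s)
    (hG : ∀ i j, ContDiffWithinAt ℝ k (fun z => G z i j) s y) (hd : (G y).det ≠ 0)
    (hmk : m + 1 ≤ k) (a i j : Fin n) : ContDiffWithinAt ℝ m (christoffel s G a i j) s y := by
  have hm : m ≤ k := le_trans le_self_add hmk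
  refine contDiffWithinAt_const.mul (ContDiffWithinAt.sum fun l _ =>
    (contDiffWithinAt_inv (fun i j => (hG i j).of_le hm) hd a l).mul ?_)
  exact ((contDiffWithinAt_partialWithin hs hy (hG _ _) hmk _).add
    (contDiffWithinAt_partialWithin hs hy (hG _ _) hmk _)).sub
    (contDiffWithinAt_partialWithin hs hy (hG _ _) hmk _)

lemma contDiffWithinAt_ricci (hs : UniqueDiffOn ℝ s) (hy : y ∈ s)
    (hG : ∀ i j, ContDiffWithinAt ℝ k (fun z => G z i j) s y) (hd : (G y).det ≠ 0)
    (hmk : m + 1 + 1 ≤ k) (i j : Fin n) : ContDiffWithinAt ℝ m (ricci s G i j) s y := by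
  have hmk' : m + 1 ≤ k := le_trans le_self_add hmk
  have h1 := contDiffWithinAt_christoffel (m := m) hs hy hG hd hmk'
  have h2 := contDiffWithinAt_christoffel (m := m + 1) hs hy hG hd hmk
  exact (ContDiffWithinAt.sum fun k _ =>
    (contDiffWithinAt_partialWithin hs hy (h2 k i j) le_rfl k).sub
    (contDiffWithinAt_partialWithin hs hy (h2 k i k) le_rfl j)).add
    (ContDiffWithinAt.sum fun k _ => ContDiffWithinAt.sum fun l _ =>
      ((h1 _ _ _).mul (h1 _ _ _)).sub ((h1 _ _ _).mul (h1 _ _ _)))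

lemma contDiffWithinAt_scalar (hs : UniqueDiffOn ℝ s) (hy : y ∈ s)
    (hG : ∀ i j, ContDiffWithinAt ℝ k (fun z => G z i j) s y) (hd : (G y).det ≠ 0)
    (hmk : m + 1 + 1 ≤ k) : ContDiffWithinAt ℝ m (scalar s G) s y := by
  have hm : m ≤ k := le_trans (le_trans le_self_add le_self_add) hmk
  exact ContDiffWithinAt.sum fun i _ => ContDiffWithinAt.sum fun j _ =>
    (contDiffWithinAt_inv (fun i j => (hG i j).of_le hm) hd i j).mul
    (contDiffWithinAt_ricci hs hy hG hd hmk i j)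

lemma chr_apply (s : Set (Coord n)) (G : Coord n → Matrix (Fin n) (Fin n) ℝ) (y u v : Coord n) :
    chr s G y u v = ∑ i, ∑ j, (u i * v j) • chr s G y (stdVec i) (stdVec j) := by
  simp only [← chrL_apply]
  conv_lhs => rw [← sum_smul_stdVec u, ← sum_smul_stdVec v]
  simp only [map_sum, map_smul, sum_apply, smul_apply, mul_smul, Finset.smul_sum]
  rw [Finset.sum_comm]
  refine Finset.sum_congr rfl fun i _ => Finset.sum_congr rfl fun j _ => ?_
  rw [smul_comm]

/-- The bilinear map `(u, v) ↦ u^i v^j e_a`. -/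
def basisBilin (i j a : Fin n) : Coord n →L[ℝ] Coord n →L[ℝ] Coord n :=
  (EuclideanSpace.proj i : Coord n →L[ℝ] ℝ).smulRight
    ((EuclideanSpace.proj j : Coord n →L[ℝ] ℝ).smulRight (stdVec a))

lemma basisBilin_apply (i j a : Fin n) (u v : Coord n) :
    basisBilin i j a u v = (u i * v j) • stdVec a := by
  have hp : ∀ (k : Fin n) (x : Coord n), (EuclideanSpace.proj k : Coord n →L[ℝ] ℝ) x = x k :=
    fun _ _ => rfl
  simp only [basisBilin, ContinuousLinearMap.smulRight_apply, smul_apply, hp, smul_smul]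

lemma chrL_eq_sum (s : Set (Coord n)) (G : Coord n → Matrix (Fin n) (Fin n) ℝ) (y : Coord n) :
    chrL s G y = ∑ i, ∑ j, ∑ a, christoffel s G a i j y • basisBilin i j a := by
  ext u v b
  simp only [chrL_apply, chr_apply s G y u v, sum_apply, smul_apply, basisBilin_apply,
    WithLp.ofLp_sum, Finset.sum_apply, PiLp.smul_apply,
    chr_stdVec, smul_eq_mul, PiLp.single_apply, mul_ite, mul_one, mul_zero,
    Finset.sum_ite_eq, Finset.mem_univ, if_true]
  exact Finset.sum_congr rfl fun i _ => Finset.sum_congr rfl fun j _ => by ring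

lemma contDiffWithinAt_sum_smul {E F ι : Type*} [NormedAddCommGroup E] [NormedSpace ℝ E]
    [NormedAddCommGroup F] [NormedSpace ℝ F] [Fintype ι] {f : ι → ι → ι → E → ℝ}
    {t : Set E} {x : E} (hf : ∀ i j a, ContDiffWithinAt ℝ m (f i j a) t x) (c : ι → ι → ι → F) :
    ContDiffWithinAt ℝ m (fun z => ∑ i, ∑ j, ∑ a, f i j a z • c i j a) t x :=
  ContDiffWithinAt.sum fun i _ => ContDiffWithinAt.sum fun j _ =>
    ContDiffWithinAt.sum fun a _ => (hf i j a).smul contDiffWithinAt_const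

set_option synthInstance.maxHeartbeats 200000 in
lemma contDiffWithinAt_chrL (hs : UniqueDiffOn ℝ s) (hy : y ∈ s)
    (hG : ∀ i j, ContDiffWithinAt ℝ k (fun z => G z i j) s y) (hd : (G y).det ≠ 0)
    (hmk : m + 1 ≤ k) : ContDiffWithinAt ℝ m (chrL s G) s y := by
  rw [funext fun y => chrL_eq_sum s G y]
  exact contDiffWithinAt_sum_smul (fun i j a => contDiffWithinAt_christoffel hs hy hG hd hmk a i j)
    basisBilin

end

/-- The Riemann curvature operator `R(u, v) w = ∇_u ∇_v w - ∇_v ∇_u w`, for constant vector fields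
`u`, `v`, `w`. -/
def riem (s : Set (Coord n)) (G : Coord n → Matrix (Fin n) (Fin n) ℝ) (y u v w : Coord n) :
    Coord n :=
  fderivWithin ℝ (chrL s G) s y u v w - fderivWithin ℝ (chrL s G) s y v u w
    + chr s G y u (chr s G y v w) - chr s G y v (chr s G y u w)

section Pullback

variable {s s' : Set (Coord n)} {T : Coord n → Coord n}
    {A B : Coord n → Matrix (Fin n) (Fin n) ℝ} {y : Coord n}

lemma IsPullbackAt.injective (h : IsPullbackAt s T A B y) (hA : (A y).det ≠ 0)
    (hAs : (A y).IsSymm) : Function.Injective (fderivWithin ℝ T s y) := by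
  intro u u' huu
  refine bil_congr_right hA hAs fun w => ?_
  rw [h, h, huu]

lemma IsPullbackAt.surjective (h : IsPullbackAt s T A B y) (hA : (A y).det ≠ 0)
    (hAs : (A y).IsSymm) : Function.Surjective (fderivWithin ℝ T s y) :=
  (LinearMap.injective_iff_surjective
    (f := (fderivWithin ℝ T s y : Coord n →ₗ[ℝ] Coord n))).1 (h.injective hA hAs)

/-- The matrix of a linear endomorphism of `ℝⁿ`. -/
def jac (L : Coord n →L[ℝ] Coord n) : Matrix (Fin n) (Fin n) ℝ :=
  Matrix.of fun a i => L (stdVec i) a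

lemma apply_eq_sum_jac (L : Coord n →L[ℝ] Coord n) (u : Coord n) (a : Fin n) :
    L u a = ∑ i, jac L a i * u i := by
  conv_lhs => rw [← sum_smul_stdVec u]
  simp [jac, mul_comm]

/-- The matrix of a pulled back bilinear form. -/
lemma matrix_eq_conj {A B : Matrix (Fin n) (Fin n) ℝ} {L : Coord n →L[ℝ] Coord n}
    (h : ∀ u v, bil A u v = bil B (L u) (L v)) : A = (jac L).transpose * B * jac L := by
  ext i j
  rw [← bil_stdVec A, h]
  simp only [bil, Matrix.mul_apply, Matrix.transpose_apply, Finset.sum_mul, jac, Matrix.of_apply]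
  rw [Finset.sum_comm]
  exact Finset.sum_congr rfl fun _ _ => Finset.sum_congr rfl fun _ _ => by ring

lemma IsPullbackAt.det_ne_zero (h : IsPullbackAt s T A B y) (hA : (A y).det ≠ 0) :
    (B (T y)).det ≠ 0 := by
  rw [matrix_eq_conj h, Matrix.det_mul, Matrix.det_mul] at hA
  exact fun h0 => hA (by simp [h0])

set_option synthInstance.maxHeartbeats 400000 in
set_option maxHeartbeats 1000000 in
/-- The curvature operator is natural under pullback. -/
lemma riem_pullback (hs : UniqueDiffOn ℝ s) (hy : y ∈ s)
    (hcl : s ⊆ closure (interior s)) (hs' : UniqueDiffOn ℝ s')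
    (hT : ContDiffWithinAt ℝ 3 T s y) (hmap : MapsTo T s s')
    (hAB : ∀ᶠ z in 𝓝[s] y, IsPullbackAt s T A B z)
    (hA : (A y).det ≠ 0) (hAs : ∀ᶠ z in 𝓝[s] y, (A z).IsSymm)
    (hA2 : ∀ i j, ContDiffWithinAt ℝ 2 (fun z => A z i j) s y)
    (hBs : ∀ᶠ z in 𝓝[s'] (T y), (B z).IsSymm)
    (hB2 : ∀ i j, ContDiffWithinAt ℝ 2 (fun z => B z i j) s' (T y)) (u v w : Coord n) :
    fderivWithin ℝ T s y (riem s A y u v w) =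
      riem s' B (T y) (fderivWithin ℝ T s y u) (fderivWithin ℝ T s y v)
        (fderivWithin ℝ T s y w) := by
  have hTc : Tendsto T (𝓝[s] y) (𝓝[s'] (T y)) := hT.continuousWithinAt.tendsto_nhdsWithin hmap
  have hB : (B (T y)).det ≠ 0 := (hAB.self_of_nhdsWithin hy).det_ne_zero hA
  have hdetA : ∀ᶠ z in 𝓝[s] y, (A z).det ≠ 0 :=
    (contDiffWithinAt_det hA2).continuousWithinAt.eventually_ne hA
  have hT' : ∀ᶠ z in 𝓝[s] y, ContDiffWithinAt ℝ 3 T s z := by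
    have := hT.eventually (by norm_cast)
    rwa [insert_eq_of_mem hy] at this
  have hB2' : ∀ᶠ z in 𝓝[s'] (T y), ∀ i j, ContDiffWithinAt ℝ 2 (fun z => B z i j) s' z := by
    refine eventually_all.2 fun i => eventually_all.2 fun j => ?_
    have := (hB2 i j).eventually (by norm_cast)
    rwa [insert_eq_of_mem (hmap hy)] at this
  have key : ∀ u v, ∀ᶠ z in 𝓝[s] y, fderivWithin ℝ T s z (chrL s A z u v) =
      fderivWithin ℝ (fderivWithin ℝ T s) s z u v
        + chrL s' B (T z) (fderivWithin ℝ T s z u) (fderivWithin ℝ T s z v) := by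
    intro u v
    filter_upwards [eventually_eventually_nhdsWithin.2 hAB, eventually_eventually_nhdsWithin.2 hAs,
      hdetA, hT', hTc.eventually hBs, hTc.eventually hB2', self_mem_nhdsWithin]
      with z h1 h2 h3 h4 h5 h6 hz
    have h1z := h1.self_of_nhdsWithin hz
    have h2z := h2.self_of_nhdsWithin hz
    exact chr_pullback hs hz (hcl hz) (h4.of_le (by norm_num)) hmap h1 h3 h2
      (h1z.det_ne_zero h3) h5 (fun i j => (h6 i j).differentiableWithinAt (by norm_num))
      (h1z.surjective h3 h2z) u v
  -- derivatives of the ingredients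
  have hTd : HasFDerivWithinAt T (fderivWithin ℝ T s y) s y :=
    (hT.differentiableWithinAt (by norm_num)).hasFDerivWithinAt
  have hJ2 : ContDiffWithinAt ℝ 2 (fderivWithin ℝ T s) s y :=
    hT.fderivWithin_right hs (by norm_num) hy
  have hJ := (hJ2.differentiableWithinAt (by norm_num)).hasFDerivWithinAt
  have hJJ : DifferentiableWithinAt ℝ (fderivWithin ℝ (fderivWithin ℝ T s) s) s y :=
    (hJ2.fderivWithin_right (m := 1) hs (by norm_num) hy).differentiableWithinAt (by norm_num)
  have hsym2 := hJ2.isSymmSndFDerivWithinAt (by simp) hs (hcl hy) hy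
  have hsym1 := (hT.of_le (by norm_num : (2 : WithTop ℕ∞) ≤ 3)).isSymmSndFDerivWithinAt
    (by simp) hs (hcl hy) hy
  have hΓA := ((contDiffWithinAt_chrL (m := 1) hs hy hA2 hA
    (by norm_num)).differentiableWithinAt (by norm_num)).hasFDerivWithinAt
  have hΓB := ((contDiffWithinAt_chrL (m := 1) hs' (hmap hy) hB2 hB
    (by norm_num)).differentiableWithinAt (by norm_num)).hasFDerivWithinAt
  have hΓBT := hΓB.comp y hTd hmap
  -- Differentiating the transformation law of the Christoffel symbols once more, in the direction
  -- `w`.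
  have diffd : ∀ w u v, fderivWithin ℝ (fderivWithin ℝ T s) s y w (chr s A y u v)
      + fderivWithin ℝ T s y (fderivWithin ℝ (chrL s A) s y w u v)
      = fderivWithin ℝ (fderivWithin ℝ (fderivWithin ℝ T s) s) s y w u v
      + (fderivWithin ℝ (chrL s' B) s' (T y) (fderivWithin ℝ T s y w) (fderivWithin ℝ T s y u)
          (fderivWithin ℝ T s y v)
        + chr s' B (T y) (fderivWithin ℝ (fderivWithin ℝ T s) s y w u) (fderivWithin ℝ T s y v)
        + chr s' B (T y) (fderivWithin ℝ T s y u)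
          (fderivWithin ℝ (fderivWithin ℝ T s) s y w v)) := by
    intro w u v
    have hL := hJ.clm_apply ((hΓA.clm_apply (hasFDerivWithinAt_const u y s)).clm_apply
      (hasFDerivWithinAt_const v y s))
    have hR := ((hJJ.hasFDerivWithinAt.clm_apply (hasFDerivWithinAt_const u y s)).clm_apply
      (hasFDerivWithinAt_const v y s)).add
      ((hΓBT.clm_apply (hJ.clm_apply (hasFDerivWithinAt_const u y s))).clm_apply
        (hJ.clm_apply (hasFDerivWithinAt_const v y s)))
    have heq := (hs y hy).eq (hL.congr_of_eventuallyEq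
      ((key u v).mono fun z hz => hz.symm) ((key u v).self_of_nhdsWithin hy).symm) hR
    have := congrArg (fun L => L w) heq
    simp at this
    rw [add_comm, this]
    abel
  have hAy := hAB.self_of_nhdsWithin hy
  have hchr : ∀ u v, fderivWithin ℝ T s y (chr s A y u v) =
      fderivWithin ℝ (fderivWithin ℝ T s) s y u v
        + chr s' B (T y) (fderivWithin ℝ T s y u) (fderivWithin ℝ T s y v) :=
    fun u v => (key u v).self_of_nhdsWithin hy
  have hadd : ∀ a b c, chr s' B (T y) a (b + c) = chr s' B (T y) a b + chr s' B (T y) a c :=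
    fun a b c => map_add (chrL s' B (T y) a) b c
  -- After antisymmetrizing in `u` and `v`, the third derivatives of `T` cancel.
  have h1 := diffd u v w
  have h2 := diffd v u w
  have h3 : fderivWithin ℝ (fderivWithin ℝ (fderivWithin ℝ T s) s) s y u v w =
      fderivWithin ℝ (fderivWithin ℝ (fderivWithin ℝ T s) s) s y v u w := by
    rw [hsym2 u v]
  have h4 := hsym1 u v
  simp only [riem, map_add, map_sub, hchr, hadd]
  rw [h4] at h1
  rw [← eq_sub_iff_add_eq'] at h1 h2
  rw [h1, h2, h3]
  abel

end Pullback

end LocalRiem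

end

/-! ### Scalar curvature under pullback -/

section

namespace LocalRiem

variable {n : ℕ}

/-- The matrix `A` is symmetric and positive definite. -/
structure IsMetric (A : Matrix (Fin n) (Fin n) ℝ) : Prop where
  isSymm : A.IsSymm
  pos : ∀ v : Coord n, v ≠ 0 → 0 < bil A v v

lemma IsMetric.det_ne_zero {A : Matrix (Fin n) (Fin n) ℝ} (h : IsMetric A) : A.det ≠ 0 := by
  intro h0
  obtain ⟨v, hv, hv0⟩ := Matrix.exists_mulVec_eq_zero_iff.2 h0
  have := h.pos (WithLp.toLp 2 v) (fun h => hv (by simpa using congrArg WithLp.ofLp h))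
  rw [bil_eq_dotProduct] at this
  simp [hv0] at this

lemma IsMetric.inv_mul {A : Matrix (Fin n) (Fin n) ℝ} (h : IsMetric A) : A⁻¹ * A = 1 :=
  Matrix.nonsing_inv_mul _ (isUnit_iff_ne_zero.2 h.det_ne_zero)

lemma IsMetric.inv_isSymm {A : Matrix (Fin n) (Fin n) ℝ} (h : IsMetric A) : A⁻¹.IsSymm := by
  rw [Matrix.IsSymm, Matrix.transpose_nonsing_inv, h.isSymm]

lemma bil_inv_col {A : Matrix (Fin n) (Fin n) ℝ} (h : A.det ≠ 0) (hs : A.IsSymm) (a : Fin n)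
    (w : Coord n) : bil A (WithLp.toLp 2 fun k => A⁻¹ k a) w = w a := by
  rw [bil_comm hs, bil_eq_dotProduct]
  have : A.mulVec (fun k => A⁻¹ k a) = Pi.single a 1 := by
    funext k
    have := congrFun (congrFun (Matrix.mul_nonsing_inv A (isUnit_iff_ne_zero.2 h)) k) a
    simpa [Matrix.mul_apply, Matrix.mulVec, dotProduct, Matrix.one_apply, Pi.single_apply]
      using this
  simp [this]

lemma IsMetric.inv_diag_pos {A : Matrix (Fin n) (Fin n) ℝ} (h : IsMetric A) (a : Fin n) :
    0 < A⁻¹ a a := by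
  have h1 := bil_inv_col h.det_ne_zero h.isSymm a (WithLp.toLp 2 fun k => A⁻¹ k a)
  rw [← show _ = A⁻¹ a a from h1]
  refine h.pos _ fun h0 => ?_
  have := bil_inv_col h.det_ne_zero h.isSymm a (stdVec a)
  rw [h0] at this
  simp [bil] at this

section Scalar

variable {s s' : Set (Coord n)} {T : Coord n → Coord n}
    {A B G : Coord n → Matrix (Fin n) (Fin n) ℝ} {y : Coord n}

lemma partialWithin_christoffel (hs : UniqueDiffWithinAt ℝ s y)
    (hG : DifferentiableWithinAt ℝ (chrL s G) s y) (m k i j : Fin n) :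
    partialWithin s m (christoffel s G k i j) y =
      fderivWithin ℝ (chrL s G) s y (stdVec m) (stdVec i) (stdVec j) k := by
  have h1 := (EuclideanSpace.proj k : Coord n →L[ℝ] ℝ).hasFDerivAt.comp_hasFDerivWithinAt y
    ((hG.hasFDerivWithinAt.clm_apply (hasFDerivWithinAt_const (stdVec i) y s)).clm_apply
      (hasFDerivWithinAt_const (stdVec j) y s))
  have h2 : christoffel s G k i j = (EuclideanSpace.proj k : Coord n →L[ℝ] ℝ) ∘
      fun z => chrL s G z (stdVec i) (stdVec j) := by
    funext z; exact (chr_stdVec s G z k i j).symm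
  rw [partialWithin, h2, h1.fderivWithin hs]
  simp

lemma fderivWithin_chrL_symm (hs : UniqueDiffWithinAt ℝ s y) (hy : y ∈ s)
    (hG : DifferentiableWithinAt ℝ (chrL s G) s y)
    (hsym : ∀ᶠ z in 𝓝[s] y, (G z).IsSymm) (w u v : Coord n) :
    fderivWithin ℝ (chrL s G) s y w u v = fderivWithin ℝ (chrL s G) s y w v u := by
  have h1 : ∀ u v, HasFDerivWithinAt (fun z => chrL s G z u v)
      (((fderivWithin ℝ (chrL s G) s y).flip u).flip v) s y := fun u v => by
    simpa using (hG.hasFDerivWithinAt.clm_apply (hasFDerivWithinAt_const u y s)).clm_apply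
      (hasFDerivWithinAt_const v y s)
  have h2 := hs.eq (h1 u v) ((h1 v u).congr_of_eventuallyEq ?_ (chr_symm hy hsym u v))
  · simpa using congrArg (fun L => L w) h2
  · filter_upwards [eventually_eventually_nhdsWithin.2 hsym, self_mem_nhdsWithin] with z hz hzs
    exact chr_symm hzs hz u v

/-- The coordinate formula for the Ricci curvature is a trace of the curvature operator. -/
lemma ricci_eq_trace (hs : UniqueDiffWithinAt ℝ s y) (hy : y ∈ s)
    (hG : DifferentiableWithinAt ℝ (chrL s G) s y)
    (hsym : ∀ᶠ z in 𝓝[s] y, (G z).IsSymm) (i j : Fin n) :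
    ricci s G i j y = ∑ k, riem s G y (stdVec k) (stdVec j) (stdVec i) k := by
  rw [ricci, ← Finset.sum_add_distrib]
  refine Finset.sum_congr rfl fun k _ => ?_
  have h3 : ∀ a b c, chr s G y (stdVec a) (chr s G y (stdVec b) (stdVec c)) k =
      ∑ l, christoffel s G k a l y * christoffel s G l b c y := by
    intro a b c
    conv_lhs => rw [← sum_smul_stdVec (chr s G y (stdVec b) (stdVec c)), ← chrL_apply]
    simp [chr_stdVec, mul_comm]
  rw [partialWithin_christoffel hs hG, partialWithin_christoffel hs hG, riem]
  rw [fderivWithin_chrL_symm hs hy hG hsym _ (stdVec i) (stdVec j),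
    fderivWithin_chrL_symm hs hy hG hsym _ (stdVec i) (stdVec k),
    chr_symm hy hsym (stdVec j) (stdVec i), chr_symm hy hsym (stdVec k) (stdVec i)]
  simp only [PiLp.sub_apply, PiLp.add_apply, h3, Finset.sum_sub_distrib]
  ring

set_option synthInstance.maxHeartbeats 400000 in
lemma riem_expand (s : Set (Coord n)) (G : Coord n → Matrix (Fin n) (Fin n) ℝ)
    (y u v w : Coord n) :
    riem s G y u v w = ∑ a, ∑ b, (v a * w b) • riem s G y u (stdVec a) (stdVec b) := by
  have hL : ∀ v v' w, riem s G y u (v + v') w = riem s G y u v w + riem s G y u v' w := by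
    intro v v' w
    simp only [riem, ← chrL_apply, map_add, add_apply]; abel
  have hL' : ∀ (c : ℝ) v w, riem s G y u (c • v) w = c • riem s G y u v w := by
    intro c v w
    simp only [riem, ← chrL_apply, map_smul, smul_apply]; module
  have hR : ∀ v w w', riem s G y u v (w + w') = riem s G y u v w + riem s G y u v w' := by
    intro v w w'
    simp only [riem, ← chrL_apply, map_add]; abel
  have hR' : ∀ (c : ℝ) v w, riem s G y u v (c • w) = c • riem s G y u v w := by
    intro c v w
    simp only [riem, ← chrL_apply, map_smul]; module
  let F := LinearMap.mk₂ ℝ (fun v w => riem s G y u v w) hL hL' hR hR'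
  change F v w = ∑ a, ∑ b, (v a * w b) • F (stdVec a) (stdVec b)
  conv_lhs => rw [← sum_smul_stdVec v, ← sum_smul_stdVec w]
  simp only [map_sum, map_smul, LinearMap.sum_apply, LinearMap.smul_apply, Finset.smul_sum,
    smul_smul]
  rw [Finset.sum_comm]
  exact Finset.sum_congr rfl fun _ _ => Finset.sum_congr rfl fun _ _ => by rw [mul_comm]

set_option synthInstance.maxHeartbeats 400000 in
lemma riem_left_expand (s : Set (Coord n)) (G : Coord n → Matrix (Fin n) (Fin n) ℝ)
    (y u v w : Coord n) :
    riem s G y u v w = ∑ a, u a • riem s G y (stdVec a) v w := by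
  let F : Coord n →ₗ[ℝ] Coord n :=
    { toFun := fun u => riem s G y u v w
      map_add' := fun u u' => by simp only [riem, ← chrL_apply, map_add, add_apply]; abel
      map_smul' := fun c u => by
        simp only [riem, ← chrL_apply, map_smul, smul_apply, RingHom.id_apply]; module }
  change F u = ∑ a, u a • F (stdVec a)
  conv_lhs => rw [← sum_smul_stdVec u]
  simp

/-- The scalar curvature is natural under pullback. -/
theorem scalar_pullback (hs : UniqueDiffOn ℝ s) (hy : y ∈ s)
    (hcl : s ⊆ closure (interior s)) (hs' : UniqueDiffOn ℝ s')
    (hT : ContDiffWithinAt ℝ 3 T s y) (hmap : MapsTo T s s')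
    (hAB : ∀ᶠ z in 𝓝[s] y, IsPullbackAt s T A B z)
    (hA : (A y).det ≠ 0) (hAs : ∀ᶠ z in 𝓝[s] y, (A z).IsSymm)
    (hA2 : ∀ i j, ContDiffWithinAt ℝ 2 (fun z => A z i j) s y)
    (hBs : ∀ᶠ z in 𝓝[s'] (T y), (B z).IsSymm)
    (hB2 : ∀ i j, ContDiffWithinAt ℝ 2 (fun z => B z i j) s' (T y)) :
    scalar s A y = scalar s' B (T y) := by
  have hAy := hAB.self_of_nhdsWithin hy
  have hB : (B (T y)).det ≠ 0 := hAy.det_ne_zero hA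
  set J := jac (fderivWithin ℝ T s y) with hJ
  have hconj : A y = J.transpose * B (T y) * J := matrix_eq_conj hAy
  have hJd : J.det ≠ 0 := by rw [hconj, Matrix.det_mul] at hA; exact right_ne_zero_of_mul hA
  have hJu : IsUnit J.det := isUnit_iff_ne_zero.2 hJd
  have hJtu : IsUnit J.transpose.det := by rwa [Matrix.det_transpose]
  have hcA := (contDiffWithinAt_chrL (m := 1) hs hy hA2 hA
    (by norm_num)).differentiableWithinAt (by norm_num)
  have hcB := (contDiffWithinAt_chrL (m := 1) hs' (hmap hy) hB2 hB
    (by norm_num)).differentiableWithinAt (by norm_num)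
  set RA : Matrix (Fin n) (Fin n) ℝ := Matrix.of fun i j => ricci s A i j y with hRA
  set RB : Matrix (Fin n) (Fin n) ℝ := Matrix.of fun i j => ricci s' B i j (T y) with hRB
  have hric : RA = J.transpose * RB * J := by
    ext i j
    let LA : Matrix (Fin n) (Fin n) ℝ := Matrix.of fun a k =>
      riem s A y (stdVec k) (stdVec j) (stdVec i) a
    let LB : Matrix (Fin n) (Fin n) ℝ := Matrix.of fun a k =>
      riem s' B (T y) (stdVec k) (fderivWithin ℝ T s y (stdVec j))
        (fderivWithin ℝ T s y (stdVec i)) a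
    -- By naturality, the Jacobian conjugates the endomorphisms of which the Ricci curvatures are
    -- the traces.
    have hcomm : J * LA = LB * J := by
      ext a k
      have h1 := congrArg (fun x : Coord n => x a) (riem_pullback hs hy hcl hs' hT hmap hAB hA hAs
        hA2 hBs hB2 (stdVec k) (stdVec j) (stdVec i))
      simp only [apply_eq_sum_jac _ (riem _ _ _ _ _ _),
        riem_left_expand s' B (T y) (fderivWithin ℝ T s y (stdVec k))] at h1
      simp only [Matrix.mul_apply, LA, LB, Matrix.of_apply]
      rw [hJ, h1]
      simp [jac, mul_comm]
    have htr : LA.trace = LB.trace := by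
      have : LA = J⁻¹ * (LB * J) := by
        rw [← hcomm, ← Matrix.mul_assoc, Matrix.nonsing_inv_mul _ hJu, Matrix.one_mul]
      rw [this, Matrix.trace_mul_comm, Matrix.mul_assoc, Matrix.mul_nonsing_inv _ hJu,
        Matrix.mul_one]
    have h2 : RA i j = LA.trace := by
      simp only [hRA, Matrix.of_apply, ricci_eq_trace (hs y hy) hy hcA hAs, Matrix.trace,
        Matrix.diag, LA]
    have h3 : LB.trace = ∑ a, ∑ b, J a j * J b i * RB b a := by
      simp only [hRB, Matrix.of_apply, ricci_eq_trace (hs' _ (hmap hy)) (hmap hy) hcB hBs,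
        Matrix.trace, Matrix.diag, LB]
      simp only [riem_expand s' B (T y) _ (fderivWithin ℝ T s y (stdVec j))]
      simp only [WithLp.ofLp_sum, Finset.sum_apply, PiLp.smul_apply, smul_eq_mul, Finset.mul_sum]
      rw [Finset.sum_comm]
      refine Finset.sum_congr rfl fun a _ => ?_
      rw [Finset.sum_comm]
      exact Finset.sum_congr rfl fun b _ => Finset.sum_congr rfl fun k _ => rfl
    rw [h2, htr, h3]
    simp only [Matrix.mul_apply, Matrix.transpose_apply, Finset.sum_mul]
    exact Finset.sum_congr rfl fun _ _ => Finset.sum_congr rfl fun _ _ => by ring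
  -- The scalar curvature is the trace of the inverse metric times the Ricci curvature.
  have hsc : ∀ (M R : Matrix (Fin n) (Fin n) ℝ), ∑ i, ∑ j, M i j * R i j
      = (M * R.transpose).trace := fun M R => by
    simp [Matrix.trace, Matrix.mul_apply]
  have e1 : scalar s A y = ((A y)⁻¹ * RA.transpose).trace := hsc _ RA
  have e2 : scalar s' B (T y) = ((B (T y))⁻¹ * RB.transpose).trace := hsc _ RB
  rw [e1, e2, hric, hconj]
  simp only [Matrix.mul_inv_rev, Matrix.transpose_mul, Matrix.transpose_transpose]
  have : J⁻¹ * ((B (T y))⁻¹ * J.transpose⁻¹) * (J.transpose * (RB.transpose * J)) =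
      J⁻¹ * ((B (T y))⁻¹ * RB.transpose * J) := by
    simp only [Matrix.mul_assoc]
    rw [← Matrix.mul_assoc J.transpose⁻¹, Matrix.nonsing_inv_mul _ hJtu, Matrix.one_mul]
  rw [this, Matrix.trace_mul_comm, Matrix.mul_assoc, Matrix.mul_nonsing_inv _ hJu, Matrix.mul_one]

end Scalar

end LocalRiem

end

/-! ### The second fundamental form on the half space -/

section

namespace LocalRiem

variable {n : ℕ} [NeZero n]

/-- The closed half space `{y | 0 ≤ y₀}`. -/
abbrev halfSpace (n : ℕ) [NeZero n] : Set (Coord n) := range (𝓡∂ n)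

lemma mem_halfSpace {y : Coord n} : y ∈ halfSpace n ↔ 0 ≤ y 0 := by
  rw [halfSpace, range_modelWithCornersEuclideanHalfSpace]; rfl

lemma uniqueDiff_halfSpace : UniqueDiffOn ℝ (halfSpace n) := (𝓡∂ n).uniqueDiffOn

lemma convex_halfSpace : Convex ℝ (halfSpace n) := (𝓡∂ n).convex_range

lemma halfSpace_subset_closure_interior : halfSpace n ⊆ closure (interior (halfSpace n)) :=
  (𝓡∂ n).range_subset_closure_interior

lemma add_smul_mem_halfSpace {y v : Coord n} (hy : y ∈ halfSpace n) (hv : v 0 = 0) (t : ℝ) :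
    y + t • v ∈ halfSpace n := by
  rw [mem_halfSpace] at *; simpa [hv] using hy

section SecondForm

variable {s : Set (Coord n)} {G : Coord n → Matrix (Fin n) (Fin n) ℝ} {y : Coord n}

/-- The outgoing unit normal as a vector field. -/
def normalVec (G : Coord n → Matrix (Fin n) (Fin n) ℝ) (y : Coord n) : Coord n :=
  WithLp.toLp 2 (outerNormal G y)

lemma bil_normalVec (hG : (G y).det ≠ 0) (hs : (G y).IsSymm) (w : Coord n) :
    bil (G y) (normalVec G y) w = -(w 0) / Real.sqrt ((G y)⁻¹ 0 0) := by
  have : normalVec G y = (-1 / Real.sqrt ((G y)⁻¹ 0 0)) •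
      (WithLp.toLp 2 fun k => (G y)⁻¹ k 0 : Coord n) := by
    ext k
    simp only [normalVec, outerNormal, PiLp.smul_apply, smul_eq_mul]; ring
  rw [this, bil_smul_left, bil_inv_col hG hs]; ring

lemma differentiableWithinAt_normalVec (hG : IsMetric (G y))
    (hd : ∀ i j, ContDiffWithinAt ℝ 1 (fun z => G z i j) s y) :
    DifferentiableWithinAt ℝ (normalVec G) s y := by
  rw [differentiableWithinAt_euclidean]
  intro k
  have hi : ∀ i j, DifferentiableWithinAt ℝ (fun z => (G z)⁻¹ i j) s y := fun i j =>
    (contDiffWithinAt_inv hd hG.det_ne_zero i j).differentiableWithinAt (by norm_num)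
  simp only [normalVec, outerNormal]
  have hq : DifferentiableWithinAt ℝ (fun z => Real.sqrt ((G z)⁻¹ 0 0)) s y :=
    (hi 0 0).sqrt (hG.inv_diag_pos 0).ne'
  simp only [div_eq_mul_inv]
  exact ((hi k 0).neg).mul (hq.inv (Real.sqrt_pos.2 (hG.inv_diag_pos 0)).ne')

/-- The second fundamental form as `g(∇_v ς, w)`, in terms of the bilinear map `Γ`. -/
lemma secondForm_eq_bil (hd : DifferentiableWithinAt ℝ (normalVec G) s y)
    (hs : UniqueDiffWithinAt ℝ s y) (v w : Coord n) :
    secondForm s G y v w =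
      bil (G y) (fderivWithin ℝ (normalVec G) s y v + chr s G y v (normalVec G y)) w := by
  have h1 : ∀ i k, partialWithin s i (fun z => outerNormal G z k) y =
      fderivWithin ℝ (normalVec G) s y (stdVec i) k := by
    intro i k
    have := ((EuclideanSpace.proj k : Coord n →L[ℝ] ℝ).hasFDerivAt.comp_hasFDerivWithinAt y
      hd.hasFDerivWithinAt).fderivWithin hs
    have h2 : (fun z => outerNormal G z k) = (EuclideanSpace.proj k : Coord n →L[ℝ] ℝ) ∘
      normalVec G := rfl
    rw [partialWithin, h2, this]; rfl
  have h2 : ∀ i k, covDeriv s G (outerNormal G) i k y =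
      (fderivWithin ℝ (normalVec G) s y (stdVec i) + chr s G y (stdVec i) (normalVec G y)) k := by
    intro i k
    rw [covDeriv, h1]
    conv_rhs => rw [← sum_smul_stdVec (normalVec G y), ← chrL_apply]
    simp only [map_sum, map_smul, PiLp.add_apply, WithLp.ofLp_sum, Finset.sum_apply,
      PiLp.smul_apply, chrL_apply, chr_stdVec, smul_eq_mul]
    congr 1
    exact Finset.sum_congr rfl fun j _ => by rw [mul_comm]; rfl
  have h3 : fderivWithin ℝ (normalVec G) s y v + chr s G y v (normalVec G y) =
      ∑ i, v i • (fderivWithin ℝ (normalVec G) s y (stdVec i)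
        + chr s G y (stdVec i) (normalVec G y)) := by
    conv_lhs => rw [← sum_smul_stdVec v, ← chrL_apply]
    simp [Finset.sum_add_distrib]
  rw [h3, bil_sum_left]
  refine Finset.sum_congr rfl fun i _ => ?_
  rw [bil_smul_left]
  simp only [bil, Finset.mul_sum, h2]
  exact Finset.sum_congr rfl fun _ _ => Finset.sum_congr rfl fun _ _ => by ring

/-- On vectors tangent to `{y₀ = const}` the second fundamental form is `Γ⁰(v, w) / √g⁰⁰`. -/
lemma secondForm_eq_chr (hs : UniqueDiffOn ℝ s) (hy : y ∈ s)
    (hG : ∀ᶠ z in 𝓝[s] y, IsMetric (G z))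
    (hd : ∀ i j, ContDiffWithinAt ℝ 1 (fun z => G z i j) s y) {v w : Coord n} (hw : w 0 = 0) :
    secondForm s G y v w = chr s G y v w 0 / Real.sqrt ((G y)⁻¹ 0 0) := by
  have hGy := hG.self_of_nhdsWithin hy
  have hsym : ∀ᶠ z in 𝓝[s] y, (G z).IsSymm := hG.mono fun z hz => hz.isSymm
  have hdiff : ∀ i j, DifferentiableWithinAt ℝ (fun z => G z i j) s y := fun i j =>
    (hd i j).differentiableWithinAt (by norm_num)
  have hν := differentiableWithinAt_normalVec hGy hd
  rw [secondForm_eq_bil hν (hs y hy), bil_add_left, bil_chr hGy.det_ne_zero hGy.isSymm]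
  -- differentiate `g(ς, w) = 0`
  have h0 : fderivWithin ℝ (fun z => bil (G z) (normalVec G z) w) s y v = 0 := by
    rw [Filter.EventuallyEq.fderivWithin_eq (f := fun _ => (0 : ℝ))]
    · simp
    · filter_upwards [hG] with z hz
      rw [bil_normalVec hz.det_ne_zero hz.isSymm]; simp [hw]
    · rw [bil_normalVec hGy.det_ne_zero hGy.isSymm]; simp [hw]
  rw [fderivWithin_bil (hs y hy) hdiff hν (differentiableWithinAt_const w)] at h0
  have hz' : ∀ x, bil (G y) x 0 = 0 := fun x => by simpa using bil_smul_right (G y) 0 x 0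
  simp only [fderivWithin_fun_const, Pi.zero_apply, zero_apply, hz', add_zero] at h0
  have h1 := bil_normalVec hGy.det_ne_zero hGy.isSymm (chr s G y v w)
  rw [bil_comm hGy.isSymm, bil_chr hGy.det_ne_zero hGy.isSymm, neg_div] at h1
  have h2 := bil_comm (dmat_isSymm hsym hy v) w (normalVec G y)
  have h3 := bil_comm (dmat_isSymm hsym hy (normalVec G y)) v w
  simp only [koszul] at h1 ⊢
  linarith [bil_comm (dmat_isSymm hsym hy w) v (normalVec G y)]

end SecondForm

section Boundary

/-- A function that vanishes on the boundary hyperplane has vanishing tangential derivatives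
there. -/
lemma hasFDerivWithinAt_tangential_eq_zero {f : Coord n → ℝ} {f' : Coord n →L[ℝ] ℝ} {y v : Coord n}
    (hf : HasFDerivWithinAt f f' (halfSpace n) y) (hy : y 0 = 0)
    (h0 : ∀ᶠ z in 𝓝[halfSpace n] y, z 0 = 0 → f z = 0) (hv : v 0 = 0) : f' v = 0 := by
  have hyH : y ∈ halfSpace n := mem_halfSpace.2 hy.ge
  have hline : HasDerivAt (fun t : ℝ => y + t • v) v 0 := by
    simpa using ((hasDerivAt_id (0 : ℝ)).smul_const v).const_add y
  have hmaps : ∀ t, y + t • v ∈ halfSpace n := add_smul_mem_halfSpace hyH hv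
  have hc : HasDerivWithinAt (fun t : ℝ => f (y + t • v)) (f' v) univ 0 := by
    have hf' : HasFDerivWithinAt f f' (halfSpace n) (y + (0 : ℝ) • v) := by simpa using hf
    exact hf'.comp_hasDerivWithinAt 0 hline.hasDerivWithinAt fun t _ => hmaps t
  have htend : Tendsto (fun t : ℝ => y + t • v) (𝓝 0) (𝓝[halfSpace n] y) := by
    refine tendsto_nhdsWithin_iff.2 ⟨?_, Eventually.of_forall hmaps⟩
    simpa using hline.continuousAt.tendsto
  have hzero : (fun t : ℝ => f (y + t • v)) =ᶠ[𝓝 0] fun _ => 0 := by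
    filter_upwards [htend.eventually h0] with t ht
    exact ht (by simp [hy, hv])
  exact (hasDerivWithinAt_univ.1 hc).unique ((hasDerivAt_const (0 : ℝ) (0 : ℝ)).congr_of_eventuallyEq
    hzero)

/-- A non-negative function that vanishes at a boundary point has a non-negative inward derivative
there. -/
lemma hasFDerivWithinAt_normal_nonneg {f : Coord n → ℝ} {f' : Coord n →L[ℝ] ℝ} {y : Coord n}
    (hf : HasFDerivWithinAt f f' (halfSpace n) y) (hy : y 0 = 0) (hfy : f y = 0)
    (h0 : ∀ z ∈ halfSpace n, 0 ≤ f z) : 0 ≤ f' (stdVec 0) := by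
  have hline : HasDerivWithinAt (fun t : ℝ => y + t • stdVec (0 : Fin n)) (stdVec 0) (Ici 0) 0 := by
    simpa using (((hasDerivAt_id (0 : ℝ)).smul_const (stdVec (0 : Fin n))).const_add
      y).hasDerivWithinAt
  have hmaps : ∀ t ∈ Ici (0 : ℝ), y + t • stdVec (0 : Fin n) ∈ halfSpace n := fun t ht => by
    rw [mem_halfSpace]; simpa [hy] using ht
  have hf' : HasFDerivWithinAt f f' (halfSpace n) (y + (0 : ℝ) • stdVec (0 : Fin n)) := by
    simpa using hf
  have hc := hf'.comp_hasDerivWithinAt 0 hline hmaps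
  refine ge_of_tendsto ((hasDerivWithinAt_iff_tendsto_slope' (by simp)).1
    (hc.mono Ioi_subset_Ici_self)) ?_
  filter_upwards [self_mem_nhdsWithin] with t ht
  rw [slope_def_field]
  have : 0 ≤ f (y + t • stdVec (0 : Fin n)) := h0 _ (hmaps t (le_of_lt ht : (0 : ℝ) ≤ t))
  simp only [Function.comp_apply, zero_smul, add_zero, hfy, sub_zero]
  exact div_nonneg this (le_of_lt ht)

variable {T : Coord n → Coord n} {A B : Coord n → Matrix (Fin n) (Fin n) ℝ} {y : Coord n}

/-- `T` maps the half space to itself and, near `y`, its boundary hyperplane to itself. -/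
structure PreservesBoundary (T : Coord n → Coord n) (y : Coord n) : Prop where
  mapsTo : MapsTo T (halfSpace n) (halfSpace n)
  eventually : ∀ᶠ z in 𝓝[halfSpace n] y, z 0 = 0 → T z 0 = 0

lemma PreservesBoundary.tangential (h : PreservesBoundary T y) (hy : y 0 = 0)
    (hT : DifferentiableWithinAt ℝ T (halfSpace n) y) {v : Coord n} (hv : v 0 = 0) :
    fderivWithin ℝ T (halfSpace n) y v 0 = 0 :=
  hasFDerivWithinAt_tangential_eq_zero
    ((EuclideanSpace.proj 0 : Coord n →L[ℝ] ℝ).hasFDerivAt.comp_hasFDerivWithinAt y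
      hT.hasFDerivWithinAt) hy h.eventually hv

lemma PreservesBoundary.normal (h : PreservesBoundary T y) (hy : y 0 = 0)
    (hT : DifferentiableWithinAt ℝ T (halfSpace n) y) (v : Coord n) :
    fderivWithin ℝ T (halfSpace n) y v 0 =
      v 0 * fderivWithin ℝ T (halfSpace n) y (stdVec 0) 0 := by
  have h1 : (v - v 0 • stdVec (0 : Fin n)) 0 = 0 := by simp
  have h2 := h.tangential hy hT h1
  rw [map_sub, map_smul] at h2
  simpa [sub_eq_zero] using h2

lemma PreservesBoundary.normal_pos (h : PreservesBoundary T y) (hy : y 0 = 0)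
    (hT : DifferentiableWithinAt ℝ T (halfSpace n) y)
    (hsurj : Function.Surjective (fderivWithin ℝ T (halfSpace n) y)) :
    0 < fderivWithin ℝ T (halfSpace n) y (stdVec 0) 0 := by
  have hyH : y ∈ halfSpace n := mem_halfSpace.2 hy.ge
  refine lt_of_le_of_ne ?_ fun h0 => ?_
  · exact hasFDerivWithinAt_normal_nonneg
      ((EuclideanSpace.proj 0 : Coord n →L[ℝ] ℝ).hasFDerivAt.comp_hasFDerivWithinAt y
      hT.hasFDerivWithinAt) hy (h.eventually.self_of_nhdsWithin hyH hy)
      fun z hz => mem_halfSpace.1 (h.mapsTo hz)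
  · obtain ⟨v, hv⟩ := hsurj (stdVec 0)
    have := h.normal hy hT v
    rw [hv, ← h0] at this
    simp at this

/-- The zeroth component of the second derivative vanishes on tangential vectors. Hence, in the
transformation law of the Christoffel symbols, the inhomogeneous term does not contribute to the
second fundamental form. -/
lemma PreservesBoundary.second (h : PreservesBoundary T y) (hy : y 0 = 0)
    (hT : ContDiffWithinAt ℝ 2 T (halfSpace n) y) {v w : Coord n} (hv : v 0 = 0) (hw : w 0 = 0) :
    fderivWithin ℝ (fderivWithin ℝ T (halfSpace n)) (halfSpace n) y v w 0 = 0 := by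
  have hyH : y ∈ halfSpace n := mem_halfSpace.2 hy.ge
  have hJ : DifferentiableWithinAt ℝ (fderivWithin ℝ T (halfSpace n)) (halfSpace n) y :=
    (hT.fderivWithin_right (m := 1) uniqueDiff_halfSpace (by norm_num)
      hyH).differentiableWithinAt (by norm_num)
  have h1 := (EuclideanSpace.proj 0 : Coord n →L[ℝ] ℝ).hasFDerivAt.comp_hasFDerivWithinAt y
    (hJ.hasFDerivWithinAt.clm_apply (hasFDerivWithinAt_const w y (halfSpace n)))
  have := hasFDerivWithinAt_tangential_eq_zero h1 hy ?_ hv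
  · simpa using this
  have hT' : ∀ᶠ z in 𝓝[halfSpace n] y, ContDiffWithinAt ℝ 2 T (halfSpace n) z := by
    have := hT.eventually (by norm_cast)
    rwa [insert_eq_of_mem hyH] at this
  filter_upwards [hT', eventually_eventually_nhdsWithin.2 h.eventually] with z hz1 hz2 hz3
  exact PreservesBoundary.tangential ⟨h.mapsTo, hz2⟩ hz3
    (hz1.differentiableWithinAt (by norm_num)) hw

/-- The inverse metrics of a pullback: `g_B⁰⁰ = ρ² g_A⁰⁰`, with `ρ = ∂₀T⁰`. -/
lemma PreservesBoundary.inv_zero_zero (h : PreservesBoundary T y) (hy : y 0 = 0)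
    (hT : DifferentiableWithinAt ℝ T (halfSpace n) y)
    (hAB : IsPullbackAt (halfSpace n) T A B y) (hA : IsMetric (A y)) (hB : (B (T y)).IsSymm) :
    (B (T y))⁻¹ 0 0 = fderivWithin ℝ T (halfSpace n) y (stdVec 0) 0 ^ 2 * (A y)⁻¹ 0 0 := by
  have hBd := hAB.det_ne_zero hA.det_ne_zero
  set ρ := fderivWithin ℝ T (halfSpace n) y (stdVec 0) 0
  -- `DT` maps `ρ` times the `A`-gradient of `y₀` to the `B`-gradient
  have key : (WithLp.toLp 2 fun k => (B (T y))⁻¹ k 0 : Coord n) =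
      fderivWithin ℝ T (halfSpace n) y (ρ • WithLp.toLp 2 fun k => (A y)⁻¹ k 0) := by
    refine bil_congr_right hBd hB fun x => ?_
    obtain ⟨w, rfl⟩ := hAB.surjective hA.det_ne_zero hA.isSymm x
    rw [← hAB, bil_smul_left, bil_inv_col hBd hB, bil_inv_col hA.det_ne_zero hA.isSymm,
      h.normal hy hT w]
    ring
  have h2 := congrArg (fun x : Coord n => x 0) key
  simp only [map_smul, PiLp.smul_apply, smul_eq_mul] at h2
  rw [h.normal hy hT] at h2
  rw [h2]
  simp only [ρ]; ring

/-- The second fundamental form of the boundary is natural under pullback by maps that preserve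
the boundary. -/
theorem secondForm_pullback (h : PreservesBoundary T y) (hy : y 0 = 0)
    (hT : ContDiffWithinAt ℝ 2 T (halfSpace n) y)
    (hAB : ∀ᶠ z in 𝓝[halfSpace n] y, IsPullbackAt (halfSpace n) T A B z)
    (hA : ∀ᶠ z in 𝓝[halfSpace n] y, IsMetric (A z))
    (hB : ∀ᶠ z in 𝓝[halfSpace n] (T y), IsMetric (B z))
    (hA1 : ∀ i j, ContDiffWithinAt ℝ 1 (fun z => A z i j) (halfSpace n) y)
    (hB1 : ∀ i j, ContDiffWithinAt ℝ 1 (fun z => B z i j) (halfSpace n) (T y))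
    {v w : Coord n} (hv : v 0 = 0) (hw : w 0 = 0) :
    secondForm (halfSpace n) A y v w = secondForm (halfSpace n) B (T y)
      (fderivWithin ℝ T (halfSpace n) y v) (fderivWithin ℝ T (halfSpace n) y w) := by
  have hyH : y ∈ halfSpace n := mem_halfSpace.2 hy.ge
  have hTd := hT.differentiableWithinAt (by norm_num)
  have hAy := hA.self_of_nhdsWithin hyH
  have hBy := hB.self_of_nhdsWithin (h.mapsTo hyH)
  have hABy := hAB.self_of_nhdsWithin hyH
  have hsurj := hABy.surjective hAy.det_ne_zero hAy.isSymm
  rw [secondForm_eq_chr uniqueDiff_halfSpace hyH hA hA1 hw,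
    secondForm_eq_chr uniqueDiff_halfSpace (h.mapsTo hyH) hB hB1 (h.tangential hy hTd hw)]
  -- The zeroth component of the transformation law compares `Γ⁰` on both sides, up to the factor
  -- `∂₀T⁰`, which cancels against the one in the normalization of the normal vector.
  have hc := chr_pullback uniqueDiff_halfSpace hyH (halfSpace_subset_closure_interior hyH) hT
    h.mapsTo hAB hAy.det_ne_zero (hA.mono fun z hz => hz.isSymm) hBy.det_ne_zero hBy.isSymm
    (fun i j => (hB1 i j).differentiableWithinAt (by norm_num)) hsurj v w
  have hc0 := congrArg (fun x : Coord n => x 0) hc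
  simp only [PiLp.add_apply, h.second hy hT hv hw, zero_add] at hc0
  rw [h.normal hy hTd] at hc0
  have hρ := h.normal_pos hy hTd hsurj
  rw [← hc0, h.inv_zero_zero hy hTd hABy hAy hBy.isSymm, Real.sqrt_mul (sq_nonneg _),
    Real.sqrt_sq hρ.le]
  have := (Real.sqrt_pos.2 (hAy.inv_diag_pos 0)).ne'
  field_simp

end Boundary

end LocalRiem

end

/-! ### Components of a metric in a chart -/

section

variable {n : ℕ} [NeZero n] {M : Type*} [TopologicalSpace M]
  [ChartedSpace (EuclideanHalfSpace n) M]

/-- A field of bilinear forms on the tangent spaces of `M`. -/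
abbrev BilinField (n : ℕ) [NeZero n] (M : Type*) [TopologicalSpace M]
    [ChartedSpace (EuclideanHalfSpace n) M] :=
  ∀ x : M, TangentSpace (𝓡∂ n) x →L[ℝ] TangentSpace (𝓡∂ n) x →L[ℝ] ℝ

namespace Chart

/-- The tangent vector of `M` with the components `v` in the chart `e`, at the point with the
coordinates `y`. -/
def symmVec (e : OpenPartialHomeomorph M (EuclideanHalfSpace n)) (y : Coord n) :
    Coord n →L[ℝ] TangentSpace (𝓡∂ n) ((e.extend (𝓡∂ n)).symm y) :=
  mfderivWithin 𝓘(ℝ, Coord n) (𝓡∂ n) (e.extend (𝓡∂ n)).symm (range (𝓡∂ n)) y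

/-- The components of `β` in the chart `e`. -/
def comps (β : BilinField n M) (e : OpenPartialHomeomorph M (EuclideanHalfSpace n)) (y : Coord n) :
    Matrix (Fin n) (Fin n) ℝ :=
  Matrix.of fun i j => β _ (symmVec e y (stdVec i)) (symmVec e y (stdVec j))

/-- The change of coordinates from `e` to `e'`. -/
abbrev trans (e e' : OpenPartialHomeomorph M (EuclideanHalfSpace n)) : Coord n → Coord n :=
  (𝓡∂ n).extendCoordChange e e'

lemma trans_apply (e e' : OpenPartialHomeomorph M (EuclideanHalfSpace n)) (y : Coord n) :
    trans e e' y = e'.extend (𝓡∂ n) ((e.extend (𝓡∂ n)).symm y) := rfl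

lemma bil_comps (β : BilinField n M) (e : OpenPartialHomeomorph M (EuclideanHalfSpace n))
    (y u v : Coord n) : bil (comps β e y) u v = β _ (symmVec e y u) (symmVec e y v) := by
  conv_rhs => rw [← sum_smul_stdVec u, ← sum_smul_stdVec v]
  simp only [map_sum, map_smul, sum_apply, smul_apply, bil, comps, Matrix.of_apply, smul_eq_mul,
    Finset.mul_sum]
  rw [Finset.sum_comm]
  exact Finset.sum_congr rfl fun _ _ => Finset.sum_congr rfl fun _ _ => by ring

lemma comps_isSymm {β : BilinField n M} (hβ : ∀ x u v, β x u v = β x v u)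
    (e : OpenPartialHomeomorph M (EuclideanHalfSpace n)) (y : Coord n) : (comps β e y).IsSymm := by
  ext i j; exact hβ _ _ _

lemma extend_mem_halfSpace (e : OpenPartialHomeomorph M (EuclideanHalfSpace n)) (x : M) :
    e.extend (𝓡∂ n) x ∈ halfSpace n := ⟨e x, rfl⟩

lemma mapsTo_trans (e e' : OpenPartialHomeomorph M (EuclideanHalfSpace n)) :
    MapsTo (trans e e') (halfSpace n) (halfSpace n) := fun _ _ => extend_mem_halfSpace e' _

lemma target_mem_nhdsWithin {e : OpenPartialHomeomorph M (EuclideanHalfSpace n)} {y : Coord n}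
    (hy : y ∈ (e.extend (𝓡∂ n)).target) : (e.extend (𝓡∂ n)).target ∈ 𝓝[halfSpace n] y := by
  rw [← (e.extend (𝓡∂ n)).right_inv hy]
  refine e.extend_target_mem_nhdsWithin ?_
  have := (e.extend (𝓡∂ n)).map_target hy
  rwa [e.extend_source] at this

lemma symm_mem_source {e : OpenPartialHomeomorph M (EuclideanHalfSpace n)} {y : Coord n}
    (hy : y ∈ (e.extend (𝓡∂ n)).target) : (e.extend (𝓡∂ n)).symm y ∈ e.source := by
  have := (e.extend (𝓡∂ n)).map_target hy
  rwa [e.extend_source] at this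

lemma target_subset (e : OpenPartialHomeomorph M (EuclideanHalfSpace n)) :
    (e.extend (𝓡∂ n)).target ⊆ halfSpace n := e.extend_target_subset_range

lemma apply_mem_target {e : OpenPartialHomeomorph M (EuclideanHalfSpace n)} {x : M}
    (hx : x ∈ e.source) : e.extend (𝓡∂ n) x ∈ (e.extend (𝓡∂ n)).target :=
  (e.extend (𝓡∂ n)).map_source (by rwa [e.extend_source])

lemma left_inv {e : OpenPartialHomeomorph M (EuclideanHalfSpace n)} {x : M}
    (hx : x ∈ e.source) : (e.extend (𝓡∂ n)).symm (e.extend (𝓡∂ n) x) = x :=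
  e.extend_left_inv hx

lemma mem_trans_source {e e' : OpenPartialHomeomorph M (EuclideanHalfSpace n)} {y : Coord n}
    (hy : y ∈ (e.extend (𝓡∂ n)).target) (hy' : (e.extend (𝓡∂ n)).symm y ∈ e'.source) :
    y ∈ ((𝓡∂ n).extendCoordChange e e').source := by
  rw [ModelWithCorners.extendCoordChange, PartialEquiv.trans_source]
  exact ⟨hy, by rwa [mem_preimage, e'.extend_source]⟩

/-- The points with coordinates near `y` lie in the second chart. -/
lemma eventually_mem_source {e e' : OpenPartialHomeomorph M (EuclideanHalfSpace n)} {y : Coord n}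
    (hy : y ∈ (e.extend (𝓡∂ n)).target) (hy' : (e.extend (𝓡∂ n)).symm y ∈ e'.source) :
    ∀ᶠ z in 𝓝[halfSpace n] y, z ∈ (e.extend (𝓡∂ n)).target ∧
      (e.extend (𝓡∂ n)).symm z ∈ e'.source := by
  filter_upwards [ModelWithCorners.extendCoordChange_source_mem_nhdsWithin
    (mem_trans_source hy hy')] with z hz
  rw [ModelWithCorners.extendCoordChange, PartialEquiv.trans_source, mem_inter_iff, mem_preimage,
    e'.extend_source] at hz
  exact hz

variable [IsManifold (𝓡∂ n) ∞ M]

lemma contDiffWithinAt_trans {e e' : OpenPartialHomeomorph M (EuclideanHalfSpace n)}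
    (he : e ∈ IsManifold.maximalAtlas (𝓡∂ n) ∞ M) (he' : e' ∈ IsManifold.maximalAtlas (𝓡∂ n) ∞ M)
    {y : Coord n} (hy : y ∈ (e.extend (𝓡∂ n)).target)
    (hy' : (e.extend (𝓡∂ n)).symm y ∈ e'.source) :
    ContDiffWithinAt ℝ ∞ (trans e e') (halfSpace n) y :=
  (𝓡∂ n).contDiffWithinAt_extendCoordChange he he' (mem_trans_source hy hy')

lemma contMDiffWithinAt_symm {e : OpenPartialHomeomorph M (EuclideanHalfSpace n)}
    (he : e ∈ IsManifold.maximalAtlas (𝓡∂ n) ∞ M) {y : Coord n}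
    (hy : y ∈ (e.extend (𝓡∂ n)).target) :
    ContMDiffWithinAt 𝓘(ℝ, Coord n) (𝓡∂ n) ∞ (e.extend (𝓡∂ n)).symm (halfSpace n) y := by
  have h := contMDiffOn_extend_symm he
  rw [← e.extend_target'] at h
  exact (h y hy).mono_of_mem_nhdsWithin (target_mem_nhdsWithin hy)

lemma mdifferentiableWithinAt_symm {e : OpenPartialHomeomorph M (EuclideanHalfSpace n)}
    (he : e ∈ IsManifold.maximalAtlas (𝓡∂ n) ∞ M) {y : Coord n}
    (hy : y ∈ (e.extend (𝓡∂ n)).target) :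
    MDifferentiableWithinAt 𝓘(ℝ, Coord n) (𝓡∂ n) (e.extend (𝓡∂ n)).symm (halfSpace n) y :=
  (contMDiffWithinAt_symm he hy).mdifferentiableWithinAt (by simp)

/-- Change of coordinates for tangent vectors. -/
lemma symmVec_trans {e e' : OpenPartialHomeomorph M (EuclideanHalfSpace n)}
    (he : e ∈ IsManifold.maximalAtlas (𝓡∂ n) ∞ M) (he' : e' ∈ IsManifold.maximalAtlas (𝓡∂ n) ∞ M)
    {y : Coord n} (hy : y ∈ (e.extend (𝓡∂ n)).target)
    (hy' : (e.extend (𝓡∂ n)).symm y ∈ e'.source) (v : Coord n) :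
    (symmVec e y v : Coord n) =
      symmVec e' (trans e e' y) (fderivWithin ℝ (trans e e') (halfSpace n) y v) := by
  have hyH := target_subset e hy
  have hu : UniqueMDiffWithinAt 𝓘(ℝ, Coord n) (halfSpace n) y :=
    (uniqueDiff_halfSpace y hyH).uniqueMDiffWithinAt
  have hT : MDifferentiableWithinAt 𝓘(ℝ, Coord n) 𝓘(ℝ, Coord n) (trans e e') (halfSpace n) y :=
    ((contDiffWithinAt_trans he he' hy hy').differentiableWithinAt
      (by simp)).mdifferentiableWithinAt
  have hTy : trans e e' y ∈ (e'.extend (𝓡∂ n)).target := apply_mem_target hy'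
  have hcomp := mfderivWithin_comp y (mdifferentiableWithinAt_symm he' hTy) hT
    (mapsTo_trans e e') hu
  have heq : ((e'.extend (𝓡∂ n)).symm ∘ trans e e') =ᶠ[𝓝[halfSpace n] y]
      (e.extend (𝓡∂ n)).symm := by
    filter_upwards [eventually_mem_source hy hy'] with z hz
    exact left_inv hz.2
  have h2 := heq.symm.mfderivWithin_eq (I := 𝓘(ℝ, Coord n)) (I' := 𝓡∂ n)
    (left_inv hy').symm
  rw [mfderivWithin_eq_fderivWithin] at hcomp
  have h3 := h2.trans hcomp
  exact congrArg (fun L : Coord n →L[ℝ] Coord n => L v) h3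

lemma field_congr (β : BilinField n M) {x x' : M} (h : x = x') (u v : Coord n) :
    β x (u : TangentSpace (𝓡∂ n) x) (v : TangentSpace (𝓡∂ n) x) =
      β x' (u : TangentSpace (𝓡∂ n) x') (v : TangentSpace (𝓡∂ n) x') := by
  subst h; rfl

/-- The components in two charts are related by the change of coordinates. -/
lemma isPullbackAt_trans (β : BilinField n M)
    {e e' : OpenPartialHomeomorph M (EuclideanHalfSpace n)}
    (he : e ∈ IsManifold.maximalAtlas (𝓡∂ n) ∞ M) (he' : e' ∈ IsManifold.maximalAtlas (𝓡∂ n) ∞ M)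
    {y : Coord n} (hy : y ∈ (e.extend (𝓡∂ n)).target)
    (hy' : (e.extend (𝓡∂ n)).symm y ∈ e'.source) :
    IsPullbackAt (halfSpace n) (trans e e') (comps β e) (comps β e') y := by
  intro u v
  rw [bil_comps, bil_comps]
  have h1 := symmVec_trans he he' hy hy' u
  have h2 := symmVec_trans he he' hy hy' v
  have h3 := field_congr β (left_inv hy').symm (symmVec e y u) (symmVec e y v)
  refine h3.trans ?_
  rw [h1, h2]
  rfl

/-- A pullback of a `C^k` matrix function by a `C^∞` map is `C^k`. -/
lemma contDiffWithinAt_of_isPullbackAt {T : Coord n → Coord n} {k : WithTop ℕ∞} (hk : k ≤ ∞)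
    {A B : Coord n → Matrix (Fin n) (Fin n) ℝ} {s s' : Set (Coord n)} {y : Coord n}
    (hs : UniqueDiffOn ℝ s) (hy : y ∈ s) (hmap : MapsTo T s s')
    (hT : ContDiffWithinAt ℝ ∞ T s y)
    (hAB : ∀ᶠ z in 𝓝[s] y, IsPullbackAt s T A B z)
    (hB : ∀ i j, ContDiffWithinAt ℝ k (fun z => B z i j) s' (T y)) (i j : Fin n) :
    ContDiffWithinAt ℝ k (fun z => A z i j) s y := by
  have hJ : ∀ v a, ContDiffWithinAt ℝ k (fun z => fderivWithin ℝ T s z v a) s y := by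
    intro v a
    have h1 : ContDiffWithinAt ℝ k (fun z => fderivWithin ℝ T s z v) s y :=
      (hT.fderivWithin_right hs ((add_le_add_left hk 1).trans le_rfl) hy).clm_apply contDiffWithinAt_const
    exact (EuclideanSpace.proj a : Coord n →L[ℝ] ℝ).contDiff.comp_contDiffWithinAt h1
  have hBT : ∀ a b, ContDiffWithinAt ℝ k (fun z => B (T z) a b) s y := fun a b =>
    (hB a b).comp y (hT.of_le hk) hmap
  have h : ContDiffWithinAt ℝ k (fun z => bil (B (T z)) (fderivWithin ℝ T s z (stdVec i))
      (fderivWithin ℝ T s z (stdVec j))) s y := by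
    unfold bil
    exact ContDiffWithinAt.sum fun a _ => ContDiffWithinAt.sum fun b _ =>
      ((hBT a b).mul (hJ _ _)).mul (hJ _ _)
  refine h.congr_of_eventuallyEq_of_mem ?_ hy
  filter_upwards [hAB] with z hz
  rw [← hz, bil_stdVec]

lemma contDiffWithinAt_comps_trans {k : WithTop ℕ∞} (hk : k ≤ ∞) (β : BilinField n M)
    {e e' : OpenPartialHomeomorph M (EuclideanHalfSpace n)}
    (he : e ∈ IsManifold.maximalAtlas (𝓡∂ n) ∞ M) (he' : e' ∈ IsManifold.maximalAtlas (𝓡∂ n) ∞ M)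
    {y : Coord n} (hy : y ∈ (e.extend (𝓡∂ n)).target)
    (hy' : (e.extend (𝓡∂ n)).symm y ∈ e'.source)
    (h : ∀ i j, ContDiffWithinAt ℝ k (fun z => comps β e' z i j) (halfSpace n) (trans e e' y))
    (i j : Fin n) : ContDiffWithinAt ℝ k (fun z => comps β e z i j) (halfSpace n) y :=
  contDiffWithinAt_of_isPullbackAt hk uniqueDiff_halfSpace (target_subset e hy)
    (mapsTo_trans e e') (contDiffWithinAt_trans he he' hy hy')
    ((eventually_mem_source hy hy').mono fun _ hz => isPullbackAt_trans β he he' hz.1 hz.2) h i j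

/-- `β` is of class `C^k` at `x`, as a section of the bundle of bilinear forms. -/
def SmoothFieldAt (k : WithTop ℕ∞) (β : BilinField n M) (x : M) : Prop :=
  ContMDiffAt (𝓡∂ n) ((𝓡∂ n).prod 𝓘(ℝ, Coord n →L[ℝ] Coord n →L[ℝ] ℝ)) k
    (fun b => Bundle.TotalSpace.mk' (Coord n →L[ℝ] Coord n →L[ℝ] ℝ)
      (E := fun b : M => TangentSpace (𝓡∂ n) b →L[ℝ] TangentSpace (𝓡∂ n) b →L[ℝ] ℝ) b (β b)) x

/-- The trivialization of the bundle of bilinear forms at `x₀` is given by the components in the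
chart at `x₀`. -/
lemma trivialization_eq_bil (β : BilinField n M) {x₀ x : M}
    (hx : x ∈ (chartAt (EuclideanHalfSpace n) x₀).source) (u v : Coord n) :
    (trivializationAt (Coord n →L[ℝ] Coord n →L[ℝ] ℝ)
      (fun b : M => TangentSpace (𝓡∂ n) b →L[ℝ] TangentSpace (𝓡∂ n) b →L[ℝ] ℝ) x₀
      ⟨x, β x⟩).2 u v =
      bil (comps β (chartAt _ x₀) ((chartAt (EuclideanHalfSpace n) x₀).extend (𝓡∂ n) x)) u v := by
  have : IsManifold (𝓡∂ n) 1 M := IsManifold.of_le (n := ∞) (by simp)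
  rw [hom_trivializationAt_apply, bil_comps]
  have hb : x ∈ (trivializationAt (Coord n) (TangentSpace (𝓡∂ n)) x₀).baseSet := by
    rwa [TangentBundle.trivializationAt_baseSet]
  erw [inCoordinates_apply_eq₂ hb hb (by simp)]
  have hs : ∀ w, (trivializationAt (Coord n) (TangentSpace (𝓡∂ n)) x₀).symm x w =
      (symmVec (chartAt _ x₀) ((chartAt (EuclideanHalfSpace n) x₀).extend (𝓡∂ n) x) w : Coord n) :=
    by
    intro w
    have := TangentBundle.symmL_trivializationAt (I := 𝓡∂ n) hx
    rw [← Bundle.Trivialization.symmL_apply (R := ℝ) _ hb]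
    exact congrArg (fun L : Coord n →L[ℝ] Coord n => L w) this
  rw [hs, hs]
  have hid : ∀ c : ℝ, (trivializationAt ℝ (Bundle.Trivial M ℝ) x₀).linearMapAt ℝ x c = c := by
    simp
  exact (hid _).trans (field_congr β (left_inv hx) _ _).symm

lemma clm_eq_sum (L : Coord n →L[ℝ] Coord n →L[ℝ] ℝ) :
    L = ∑ i, ∑ j, L (stdVec i) (stdVec j) •
      (EuclideanSpace.proj i : Coord n →L[ℝ] ℝ).smulRight
        (EuclideanSpace.proj j : Coord n →L[ℝ] ℝ) := by
  have hp : ∀ (k : Fin n) (x : Coord n), (EuclideanSpace.proj k : Coord n →L[ℝ] ℝ) x = x k :=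
    fun _ _ => rfl
  ext u v
  conv_lhs => rw [← sum_smul_stdVec u, ← sum_smul_stdVec v]
  simp only [map_sum, map_smul, sum_apply, smul_apply, ContinuousLinearMap.smulRight_apply,
    smul_eq_mul, hp, Finset.mul_sum]
  rw [Finset.sum_comm]
  exact Finset.sum_congr rfl fun _ _ => Finset.sum_congr rfl fun _ _ => by ring

/-- Smoothness of a field of bilinear forms can be tested on its components in any chart. -/
theorem smoothFieldAt_iff {k : WithTop ℕ∞} (hk : k ≤ ∞) (β : BilinField n M)
    {e : OpenPartialHomeomorph M (EuclideanHalfSpace n)}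
    (he : e ∈ IsManifold.maximalAtlas (𝓡∂ n) ∞ M) {x : M} (hx : x ∈ e.source) :
    SmoothFieldAt k β x ↔ ∀ i j,
      ContDiffWithinAt ℝ k (fun z => comps β e z i j) (halfSpace n) (e.extend (𝓡∂ n) x) := by
  set c := chartAt (EuclideanHalfSpace n) x with hc
  have hcx : x ∈ c.source := mem_chart_source _ x
  have hcA : c ∈ IsManifold.maximalAtlas (𝓡∂ n) ∞ M := IsManifold.chart_mem_maximalAtlas x
  rw [SmoothFieldAt, Bundle.contMDiffAt_section]
  constructor
  · intro h
    have h0 : ∀ i j, ContDiffWithinAt ℝ k (fun z => comps β c z i j) (halfSpace n)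
        (c.extend (𝓡∂ n) x) := by
      intro i j
      have hsm := (contMDiffWithinAt_symm hcA (apply_mem_target hcx)).of_le hk
      have h1 := ContMDiffAt.comp_contMDiffWithinAt_of_eq h hsm (left_inv hcx)
      have h2 := contMDiffWithinAt_iff_contDiffWithinAt.1 h1
      have h3 := (h2.clm_apply (contDiffWithinAt_const (c := (stdVec i : Coord n)))).clm_apply
        (contDiffWithinAt_const (c := (stdVec j : Coord n)))
      refine h3.congr_of_eventuallyEq_of_mem ?_ (extend_mem_halfSpace c x)
      filter_upwards [target_mem_nhdsWithin (apply_mem_target hcx)] with z hz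
      have := trivialization_eq_bil β (symm_mem_source hz) (stdVec i) (stdVec j)
      rw [← hc, (c.extend (𝓡∂ n)).right_inv hz, bil_stdVec] at this
      exact this.symm
    intro i j
    refine contDiffWithinAt_comps_trans hk β he hcA (apply_mem_target hx) ?_ ?_ i j
    · rwa [left_inv hx]
    · rw [trans_apply, left_inv hx]; exact h0
  · intro h
    have h0 : ∀ i j, ContDiffWithinAt ℝ k (fun z => comps β c z i j) (halfSpace n)
        (c.extend (𝓡∂ n) x) := by
      refine contDiffWithinAt_comps_trans hk β hcA he (apply_mem_target hcx) ?_ ?_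
      · rwa [left_inv hcx]
      · rw [trans_apply, left_inv hcx]; exact h
    have h1 : ∀ i j, ContMDiffAt (𝓡∂ n) 𝓘(ℝ, ℝ) k
        (fun z => comps β c (c.extend (𝓡∂ n) z) i j) x := by
      intro i j
      have hX : ContMDiffAt (𝓡∂ n) 𝓘(ℝ, Coord n) k (c.extend (𝓡∂ n)) x :=
        (c.contMDiffAt_extend hcA hcx).of_le hk
      exact contMDiffWithinAt_univ.1 ((h0 i j).contMDiffWithinAt.comp x
        (contMDiffWithinAt_univ.2 hX) fun z _ => extend_mem_halfSpace c z)
    have h2 : ContMDiffAt (𝓡∂ n) 𝓘(ℝ, Coord n →L[ℝ] Coord n →L[ℝ] ℝ) k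
        (fun z => ∑ i, ∑ j, comps β c (c.extend (𝓡∂ n) z) i j •
          (EuclideanSpace.proj i : Coord n →L[ℝ] ℝ).smulRight
            (EuclideanSpace.proj j : Coord n →L[ℝ] ℝ)) x :=
      contMDiffAt_finsetSum fun i _ => contMDiffAt_finsetSum fun j _ =>
        (h1 i j).smul contMDiffAt_const
    refine h2.congr_of_eventuallyEq ?_
    filter_upwards [c.open_source.mem_nhds hcx] with z hz
    refine (clm_eq_sum _).trans ?_
    refine Finset.sum_congr rfl fun i _ => Finset.sum_congr rfl fun j _ => ?_
    rw [trivialization_eq_bil β hz, bil_stdVec]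

end Chart

end

/-! ### Curvature in arbitrary charts -/

section

variable {n : ℕ} [NeZero n] {M : Type*} [TopologicalSpace M]
  [ChartedSpace (EuclideanHalfSpace n) M]

namespace Chart

/-- The components in the chart `e` of a tangent vector at `x`. -/
def vecOf (e : OpenPartialHomeomorph M (EuclideanHalfSpace n)) (x : M) :
    TangentSpace (𝓡∂ n) x →L[ℝ] Coord n :=
  mfderiv (𝓡∂ n) 𝓘(ℝ, Coord n) (e.extend (𝓡∂ n)) x

variable [IsManifold (𝓡∂ n) ∞ M]

lemma mdifferentiableAt_extend {e : OpenPartialHomeomorph M (EuclideanHalfSpace n)}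
    (he : e ∈ IsManifold.maximalAtlas (𝓡∂ n) ∞ M) {x : M} (hx : x ∈ e.source) :
    MDifferentiableAt (𝓡∂ n) 𝓘(ℝ, Coord n) (e.extend (𝓡∂ n)) x :=
  (e.contMDiffAt_extend he hx).mdifferentiableAt (by simp)

lemma vecOf_symmVec {e : OpenPartialHomeomorph M (EuclideanHalfSpace n)}
    (he : e ∈ IsManifold.maximalAtlas (𝓡∂ n) ∞ M) {x : M} (hx : x ∈ e.source) (v : Coord n) :
    vecOf e x (symmVec e (e.extend (𝓡∂ n) x) v : Coord n) = v := by
  set y := e.extend (𝓡∂ n) x with hy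
  have hyt : y ∈ (e.extend (𝓡∂ n)).target := apply_mem_target hx
  have hu : UniqueMDiffWithinAt 𝓘(ℝ, Coord n) (halfSpace n) y :=
    (uniqueDiff_halfSpace y (target_subset e hyt)).uniqueMDiffWithinAt
  have hd : MDifferentiableAt (𝓡∂ n) 𝓘(ℝ, Coord n) (e.extend (𝓡∂ n))
      ((e.extend (𝓡∂ n)).symm y) := by
    rw [hy, left_inv hx]; exact mdifferentiableAt_extend he hx
  have hcomp := mfderiv_comp_mfderivWithin y hd (mdifferentiableWithinAt_symm he hyt) hu
  have heq : (e.extend (𝓡∂ n) ∘ (e.extend (𝓡∂ n)).symm) =ᶠ[𝓝[halfSpace n] y] id := by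
    filter_upwards [target_mem_nhdsWithin hyt] with z hz
    exact (e.extend (𝓡∂ n)).right_inv hz
  have h2 := heq.mfderivWithin_eq (I := 𝓘(ℝ, Coord n)) (I' := 𝓘(ℝ, Coord n))
    ((e.extend (𝓡∂ n)).right_inv hyt)
  rw [mfderivWithin_id hu] at h2
  have h3 := congrArg (fun L : Coord n →L[ℝ] Coord n => L v) (hcomp.symm.trans h2)
  have hx' : (e.extend (𝓡∂ n)).symm y = x := left_inv hx
  rw [hx'] at h3
  exact h3

lemma symmVec_vecOf {e : OpenPartialHomeomorph M (EuclideanHalfSpace n)}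
    (he : e ∈ IsManifold.maximalAtlas (𝓡∂ n) ∞ M) {x : M} (hx : x ∈ e.source)
    (v : TangentSpace (𝓡∂ n) x) :
    (symmVec e (e.extend (𝓡∂ n) x) (vecOf e x v) : Coord n) = (v : Coord n) := by
  let L' : Coord n →L[ℝ] Coord n := vecOf e x
  let R' : Coord n →L[ℝ] Coord n := symmVec e (e.extend (𝓡∂ n) x)
  let L : Coord n →ₗ[ℝ] Coord n := L'
  let R : Coord n →ₗ[ℝ] Coord n := R'
  have h : L * R = 1 := LinearMap.ext fun v => vecOf_symmVec he hx v
  have h' : R * L = 1 := mul_eq_one_comm.1 h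
  exact congrArg (fun T : Coord n →ₗ[ℝ] Coord n => T v) h'

lemma vecOf_injective {e : OpenPartialHomeomorph M (EuclideanHalfSpace n)}
    (he : e ∈ IsManifold.maximalAtlas (𝓡∂ n) ∞ M) {x : M} (hx : x ∈ e.source) :
    Function.Injective (vecOf e x) := by
  intro v w h
  have h1 := symmVec_vecOf he hx v
  have h2 := symmVec_vecOf he hx w
  rw [h] at h1
  exact h1.symm.trans h2

/-- The value of a field of bilinear forms, in terms of its components. -/
lemma apply_eq_bil (β : BilinField n M) {e : OpenPartialHomeomorph M (EuclideanHalfSpace n)}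
    (he : e ∈ IsManifold.maximalAtlas (𝓡∂ n) ∞ M) {x : M} (hx : x ∈ e.source)
    (v w : TangentSpace (𝓡∂ n) x) :
    β x v w = bil (comps β e (e.extend (𝓡∂ n) x)) (vecOf e x v) (vecOf e x w) := by
  rw [bil_comps]
  have h1 := field_congr β (left_inv hx) (symmVec e (e.extend (𝓡∂ n) x) (vecOf e x v))
    (symmVec e (e.extend (𝓡∂ n) x) (vecOf e x w))
  refine Eq.trans ?_ h1.symm
  rw [symmVec_vecOf he hx, symmVec_vecOf he hx]

lemma vecOf_trans {e e' : OpenPartialHomeomorph M (EuclideanHalfSpace n)}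
    (he : e ∈ IsManifold.maximalAtlas (𝓡∂ n) ∞ M) (he' : e' ∈ IsManifold.maximalAtlas (𝓡∂ n) ∞ M)
    {x : M} (hx : x ∈ e.source) (hx' : x ∈ e'.source) (v : TangentSpace (𝓡∂ n) x) :
    vecOf e' x v =
      fderivWithin ℝ (trans e e') (halfSpace n) (e.extend (𝓡∂ n) x) (vecOf e x v) := by
  have h1 := symmVec_trans he he' (apply_mem_target hx) (by rwa [left_inv hx]) (vecOf e x v)
  rw [symmVec_vecOf he hx, trans_apply, left_inv hx] at h1
  have h2 := vecOf_symmVec he' hx' (fderivWithin ℝ (trans e e') (halfSpace n)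
    (e.extend (𝓡∂ n) x) (vecOf e x v))
  rw [← h1] at h2
  exact h2

lemma interior_halfSpace_eq : interior (halfSpace n) = {y : Coord n | 0 < y 0} :=
  interior_range_modelWithCornersEuclideanHalfSpace n

lemma fderivWithin_trans_surjective {e e' : OpenPartialHomeomorph M (EuclideanHalfSpace n)}
    (he : e ∈ IsManifold.maximalAtlas (𝓡∂ n) ∞ M) (he' : e' ∈ IsManifold.maximalAtlas (𝓡∂ n) ∞ M)
    {x : M} (hx : x ∈ e.source) (hx' : x ∈ e'.source) :
    Function.Surjective (fderivWithin ℝ (trans e e') (halfSpace n) (e.extend (𝓡∂ n) x)) := by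
  intro w
  exact ⟨vecOf e x (symmVec e' (e'.extend (𝓡∂ n) x) w : Coord n),
    (vecOf_trans he he' hx hx' _).symm.trans (vecOf_symmVec he' hx' w)⟩

/-- Changes of coordinates preserve the interior of the half space. -/
lemma trans_pos {e e' : OpenPartialHomeomorph M (EuclideanHalfSpace n)}
    (he : e ∈ IsManifold.maximalAtlas (𝓡∂ n) ∞ M) (he' : e' ∈ IsManifold.maximalAtlas (𝓡∂ n) ∞ M)
    {x : M} (hx : x ∈ e.source) (hx' : x ∈ e'.source) (h : 0 < e.extend (𝓡∂ n) x 0) :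
    0 < e'.extend (𝓡∂ n) x 0 := by
  have hint : halfSpace n ∈ 𝓝 (e.extend (𝓡∂ n) x) :=
    mem_interior_iff_mem_nhds.1 (by rw [interior_halfSpace_eq]; exact h)
  have hT := (contDiffWithinAt_trans he he' (apply_mem_target hx)
    (by rwa [left_inv hx])).differentiableWithinAt (by simp)
  have hsurj := fderivWithin_trans_surjective he he' hx hx'
  rw [fderivWithin_of_mem_nhds hint] at hsurj
  have := (hT.differentiableAt hint).mem_interior_convex_of_surjective_fderiv hint
    convex_halfSpace (𝓡∂ n).isClosed_range
    ⟨_, by rw [interior_halfSpace_eq]; exact h⟩ (mapsTo_trans e e') hsurj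
  rw [interior_halfSpace_eq, trans_apply, left_inv hx] at this
  exact this

lemma extend_zero_iff {e e' : OpenPartialHomeomorph M (EuclideanHalfSpace n)}
    (he : e ∈ IsManifold.maximalAtlas (𝓡∂ n) ∞ M) (he' : e' ∈ IsManifold.maximalAtlas (𝓡∂ n) ∞ M)
    {x : M} (hx : x ∈ e.source) (hx' : x ∈ e'.source) :
    e.extend (𝓡∂ n) x 0 = 0 ↔ e'.extend (𝓡∂ n) x 0 = 0 := by
  have h1 := mem_halfSpace.1 (extend_mem_halfSpace e x)
  have h2 := mem_halfSpace.1 (extend_mem_halfSpace e' x)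
  constructor
  · intro h
    by_contra h0
    exact (trans_pos he' he hx' hx (lt_of_le_of_ne h2 (Ne.symm h0))).ne' h
  · intro h
    by_contra h0
    exact (trans_pos he he' hx hx' (lt_of_le_of_ne h1 (Ne.symm h0))).ne' h

/-- The boundary is `{y₀ = 0}` in every chart. -/
lemma mem_boundary_iff {e : OpenPartialHomeomorph M (EuclideanHalfSpace n)}
    (he : e ∈ IsManifold.maximalAtlas (𝓡∂ n) ∞ M) {x : M} (hx : x ∈ e.source) :
    x ∈ (𝓡∂ n).boundary M ↔ e.extend (𝓡∂ n) x 0 = 0 := by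
  rw [extend_zero_iff he (IsManifold.chart_mem_maximalAtlas x) hx (mem_chart_source _ x)]
  change (𝓡∂ n).IsBoundaryPoint x ↔ _
  rw [ModelWithCorners.isBoundaryPoint_iff, frontier_range_modelWithCornersEuclideanHalfSpace]
  exact ⟨fun h => h.symm, fun h => h.symm⟩

lemma preservesBoundary_trans {e e' : OpenPartialHomeomorph M (EuclideanHalfSpace n)}
    (he : e ∈ IsManifold.maximalAtlas (𝓡∂ n) ∞ M) (he' : e' ∈ IsManifold.maximalAtlas (𝓡∂ n) ∞ M)
    {y : Coord n} (hy : y ∈ (e.extend (𝓡∂ n)).target)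
    (hy' : (e.extend (𝓡∂ n)).symm y ∈ e'.source) : PreservesBoundary (trans e e') y where
  mapsTo := mapsTo_trans e e'
  eventually := by
    filter_upwards [eventually_mem_source hy hy'] with z hz hz0
    have h := extend_zero_iff he he' (symm_mem_source hz.1) hz.2
    rw [(e.extend (𝓡∂ n)).right_inv hz.1] at h
    exact h.1 hz0

end Chart

open Chart

namespace RMetric

variable [IsManifold (𝓡∂ n) ∞ M] {k : WithTop ℕ∞}

lemma isMetric_comps (g : RMetric n k M) {e : OpenPartialHomeomorph M (EuclideanHalfSpace n)}
    (he : e ∈ IsManifold.maximalAtlas (𝓡∂ n) ∞ M) {y : Coord n}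
    (hy : y ∈ (e.extend (𝓡∂ n)).target) : IsMetric (comps g.inner e y) where
  isSymm := comps_isSymm g.symm e y
  pos := fun v hv => by
    rw [bil_comps]
    refine g.pos _ _ fun h0 => hv ?_
    have := vecOf_symmVec he (symm_mem_source hy) v
    rw [(e.extend (𝓡∂ n)).right_inv hy, h0] at this
    exact this.symm.trans (map_zero (vecOf e _))

lemma contDiffWithinAt_comps (g : RMetric n k M) (hk : k ≤ ∞)
    {e : OpenPartialHomeomorph M (EuclideanHalfSpace n)}
    (he : e ∈ IsManifold.maximalAtlas (𝓡∂ n) ∞ M) {y : Coord n}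
    (hy : y ∈ (e.extend (𝓡∂ n)).target) (i j : Fin n) :
    ContDiffWithinAt ℝ k (fun z => comps g.inner e z i j) (halfSpace n) y := by
  have := (smoothFieldAt_iff hk g.inner he (symm_mem_source hy)).1
    (g.contMDiff ((e.extend (𝓡∂ n)).symm y)) i j
  rwa [(e.extend (𝓡∂ n)).right_inv hy] at this

lemma components_eq (g : RMetric n k M) (x : M) : g.components x = comps g.inner (chartAt _ x) :=
  rfl

/-- The scalar curvature can be computed in any chart. -/
theorem scalarCurvature_eq (g : RMetric n k M) (hk : k ≤ ∞) (hk2 : 2 ≤ k)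
    {e : OpenPartialHomeomorph M (EuclideanHalfSpace n)}
    (he : e ∈ IsManifold.maximalAtlas (𝓡∂ n) ∞ M) {x : M} (hx : x ∈ e.source) :
    g.scalarCurvature x = scalar (halfSpace n) (comps g.inner e) (e.extend (𝓡∂ n) x) := by
  have hc : chartAt (EuclideanHalfSpace n) x ∈ IsManifold.maximalAtlas (𝓡∂ n) ∞ M :=
    IsManifold.chart_mem_maximalAtlas x
  have hy := apply_mem_target (mem_chart_source (EuclideanHalfSpace n) x)
  have hy' : ((chartAt (EuclideanHalfSpace n) x).extend (𝓡∂ n)).symm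
      ((chartAt (EuclideanHalfSpace n) x).extend (𝓡∂ n) x) ∈ e.source := by
    rwa [left_inv (mem_chart_source (EuclideanHalfSpace n) x)]
  have hev := eventually_mem_source hy hy'
  have hTy : trans (chartAt (EuclideanHalfSpace n) x) e
      ((chartAt (EuclideanHalfSpace n) x).extend (𝓡∂ n) x) = e.extend (𝓡∂ n) x := by
    rw [trans_apply, left_inv (mem_chart_source (EuclideanHalfSpace n) x)]
  have h := scalar_pullback uniqueDiff_halfSpace (extend_mem_halfSpace _ x)
    halfSpace_subset_closure_interior uniqueDiff_halfSpace
    ((contDiffWithinAt_trans hc he hy hy').of_le (by norm_cast))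
    (mapsTo_trans _ _) (hev.mono fun z hz => isPullbackAt_trans g.inner hc he hz.1 hz.2)
    (g.isMetric_comps hc hy).det_ne_zero
    (hev.mono fun z hz => (g.isMetric_comps hc hz.1).isSymm)
    (fun i j => (g.contDiffWithinAt_comps hk hc hy i j).of_le hk2)
    (Eventually.of_forall fun z => comps_isSymm g.symm e z)
    (fun i j => ?_)
  · rw [hTy] at h
    exact h
  · rw [hTy]
    exact (g.contDiffWithinAt_comps hk he (apply_mem_target hx) i j).of_le hk2

lemma isTangentToBoundary_iff {e : OpenPartialHomeomorph M (EuclideanHalfSpace n)}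
    (he : e ∈ IsManifold.maximalAtlas (𝓡∂ n) ∞ M) {x : M} (hx : x ∈ e.source)
    (hb : x ∈ (𝓡∂ n).boundary M) (v : TangentSpace (𝓡∂ n) x) (hv : IsTangentToBoundary x v) :
    vecOf e x v 0 = 0 := by
  have hc : chartAt (EuclideanHalfSpace n) x ∈ IsManifold.maximalAtlas (𝓡∂ n) ∞ M :=
    IsManifold.chart_mem_maximalAtlas x
  have hy := apply_mem_target (mem_chart_source (EuclideanHalfSpace n) x)
  have hy' : ((chartAt (EuclideanHalfSpace n) x).extend (𝓡∂ n)).symm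
      ((chartAt (EuclideanHalfSpace n) x).extend (𝓡∂ n) x) ∈ e.source := by
    rwa [left_inv (mem_chart_source (EuclideanHalfSpace n) x)]
  rw [vecOf_trans hc he (mem_chart_source _ x) hx]
  exact (preservesBoundary_trans hc he hy hy').tangential
    ((mem_boundary_iff hc (mem_chart_source _ x)).1 hb)
    ((contDiffWithinAt_trans hc he hy hy').differentiableWithinAt (by simp)) hv

/-- The second fundamental form on tangential vectors can be computed in any chart. -/
theorem secondFundamentalForm_eq (g : RMetric n k M) (hk : k ≤ ∞) (hk1 : 1 ≤ k)
    {e : OpenPartialHomeomorph M (EuclideanHalfSpace n)}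
    (he : e ∈ IsManifold.maximalAtlas (𝓡∂ n) ∞ M) {x : M} (hx : x ∈ e.source)
    (hb : x ∈ (𝓡∂ n).boundary M) {v w : TangentSpace (𝓡∂ n) x} (hv : IsTangentToBoundary x v)
    (hw : IsTangentToBoundary x w) :
    g.secondFundamentalForm x v w =
      secondForm (halfSpace n) (comps g.inner e) (e.extend (𝓡∂ n) x) (vecOf e x v)
        (vecOf e x w) := by
  have hc : chartAt (EuclideanHalfSpace n) x ∈ IsManifold.maximalAtlas (𝓡∂ n) ∞ M :=
    IsManifold.chart_mem_maximalAtlas x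
  have hy := apply_mem_target (mem_chart_source (EuclideanHalfSpace n) x)
  have hy' : ((chartAt (EuclideanHalfSpace n) x).extend (𝓡∂ n)).symm
      ((chartAt (EuclideanHalfSpace n) x).extend (𝓡∂ n) x) ∈ e.source := by
    rwa [left_inv (mem_chart_source (EuclideanHalfSpace n) x)]
  have hTy : trans (chartAt (EuclideanHalfSpace n) x) e
      ((chartAt (EuclideanHalfSpace n) x).extend (𝓡∂ n) x) = e.extend (𝓡∂ n) x := by
    rw [trans_apply, left_inv (mem_chart_source (EuclideanHalfSpace n) x)]
  have hev := eventually_mem_source hy hy'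
  have h := secondForm_pullback (preservesBoundary_trans hc he hy hy')
    ((mem_boundary_iff hc (mem_chart_source _ x)).1 hb)
    ((contDiffWithinAt_trans hc he hy hy').of_le (by norm_cast))
    (hev.mono fun z hz => isPullbackAt_trans g.inner hc he hz.1 hz.2)
    (hev.mono fun z hz => g.isMetric_comps hc hz.1)
    (by
      rw [hTy]
      filter_upwards [target_mem_nhdsWithin (apply_mem_target hx)] with z hz
      exact g.isMetric_comps he hz)
    (fun i j => (g.contDiffWithinAt_comps hk hc hy i j).of_le hk1)
    (fun i j => by
      rw [hTy]; exact (g.contDiffWithinAt_comps hk he (apply_mem_target hx) i j).of_le hk1)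
    (v := vecOf (chartAt (EuclideanHalfSpace n) x) x v)
    (w := vecOf (chartAt (EuclideanHalfSpace n) x) x w) hv hw
  rw [hTy, ← vecOf_trans hc he (mem_chart_source _ x) hx,
    ← vecOf_trans hc he (mem_chart_source _ x) hx] at h
  exact h

end RMetric

end

/-! ### The inverse function theorem on the half space -/

section

namespace LocalRiem

variable {n : ℕ} [NeZero n]

/-- The point with the coordinates of `y`, except that the zeroth coordinate is `t`. -/
def setZero (t : ℝ) (y : Coord n) : Coord n := y + (t - y 0) • stdVec 0

@[simp] lemma setZero_zero (t : ℝ) (y : Coord n) : setZero t y 0 = t := by simp [setZero]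

lemma setZero_of_ne (t : ℝ) (y : Coord n) {i : Fin n} (hi : i ≠ 0) : setZero t y i = y i := by
  simp [setZero, hi]

lemma setZero_self (y : Coord n) : setZero (y 0) y = y := by simp [setZero]

lemma setZero_of_eq {t : ℝ} {y : Coord n} (h : y 0 = t) : setZero t y = y := by
  simp [setZero, h]

lemma setZero_setZero (s t : ℝ) (y : Coord n) :
    setZero s (setZero t y) = setZero s y := by
  ext i
  by_cases hi : i = 0
  · subst hi; simp
  · simp only [setZero_of_ne _ _ hi]

lemma contDiff_setZero : ContDiff ℝ ω fun p : ℝ × Coord n => setZero p.1 p.2 := by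
  have h0 : ContDiff ℝ ω fun p : ℝ × Coord n => p.2 0 :=
    (EuclideanSpace.proj 0 : Coord n →L[ℝ] ℝ).contDiff.comp contDiff_snd
  unfold setZero
  exact contDiff_snd.add ((contDiff_fst.sub h0).smul contDiff_const)

lemma continuous_setZero : Continuous fun p : ℝ × Coord n => setZero p.1 p.2 :=
  contDiff_setZero.continuous

/-- The nearest point projection to the half space. -/
def projHalfSpace (y : Coord n) : Coord n := setZero (max (y 0) 0) y

lemma projHalfSpace_mem (y : Coord n) : projHalfSpace y ∈ halfSpace n :=
  mem_halfSpace.2 (by simp [projHalfSpace])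

lemma projHalfSpace_of_mem {y : Coord n} (hy : y ∈ halfSpace n) : projHalfSpace y = y :=
  setZero_of_eq (max_eq_left (mem_halfSpace.1 hy)).symm

lemma continuous_projHalfSpace : Continuous (projHalfSpace : Coord n → Coord n) := by
  unfold projHalfSpace
  exact continuous_setZero.comp (by fun_prop : Continuous fun y : Coord n => (max (y 0) 0, y))

lemma norm_projHalfSpace_sub_le (x y : Coord n) :
    ‖projHalfSpace x - projHalfSpace y‖ ≤ ‖x - y‖ := by
  rw [EuclideanSpace.norm_eq, EuclideanSpace.norm_eq]
  refine Real.sqrt_le_sqrt (Finset.sum_le_sum fun i _ => ?_)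
  refine pow_le_pow_left₀ (norm_nonneg _) ?_ 2
  by_cases hi : i = 0
  · subst hi
    simp only [PiLp.sub_apply, projHalfSpace, setZero_zero, Real.norm_eq_abs]
    exact abs_max_sub_max_le_abs _ _ _
  · simp only [PiLp.sub_apply, projHalfSpace, setZero_of_ne _ _ hi, le_refl]

/-- The smooth inverse of a smooth homeomorphism between relatively open subsets of the half
space whose derivative is invertible. -/
lemma contDiffOn_of_inverse {F G : Coord n → Coord n} {s : Set (Coord n)}
    (hs : UniqueDiffOn ℝ s) (hG : ContinuousOn G s) (hmaps : MapsTo G s (halfSpace n))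
    (hFG : ∀ z ∈ s, F (G z) = z) (hF : ∀ z ∈ s, ContDiffWithinAt ℝ ∞ F (halfSpace n) (G z))
    (hinv : ∀ z ∈ s, fderivWithin ℝ F (halfSpace n) (G z) ∈
      range ((↑) : (Coord n ≃L[ℝ] Coord n) → (Coord n →L[ℝ] Coord n))) : ContDiffOn ℝ ∞ G s := by
  have hder : ∀ z ∈ s, HasFDerivWithinAt G
      (ContinuousLinearMap.inverse (fderivWithin ℝ F (halfSpace n) (G z))) s z := by
    intro z hz
    obtain ⟨L, hL⟩ := hinv z hz
    rw [← hL, ContinuousLinearMap.inverse_equiv]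
    have h1 := ((hF z hz).differentiableWithinAt (by simp)).hasFDerivWithinAt
    rw [← hL] at h1
    exact h1.of_local_left_inverse ((hG z hz).tendsto_nhdsWithin hmaps) hz
      (eventually_mem_nhdsWithin.mono hFG)
  refine contDiffOn_infty.2 fun k => ?_
  induction k with
  | zero => exact contDiffOn_zero.2 hG
  | succ k ih =>
    push_cast
    refine (contDiffOn_succ_iff_fderivWithin hs).2 ⟨fun z hz => (hder z hz).differentiableWithinAt,
      fun h => absurd h (by simp), ?_⟩
    intro z hz
    obtain ⟨L, hL⟩ := hinv z hz
    have h1 : ContDiffWithinAt ℝ k (fun z => fderivWithin ℝ F (halfSpace n) (G z)) s z :=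
      ((hF z hz).fderivWithin_right (m := k) uniqueDiff_halfSpace (by
        exact_mod_cast le_top) (hmaps hz)).comp z (ih z hz) hmaps
    have h2 : ContDiffAt ℝ k ContinuousLinearMap.inverse
        (fderivWithin ℝ F (halfSpace n) (G z)) := hL ▸ contDiffAt_map_inverse L
    have h3 : ∀ x ∈ s, fderivWithin ℝ G s x =
        (ContinuousLinearMap.inverse ∘ fun z => fderivWithin ℝ F (halfSpace n) (G z)) x :=
      fun x hx => (hder x hx).fderivWithin (hs x hx)
    exact (h2.comp_contDiffWithinAt z h1).congr h3 (h3 z hz)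

/-- A map that fixes the boundary pointwise has the identity as tangential derivative. -/
lemma fderivWithin_eq_of_fixes_boundary {F : Coord n → Coord n} {y₀ : Coord n} (h0 : y₀ 0 = 0)
    (hF : DifferentiableWithinAt ℝ F (halfSpace n) y₀)
    (hid : ∀ᶠ y in 𝓝[halfSpace n] y₀, y 0 = 0 → F y = y) {v : Coord n} (hv : v 0 = 0) :
    fderivWithin ℝ F (halfSpace n) y₀ v = v := by
  ext i
  have h1 : HasFDerivWithinAt (fun y => F y i - y i)
      ((EuclideanSpace.proj i : Coord n →L[ℝ] ℝ).comp (fderivWithin ℝ F (halfSpace n) y₀) -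
        EuclideanSpace.proj i) (halfSpace n) y₀ :=
    ((EuclideanSpace.proj i : Coord n →L[ℝ] ℝ).hasFDerivAt.comp_hasFDerivWithinAt y₀
      hF.hasFDerivWithinAt).sub (EuclideanSpace.proj i : Coord n →L[ℝ] ℝ).hasFDerivWithinAt
  have := hasFDerivWithinAt_tangential_eq_zero h1 h0
    (hid.mono fun y hy h => by rw [hy h, sub_self]) hv
  exact sub_eq_zero.1 this

/-- The inverse function theorem on the half space, for maps that fix the boundary pointwise. The
map is continued to the other side by its linearization, which keeps strict differentiability. -/
theorem exists_inverse_halfSpace {F : Coord n → Coord n} {y₀ : Coord n} (h0 : y₀ 0 = 0)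
    (hF : ∀ᶠ y in 𝓝[halfSpace n] y₀, ContDiffWithinAt ℝ ∞ F (halfSpace n) y)
    (hid : ∀ᶠ y in 𝓝[halfSpace n] y₀, y 0 = 0 → F y = y)
    (hpos : 0 < fderivWithin ℝ F (halfSpace n) y₀ (stdVec 0) 0) :
    ∃ G : Coord n → Coord n, G y₀ = y₀ ∧
      (∀ᶠ z in 𝓝[halfSpace n] y₀,
        ContDiffWithinAt ℝ ∞ G (halfSpace n) z ∧ G z ∈ halfSpace n ∧ F (G z) = z) ∧
      ∀ᶠ y in 𝓝[halfSpace n] y₀, G (F y) = y := by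
  have hy₀ : y₀ ∈ halfSpace n := mem_halfSpace.2 h0.ge
  have hF0 : ContDiffWithinAt ℝ ∞ F (halfSpace n) y₀ := hF.self_of_nhdsWithin hy₀
  have hFd := hF0.differentiableWithinAt (by simp)
  have hFy₀ : F y₀ = y₀ := hid.self_of_nhdsWithin hy₀ h0
  set L := fderivWithin ℝ F (halfSpace n) y₀ with hL
  have hLt : ∀ v : Coord n, v 0 = 0 → L v = v := fun v hv =>
    fderivWithin_eq_of_fixes_boundary h0 hFd hid hv
  -- The derivative is the identity on the boundary hyperplane and moves the normal vector off it,
  -- so it is injective.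
  have hL0 : ∀ v : Coord n, L v 0 = v 0 * L (stdVec 0) 0 := by
    intro v
    have h1 : v = v 0 • stdVec 0 + setZero 0 v := by ext i; simp [setZero]
    have h2 : L v = v 0 • L (stdVec 0) + setZero 0 v := by
      conv_lhs => rw [h1]
      rw [map_add, map_smul, hLt _ (setZero_zero 0 v)]
    rw [h2]; simp
  have hinj : Function.Injective L := by
    rw [injective_iff_map_eq_zero]
    intro v hv
    have h1 := hL0 v
    rw [hv] at h1
    have h2 : v 0 = 0 := by
      rcases mul_eq_zero.1 h1.symm with h | h
      · exact h
      · exact absurd h hpos.ne'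
    rw [← hLt v h2, hv]
  let L' : Coord n ≃L[ℝ] Coord n :=
    (LinearEquiv.ofInjectiveEndo (L : Coord n →ₗ[ℝ] Coord n) hinj).toContinuousLinearEquiv
  have hL' : (L' : Coord n →L[ℝ] Coord n) = L := by ext v; rfl
  -- `F` is continued by `D ∘ projHalfSpace + L`, where `D = F - L` has small derivative near
  -- `y₀`.
  let D : Coord n → Coord n := fun y => F y - L y
  let F' : Coord n → Coord n := fun y => D (projHalfSpace y) + L y
  have hF'H : ∀ y ∈ halfSpace n, F' y = F y := fun y hy => by
    simp only [F', D, projHalfSpace_of_mem hy]; abel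
  have hF'y₀ : F' y₀ = y₀ := by rw [hF'H y₀ hy₀, hFy₀]
  have hpt : Tendsto (projHalfSpace : Coord n → Coord n) (𝓝 y₀) (𝓝[halfSpace n] y₀) :=
    tendsto_nhdsWithin_iff.2 ⟨by
      simpa only [projHalfSpace_of_mem hy₀] using (continuous_projHalfSpace (n := n)).tendsto y₀,
      Eventually.of_forall projHalfSpace_mem⟩
  have hstrict : HasStrictFDerivAt F' (L' : Coord n →L[ℝ] Coord n) y₀ := by
    rw [hL', hasStrictFDerivAt_iff_isLittleO, Asymptotics.isLittleO_iff]
    intro c hc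
    have hcont : ContinuousWithinAt (fun y => fderivWithin ℝ F (halfSpace n) y) (halfSpace n) y₀ :=
      (hF0.fderivWithin_right (m := 0) uniqueDiff_halfSpace (by simp) hy₀).continuousWithinAt
    have h1 : ∀ᶠ y in 𝓝[halfSpace n] y₀, ‖fderivWithin ℝ F (halfSpace n) y - L‖ < c := by
      have := (hcont.sub continuousWithinAt_const (g := fun _ => L)).norm
      refine this.eventually_lt continuousWithinAt_const ?_
      simpa [hL] using hc
    obtain ⟨r, hr, hball⟩ := Metric.mem_nhdsWithin_iff.1 (hF.and h1)
    have hconv : Convex ℝ (Metric.ball y₀ r ∩ halfSpace n) :=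
      (convex_ball _ _).inter convex_halfSpace
    have hDder : ∀ y ∈ Metric.ball y₀ r ∩ halfSpace n, HasFDerivWithinAt D
        (fderivWithin ℝ F (halfSpace n) y - L) (Metric.ball y₀ r ∩ halfSpace n) y := fun y hy =>
      ((((hball hy).1.differentiableWithinAt (by simp)).hasFDerivWithinAt).sub
        L.hasFDerivWithinAt).mono inter_subset_right
    have hev : ∀ᶠ y in 𝓝 y₀, projHalfSpace y ∈ Metric.ball y₀ r ∩ halfSpace n := by
      have := hpt (inter_mem (mem_nhdsWithin_of_mem_nhds (Metric.ball_mem_nhds y₀ hr))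
        self_mem_nhdsWithin)
      exact this
    rw [nhds_prod_eq]
    filter_upwards [hev.prod_mk hev] with p hp
    -- By the mean value inequality, `D` is Lipschitz with constant `c` on a half ball.
    have h2 := hconv.norm_image_sub_le_of_norm_hasFDerivWithin_le hDder
      (fun y hy => (hball hy).2.le) hp.2 hp.1
    calc ‖F' p.1 - F' p.2 - L (p.1 - p.2)‖ = ‖D (projHalfSpace p.1) - D (projHalfSpace p.2)‖ := by
          congr 1; simp only [F', map_sub]; abel
      _ ≤ c * ‖projHalfSpace p.1 - projHalfSpace p.2‖ := h2
      _ ≤ c * ‖p.1 - p.2‖ := by gcongr; exact norm_projHalfSpace_sub_le _ _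
  let P := hstrict.toOpenPartialHomeomorph F'
  have hPc : ∀ y, P y = F' y := fun y => rfl
  have hsrc : y₀ ∈ P.source := hstrict.mem_toOpenPartialHomeomorph_source
  have htgt : y₀ ∈ P.target := by
    have := P.map_source hsrc
    rwa [hPc, hF'y₀] at this
  have hsymm : P.symm y₀ = y₀ := by
    have := P.left_inv hsrc
    rwa [hPc, hF'y₀] at this
  have hsymmc : ContinuousAt P.symm y₀ := P.continuousAt_symm htgt
  -- below the boundary, `F'` is the linearization
  have hneg : ∀ᶠ y in 𝓝 y₀, F' y ∈ halfSpace n → y ∈ halfSpace n := by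
    filter_upwards [hpt.eventually hid] with y hy hmem
    rw [mem_halfSpace] at hmem ⊢
    by_contra hlt
    have h2 : (projHalfSpace y) 0 = 0 := by
      simp only [projHalfSpace, setZero_zero, max_eq_right_iff]
      exact (not_le.1 hlt).le
    have h3 : F' y = L y := by simp only [F', D, hy h2, hLt _ h2, sub_self, zero_add]
    rw [h3, hL0] at hmem
    nlinarith [not_le.1 hlt]
  have hinvF : ∀ᶠ y in 𝓝[halfSpace n] y₀, fderivWithin ℝ F (halfSpace n) y ∈
      range ((↑) : (Coord n ≃L[ℝ] Coord n) → (Coord n →L[ℝ] Coord n)) := by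
    have hcont : ContinuousWithinAt (fun y => fderivWithin ℝ F (halfSpace n) y) (halfSpace n) y₀ :=
      (hF0.fderivWithin_right (m := 0) uniqueDiff_halfSpace (by simp) hy₀).continuousWithinAt
    have h := ContinuousLinearEquiv.nhds L'
    rw [hL'] at h
    exact hcont h
  have hall : ∀ᶠ z in 𝓝[halfSpace n] y₀, z ∈ P.target ∧ P.symm z ∈ halfSpace n ∧
      ContDiffWithinAt ℝ ∞ F (halfSpace n) (P.symm z) ∧
      fderivWithin ℝ F (halfSpace n) (P.symm z) ∈
        range ((↑) : (Coord n ≃L[ℝ] Coord n) → (Coord n →L[ℝ] Coord n)) := by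
    have h1 : ∀ᶠ z in 𝓝[halfSpace n] y₀, P.symm z ∈ halfSpace n := by
      have ha : ∀ᶠ z in 𝓝[halfSpace n] y₀, F' (P.symm z) ∈ halfSpace n → P.symm z ∈ halfSpace n :=
        nhdsWithin_le_nhds (by
          have := hsymmc.eventually (p := fun y => F' y ∈ halfSpace n → y ∈ halfSpace n)
          rw [hsymm] at this
          exact this hneg)
      filter_upwards [ha, self_mem_nhdsWithin,
        mem_nhdsWithin_of_mem_nhds (P.open_target.mem_nhds htgt)] with z hz hzH hzt
      refine hz ?_
      rw [← hPc, P.right_inv hzt]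
      exact hzH
    have ht : Tendsto P.symm (𝓝[halfSpace n] y₀) (𝓝[halfSpace n] y₀) := by
      refine tendsto_nhdsWithin_iff.2 ⟨?_, h1⟩
      have := hsymmc.tendsto
      rw [hsymm] at this
      exact this.mono_left nhdsWithin_le_nhds
    filter_upwards [h1, mem_nhdsWithin_of_mem_nhds (P.open_target.mem_nhds htgt),
      ht.eventually hF, ht.eventually hinvF] with z a b c d
    exact ⟨b, a, c, d⟩
  obtain ⟨V, hVo, hV0, hV⟩ := mem_nhdsWithin.1 hall
  have hright : ∀ z ∈ V ∩ halfSpace n, F (P.symm z) = z := fun z hz => by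
    have := P.right_inv (hV hz).1
    rwa [hPc, hF'H _ (hV hz).2.1] at this
  have hsm : ContDiffOn ℝ ∞ P.symm (V ∩ halfSpace n) := by
    refine contDiffOn_of_inverse (F := F) ?_ ?_ (fun z hz => (hV hz).2.1) hright
      (fun z hz => (hV hz).2.2.1) (fun z hz => (hV hz).2.2.2)
    · rw [inter_comm]; exact uniqueDiff_halfSpace.inter hVo
    · exact P.symm.continuousOn.mono fun z hz => (hV hz).1
  refine ⟨P.symm, hsymm, ?_, ?_⟩
  · have hmem : V ∩ halfSpace n ∈ 𝓝[halfSpace n] y₀ :=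
      inter_mem (mem_nhdsWithin_of_mem_nhds (hVo.mem_nhds hV0)) self_mem_nhdsWithin
    filter_upwards [hmem] with z hz
    refine ⟨(hsm z hz).mono_of_mem_nhdsWithin ?_, (hV hz).2.1, hright z hz⟩
    exact inter_mem (mem_nhdsWithin_of_mem_nhds (hVo.mem_nhds hz.1)) self_mem_nhdsWithin
  · filter_upwards [self_mem_nhdsWithin,
      mem_nhdsWithin_of_mem_nhds (P.open_source.mem_nhds hsrc)] with y hy hys
    rw [← hF'H y hy, ← hPc, P.left_inv hys]

end LocalRiem

end

/-! ### Pushing the boundary inward -/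

section

variable {n : ℕ} [NeZero n] {M : Type*} [TopologicalSpace M]
  [ChartedSpace (EuclideanHalfSpace n) M]

open Chart

lemma exists_open_inter_target (e : OpenPartialHomeomorph M (EuclideanHalfSpace n)) :
    ∃ V : Set (Coord n), IsOpen V ∧ (e.extend (𝓡∂ n)).target = V ∩ halfSpace n :=
  ⟨(𝓡∂ n).symm ⁻¹' e.target, e.open_target.preimage (𝓡∂ n).continuous_symm, e.extend_target⟩

variable [IsManifold (𝓡∂ n) ∞ M]

lemma IsBoundaryComponent.subset {C : Set M} (hC : IsBoundaryComponent n C) :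
    C ⊆ (𝓡∂ n).boundary M := by
  obtain ⟨q, -, rfl⟩ := hC
  exact connectedComponentIn_subset _ _

/-- A boundary component is relatively open in the boundary, since the boundary points in a small
coordinate half ball form a connected set. -/
lemma IsBoundaryComponent.eventually_mem {C : Set M} (hC : IsBoundaryComponent n C) {p : M}
    (hp : p ∈ C) : ∀ᶠ x in 𝓝 p, x ∈ (𝓡∂ n).boundary M → x ∈ C := by
  set c := chartAt (EuclideanHalfSpace n) p with hc
  have hpc : p ∈ c.source := mem_chart_source _ p
  have hcA : c ∈ IsManifold.maximalAtlas (𝓡∂ n) ∞ M := IsManifold.chart_mem_maximalAtlas p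
  have hpb : p ∈ (𝓡∂ n).boundary M := hC.subset hp
  obtain ⟨V, hVo, hV⟩ := exists_open_inter_target c
  have hyV : c.extend (𝓡∂ n) p ∈ V := (hV ▸ apply_mem_target hpc : _ ∈ V ∩ halfSpace n).1
  obtain ⟨r, hr, hball⟩ := Metric.isOpen_iff.1 hVo _ hyV
  set A : Set (Coord n) := Metric.ball (c.extend (𝓡∂ n) p) r ∩ {y | y 0 = 0} with hA
  have hAt : A ⊆ (c.extend (𝓡∂ n)).target := fun y hy => by
    rw [hV]; exact ⟨hball hy.1, mem_halfSpace.2 hy.2.ge⟩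
  have hAc : IsPreconnected A := by
    refine ((convex_ball _ _).inter ?_).isPreconnected
    exact convex_hyperplane (EuclideanSpace.proj 0 : Coord n →L[ℝ] ℝ).isBoundedLinearMap.toIsLinearMap 0
  have hB : IsPreconnected ((c.extend (𝓡∂ n)).symm '' A) :=
    hAc.image _ ((contMDiffOn_extend_symm hcA).continuousOn.mono (by
      rw [← c.extend_target']; exact hAt))
  have hpA : p ∈ (c.extend (𝓡∂ n)).symm '' A :=
    ⟨_, ⟨Metric.mem_ball_self hr, (mem_boundary_iff hcA hpc).1 hpb⟩, left_inv hpc⟩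
  have hsub : (c.extend (𝓡∂ n)).symm '' A ⊆ (𝓡∂ n).boundary M := by
    rintro _ ⟨y, hy, rfl⟩
    rw [mem_boundary_iff hcA (symm_mem_source (hAt hy)), (c.extend (𝓡∂ n)).right_inv (hAt hy)]
    exact hy.2
  have hin := hB.subset_connectedComponentIn hpA hsub
  have hCp : C = connectedComponentIn ((𝓡∂ n).boundary M) p := by
    obtain ⟨q, -, rfl⟩ := hC
    exact connectedComponentIn_eq hp
  have h1 : ∀ᶠ x in 𝓝 p, c.extend (𝓡∂ n) x ∈ Metric.ball (c.extend (𝓡∂ n) p) r :=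
    (c.continuousAt_extend hpc).eventually (Metric.ball_mem_nhds _ hr)
  filter_upwards [h1, c.open_source.mem_nhds hpc] with x hx hxs hxb
  rw [hCp]
  exact hin ⟨_, ⟨hx, (mem_boundary_iff hcA hxs).1 hxb⟩, left_inv hxs⟩

/-- The speed, in the chart `e`, with which the curve `γ` leaves the boundary at time `0`. -/
def normalSpeed (e : OpenPartialHomeomorph M (EuclideanHalfSpace n)) (γ : ℝ → M) : ℝ :=
  derivWithin (fun s => e.extend (𝓡∂ n) (γ s) 0) (Ici 0) 0

lemma hasDerivWithinAt_zeroth {γ : ℝ → Coord n} (h : DifferentiableWithinAt ℝ γ (Ici 0) 0) :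
    HasDerivWithinAt (fun s => γ s 0) (derivWithin γ (Ici 0) 0 0) (Ici 0) 0 :=
  (EuclideanSpace.proj 0 : Coord n →L[ℝ] ℝ).hasFDerivAt.comp_hasDerivWithinAt 0
    h.hasDerivWithinAt

/-- Whether a curve leaves the boundary with positive speed does not depend on the chart. -/
lemma normalSpeed_pos_of {e e' : OpenPartialHomeomorph M (EuclideanHalfSpace n)}
    (he : e ∈ IsManifold.maximalAtlas (𝓡∂ n) ∞ M) (he' : e' ∈ IsManifold.maximalAtlas (𝓡∂ n) ∞ M)
    {γ : ℝ → M} (hb : γ 0 ∈ (𝓡∂ n).boundary M) (hx : γ 0 ∈ e.source) (hx' : γ 0 ∈ e'.source)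
    (hγ : ContMDiffWithinAt 𝓘(ℝ, ℝ) (𝓡∂ n) ∞ γ (Ici 0) 0) (h : 0 < normalSpeed e γ) :
    0 < normalSpeed e' γ := by
  have hu : UniqueDiffWithinAt ℝ (Ici (0 : ℝ)) 0 := uniqueDiffOn_Ici 0 0 self_mem_Ici
  set f : ℝ → Coord n := fun s => e.extend (𝓡∂ n) (γ s) with hf
  have hfd : DifferentiableWithinAt ℝ f (Ici 0) 0 := by
    have := (e.contMDiffAt_extend he hx).comp_contMDiffWithinAt (0 : ℝ) hγ
    exact (contMDiffWithinAt_iff_contDiffWithinAt.1 this).differentiableWithinAt (by simp)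
  have hs : normalSpeed e γ = derivWithin f (Ici 0) 0 0 :=
    (hasDerivWithinAt_zeroth hfd).derivWithin hu
  have hy : f 0 ∈ (e.extend (𝓡∂ n)).target := apply_mem_target hx
  have hy' : (e.extend (𝓡∂ n)).symm (f 0) ∈ e'.source := by simpa only [hf, left_inv hx] using hx'
  have hT := (contDiffWithinAt_trans he he' hy hy').differentiableWithinAt (by simp)
  have hcomp : HasDerivWithinAt (fun s => trans e e' (f s))
      (fderivWithin ℝ (trans e e') (halfSpace n) (f 0) (derivWithin f (Ici 0) 0)) (Ici 0) 0 :=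
    hT.hasFDerivWithinAt.comp_hasDerivWithinAt 0 hfd.hasDerivWithinAt
      fun s _ => extend_mem_halfSpace e _
  have heq : (fun s => e'.extend (𝓡∂ n) (γ s)) =ᶠ[𝓝[Ici 0] 0] fun s => trans e e' (f s) := by
    filter_upwards [hγ.continuousWithinAt.tendsto (e.open_source.mem_nhds hx)] with s hs
    simp only [hf, trans_apply, left_inv (show γ s ∈ e.source from hs)]
  have h2 := hcomp.congr_of_eventuallyEq_of_mem heq self_mem_Ici
  have h3 : normalSpeed e' γ = _ := (hasDerivWithinAt_zeroth h2.differentiableWithinAt).derivWithin hu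
  have hP := preservesBoundary_trans he he' hy hy'
  have h0 : f 0 0 = 0 := (mem_boundary_iff he hx).1 hb
  rw [h3, h2.derivWithin hu, hP.normal h0 hT, ← hs]
  refine mul_pos h (hP.normal_pos h0 hT ?_)
  exact fderivWithin_trans_surjective he he' hx hx'

/-- A smooth deformation `Q` of the identity of `M` into `M`, under which the points of the set
`Z` of boundary points leave the boundary with positive speed. -/
structure IsPush (n : ℕ) [NeZero n] {M : Type*} [TopologicalSpace M]
    [ChartedSpace (EuclideanHalfSpace n) M] [IsManifold (𝓡∂ n) ∞ M] (Q : M × ℝ → M) (s₀ : ℝ) (Z : Set M) : Prop where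
  pos : 0 < s₀
  contMDiffOn : ContMDiffOn ((𝓡∂ n).prod 𝓘(ℝ, ℝ)) (𝓡∂ n) ∞ Q (univ ×ˢ Icc 0 s₀)
  apply_zero : ∀ x, Q (x, 0) = x
  normalSpeed_pos : ∀ p ∈ Z, ∀ e ∈ IsManifold.maximalAtlas (𝓡∂ n) ∞ M, p ∈ e.source →
    0 < normalSpeed e fun s => Q (p, s)

lemma contMDiffWithinAt_curve {Q : M × ℝ → M} {s₀ : ℝ} (h0 : 0 < s₀)
    (hQ : ContMDiffOn ((𝓡∂ n).prod 𝓘(ℝ, ℝ)) (𝓡∂ n) ∞ Q (univ ×ˢ Icc 0 s₀)) (p : M) :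
    ContMDiffWithinAt 𝓘(ℝ, ℝ) (𝓡∂ n) ∞ (fun s => Q (p, s)) (Ici 0) 0 := by
  have h1 : ContMDiffWithinAt 𝓘(ℝ, ℝ) (𝓡∂ n) ∞ (fun s => Q (p, s)) (Icc 0 s₀) 0 :=
    (hQ (p, 0) ⟨mem_univ _, le_rfl, h0.le⟩).comp (0 : ℝ)
      (contMDiffWithinAt_const.prodMk contMDiffWithinAt_id) fun s hs => ⟨mem_univ _, hs⟩
  exact h1.mono_of_mem_nhdsWithin (Icc_mem_nhdsGE h0)

/-- In the chart at `p`, push in the direction of the zeroth coordinate, at the speed given by a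
bump function. -/
def chartPush {p : M} (f : SmoothBumpFunction (𝓡∂ n) p) (z : M × ℝ) : M :=
  open Classical in
  if z.1 ∈ (chartAt (EuclideanHalfSpace n) p).source then
    ((chartAt (EuclideanHalfSpace n) p).extend (𝓡∂ n)).symm
      ((chartAt (EuclideanHalfSpace n) p).extend (𝓡∂ n) z.1 + (z.2 * f z.1) • stdVec 0)
  else z.1

lemma chartPush_of_eq_zero {p : M} (f : SmoothBumpFunction (𝓡∂ n) p) {z : M × ℝ}
    (hz : z.2 * f z.1 = 0) : chartPush f z = z.1 := by
  unfold chartPush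
  split_ifs with h
  · rw [hz, zero_smul, add_zero, left_inv h]
  · rfl

/-- For short times the push in a chart does not leave the chart, since the support of the bump
function is contained in a compact subset. -/
lemma exists_chartPush_mem_target {p : M} (f : SmoothBumpFunction (𝓡∂ n) p) :
    ∃ s₀ > 0, ∀ x ∈ (chartAt (EuclideanHalfSpace n) p).source, ∀ s ∈ Icc 0 s₀,
      (chartAt (EuclideanHalfSpace n) p).extend (𝓡∂ n) x + (s * f x) • stdVec 0 ∈
        ((chartAt (EuclideanHalfSpace n) p).extend (𝓡∂ n)).target := by
  set c := chartAt (EuclideanHalfSpace n) p with hc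
  obtain ⟨V, hVo, hV⟩ := exists_open_inter_target c
  set K : Set (Coord n) := Metric.closedBall (c.extend (𝓡∂ n) p) f.rOut ∩ halfSpace n with hK
  have hKc : IsCompact K := (isCompact_closedBall _ _).inter_right (𝓡∂ n).isClosed_range
  have hKV : K ⊆ V := fun y hy => by
    have : y ∈ (c.extend (𝓡∂ n)).target := f.closedBall_subset hy
    rw [hV] at this
    exact this.1
  obtain ⟨δ, hδ, hsub⟩ := hKc.exists_thickening_subset_open hVo hKV
  refine ⟨δ / 2, half_pos hδ, fun x hx s hs => ?_⟩
  by_cases hfx : f x = 0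
  · rw [hfx, mul_zero, zero_smul, add_zero]
    exact apply_mem_target hx
  have hxs : x ∈ Function.support f := hfx
  rw [f.support_eq_inter_preimage] at hxs
  have hxK : c.extend (𝓡∂ n) x ∈ K :=
    ⟨Metric.ball_subset_closedBall hxs.2, extend_mem_halfSpace c x⟩
  have hnn : 0 ≤ s * f x := mul_nonneg hs.1 f.nonneg
  rw [hV]
  refine ⟨hsub (Metric.mem_thickening_iff.2 ⟨_, hxK, ?_⟩), ?_⟩
  · rw [dist_eq_norm, add_sub_cancel_left, norm_smul, PiLp.norm_single, norm_one, mul_one,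
      Real.norm_of_nonneg hnn]
    calc s * f x ≤ s * 1 := mul_le_mul_of_nonneg_left f.le_one hs.1
      _ < δ := by linarith [hs.2]
  · have := mem_halfSpace.1 (extend_mem_halfSpace c x)
    rw [mem_halfSpace]
    simp only [PiLp.add_apply, PiLp.smul_apply, PiLp.single_apply, if_true, smul_eq_mul,
      mul_one]
    exact add_nonneg this hnn

/-- The push is smooth across the boundary of the chart domain, because it is the identity outside
the support of the bump function. -/
lemma contMDiffOn_chartPush [T2Space M] {p : M} (f : SmoothBumpFunction (𝓡∂ n) p) {s₀ : ℝ}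
    (h : ∀ x ∈ (chartAt (EuclideanHalfSpace n) p).source, ∀ s ∈ Icc 0 s₀,
      (chartAt (EuclideanHalfSpace n) p).extend (𝓡∂ n) x + (s * f x) • stdVec 0 ∈
        ((chartAt (EuclideanHalfSpace n) p).extend (𝓡∂ n)).target) :
    ContMDiffOn ((𝓡∂ n).prod 𝓘(ℝ, ℝ)) (𝓡∂ n) ∞ (chartPush f) (univ ×ˢ Icc 0 s₀) := by
  set c := chartAt (EuclideanHalfSpace n) p with hc
  have hcA : c ∈ IsManifold.maximalAtlas (𝓡∂ n) ∞ M := IsManifold.chart_mem_maximalAtlas p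
  intro z hz
  by_cases hzc : z.1 ∈ c.source
  · have h1 : ContMDiffOn ((𝓡∂ n).prod 𝓘(ℝ, ℝ)) 𝓘(ℝ, Coord n) ∞
        (fun z : M × ℝ => c.extend (𝓡∂ n) z.1 + (z.2 * f z.1) • (stdVec 0 : Coord n))
        (c.source ×ˢ Icc 0 s₀) := by
      refine ContMDiffOn.add ?_ (ContMDiffOn.smul (ContMDiffOn.mul contMDiffOn_snd ?_)
        contMDiffOn_const)
      · exact (c.contMDiffOn_extend hcA).comp contMDiffOn_fst fun z hz => hz.1
      · exact f.contMDiff.comp_contMDiffOn contMDiffOn_fst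
    have hsym := contMDiffOn_extend_symm (I := 𝓡∂ n) hcA
    rw [← c.extend_target'] at hsym
    have h2 := hsym.comp h1 fun z hz => h z.1 hz.1 z.2 hz.2
    have h3 : ContMDiffOn ((𝓡∂ n).prod 𝓘(ℝ, ℝ)) (𝓡∂ n) ∞ (chartPush f)
        (c.source ×ˢ Icc 0 s₀) := h2.congr fun z hz => if_pos hz.1
    refine (h3 z ⟨hzc, hz.2⟩).mono_of_mem_nhdsWithin ?_
    filter_upwards [self_mem_nhdsWithin, mem_nhdsWithin_of_mem_nhds
      ((c.open_source.preimage continuous_fst).mem_nhds hzc)] with w hw hw'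
    exact ⟨hw', hw.2⟩
  · have h1 : ∀ᶠ w in 𝓝 z, chartPush f w = w.1 := by
      have : (tsupport f)ᶜ ∈ 𝓝 z.1 := (isClosed_tsupport _).isOpen_compl.mem_nhds
        fun hmem => hzc (f.tsupport_subset_chartAt_source hmem)
      filter_upwards [continuous_fst.continuousAt.preimage_mem_nhds this] with w hw
      refine chartPush_of_eq_zero f ?_
      rw [image_eq_zero_of_notMem_tsupport hw, mul_zero]
    exact (contMDiffAt_fst.congr_of_eventuallyEq h1).contMDiffWithinAt

/-- Composing a push with the push in a chart. In that chart the speeds add up. -/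
lemma IsPush.chartPush_comp [T2Space M] {Q : M × ℝ → M} {s₀ : ℝ} {Z : Set M} (hQ : IsPush n Q s₀ Z)
    {p : M} (f : SmoothBumpFunction (𝓡∂ n) p) (hZ : Z ⊆ (𝓡∂ n).boundary M) :
    ∃ s₁, IsPush n (fun z => chartPush f (Q z, z.2)) s₁
      (Z ∪ Function.support f ∩ (𝓡∂ n).boundary M) := by
  obtain ⟨s', hs', hmem⟩ := exists_chartPush_mem_target f
  set c := chartAt (EuclideanHalfSpace n) p with hc
  have hcA : c ∈ IsManifold.maximalAtlas (𝓡∂ n) ∞ M := IsManifold.chart_mem_maximalAtlas p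
  have hpos : 0 < min s₀ s' := lt_min hQ.pos hs'
  have hsm : ContMDiffOn ((𝓡∂ n).prod 𝓘(ℝ, ℝ)) (𝓡∂ n) ∞ (fun z => chartPush f (Q z, z.2))
      (univ ×ˢ Icc 0 (min s₀ s')) := by
    refine (contMDiffOn_chartPush f hmem).comp
      ((hQ.contMDiffOn.mono ?_).prodMk contMDiffOn_snd) ?_
    · exact prod_mono le_rfl (Icc_subset_Icc_right (min_le_left _ _))
    · exact fun z hz => ⟨mem_univ _, hz.2.1, hz.2.2.trans (min_le_right _ _)⟩
  have hzero : ∀ x, chartPush f (Q (x, 0), (0 : ℝ)) = x := fun x => by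
    rw [chartPush_of_eq_zero f (zero_mul _), hQ.apply_zero]
  refine ⟨min s₀ s', hpos, hsm, hzero, ?_⟩
  intro q hq
  have hqb : q ∈ (𝓡∂ n).boundary M := hq.elim (fun h => hZ h) fun h => h.2
  have hcurve := contMDiffWithinAt_curve hpos hsm q
  have hQcurve := contMDiffWithinAt_curve hQ.pos hQ.contMDiffOn q
  have hu : UniqueDiffWithinAt ℝ (Ici (0 : ℝ)) 0 := uniqueDiffOn_Ici 0 0 self_mem_Ici
  -- it is enough to find one chart in which the speed is positive
  suffices h : ∃ e ∈ IsManifold.maximalAtlas (𝓡∂ n) ∞ M, q ∈ e.source ∧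
      0 < normalSpeed e fun s => chartPush f (Q (q, s), s) by
    obtain ⟨e, he, hqe, hsp⟩ := h
    intro e' he' hqe'
    refine normalSpeed_pos_of he he' ?_ ?_ ?_ hcurve hsp
    all_goals rw [hzero]
    exacts [hqb, hqe, hqe']
  have hQc : ContinuousWithinAt (fun s => Q (q, s)) (Ici 0) 0 := hQcurve.continuousWithinAt
  by_cases hqc : q ∈ c.source
  · refine ⟨c, hcA, hqc, ?_⟩
    set γ : ℝ → Coord n := fun s => c.extend (𝓡∂ n) (Q (q, s)) with hγ
    have hQq : Q (q, 0) ∈ c.source := by rwa [hQ.apply_zero]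
    have hγd : DifferentiableWithinAt ℝ γ (Ici 0) 0 := by
      have := (c.contMDiffAt_extend hcA hQq).comp_contMDiffWithinAt (0 : ℝ) hQcurve
      exact (contMDiffWithinAt_iff_contDiffWithinAt.1 this).differentiableWithinAt (by simp)
    have h1 := hasDerivWithinAt_zeroth hγd
    have hfc : ContinuousWithinAt (fun s => f (Q (q, s))) (Ici 0) 0 :=
      f.contMDiff.continuous.continuousAt.comp_continuousWithinAt hQc
    have h2 : HasDerivWithinAt (fun s => s * f (Q (q, s))) (f q) (Ici 0) 0 := by
      rw [hasDerivWithinAt_iff_tendsto_slope]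
      have h3 : Tendsto (fun s => f (Q (q, s))) (𝓝[Ici 0 \ {0}] 0) (𝓝 (f q)) := by
        have := hfc.tendsto
        simp only [hQ.apply_zero] at this
        exact this.mono_left (nhdsWithin_mono _ sdiff_subset)
      refine h3.congr' ?_
      filter_upwards [self_mem_nhdsWithin] with s hs
      have hs0 : s ≠ 0 := hs.2
      rw [slope_def_field]
      field_simp
      simp
    have h4 := h1.add h2
    have heq : (fun s => c.extend (𝓡∂ n) (chartPush f (Q (q, s), s)) 0) =ᶠ[𝓝[Ici 0] 0]
        fun s => γ s 0 + s * f (Q (q, s)) := by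
      have hsrc : ∀ᶠ s in 𝓝[Ici 0] (0 : ℝ), Q (q, s) ∈ c.source :=
        hQc.tendsto (c.open_source.mem_nhds hQq)
      filter_upwards [hsrc, Icc_mem_nhdsGE hs'] with s hs hs1
      have : chartPush f (Q (q, s), s) = (c.extend (𝓡∂ n)).symm
        (c.extend (𝓡∂ n) (Q (q, s)) + (s * f (Q (q, s))) • stdVec 0) := if_pos hs
      rw [this, (c.extend (𝓡∂ n)).right_inv (hmem _ hs s hs1)]
      simp [hγ]
    -- The speeds of the two pushes add up.
    have h5 : normalSpeed c (fun s => chartPush f (Q (q, s), s)) =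
        derivWithin γ (Ici 0) 0 0 + f q :=
      (h4.congr_of_eventuallyEq_of_mem heq self_mem_Ici).derivWithin hu
    rw [h5]
    have h6 : normalSpeed c (fun s => Q (q, s)) = derivWithin γ (Ici 0) 0 0 := h1.derivWithin hu
    -- A curve that starts on the boundary stays in the half space, so its speed is non-negative.
    have h7 : 0 ≤ derivWithin γ (Ici 0) 0 0 := by
      refine h1.derivWithin hu ▸ ?_
      have hγ0 : γ 0 0 = 0 := by
        simp only [hγ, hQ.apply_zero]; exact (mem_boundary_iff hcA hqc).1 hqb
      rw [h1.derivWithin hu]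
      have hne : (𝓝[Ici 0 \ {0}] (0 : ℝ)).NeBot := by
        have : Ici 0 \ {0} = Ioi (0 : ℝ) := by ext s; simp [lt_iff_le_and_ne, eq_comm]
        rw [this]; infer_instance
      refine ge_of_tendsto (hasDerivWithinAt_iff_tendsto_slope.1 h1) ?_
      filter_upwards [self_mem_nhdsWithin] with s hs
      rw [slope_def_field, hγ0, sub_zero, sub_zero]
      exact div_nonneg (mem_halfSpace.1 (extend_mem_halfSpace c _)) hs.1
    rcases hq with hq | hq
    · have := hQ.normalSpeed_pos q hq c hcA hqc
      rw [h6] at this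
      exact add_pos_of_pos_of_nonneg this f.nonneg
    · exact add_pos_of_nonneg_of_pos h7 (lt_of_le_of_ne f.nonneg (Ne.symm hq.1))
  · have hts : q ∉ tsupport f := fun h => hqc (f.tsupport_subset_chartAt_source h)
    have hqZ : q ∈ Z := hq.resolve_right fun h => hts (subset_tsupport _ h.1)
    refine ⟨chartAt _ q, IsManifold.chart_mem_maximalAtlas q, mem_chart_source _ q, ?_⟩
    have h0 := hQ.normalSpeed_pos q hqZ _ (IsManifold.chart_mem_maximalAtlas q)
      (mem_chart_source _ q)
    have heq : (fun s => (chartAt (EuclideanHalfSpace n) q).extend (𝓡∂ n)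
        (chartPush f (Q (q, s), s)) 0) =ᶠ[𝓝[Ici 0] 0]
        fun s => (chartAt (EuclideanHalfSpace n) q).extend (𝓡∂ n) (Q (q, s)) 0 := by
      have hn : (tsupport f)ᶜ ∈ 𝓝 (Q (q, 0)) := by
        rw [hQ.apply_zero]; exact (isClosed_tsupport _).isOpen_compl.mem_nhds hts
      filter_upwards [hQc.tendsto hn] with s hs
      rw [chartPush_of_eq_zero f]
      rw [image_eq_zero_of_notMem_tsupport (show Q (q, s) ∉ tsupport f from hs), mul_zero]
    unfold normalSpeed at h0 ⊢
    rwa [heq.derivWithin_eq_of_mem self_mem_Ici]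

/-- Every compact boundary component can be pushed into the interior. -/
lemma exists_isPush [T2Space M] {C : Set M} (hC : IsBoundaryComponent n C) (hCc : IsCompact C) :
    ∃ (Q : M × ℝ → M) (s₀ : ℝ), IsPush n Q s₀ C := by
  let f : ∀ p : M, SmoothBumpFunction (𝓡∂ n) p := fun p => Classical.arbitrary _
  obtain ⟨F, -, hF⟩ := hCc.elim_nhds_subcover (fun p => Function.support (f p)) fun p _ =>
    (f p).isOpen_support.mem_nhds (by simp)
  suffices h : ∃ (Q : M × ℝ → M) (s₀ : ℝ),
      IsPush n Q s₀ ((⋃ p ∈ F, Function.support (f p)) ∩ (𝓡∂ n).boundary M) by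
    obtain ⟨Q, s₀, hQ⟩ := h
    exact ⟨Q, s₀, hQ.pos, hQ.contMDiffOn, hQ.apply_zero,
      fun p hp => hQ.normalSpeed_pos p ⟨hF hp, hC.subset hp⟩⟩
  clear hF
  classical
  induction F using Finset.induction_on with
  | empty => exact ⟨Prod.fst, 1, one_pos, contMDiffOn_fst, fun x => rfl, fun p hp => by simp at hp⟩
  | insert p F _ ih =>
    obtain ⟨Q, s₀, hQ⟩ := ih
    obtain ⟨s₁, h⟩ := hQ.chartPush_comp (f p) inter_subset_right
    refine ⟨fun z => chartPush (f p) (Q z, z.2), s₁, ?_⟩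
    rw [Finset.set_biUnion_insert, union_inter_distrib_right, union_comm]
    exact h

end

/-! ### The collar neighbourhood theorem -/

section

variable {n : ℕ} [NeZero n] {M : Type*} [TopologicalSpace M]
  [ChartedSpace (EuclideanHalfSpace n) M] [IsManifold (𝓡∂ n) ∞ M]

open Chart

/-- `ρ` and `t` are the components of a smooth local inverse, near `x`, of the restriction of `Q`
to `C × [0, ∞)`. -/
structure IsLocalCollarInverse (n : ℕ) [NeZero n] {M : Type*} [TopologicalSpace M]
    [ChartedSpace (EuclideanHalfSpace n) M] (Q : M × ℝ → M) (C : Set M)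
    (ρ : M → M) (t : M → ℝ) (x : M) : Prop where
  contMDiffAt_fst : ContMDiffAt (𝓡∂ n) (𝓡∂ n) ∞ ρ x
  contMDiffAt_snd : ContMDiffAt (𝓡∂ n) 𝓘(ℝ, ℝ) ∞ t x
  mem : ρ x ∈ C
  nonneg : 0 ≤ t x
  apply_eq : Q (ρ x, t x) = x
  boundary : x ∈ (𝓡∂ n).boundary M → t x = 0

/-- Near a boundary point, a push restricts to a diffeomorphism from a product of a piece of the
boundary with an interval: the inverse function theorem on the half space, in a chart. -/
lemma IsPush.exists_local_inverse {Q : M × ℝ → M} {s₀ : ℝ} {C : Set M} (hQ : IsPush n Q s₀ C)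
    (hC : IsBoundaryComponent n C) {p : M} (hp : p ∈ C) :
    ∃ (ρ : M → M) (t : M → ℝ),
      (∀ᶠ x in 𝓝 p, IsLocalCollarInverse n Q C ρ t x) ∧
      ∀ᶠ z in 𝓝[univ ×ˢ Ici 0] (p, (0 : ℝ)), z.1 ∈ C → ρ (Q z) = z.1 ∧ t (Q z) = z.2 := by
  set c := chartAt (EuclideanHalfSpace n) p with hc
  have hpc : p ∈ c.source := mem_chart_source _ p
  have hcA : c ∈ IsManifold.maximalAtlas (𝓡∂ n) ∞ M := IsManifold.chart_mem_maximalAtlas p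
  set y₀ := c.extend (𝓡∂ n) p with hy₀
  have hy₀t : y₀ ∈ (c.extend (𝓡∂ n)).target := apply_mem_target hpc
  have hy₀H : y₀ ∈ halfSpace n := extend_mem_halfSpace c p
  have h0 : y₀ 0 = 0 := (mem_boundary_iff hcA hpc).1 (hC.subset hp)
  obtain ⟨V, hVo, hV⟩ := exists_open_inter_target c
  have hy₀V : y₀ ∈ V := (hV ▸ hy₀t : _ ∈ V ∩ halfSpace n).1
  have hcsymm : (c.extend (𝓡∂ n)).symm y₀ = p := left_inv hpc
  -- the points over which the boundary projection stays in the chart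
  have hset0 : ∀ᶠ y in 𝓝 y₀, setZero 0 y ∈ (c.extend (𝓡∂ n)).target := by
    have h1 : Tendsto (fun y : Coord n => setZero 0 y) (𝓝 y₀) (𝓝 y₀) := by
      have := (continuous_setZero (n := n)).comp (Continuous.prodMk_right (0 : ℝ))
      have h2 := this.tendsto y₀
      simpa only [Function.comp_def, setZero_of_eq h0] using h2
    filter_upwards [h1 (hVo.mem_nhds hy₀V)] with y hy
    rw [hV]
    exact ⟨hy, mem_halfSpace.2 (by simp)⟩
  -- The coordinates `y` stand for the boundary point below `y` and the parameter `y 0`; in these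
  -- terms, `Q` becomes the map `F` of the half space.
  let A : Coord n → M × ℝ := fun y => ((c.extend (𝓡∂ n)).symm (setZero 0 y), y 0)
  have hA₀ : A y₀ = (p, 0) := by simp only [A, setZero_of_eq h0, hcsymm, h0]
  have hsz : ContDiff ℝ ∞ fun y : Coord n => setZero 0 y :=
    (contDiff_setZero (n := n)).of_le le_top |>.comp (contDiff_const.prodMk contDiff_id)
  have hsymm_zero : ∀ y, setZero 0 y ∈ (c.extend (𝓡∂ n)).target →
      ContMDiffAt 𝓘(ℝ, Coord n) (𝓡∂ n) ∞
        (fun y => (c.extend (𝓡∂ n)).symm (setZero 0 y)) y := by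
    intro y hy
    exact contMDiffWithinAt_univ.1 ((contMDiffWithinAt_symm hcA hy).comp y
      (t := halfSpace n) hsz.contMDiff.contMDiffAt.contMDiffWithinAt
      fun z _ => mem_halfSpace.2 (by simp))
  have hAsm : ∀ y, setZero 0 y ∈ (c.extend (𝓡∂ n)).target →
      ContMDiffAt 𝓘(ℝ, Coord n) ((𝓡∂ n).prod 𝓘(ℝ, ℝ)) ∞ A y := fun y hy =>
    (hsymm_zero y hy).prodMk
      (EuclideanSpace.proj 0 : Coord n →L[ℝ] ℝ).contDiff.contMDiff.contMDiffAt
  have hQ0 : ContinuousWithinAt Q (univ ×ˢ Icc 0 s₀) (p, 0) :=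
    (hQ.contMDiffOn (p, 0) ⟨mem_univ _, le_rfl, hQ.pos.le⟩).continuousWithinAt
  have hQI : ContinuousWithinAt Q (univ ×ˢ Ici 0) (p, 0) := by
    refine hQ0.mono_of_mem_nhdsWithin ?_
    filter_upwards [self_mem_nhdsWithin, mem_nhdsWithin_of_mem_nhds
      (continuous_snd.continuousAt.preimage_mem_nhds (Iio_mem_nhds hQ.pos))] with z hz hz'
    exact ⟨mem_univ _, hz.2, le_of_lt hz'⟩
  have hQIt : Tendsto Q (𝓝[univ ×ˢ Ici 0] (p, 0)) (𝓝 p) := by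
    have := hQI.tendsto
    rwa [hQ.apply_zero] at this
  have hAt : Tendsto A (𝓝[halfSpace n] y₀) (𝓝[univ ×ˢ Ici 0] (p, 0)) := by
    refine tendsto_nhdsWithin_iff.2 ⟨?_, ?_⟩
    · have := (hAsm y₀ hset0.self_of_nhds).continuousAt.tendsto
      rw [hA₀] at this
      exact this.mono_left nhdsWithin_le_nhds
    · filter_upwards [self_mem_nhdsWithin] with y hy
      exact ⟨mem_univ _, mem_halfSpace.1 hy⟩
  let F : Coord n → Coord n := fun y => c.extend (𝓡∂ n) (Q (A y))
  have hsrc : ∀ᶠ y in 𝓝[halfSpace n] y₀, Q (A y) ∈ c.source :=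
    hAt.eventually (hQIt.eventually (c.open_source.mem_nhds hpc))
  have hlt : ∀ᶠ y in 𝓝[halfSpace n] y₀, y 0 < s₀ := by
    refine mem_nhdsWithin_of_mem_nhds ((by fun_prop : Continuous fun y : Coord n => y 0).continuousAt.preimage_mem_nhds
      (Iio_mem_nhds ?_))
    rw [h0]; exact hQ.pos
  have hFsm : ∀ᶠ y in 𝓝[halfSpace n] y₀, ContDiffWithinAt ℝ ∞ F (halfSpace n) y := by
    filter_upwards [nhdsWithin_le_nhds hset0, hsrc, hlt, self_mem_nhdsWithin] with y a b d hyH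
    have h1 : ContMDiffWithinAt 𝓘(ℝ, Coord n) (𝓡∂ n) ∞ (fun y => Q (A y))
        (halfSpace n ∩ {y | y 0 < s₀}) y :=
      (hQ.contMDiffOn (A y) ⟨mem_univ _, mem_halfSpace.1 hyH, d.le⟩).comp y
        (hAsm y a).contMDiffWithinAt
        fun z hz => ⟨mem_univ _, mem_halfSpace.1 hz.1, le_of_lt hz.2⟩
    have h2 := (c.contMDiffAt_extend hcA b).comp_contMDiffWithinAt y h1
    refine (contMDiffWithinAt_iff_contDiffWithinAt.1 h2).mono_of_mem_nhdsWithin ?_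
    refine inter_mem self_mem_nhdsWithin (mem_nhdsWithin_of_mem_nhds ?_)
    exact (by fun_prop : Continuous fun y : Coord n => y 0).continuousAt.preimage_mem_nhds
      (Iio_mem_nhds d)
  have htgt : ∀ᶠ y in 𝓝[halfSpace n] y₀, y ∈ (c.extend (𝓡∂ n)).target :=
    target_mem_nhdsWithin hy₀t
  have hFid : ∀ᶠ y in 𝓝[halfSpace n] y₀, y 0 = 0 → F y = y := by
    filter_upwards [htgt] with y hy hy0
    simp only [F, A, hy0, setZero_of_eq hy0, hQ.apply_zero]
    exact (c.extend (𝓡∂ n)).right_inv hy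
  have hpos : 0 < fderivWithin ℝ F (halfSpace n) y₀ (stdVec 0) 0 := by
    have hd := ((hFsm.self_of_nhdsWithin hy₀H).differentiableWithinAt (by simp)).hasFDerivWithinAt
    have hline : HasDerivWithinAt (fun s : ℝ => y₀ + s • (stdVec 0 : Coord n)) (stdVec 0)
        (Ici 0) 0 := by
      have := ((hasDerivAt_id (0 : ℝ)).smul_const (stdVec 0 : Coord n)).const_add y₀
      simpa using this.hasDerivWithinAt
    have hd' : HasFDerivWithinAt F (fderivWithin ℝ F (halfSpace n) y₀) (halfSpace n)
        (y₀ + (0 : ℝ) • (stdVec 0 : Coord n)) := by simpa using hd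
    have h1 := hd'.comp_hasDerivWithinAt (0 : ℝ) hline fun s hs => mem_halfSpace.2 (by
      simp only [PiLp.add_apply, h0, PiLp.smul_apply, PiLp.single_apply, if_true, smul_eq_mul,
        mul_one, zero_add]
      exact hs)
    have h2 : ∀ s : ℝ, (F ∘ fun s : ℝ => y₀ + s • (stdVec 0 : Coord n)) s =
        c.extend (𝓡∂ n) (Q (p, s)) := by
      intro s
      have ha : setZero 0 (y₀ + s • (stdVec 0 : Coord n)) = y₀ := by
        ext i
        by_cases hi : i = 0
        · subst hi; simp [h0]
        · rw [setZero_of_ne _ _ hi]; simp [hi]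
      have hb : (y₀ + s • (stdVec 0 : Coord n)) 0 = s := by simp [h0]
      simp only [Function.comp_apply, F, A]
      rw [ha, hb, hcsymm]
    rw [funext h2] at h1
    have hu : UniqueDiffWithinAt ℝ (Ici (0 : ℝ)) 0 := uniqueDiffOn_Ici 0 0 self_mem_Ici
    have h3 : normalSpeed c (fun s => Q (p, s)) = _ :=
      (hasDerivWithinAt_zeroth h1.differentiableWithinAt).derivWithin hu
    rw [h1.derivWithin hu] at h3
    rw [← h3]
    exact hQ.normalSpeed_pos p hp c hcA hpc
  obtain ⟨G, hG0, hG, hGF⟩ := exists_inverse_halfSpace h0 hFsm hFid hpos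
  have hGc : ContinuousWithinAt G (halfSpace n) y₀ :=
    (hG.self_of_nhdsWithin hy₀H).1.continuousWithinAt
  have hGt : Tendsto G (𝓝[halfSpace n] y₀) (𝓝[halfSpace n] y₀) := by
    refine tendsto_nhdsWithin_iff.2 ⟨?_, hG.mono fun z hz => hz.2.1⟩
    have := hGc.tendsto
    rwa [hG0] at this
  have hct : Tendsto (c.extend (𝓡∂ n)) (𝓝 p) (𝓝[halfSpace n] y₀) :=
    tendsto_nhdsWithin_iff.2 ⟨c.continuousAt_extend hpc,
      Eventually.of_forall (extend_mem_halfSpace c)⟩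
  have hGid : ∀ᶠ y in 𝓝[halfSpace n] y₀, y 0 = 0 → G y = y := by
    filter_upwards [hFid, hGF] with y hy1 hy2 hy0
    rwa [hy1 hy0] at hy2
  -- The local inverse of `Q`, read off from the inverse `G` of `F`.
  let ρ : M → M := fun x => (A (G (c.extend (𝓡∂ n) x))).1
  let t : M → ℝ := fun x => G (c.extend (𝓡∂ n) x) 0
  have hρp : ρ p = p := by simp only [ρ, ← hy₀, hG0, hA₀]
  refine ⟨ρ, t, ?_, ?_⟩
  · have hGsm : ∀ᶠ x in 𝓝 p, ContMDiffAt (𝓡∂ n) 𝓘(ℝ, Coord n) ∞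
        (fun x => G (c.extend (𝓡∂ n) x)) x := by
      filter_upwards [hct.eventually hG, c.open_source.mem_nhds hpc] with x hx hxs
      exact contMDiffWithinAt_univ.1 (hx.1.contMDiffWithinAt.comp x
        (contMDiffWithinAt_univ.2 (c.contMDiffAt_extend hcA hxs))
        fun z _ => extend_mem_halfSpace c z)
    have hG0t : ∀ᶠ x in 𝓝 p, setZero 0 (G (c.extend (𝓡∂ n) x)) ∈ (c.extend (𝓡∂ n)).target :=
      hct.eventually (hGt.eventually (nhdsWithin_le_nhds hset0))
    have hρsm : ∀ᶠ x in 𝓝 p, ContMDiffAt (𝓡∂ n) (𝓡∂ n) ∞ ρ x := by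
      filter_upwards [hGsm, hG0t] with x hx hx'
      exact ContMDiffAt.comp (g := fun y => (c.extend (𝓡∂ n)).symm (setZero 0 y)) x
        (hsymm_zero _ hx') hx
    have hρt : Tendsto ρ (𝓝 p) (𝓝 p) := by
      have := hρsm.self_of_nhds.continuousAt.tendsto
      rwa [hρp] at this
    filter_upwards [hct.eventually hG, c.open_source.mem_nhds hpc, hGsm, hρsm, hG0t,
      hρt.eventually (hC.eventually_mem hp), hct.eventually (hGt.eventually hsrc),
      hct.eventually hGid] with x a b d e f g h i
    refine ⟨e, (EuclideanSpace.proj 0 : Coord n →L[ℝ] ℝ).contDiff.contMDiff.contMDiffAt.comp x d,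
      g ?_, mem_halfSpace.1 a.2.1, ?_, ?_⟩
    · rw [mem_boundary_iff hcA (symm_mem_source f)]
      rw [(c.extend (𝓡∂ n)).right_inv f, setZero_zero]
    · have h1 : c.extend (𝓡∂ n) (Q (ρ x, t x)) = c.extend (𝓡∂ n) x := a.2.2
      have h2 := congrArg (c.extend (𝓡∂ n)).symm h1
      rwa [left_inv h, left_inv b] at h2
    · intro hxb
      have hx0 := (mem_boundary_iff hcA b).1 hxb
      simp only [t, i hx0, hx0]
  · let B : M × ℝ → Coord n := fun z => setZero z.2 (c.extend (𝓡∂ n) z.1)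
    have hBt : Tendsto B (𝓝[univ ×ˢ Ici 0] (p, 0)) (𝓝[halfSpace n] y₀) := by
      refine tendsto_nhdsWithin_iff.2 ⟨?_, ?_⟩
      · have h1 : ContinuousAt B (p, 0) := by
          refine (continuous_setZero (n := n)).continuousAt.comp
            (continuousAt_snd.prodMk ?_)
          exact ContinuousAt.comp (g := c.extend (𝓡∂ n)) (f := (Prod.fst : M × ℝ → M))
            (x := (p, (0 : ℝ))) (c.continuousAt_extend hpc) continuousAt_fst
        have h2 := h1.tendsto
        have h3 : B (p, 0) = y₀ := setZero_of_eq h0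
        rw [h3] at h2
        exact h2.mono_left nhdsWithin_le_nhds
      · filter_upwards [self_mem_nhdsWithin] with z hz
        exact mem_halfSpace.2 (by simp only [B, setZero_zero]; exact hz.2)
    have hfst : ∀ᶠ z : M × ℝ in 𝓝[univ ×ˢ Ici 0] (p, (0 : ℝ)), z.1 ∈ c.source :=
      mem_nhdsWithin_of_mem_nhds (continuous_fst.continuousAt.preimage_mem_nhds
        (c.open_source.mem_nhds hpc))
    filter_upwards [hBt.eventually hGF, hfst] with z a b hzC
    have hz0 : c.extend (𝓡∂ n) z.1 0 = 0 := (mem_boundary_iff hcA b).1 (hC.subset hzC)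
    have h1 : A (B z) = z := by
      simp only [A, B, setZero_setZero, setZero_of_eq hz0, setZero_zero, left_inv b]
    have h2 : G (c.extend (𝓡∂ n) (Q z)) = B z := by
      have : F (B z) = c.extend (𝓡∂ n) (Q z) := by simp only [F, h1]
      rw [← this]; exact a
    simp only [ρ, t, h2, h1]
    exact ⟨trivial, setZero_zero _ _⟩

/-- A collar of the compact set `C` of boundary points: mutually inverse smooth maps between
`C × [0, width)` and an open set `U`. The map `κ` is defined on all of `M × [0, width)`. -/
structure Collar (n : ℕ) [NeZero n] {M : Type*} [TopologicalSpace M]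
    [ChartedSpace (EuclideanHalfSpace n) M] (C : Set M) where
  /-- The supremum of the collar parameters. -/
  width : ℝ
  width_pos : 0 < width
  /-- The collar map. -/
  κ : M × ℝ → M
  /-- The projection of the collar to the boundary. -/
  pr : M → M
  /-- The collar parameter. -/
  t : M → ℝ
  /-- The image of the collar. -/
  U : Set M
  isOpen_U : IsOpen U
  contMDiffOn_κ : ContMDiffOn ((𝓡∂ n).prod 𝓘(ℝ, ℝ)) (𝓡∂ n) ∞ κ (univ ×ˢ Ico 0 width)
  contMDiffOn_pr : ContMDiffOn (𝓡∂ n) (𝓡∂ n) ∞ pr U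
  contMDiffOn_t : ContMDiffOn (𝓡∂ n) 𝓘(ℝ, ℝ) ∞ t U
  κ_zero : ∀ x, κ (x, 0) = x
  κ_mem : ∀ {p s}, p ∈ C → s ∈ Ico 0 width → κ (p, s) ∈ U
  pr_κ : ∀ {p s}, p ∈ C → s ∈ Ico 0 width → pr (κ (p, s)) = p
  t_κ : ∀ {p s}, p ∈ C → s ∈ Ico 0 width → t (κ (p, s)) = s
  pr_mem : ∀ {x}, x ∈ U → pr x ∈ C
  t_mem : ∀ {x}, x ∈ U → t x ∈ Ico 0 width
  κ_pr_t : ∀ {x}, x ∈ U → κ (pr x, t x) = x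
  mem_of_boundary : ∀ {x}, x ∈ U → x ∈ (𝓡∂ n).boundary M → x ∈ C

/-- The collar neighbourhood theorem: a short time push restricts to a collar, by compactness. -/
theorem exists_collar [T2Space M] {C : Set M} (hC : IsBoundaryComponent n C) (hCc : IsCompact C) :
    Nonempty (Collar n C) := by
  obtain ⟨Q, s₀, hQ⟩ := exists_isPush hC hCc
  -- What holds near `(p, 0)` holds on a short interval over all points near `p`.
  have hev : ∀ {p : M} {P : M × ℝ → Prop}, (∀ᶠ z in 𝓝[univ ×ˢ Ici 0] (p, (0 : ℝ)), P z) →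
      ∀ᶠ z : ℝ × M in 𝓝 (0, p), ∀ s ∈ Ico 0 z.1, P (z.2, s) := by
    intro p P h
    obtain ⟨N, hN, W, hW, hNW⟩ := mem_nhds_prod_iff.1 (eventually_nhdsWithin_iff.1 h)
    obtain ⟨r, hr, hball⟩ := Metric.mem_nhds_iff.1 hW
    rw [nhds_prod_eq]
    filter_upwards [prod_mem_prod (Iio_mem_nhds hr) hN] with z hz s hs
    refine hNW (show (z.2, s) ∈ N ×ˢ W from ⟨hz.2, hball ?_⟩) ⟨mem_univ _, hs.1⟩
    rw [Metric.mem_ball, Real.dist_eq, sub_zero, abs_of_nonneg hs.1]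
    exact hs.2.trans hz.1
  have hQc : ∀ p, ContinuousWithinAt Q (univ ×ˢ Ici 0) (p, 0) := fun p => by
    refine (hQ.contMDiffOn (p, 0) ⟨mem_univ _, le_rfl,
      hQ.pos.le⟩).continuousWithinAt.mono_of_mem_nhdsWithin ?_
    filter_upwards [self_mem_nhdsWithin, mem_nhdsWithin_of_mem_nhds
      (continuous_snd.continuousAt.preimage_mem_nhds (Iio_mem_nhds hQ.pos))] with z hz hz'
    exact ⟨mem_univ _, hz.2, le_of_lt hz'⟩
  have hQt : ∀ p, Tendsto Q (𝓝[univ ×ˢ Ici 0] (p, 0)) (𝓝 p) := fun p => by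
    have := (hQc p).tendsto
    rwa [hQ.apply_zero] at this
  -- Local inverses exist for all short times, uniformly in the boundary point.
  have hinv : ∀ᶠ b in 𝓝 (0 : ℝ), ∀ q ∈ C, q ∈ C → ∀ s ∈ Ico 0 b, ∃ (ρ : M → M) (t : M → ℝ),
      (∀ᶠ x in 𝓝 (Q (q, s)), IsLocalCollarInverse n Q C ρ t x) ∧ t (Q (q, s)) = s := by
    refine hCc.eventually_forall_of_forall_eventually (P := fun b q => q ∈ C → ∀ s ∈ Ico 0 b,
      ∃ (ρ : M → M) (t : M → ℝ),
      (∀ᶠ x in 𝓝 (Q (q, s)), IsLocalCollarInverse n Q C ρ t x) ∧ t (Q (q, s)) = s) fun p hp => ?_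
    obtain ⟨ρ, t, h1, h2⟩ := hQ.exists_local_inverse hC hp
    have h3 := (hQt p).eventually (eventually_eventually_nhds.2 h1)
    filter_upwards [hev (h3.and h2)] with z hz hzC s hs
    exact ⟨ρ, t, (hz s hs).1, ((hz s hs).2 hzC).2⟩
  -- Injectivity: near the diagonal of `C × C` by the local inverses, away from it by separation.
  have hinj : ∀ᶠ b in 𝓝 (0 : ℝ), ∀ z ∈ C ×ˢ C, z.1 ∈ C → z.2 ∈ C → ∀ s ∈ Ico 0 b,
      ∀ s' ∈ Ico 0 b, Q (z.1, s) = Q (z.2, s') → z.1 = z.2 ∧ s = s' := by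
    refine (hCc.prod hCc).eventually_forall_of_forall_eventually (P := fun b (z : M × M) => z.1 ∈ C →
      z.2 ∈ C → ∀ s ∈ Ico 0 b,
      ∀ s' ∈ Ico 0 b, Q (z.1, s) = Q (z.2, s') → z.1 = z.2 ∧ s = s') fun z hz => ?_
    have hpair : ∀ {P₁ P₂ : M × ℝ → Prop}, (∀ᶠ w in 𝓝[univ ×ˢ Ici 0] (z.1, (0 : ℝ)), P₁ w) →
        (∀ᶠ w in 𝓝[univ ×ˢ Ici 0] (z.2, (0 : ℝ)), P₂ w) →
        ∀ᶠ w : ℝ × M × M in 𝓝 (0, z), (∀ s ∈ Ico 0 w.1, P₁ (w.2.1, s)) ∧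
          ∀ s ∈ Ico 0 w.1, P₂ (w.2.2, s) := by
      intro P₁ P₂ h₁ h₂
      have e₁ : Tendsto (fun w : ℝ × M × M => (w.1, w.2.1)) (𝓝 (0, z)) (𝓝 (0, z.1)) :=
        (continuous_fst.prodMk (continuous_fst.comp continuous_snd)).tendsto _
      have e₂ : Tendsto (fun w : ℝ × M × M => (w.1, w.2.2)) (𝓝 (0, z)) (𝓝 (0, z.2)) :=
        (continuous_fst.prodMk (continuous_snd.comp continuous_snd)).tendsto _
      exact (e₁.eventually (hev h₁)).and (e₂.eventually (hev h₂))
    by_cases hzz : z.1 = z.2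
    · obtain ⟨ρ, t, -, h2⟩ := hQ.exists_local_inverse hC hz.1
      filter_upwards [hpair h2 (hzz ▸ h2)] with w hw h1C h2C s hs s' hs' heq
      have a := hw.1 s hs h1C
      have b := hw.2 s' hs' h2C
      simp only [heq] at a
      exact ⟨a.1.symm.trans b.1, a.2.symm.trans b.2⟩
    · obtain ⟨N₁, N₂, hN₁, hN₂, hm₁, hm₂, hdisj⟩ := t2_separation hzz
      filter_upwards [hpair ((hQt z.1).eventually (hN₁.mem_nhds hm₁))
        ((hQt z.2).eventually (hN₂.mem_nhds hm₂))] with w hw _ _ s hs s' hs' heq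
      have a := hw.1 s hs
      have b := hw.2 s' hs'
      rw [heq] at a
      exact absurd b (disjoint_left.1 hdisj a)
  obtain ⟨b, ⟨h1, h2⟩, hb⟩ : ∃ b : ℝ, (_ ∧ _) ∧ b ∈ Ioc 0 s₀ :=
    (((hinv.and hinj).filter_mono nhdsWithin_le_nhds).and (Ioc_mem_nhdsGT hQ.pos)).exists
  set U : Set M := {x | ∃ z : M × ℝ, z.1 ∈ C ∧ z.2 ∈ Ico 0 b ∧ Q z = x} with hU
  choose! inv hinvC hinvI hinvQ using (fun (x : M) (hx : x ∈ U) => hx)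
  have huniq : ∀ {q s x}, q ∈ C → s ∈ Ico 0 b → Q (q, s) = x → inv x = (q, s) := by
    intro q s x hq hs hx
    have hxU : x ∈ U := ⟨(q, s), hq, hs, hx⟩
    have := h2 ((inv x).1, q) ⟨hinvC x hxU, hq⟩ (hinvC x hxU) hq _ (hinvI x hxU) s hs
      ((hinvQ x hxU).trans hx.symm)
    exact Prod.ext this.1 this.2
  -- near each point of `U`, the inverse is a smooth local inverse
  have hloc : ∀ x ∈ U, ∃ (ρ : M → M) (t : M → ℝ), IsLocalCollarInverse n Q C ρ t x ∧
      ∀ᶠ x' in 𝓝 x, x' ∈ U ∧ inv x' = (ρ x', t x') := by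
    rintro x ⟨⟨q, s⟩, hq, hs, rfl⟩
    obtain ⟨ρ, t, hev, hts⟩ := h1 q hq hq s hs
    refine ⟨ρ, t, hev.self_of_nhds, ?_⟩
    have htb : ∀ᶠ x' in 𝓝 (Q (q, s)), t x' < b :=
      hev.self_of_nhds.contMDiffAt_snd.continuousAt.eventually (Iio_mem_nhds (by
        rw [hts]; exact hs.2))
    filter_upwards [hev, htb] with x' h h'
    exact ⟨⟨(ρ x', t x'), h.mem, ⟨h.nonneg, h'⟩, h.apply_eq⟩, huniq h.mem ⟨h.nonneg, h'⟩ h.apply_eq⟩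
  refine ⟨{ width := b, width_pos := hb.1, κ := Q, pr := fun x => (inv x).1,
            t := fun x => (inv x).2, U := U, isOpen_U := ?_, contMDiffOn_κ := ?_,
            contMDiffOn_pr := ?_, contMDiffOn_t := ?_, κ_zero := hQ.apply_zero, κ_mem := ?_,
            pr_κ := ?_, t_κ := ?_, pr_mem := fun hx => hinvC _ hx, t_mem := fun hx => hinvI _ hx,
            κ_pr_t := fun hx => hinvQ _ hx, mem_of_boundary := ?_ }⟩
  · rw [isOpen_iff_mem_nhds]
    intro x hx
    obtain ⟨ρ, t, -, h⟩ := hloc x hx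
    exact h.mono fun _ h => h.1
  · exact hQ.contMDiffOn.mono (prod_mono le_rfl fun s hs => ⟨hs.1, hs.2.le.trans hb.2⟩)
  · intro x hx
    obtain ⟨ρ, t, h, h'⟩ := hloc x hx
    exact (h.contMDiffAt_fst.congr_of_eventuallyEq
      (h'.mono fun x' hx' => by simp only [hx'.2])).contMDiffWithinAt
  · intro x hx
    obtain ⟨ρ, t, h, h'⟩ := hloc x hx
    exact (h.contMDiffAt_snd.congr_of_eventuallyEq
      (h'.mono fun x' hx' => by simp only [hx'.2])).contMDiffWithinAt
  · exact fun hp hs => ⟨(_, _), hp, hs, rfl⟩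
  · exact fun hp hs => by rw [huniq hp hs rfl]
  · exact fun hp hs => by rw [huniq hp hs rfl]
  · intro x hx hxb
    obtain ⟨ρ, t, h, h'⟩ := hloc x hx
    have h3 := h.apply_eq
    rw [h.boundary hxb, hQ.apply_zero] at h3
    exact h3 ▸ h.mem

end

/-! ### Charts adapted to a collar -/

section

variable {n : ℕ} [NeZero n] {M : Type*} [TopologicalSpace M]
  [ChartedSpace (EuclideanHalfSpace n) M] [IsManifold (𝓡∂ n) ∞ M]

open Chart

namespace Collar

variable {C : Set M} (K : Collar n C)

/-- A chart in which the zeroth coordinate is the collar parameter, while the other coordinates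
are constant along the lines `s ↦ κ (p, s)`. -/
structure IsCollarChart (e : OpenPartialHomeomorph M (EuclideanHalfSpace n)) : Prop where
  mem_maximalAtlas : e ∈ IsManifold.maximalAtlas (𝓡∂ n) ∞ M
  source_subset : e.source ⊆ K.U
  extend_zero : ∀ {x}, x ∈ e.source → e.extend (𝓡∂ n) x 0 = K.t x
  pr_mem : ∀ {x}, x ∈ e.source → K.pr x ∈ e.source
  extend_pr : ∀ {x}, x ∈ e.source →
    e.extend (𝓡∂ n) (K.pr x) = setZero 0 (e.extend (𝓡∂ n) x)
  κ_mem : ∀ {p s}, p ∈ C → p ∈ e.source → s ∈ Ico 0 K.width → K.κ (p, s) ∈ e.source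

lemma subset_U (hx : x ∈ C) : x ∈ K.U := by
  have := K.κ_mem hx (left_mem_Ico.2 K.width_pos)
  rwa [K.κ_zero] at this

lemma t_of_mem {x : M} (hx : x ∈ C) : K.t x = 0 := by
  have := K.t_κ hx (left_mem_Ico.2 K.width_pos)
  rwa [K.κ_zero] at this

lemma pr_of_mem {x : M} (hx : x ∈ C) : K.pr x = x := by
  have := K.pr_κ hx (left_mem_Ico.2 K.width_pos)
  rwa [K.κ_zero] at this

variable {K}

lemma IsCollarChart.extend_κ {e : OpenPartialHomeomorph M (EuclideanHalfSpace n)}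
    (h : K.IsCollarChart e) {p : M} {s : ℝ} (hp : p ∈ C) (hpe : p ∈ e.source)
    (hs : s ∈ Ico 0 K.width) :
    e.extend (𝓡∂ n) (K.κ (p, s)) = setZero s (e.extend (𝓡∂ n) p) := by
  have h1 := h.extend_pr (h.κ_mem hp hpe hs)
  rw [K.pr_κ hp hs] at h1
  rw [h1, setZero_setZero, setZero_of_eq]
  rw [h.extend_zero (h.κ_mem hp hpe hs), K.t_κ hp hs]

lemma IsCollarChart.setZero_mem_target {e : OpenPartialHomeomorph M (EuclideanHalfSpace n)}
    (h : K.IsCollarChart e) {y : Coord n} (hy : y ∈ (e.extend (𝓡∂ n)).target) {s : ℝ}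
    (hs : s ∈ Ico 0 K.width) : setZero s y ∈ (e.extend (𝓡∂ n)).target ∧
      (e.extend (𝓡∂ n)).symm (setZero s y) = K.κ (K.pr ((e.extend (𝓡∂ n)).symm y), s) := by
  set x := (e.extend (𝓡∂ n)).symm y with hx
  have hxe : x ∈ e.source := symm_mem_source hy
  have hp := K.pr_mem (h.source_subset hxe)
  have h1 : e.extend (𝓡∂ n) (K.κ (K.pr x, s)) = setZero s y := by
    rw [h.extend_κ hp (h.pr_mem hxe) hs, h.extend_pr hxe, setZero_setZero, hx,
      (e.extend (𝓡∂ n)).right_inv hy]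
  have hκ := h.κ_mem hp (h.pr_mem hxe) hs
  constructor
  · rw [← h1]; exact apply_mem_target hκ
  · rw [← h1, left_inv hκ]

lemma IsCollarChart.zero_mem_Ico {e : OpenPartialHomeomorph M (EuclideanHalfSpace n)}
    (h : K.IsCollarChart e) {y : Coord n} (hy : y ∈ (e.extend (𝓡∂ n)).target) :
    y 0 ∈ Ico 0 K.width := by
  have h1 := h.extend_zero (symm_mem_source hy)
  rw [(e.extend (𝓡∂ n)).right_inv hy] at h1
  rw [h1]
  exact K.t_mem (h.source_subset (symm_mem_source hy))

/-- Changes of collar charts commute with translations along the collar lines. -/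
lemma IsCollarChart.trans_setZero {e e' : OpenPartialHomeomorph M (EuclideanHalfSpace n)}
    (h : K.IsCollarChart e) (h' : K.IsCollarChart e') {y : Coord n}
    (hy : y ∈ (e.extend (𝓡∂ n)).target) (hy' : (e.extend (𝓡∂ n)).symm y ∈ e'.source) {s : ℝ}
    (hs : s ∈ Ico 0 K.width) :
    (e.extend (𝓡∂ n)).symm (setZero s y) ∈ e'.source ∧
      trans e e' (setZero s y) = setZero s (trans e e' y) := by
  set x := (e.extend (𝓡∂ n)).symm y with hx
  have hp := K.pr_mem (h.source_subset (symm_mem_source hy))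
  have h1 := (h.setZero_mem_target hy hs).2
  rw [← hx] at h1
  constructor
  · rw [h1]; exact h'.κ_mem hp (h'.pr_mem hy') hs
  · rw [trans_apply, h1, h'.extend_κ hp (h'.pr_mem hy') hs, h'.extend_pr hy', setZero_setZero,
      trans_apply]

lemma IsCollarChart.trans_zero {e e' : OpenPartialHomeomorph M (EuclideanHalfSpace n)}
    (h : K.IsCollarChart e) (h' : K.IsCollarChart e') {y : Coord n}
    (hy : y ∈ (e.extend (𝓡∂ n)).target) (hy' : (e.extend (𝓡∂ n)).symm y ∈ e'.source) :
    trans e e' y 0 = y 0 := by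
  rw [trans_apply, h'.extend_zero hy', ← h.extend_zero (symm_mem_source hy),
    (e.extend (𝓡∂ n)).right_inv hy]

variable (K)

/-- Every chart at a point of `C` gives rise to a collar chart, with the same coordinates on the
boundary. -/
lemma exists_isCollarChart (hC : IsBoundaryComponent n C)
    {c : OpenPartialHomeomorph M (EuclideanHalfSpace n)}
    (hcA : c ∈ IsManifold.maximalAtlas (𝓡∂ n) ∞ M) :
    ∃ e, K.IsCollarChart e ∧ (∀ x ∈ K.U, K.pr x ∈ c.source → x ∈ e.source) ∧
      ∀ x ∈ C, x ∈ c.source → e.extend (𝓡∂ n) x = c.extend (𝓡∂ n) x := by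
  obtain ⟨V, hVo, hV⟩ := exists_open_inter_target c
  -- `W` is an open set that separates `C` from the other boundary components.
  set W : Set M := interior {x | x ∈ (𝓡∂ n).boundary M → x ∈ C} with hW
  have hCW : ∀ x, x ∈ (𝓡∂ n).boundary M → (x ∈ C ↔ x ∈ W) := fun x hx =>
    ⟨fun h => mem_interior_iff_mem_nhds.2 (hC.eventually_mem h), fun h => interior_subset h hx⟩
  -- `E` is the collar chart, and `J` the parametrization of the foot points on the boundary.
  let E : M → Coord n := fun x => setZero (K.t x) (c.extend (𝓡∂ n) (K.pr x))
  let J : Coord n → M := fun y => (c.extend (𝓡∂ n)).symm (setZero 0 y)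
  let src : Set M := K.U ∩ K.pr ⁻¹' c.source
  let O : Set (EuclideanHalfSpace n) := {h | (𝓡∂ n) h 0 < K.width ∧ setZero 0 ((𝓡∂ n) h) ∈ V}
  let tgt : Set (EuclideanHalfSpace n) := O ∩ (fun h => J ((𝓡∂ n) h)) ⁻¹' W
  have hIc : Continuous (𝓡∂ n) := (𝓡∂ n).continuous
  have h0c : Continuous fun y : Coord n => y 0 := by fun_prop
  have hset : Continuous fun y : Coord n => setZero 0 y :=
    (continuous_setZero (n := n)).comp (Continuous.prodMk_right (0 : ℝ))
  have hOo : IsOpen O :=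
    (isOpen_Iio.preimage (h0c.comp hIc)).inter (hVo.preimage (hset.comp hIc))
  have hOt : ∀ h ∈ O, setZero 0 ((𝓡∂ n) h) ∈ (c.extend (𝓡∂ n)).target := fun h hh => by
    rw [hV]; exact ⟨hh.2, mem_halfSpace.2 (by simp)⟩
  have hsym := contMDiffOn_extend_symm (I := 𝓡∂ n) hcA
  rw [← c.extend_target'] at hsym
  have hsetsm : ContDiff ℝ ∞ fun y : Coord n => setZero 0 y :=
    ((contDiff_setZero (n := n)).of_le le_top).comp (contDiff_const.prodMk contDiff_id)
  have hJ : ContMDiffOn (𝓡∂ n) (𝓡∂ n) ∞ (fun h => J ((𝓡∂ n) h)) O :=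
    hsym.comp (hsetsm.contMDiff.comp (𝓡∂ n).contMDiff).contMDiffOn hOt
  have hJb : ∀ h ∈ O, J ((𝓡∂ n) h) ∈ (𝓡∂ n).boundary M := fun h hh => by
    rw [mem_boundary_iff hcA (symm_mem_source (hOt h hh)), (c.extend (𝓡∂ n)).right_inv (hOt h hh),
      setZero_zero]
  have hJC : ∀ h ∈ tgt, J ((𝓡∂ n) h) ∈ C := fun h hh => (hCW _ (hJb h hh.1)).2 hh.2
  have hEH : ∀ x ∈ src, E x ∈ halfSpace n := fun x hx =>
    mem_halfSpace.2 (by simp only [E, setZero_zero]; exact (K.t_mem hx.1).1)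
  have hpr0 : ∀ x ∈ src, c.extend (𝓡∂ n) (K.pr x) 0 = 0 := fun x hx =>
    (mem_boundary_iff hcA hx.2).1 (hC.subset (K.pr_mem hx.1))
  have hset0E : ∀ x ∈ src, setZero 0 (E x) = c.extend (𝓡∂ n) (K.pr x) := fun x hx => by
    simp only [E, setZero_setZero, setZero_of_eq (hpr0 x hx)]
  have hJE : ∀ x ∈ src, J (E x) = K.pr x := fun x hx => by
    simp only [J, hset0E x hx, left_inv (show K.pr x ∈ c.source from hx.2)]
  have hEJ : ∀ h ∈ tgt, K.κ (J ((𝓡∂ n) h), (𝓡∂ n) h 0) ∈ src ∧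
      E (K.κ (J ((𝓡∂ n) h), (𝓡∂ n) h 0)) = (𝓡∂ n) h := by
    intro h hh
    have hC' := hJC h hh
    have hI : (𝓡∂ n) h 0 ∈ Ico 0 K.width := ⟨mem_halfSpace.1 ⟨h, rfl⟩, hh.1.1⟩
    refine ⟨⟨K.κ_mem hC' hI, ?_⟩, ?_⟩
    · rw [mem_preimage, K.pr_κ hC' hI]; exact symm_mem_source (hOt h hh.1)
    · simp only [E, K.pr_κ hC' hI, K.t_κ hC' hI]
      simp only [J]
      rw [(c.extend (𝓡∂ n)).right_inv (hOt h hh.1), setZero_setZero, setZero_self]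
  have hII : ∀ x ∈ src, (𝓡∂ n) ((𝓡∂ n).symm (E x)) = E x := fun x hx =>
    (𝓡∂ n).right_inv (hEH x hx)
  have hsrco : IsOpen src :=
    K.contMDiffOn_pr.continuousOn.isOpen_inter_preimage K.isOpen_U c.open_source
  have hEsm : ContMDiffOn (𝓡∂ n) 𝓘(ℝ, Coord n) ∞ E src := by
    have h1 : ContMDiffOn (𝓡∂ n) 𝓘(ℝ, ℝ × Coord n) ∞
        (fun x => (K.t x, c.extend (𝓡∂ n) (K.pr x))) src :=
      (K.contMDiffOn_t.mono inter_subset_left).prodMk_space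
        ((c.contMDiffOn_extend hcA).comp (K.contMDiffOn_pr.mono inter_subset_left)
          fun x hx => hx.2)
    exact ((contDiff_setZero (n := n)).of_le le_top).contMDiff.comp_contMDiffOn h1
  have hEsm' : ContMDiffOn (𝓡∂ n) (𝓡∂ n) ∞ (fun x => (𝓡∂ n).symm (E x)) src :=
    (𝓡∂ n).contMDiffOn_symm.comp hEsm hEH
  have hinv : ContMDiffOn (𝓡∂ n) (𝓡∂ n) ∞
      (fun h => K.κ (J ((𝓡∂ n) h), (𝓡∂ n) h 0)) tgt := by
    refine K.contMDiffOn_κ.comp (ContMDiffOn.prodMk (hJ.mono inter_subset_left) ?_) ?_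
    · exact ((EuclideanSpace.proj 0 : Coord n →L[ℝ] ℝ).contDiff.contMDiff.comp
        (𝓡∂ n).contMDiff).contMDiffOn
    · exact fun h hh => ⟨mem_univ _, mem_halfSpace.1 ⟨h, rfl⟩, hh.1.1⟩
  let e : OpenPartialHomeomorph M (EuclideanHalfSpace n) :=
    { toFun := fun x => (𝓡∂ n).symm (E x)
      invFun := fun h => K.κ (J ((𝓡∂ n) h), (𝓡∂ n) h 0)
      source := src
      target := tgt
      map_source' := fun x hx => by
        have hIx := hII x hx
        refine ⟨⟨?_, ?_⟩, ?_⟩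
        · rw [hIx]; simp only [E, setZero_zero]; exact (K.t_mem hx.1).2
        · rw [hIx, hset0E x hx]
          exact (hV ▸ apply_mem_target hx.2 : _ ∈ V ∩ halfSpace n).1
        · rw [mem_preimage, hIx, hJE x hx]
          exact (hCW _ (hC.subset (K.pr_mem hx.1))).1 (K.pr_mem hx.1)
      map_target' := fun h hh => (hEJ h hh).1
      left_inv' := fun x hx => by
        have h0 : E x 0 = K.t x := setZero_zero _ _
        rw [hII x hx, hJE x hx, h0, K.κ_pr_t hx.1]
      right_inv' := fun h hh => by rw [(hEJ h hh).2, (𝓡∂ n).left_inv]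
      open_source := hsrco
      open_target := (hJ.continuousOn).isOpen_inter_preimage hOo isOpen_interior
      continuousOn_toFun := hEsm'.continuousOn
      continuousOn_invFun := hinv.continuousOn }
  have hext : ∀ x ∈ src, e.extend (𝓡∂ n) x = E x := fun x hx => hII x hx
  have hprsrc : ∀ x ∈ src, K.pr x ∈ src := fun x hx =>
    ⟨K.subset_U (K.pr_mem hx.1), by rw [mem_preimage, K.pr_of_mem (K.pr_mem hx.1)]; exact hx.2⟩
  refine ⟨e, ⟨e.mem_maximalAtlas_of_contMDiffOn hEsm' hinv, inter_subset_left, ?_,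
    fun hx => hprsrc _ hx, ?_, ?_⟩, fun x hx hx' => ⟨hx, hx'⟩, ?_⟩
  · intro x hx
    rw [hext x hx]; exact setZero_zero _ _
  · intro x hx
    rw [hext _ (hprsrc x hx), hext x hx, hset0E x hx]
    have hp := K.pr_mem (hx : x ∈ src).1
    simp only [E, K.pr_of_mem hp, K.t_of_mem hp, setZero_of_eq (hpr0 x hx)]
  · intro p s hp hpe hs
    refine ⟨K.κ_mem hp hs, ?_⟩
    rw [mem_preimage, K.pr_κ hp hs, ← K.pr_of_mem hp]
    exact hpe.2
  · intro x hx hxc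
    have hxs : x ∈ src := ⟨K.subset_U hx, by rw [mem_preimage, K.pr_of_mem hx]; exact hxc⟩
    rw [hext x hxs]
    simp only [E, K.pr_of_mem hx, K.t_of_mem hx]
    have := hpr0 x hxs
    rw [K.pr_of_mem hx] at this
    exact setZero_of_eq this

lemma exists_isCollarChart_of_mem (hC : IsBoundaryComponent n C) {x : M} (hx : x ∈ K.U) :
    ∃ e, K.IsCollarChart e ∧ x ∈ e.source := by
  obtain ⟨e, he, h, -⟩ := K.exists_isCollarChart hC
    (IsManifold.chart_mem_maximalAtlas (I := 𝓡∂ n) (n := ∞) (K.pr x))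
  exact ⟨e, he, h x hx (mem_chart_source _ _)⟩

end Collar

end

/-! ### Hestenes reflection of functions -/

section

namespace LocalRiem

variable {n : ℕ} [NeZero n]

/-- The linear map that multiplies the zeroth coordinate by `m`. -/
def scaleZero (m : ℝ) : Coord n →L[ℝ] Coord n :=
  ContinuousLinearMap.id ℝ (Coord n) +
    (m - 1) • (EuclideanSpace.proj 0 : Coord n →L[ℝ] ℝ).smulRight (stdVec 0)

lemma scaleZero_apply (m : ℝ) (v : Coord n) : scaleZero m v = setZero (m * v 0) v := by
  ext i
  by_cases hi : i = 0
  · subst hi; simp [scaleZero]; ring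
  · simp [scaleZero, setZero_of_ne _ _ hi, hi]

@[simp] lemma scaleZero_zero (m : ℝ) (v : Coord n) : scaleZero m v 0 = m * v 0 := by
  rw [scaleZero_apply, setZero_zero]

lemma scaleZero_of_eq_zero (m : ℝ) {v : Coord n} (hv : v 0 = 0) : scaleZero m v = v := by
  rw [scaleZero_apply, setZero_of_eq]; rw [hv, mul_zero]

lemma scaleZero_of_ne (m : ℝ) (v : Coord n) {i : Fin n} (hi : i ≠ 0) :
    scaleZero m v i = v i := by
  rw [scaleZero_apply, setZero_of_ne _ _ hi]

lemma scaleZero_scaleZero (m l : ℝ) (v : Coord n) :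
    scaleZero m (scaleZero l v) = scaleZero (m * l) v := by
  rw [scaleZero_apply, scaleZero_apply, scaleZero_apply, setZero_setZero, setZero_zero,
    mul_assoc]

lemma scaleZero_one (v : Coord n) : scaleZero 1 v = v := by
  rw [scaleZero_apply, one_mul, setZero_self]

lemma scaleZero_stdVec_zero (m : ℝ) : scaleZero m (stdVec 0 : Coord n) = m • stdVec 0 := by
  ext i
  by_cases hi : i = 0
  · subst hi; simp
  · rw [scaleZero_of_ne _ _ hi]; simp [hi]

/-- The number of zeros among the arguments. -/
def zeroCount (i j : Fin n) : ℕ := (if i = 0 then 1 else 0) + if j = 0 then 1 else 0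

lemma zeroCount_le (i j : Fin n) : zeroCount i j ≤ 2 := by
  unfold zeroCount; split_ifs <;> norm_num

lemma zeroCount_comm (i j : Fin n) : zeroCount i j = zeroCount j i := add_comm _ _

/-- The coefficients `c_j` of Hestenes' reflection, which solve `∑ c_j (-m_j) ^ l = 1` for
`l ≤ 4`. -/
def reflCoeff : Fin 5 → ℝ := ![15, -40, 45, -24, 5]

/-- The scales `m_j = 1, …, 5` of Hestenes' reflection. -/
def reflScale (j : Fin 5) : ℝ := (j : ℕ) + 1

lemma reflScale_pos (j : Fin 5) : 0 < reflScale j := by unfold reflScale; positivity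

lemma reflScale_le (j : Fin 5) : reflScale j ≤ 5 := by
  have : ((j : ℕ) : ℝ) ≤ 4 := by exact_mod_cast Nat.le_of_lt_succ j.2
  unfold reflScale; linarith

lemma sum_reflCoeff {l : ℕ} (hl : l ≤ 4) : ∑ j, reflCoeff j * (-reflScale j) ^ l = 1 := by
  have h0 : reflCoeff 0 = 15 := rfl
  have h1 : reflCoeff 1 = -40 := rfl
  have h2 : reflCoeff 2 = 45 := rfl
  have h3 : reflCoeff 3 = -24 := rfl
  have h4 : reflCoeff 4 = 5 := rfl
  simp only [Fin.sum_univ_five, h0, h1, h2, h3, h4, reflScale]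
  interval_cases l <;> norm_num

/-- The extension of `f` across the boundary of the half space by a weighted Hestenes reflection.
The weight `k` is the number of derivatives or of lower indices in the direction of the zeroth
coordinate. -/
def reflExt (k : ℕ) (f : Coord n → ℝ) (y : Coord n) : ℝ :=
  if 0 ≤ y 0 then f y
  else ∑ j, reflCoeff j * (-reflScale j) ^ k * f (scaleZero (-reflScale j) y)

lemma reflExt_of_mem {k : ℕ} {f : Coord n → ℝ} {y : Coord n} (hy : y ∈ halfSpace n) :
    reflExt k f y = f y := if_pos (mem_halfSpace.1 hy)

lemma reflExt_of_nonpos {k : ℕ} (hk : k ≤ 4) {f : Coord n → ℝ} {y : Coord n} (hy : y 0 ≤ 0) :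
    reflExt k f y =
      ∑ j, reflCoeff j * (-reflScale j) ^ k * f (scaleZero (-reflScale j) y) := by
  rcases hy.lt_or_eq with h | h
  · exact if_neg (not_le.2 h)
  · rw [reflExt, if_pos h.ge]
    simp only [scaleZero_of_eq_zero _ h]
    rw [← Finset.sum_mul, sum_reflCoeff hk, one_mul]

/-- The complementary closed half space. -/
def lowerHalfSpace (n : ℕ) [NeZero n] : Set (Coord n) := {y | y 0 ≤ 0}

lemma halfSpace_union_lower : halfSpace n ∪ lowerHalfSpace n = univ :=
  eq_univ_of_forall fun y => (le_total 0 (y 0)).imp (fun h => mem_halfSpace.2 h) id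

lemma mapsTo_scaleZero_neg {m : ℝ} (hm : 0 ≤ m) :
    MapsTo (scaleZero (-m)) (lowerHalfSpace n) (halfSpace n) := fun y hy =>
  mem_halfSpace.2 (by rw [scaleZero_zero]; nlinarith [show y 0 ≤ 0 from hy])

lemma mapsTo_scaleZero {m : ℝ} (hm : 0 ≤ m) :
    MapsTo (scaleZero m) (halfSpace n) (halfSpace n) := fun y hy =>
  mem_halfSpace.2 (by rw [scaleZero_zero]; exact mul_nonneg hm (mem_halfSpace.1 hy))

lemma mem_nhds_halfSpace {y : Coord n} (hy : 0 < y 0) : halfSpace n ∈ 𝓝 y := by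
  filter_upwards [(by fun_prop : Continuous fun y : Coord n => y 0).continuousAt.preimage_mem_nhds
    (Ioi_mem_nhds hy)] with z hz
  exact mem_halfSpace.2 (le_of_lt hz)

lemma mem_nhds_lowerHalfSpace {y : Coord n} (hy : y 0 < 0) : lowerHalfSpace n ∈ 𝓝 y := by
  filter_upwards [(by fun_prop : Continuous fun y : Coord n => y 0).continuousAt.preimage_mem_nhds
    (Iio_mem_nhds hy)] with z hz
  exact (show z 0 < 0 from hz).le

/-- Near a boundary point `y`, the images of a point under the reflections inherit any property
that holds near `y` in the half space. -/
lemma eventually_scaleZero_neg {y : Coord n} (hy : y 0 = 0) {P : Coord n → Prop}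
    (h : ∀ᶠ z in 𝓝[halfSpace n] y, P z) :
    ∀ᶠ z in 𝓝 y, (z ∈ halfSpace n → P z) ∧
      (z ∈ lowerHalfSpace n → ∀ j, P (scaleZero (-reflScale j) z)) := by
  have h1 := eventually_nhdsWithin_iff.1 h
  have h2 : ∀ j, ∀ᶠ z in 𝓝 y, scaleZero (-reflScale j) z ∈ halfSpace n →
      P (scaleZero (-reflScale j) z) := by
    intro j
    have ht : Tendsto (scaleZero (-reflScale j) : Coord n → Coord n) (𝓝 y) (𝓝 y) := by
      have := (scaleZero (-reflScale j) : Coord n →L[ℝ] Coord n).continuous.tendsto y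
      rwa [scaleZero_of_eq_zero _ hy] at this
    exact ht.eventually h1
  filter_upwards [h1, eventually_all.2 h2] with z hz1 hz2
  exact ⟨hz1, fun hz j => hz2 j (mapsTo_scaleZero_neg (reflScale_pos j).le hz)⟩

lemma clm_eq_sum_proj (L : Coord n →L[ℝ] ℝ) :
    L = ∑ a, L (stdVec a) • (EuclideanSpace.proj a : Coord n →L[ℝ] ℝ) := by
  have hp : ∀ (k : Fin n) (x : Coord n), (EuclideanSpace.proj k : Coord n →L[ℝ] ℝ) x = x k :=
    fun _ _ => rfl
  ext v
  conv_lhs => rw [← sum_smul_stdVec v]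
  simp only [map_sum, map_smul, sum_apply, smul_apply, smul_eq_mul, hp]
  exact Finset.sum_congr rfl fun _ _ => mul_comm _ _

/-- The reflected function is as smooth at the boundary as the weight permits, since the partial
derivatives of a reflected function are reflections of the partial derivatives. -/
theorem contDiffAt_reflExt (m : ℕ) : ∀ (k : ℕ), m + k ≤ 4 → ∀ {f : Coord n → ℝ} {y : Coord n},
    y 0 = 0 → ContDiffWithinAt ℝ m f (halfSpace n) y → ContDiffAt ℝ m (reflExt k f) y := by
  induction m with
  | zero =>
    intro k hk f y hy hf
    have hyH : y ∈ halfSpace n := mem_halfSpace.2 hy.ge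
    have hev : ∀ᶠ z in 𝓝[halfSpace n] y, ContinuousWithinAt f (halfSpace n) z := by
      have := hf.eventually (by simp)
      rw [insert_eq_of_mem hyH] at this
      exact this.mono fun z hz => hz.continuousWithinAt
    have hc : ∀ᶠ z in 𝓝 y, ContinuousAt (reflExt k f) z := by
      filter_upwards [eventually_scaleZero_neg hy hev] with z hz
      rw [← continuousWithinAt_univ, ← halfSpace_union_lower]
      refine ContinuousWithinAt.union ?_ ?_
      · by_cases hzH : z ∈ halfSpace n
        · exact (hz.1 hzH).congr (fun w hw => reflExt_of_mem hw) (reflExt_of_mem hzH)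
        · exact continuousWithinAt_of_notMem_closure (by
            rwa [(𝓡∂ n).isClosed_range.closure_eq])
      · have hcl : IsClosed (lowerHalfSpace n) :=
          isClosed_le (by fun_prop : Continuous fun y : Coord n => y 0) continuous_const
        by_cases hzL : z ∈ lowerHalfSpace n
        · have h1 : ContinuousWithinAt (fun w => ∑ j, reflCoeff j * (-reflScale j) ^ k *
              f (scaleZero (-reflScale j) w)) (lowerHalfSpace n) z :=
            tendsto_finsetSum _ fun j _ => (continuousWithinAt_const.mul
              ((hz.2 hzL j).comp (scaleZero (-reflScale j)).continuous.continuousWithinAt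
                (mapsTo_scaleZero_neg (reflScale_pos j).le)))
          exact h1.congr (fun w hw => reflExt_of_nonpos (by omega) hw)
            (reflExt_of_nonpos (by omega) hzL)
        · exact continuousWithinAt_of_notMem_closure (by rwa [hcl.closure_eq])
    rw [Nat.cast_zero, contDiffAt_zero]
    obtain ⟨V, hV, hVo, hyV⟩ := eventually_nhds_iff.1 hc
    exact ⟨V, hVo.mem_nhds hyV, fun z hz => (hV z hz).continuousWithinAt⟩
  | succ m ih =>
    intro k hk f y hy hf
    have hyH : y ∈ halfSpace n := mem_halfSpace.2 hy.ge
    have hev : ∀ᶠ z in 𝓝[halfSpace n] y, DifferentiableWithinAt ℝ f (halfSpace n) z := by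
      have := hf.eventually (by simp)
      rw [insert_eq_of_mem hyH] at this
      exact this.mono fun z hz => hz.differentiableWithinAt (by simp)
    -- The chain rule gives one more factor `-reflScale j` for the derivative along the zeroth
    -- axis.
    let w : Fin n → ℕ := fun a => k + if a = 0 then 1 else 0
    have hw : ∀ a, w a ≤ k + 1 := fun a => by simp only [w]; split_ifs <;> omega
    push_cast
    rw [contDiffAt_succ_iff_hasFDerivAt]
    refine ⟨fun z => ∑ a, reflExt (w a) (fun z => partialWithin (halfSpace n) a f z) z •
      (EuclideanSpace.proj a : Coord n →L[ℝ] ℝ), ⟨_, eventually_scaleZero_neg hy hev, ?_⟩, ?_⟩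
    · intro z hz
      rw [← hasFDerivWithinAt_univ, ← halfSpace_union_lower]
      refine HasFDerivWithinAt.union ?_ ?_
      · by_cases hzH : z ∈ halfSpace n
        · have h1 := (hz.1 hzH).hasFDerivWithinAt
          rw [clm_eq_sum_proj (fderivWithin ℝ f (halfSpace n) z)] at h1
          refine (h1.congr (fun w hw => reflExt_of_mem hw) (reflExt_of_mem hzH)).congr_fderiv ?_
          exact Finset.sum_congr rfl fun a _ => by rw [reflExt_of_mem hzH]; rfl
        · exact HasFDerivWithinAt.of_notMem_closure (by rwa [(𝓡∂ n).isClosed_range.closure_eq])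
      · have hcl : IsClosed (lowerHalfSpace n) :=
          isClosed_le (by fun_prop : Continuous fun y : Coord n => y 0) continuous_const
        by_cases hzL : z ∈ lowerHalfSpace n
        · have h1 : HasFDerivWithinAt (fun w => ∑ j, reflCoeff j * (-reflScale j) ^ k *
              f (scaleZero (-reflScale j) w))
              (∑ j, (reflCoeff j * (-reflScale j) ^ k) •
                (fderivWithin ℝ f (halfSpace n) (scaleZero (-reflScale j) z)).comp
                  (scaleZero (-reflScale j))) (lowerHalfSpace n) z :=
            HasFDerivWithinAt.fun_sum fun j _ => ((hz.2 hzL j).hasFDerivWithinAt.comp z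
              (scaleZero (-reflScale j)).hasFDerivWithinAt
              (mapsTo_scaleZero_neg (reflScale_pos j).le)).const_mul _
          refine (h1.congr (fun w hw => reflExt_of_nonpos (by omega) hw)
            (reflExt_of_nonpos (by omega) hzL)).congr_fderiv ?_
          rw [clm_eq_sum_proj (∑ j, _)]
          refine Finset.sum_congr rfl fun a _ => ?_
          congr 1
          rw [reflExt_of_nonpos ((hw a).trans (by omega)) hzL, sum_apply]
          refine Finset.sum_congr rfl fun j _ => ?_
          simp only [smul_apply, ContinuousLinearMap.comp_apply, smul_eq_mul, w, partialWithin]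
          by_cases ha : a = 0
          · subst ha
            rw [scaleZero_stdVec_zero, map_smul, smul_eq_mul, if_pos rfl, pow_succ]
            ring
          · rw [scaleZero_of_eq_zero _ (show (stdVec a : Coord n) 0 = 0 by simp [Ne.symm ha]),
              if_neg ha, add_zero]
        · exact HasFDerivWithinAt.of_notMem_closure (by rwa [hcl.closure_eq])
    · refine ContDiffAt.sum fun a _ => ContDiffAt.fun_smul ?_ contDiffAt_const
      exact ih (w a) (by have := hw a; omega) hy
        (contDiffWithinAt_partialWithin (k := (m + 1 : ℕ)) uniqueDiff_halfSpace hyH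
          hf (by push_cast; exact le_rfl) a)

end LocalRiem

end

/-! ### Scalar curvature as a function of the 2-jet -/

section

namespace LocalRiem

variable {n : ℕ}

/-- The Christoffel symbols, as a function of the metric `A` and its first derivatives
`d k i j = ∂_k g_{ij}`. -/
def christoffelJet (A : Matrix (Fin n) (Fin n) ℝ) (d : Fin n → Fin n → Fin n → ℝ)
    (k i j : Fin n) : ℝ :=
  (1 / 2) * ∑ l, A⁻¹ k l * (d i j l + d j i l - d l i j)

/-- The part of the derivative `∂_m Γ^k_{ij}` that involves second derivatives
`dd m k i j = ∂_m ∂_k g_{ij}` of the metric. -/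
def christoffelJetTop (A : Matrix (Fin n) (Fin n) ℝ) (dd : Fin n → Fin n → Fin n → Fin n → ℝ)
    (m k i j : Fin n) : ℝ :=
  (1 / 2) * ∑ l, A⁻¹ k l * (dd m i j l + dd m j i l - dd m l i j)

/-- The part of the derivative `∂_m Γ^k_{ij}` that involves no second derivatives. -/
def christoffelJetLow (A : Matrix (Fin n) (Fin n) ℝ) (d : Fin n → Fin n → Fin n → ℝ)
    (m k i j : Fin n) : ℝ :=
  (1 / 2) * ∑ l, (-∑ p, ∑ q, A⁻¹ k p * d m p q * A⁻¹ q l) * (d i j l + d j i l - d l i j)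

/-- The part of the scalar curvature that is linear in the second derivatives of the metric. -/
def scalarTop (A : Matrix (Fin n) (Fin n) ℝ) (dd : Fin n → Fin n → Fin n → Fin n → ℝ) : ℝ :=
  ∑ i, ∑ j, A⁻¹ i j * ∑ k, (christoffelJetTop A dd k k i j - christoffelJetTop A dd j k i k)

/-- The part of the scalar curvature that involves no second derivatives of the metric. -/
def scalarLow (A : Matrix (Fin n) (Fin n) ℝ) (d : Fin n → Fin n → Fin n → ℝ) : ℝ :=
  ∑ i, ∑ j, A⁻¹ i j * (∑ k, (christoffelJetLow A d k k i j - christoffelJetLow A d j k i k) +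
    ∑ k, ∑ l, (christoffelJet A d k k l * christoffelJet A d l i j
      - christoffelJet A d k j l * christoffelJet A d l i k))

/-- The top order part is linear in the second derivatives. -/
lemma scalarTop_add_smul (A : Matrix (Fin n) (Fin n) ℝ)
    (dd dd' : Fin n → Fin n → Fin n → Fin n → ℝ) (c : ℝ) :
    scalarTop A (fun m k i j => dd m k i j + c * dd' m k i j) =
      scalarTop A dd + c * scalarTop A dd' := by
  have h : ∀ m k i j, christoffelJetTop A (fun m k i j => dd m k i j + c * dd' m k i j) m k i j =
      christoffelJetTop A dd m k i j + c * christoffelJetTop A dd' m k i j := by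
    intro m k i j
    simp only [christoffelJetTop, Finset.mul_sum]
    rw [← Finset.sum_add_distrib]
    exact Finset.sum_congr rfl fun l _ => by ring
  simp only [scalarTop, h]
  rw [Finset.mul_sum, ← Finset.sum_add_distrib]
  refine Finset.sum_congr rfl fun i _ => ?_
  rw [Finset.mul_sum, ← Finset.sum_add_distrib]
  refine Finset.sum_congr rfl fun j _ => ?_
  have : ∀ k, christoffelJetTop A dd k k i j + c * christoffelJetTop A dd' k k i j -
      (christoffelJetTop A dd j k i k + c * christoffelJetTop A dd' j k i k) =
      (christoffelJetTop A dd k k i j - christoffelJetTop A dd j k i k) +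
      c * (christoffelJetTop A dd' k k i j - christoffelJetTop A dd' j k i k) := fun k => by ring
  simp only [this, Finset.sum_add_distrib, ← Finset.mul_sum]
  ring

section Regularity

variable {E : Type*} [NormedAddCommGroup E] [NormedSpace ℝ E] {r : WithTop ℕ∞} {s : Set E} {x : E}
  {A : E → Matrix (Fin n) (Fin n) ℝ} {d : E → Fin n → Fin n → Fin n → ℝ}
  {dd : E → Fin n → Fin n → Fin n → Fin n → ℝ}

lemma contDiffWithinAt_christoffelJet (hA : ∀ i j, ContDiffWithinAt ℝ r (fun z => A z i j) s x)
    (hdet : (A x).det ≠ 0) (hd : ∀ k i j, ContDiffWithinAt ℝ r (fun z => d z k i j) s x)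
    (k i j : Fin n) : ContDiffWithinAt ℝ r (fun z => christoffelJet (A z) (d z) k i j) s x :=
  contDiffWithinAt_const.mul (ContDiffWithinAt.sum fun l _ =>
    (contDiffWithinAt_inv hA hdet k l).mul (((hd i j l).add (hd j i l)).sub (hd l i j)))

lemma contDiffWithinAt_scalarTop (hA : ∀ i j, ContDiffWithinAt ℝ r (fun z => A z i j) s x)
    (hdet : (A x).det ≠ 0) (hdd : ∀ m k i j, ContDiffWithinAt ℝ r (fun z => dd z m k i j) s x) :
    ContDiffWithinAt ℝ r (fun z => scalarTop (A z) (dd z)) s x := by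
  have hi := contDiffWithinAt_inv hA hdet
  have h : ∀ m k i j, ContDiffWithinAt ℝ r (fun z => christoffelJetTop (A z) (dd z) m k i j) s x :=
    fun m k i j => contDiffWithinAt_const.mul (ContDiffWithinAt.sum fun l _ =>
      (hi k l).mul (((hdd m i j l).add (hdd m j i l)).sub (hdd m l i j)))
  exact ContDiffWithinAt.sum fun i _ => ContDiffWithinAt.sum fun j _ => (hi i j).mul
    (ContDiffWithinAt.sum fun k _ => (h k k i j).sub (h j k i k))

lemma contDiffWithinAt_scalarLow (hA : ∀ i j, ContDiffWithinAt ℝ r (fun z => A z i j) s x)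
    (hdet : (A x).det ≠ 0) (hd : ∀ k i j, ContDiffWithinAt ℝ r (fun z => d z k i j) s x) :
    ContDiffWithinAt ℝ r (fun z => scalarLow (A z) (d z)) s x := by
  have hi := contDiffWithinAt_inv hA hdet
  have hc := contDiffWithinAt_christoffelJet hA hdet hd
  have h : ∀ m k i j, ContDiffWithinAt ℝ r (fun z => christoffelJetLow (A z) (d z) m k i j) s x :=
    fun m k i j => contDiffWithinAt_const.mul (ContDiffWithinAt.sum fun l _ =>
      ((ContDiffWithinAt.sum fun p _ => ContDiffWithinAt.sum fun q _ =>
        ((hi k p).mul (hd m p q)).mul (hi q l)).neg).mul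
        (((hd i j l).add (hd j i l)).sub (hd l i j)))
  exact ContDiffWithinAt.sum fun i _ => ContDiffWithinAt.sum fun j _ => (hi i j).mul
    ((ContDiffWithinAt.sum fun k _ => (h k k i j).sub (h j k i k)).add
      (ContDiffWithinAt.sum fun k _ => ContDiffWithinAt.sum fun l _ =>
        ((hc _ _ _).mul (hc _ _ _)).sub ((hc _ _ _).mul (hc _ _ _))))

end Regularity

section

variable {s : Set (Coord n)} {G : Coord n → Matrix (Fin n) (Fin n) ℝ} {y : Coord n}

/-- The first partial derivatives of a matrix function. -/
def dJet (s : Set (Coord n)) (G : Coord n → Matrix (Fin n) (Fin n) ℝ) (y : Coord n)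
    (k i j : Fin n) : ℝ := partialWithin s k (fun z => G z i j) y

/-- The second partial derivatives of a matrix function. -/
def ddJet (s : Set (Coord n)) (G : Coord n → Matrix (Fin n) (Fin n) ℝ) (y : Coord n)
    (m k i j : Fin n) : ℝ := partialWithin s m (fun z => dJet s G z k i j) y

lemma christoffel_eq_jet (s : Set (Coord n)) (G : Coord n → Matrix (Fin n) (Fin n) ℝ)
    (y : Coord n) (k i j : Fin n) :
    christoffel s G k i j y = christoffelJet (G y) (dJet s G y) k i j := rfl

lemma partialWithin_add {f g : Coord n → ℝ} (hs : UniqueDiffWithinAt ℝ s y)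
    (hf : DifferentiableWithinAt ℝ f s y) (hg : DifferentiableWithinAt ℝ g s y) (k : Fin n) :
    partialWithin s k (fun z => f z + g z) y = partialWithin s k f y + partialWithin s k g y := by
  simp only [partialWithin, fderivWithin_fun_add hs hf hg, add_apply]

lemma partialWithin_mul {f g : Coord n → ℝ} (hs : UniqueDiffWithinAt ℝ s y)
    (hf : DifferentiableWithinAt ℝ f s y) (hg : DifferentiableWithinAt ℝ g s y) (k : Fin n) :
    partialWithin s k (fun z => f z * g z) y =
      f y * partialWithin s k g y + g y * partialWithin s k f y := by
  simp only [partialWithin, fderivWithin_fun_mul hs hf hg, add_apply, smul_apply, smul_eq_mul]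

lemma partialWithin_sum {ι : Type*} {t : Finset ι} {f : ι → Coord n → ℝ}
    (hs : UniqueDiffWithinAt ℝ s y) (hf : ∀ i ∈ t, DifferentiableWithinAt ℝ (f i) s y) (k : Fin n) :
    partialWithin s k (fun z => ∑ i ∈ t, f i z) y = ∑ i ∈ t, partialWithin s k (f i) y := by
  simp only [partialWithin, fderivWithin_fun_sum hs hf, sum_apply]

lemma partialWithin_congr {f g : Coord n → ℝ} (h : f =ᶠ[𝓝[s] y] g) (hy : y ∈ s) (k : Fin n) :
    partialWithin s k f y = partialWithin s k g y := by
  simp only [partialWithin, h.fderivWithin_eq (h.self_of_nhdsWithin hy)]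

/-- The derivative of the inverse of a matrix function. -/
lemma partialWithin_inv (hs : UniqueDiffWithinAt ℝ s y) (hy : y ∈ s)
    (hG : ∀ i j, ContDiffWithinAt ℝ 1 (fun z => G z i j) s y) (hdet : (G y).det ≠ 0)
    (m k l : Fin n) :
    partialWithin s m (fun z => (G z)⁻¹ k l) y =
      -∑ p, ∑ q, (G y)⁻¹ k p * dJet s G y m p q * (G y)⁻¹ q l := by
  have hGd : ∀ i j, DifferentiableWithinAt ℝ (fun z => G z i j) s y := fun i j =>
    (hG i j).differentiableWithinAt (by norm_num)
  have hid : ∀ i j, DifferentiableWithinAt ℝ (fun z => (G z)⁻¹ i j) s y := fun i j =>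
    (contDiffWithinAt_inv hG hdet i j).differentiableWithinAt (by norm_num)
  have hev : ∀ᶠ z in 𝓝[s] y, (G z).det ≠ 0 :=
    (contDiffWithinAt_det hG).continuousWithinAt.eventually_ne hdet
  -- differentiate `G⁻¹ * G = 1`
  have h1 : ∀ q, (∑ p, ((G y)⁻¹ k p * dJet s G y m p q +
      G y p q * partialWithin s m (fun z => (G z)⁻¹ k p) y)) = 0 := by
    intro q
    have ha : partialWithin s m (fun z => ∑ p, (G z)⁻¹ k p * G z p q) y =
        ∑ p, ((G y)⁻¹ k p * dJet s G y m p q +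
          G y p q * partialWithin s m (fun z => (G z)⁻¹ k p) y) := by
      rw [partialWithin_sum hs fun p _ => (hid k p).fun_mul (hGd p q)]
      exact Finset.sum_congr rfl fun p _ => partialWithin_mul hs (hid k p) (hGd p q) m
    rw [← ha, partialWithin_congr (g := fun _ => (1 : Matrix (Fin n) (Fin n) ℝ) k q) _ hy]
    · simp [partialWithin]
    · filter_upwards [hev] with z hz
      rw [← Matrix.nonsing_inv_mul (G z) (isUnit_iff_ne_zero.2 hz), Matrix.mul_apply]
  have h2 : partialWithin s m (fun z => (G z)⁻¹ k l) y =
      ∑ q, (∑ p, G y p q * partialWithin s m (fun z => (G z)⁻¹ k p) y) * (G y)⁻¹ q l := by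
    have hm : ∀ p, ∑ q, G y p q * (G y)⁻¹ q l = (1 : Matrix (Fin n) (Fin n) ℝ) p l := fun p => by
      rw [← Matrix.mul_nonsing_inv (G y) (isUnit_iff_ne_zero.2 hdet), Matrix.mul_apply]
    simp only [Finset.sum_mul]
    rw [Finset.sum_comm]
    have : ∀ p, ∑ q, G y p q * partialWithin s m (fun z => (G z)⁻¹ k p) y * (G y)⁻¹ q l =
        partialWithin s m (fun z => (G z)⁻¹ k p) y * (1 : Matrix (Fin n) (Fin n) ℝ) p l := by
      intro p
      rw [← hm p, Finset.mul_sum]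
      exact Finset.sum_congr rfl fun q _ => by ring
    simp only [this, Matrix.one_apply, mul_ite, mul_one, mul_zero, Finset.sum_ite_eq',
      Finset.mem_univ, if_true]
  rw [h2, Finset.sum_comm, ← Finset.sum_neg_distrib]
  refine Finset.sum_congr rfl fun q _ => ?_
  have h3 := h1 q
  rw [Finset.sum_add_distrib] at h3
  rw [← Finset.sum_mul, ← neg_mul]
  congr 1
  linarith

lemma partialWithin_christoffel_eq_jet (hs : UniqueDiffOn ℝ s) (hy : y ∈ s)
    (hG : ∀ i j, ContDiffWithinAt ℝ 2 (fun z => G z i j) s y) (hdet : (G y).det ≠ 0)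
    (m k i j : Fin n) :
    partialWithin s m (christoffel s G k i j) y =
      christoffelJetLow (G y) (dJet s G y) m k i j +
        christoffelJetTop (G y) (ddJet s G y) m k i j := by
  have hG1 : ∀ i j, ContDiffWithinAt ℝ 1 (fun z => G z i j) s y := fun i j =>
    (hG i j).of_le (by norm_num)
  have hid : ∀ i j, DifferentiableWithinAt ℝ (fun z => (G z)⁻¹ i j) s y := fun i j =>
    (contDiffWithinAt_inv hG1 hdet i j).differentiableWithinAt (by norm_num)
  have hd : ∀ k i j, DifferentiableWithinAt ℝ (fun z => dJet s G z k i j) s y := fun k i j =>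
    (contDiffWithinAt_partialWithin (m := 1) hs hy (hG i j) (by norm_num) k).differentiableWithinAt
      (by norm_num)
  have hb : ∀ l, DifferentiableWithinAt ℝ
      (fun z => dJet s G z i j l + dJet s G z j i l - dJet s G z l i j) s y := fun l =>
    ((hd i j l).add (hd j i l)).sub (hd l i j)
  have h1 : ∀ l, partialWithin s m
      (fun z => dJet s G z i j l + dJet s G z j i l - dJet s G z l i j) y =
      ddJet s G y m i j l + ddJet s G y m j i l - ddJet s G y m l i j := by
    intro l
    simp only [ddJet, partialWithin]
    rw [fderivWithin_fun_sub (hs y hy) ((hd i j l).fun_add (hd j i l)) (hd l i j),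
      fderivWithin_fun_add (hs y hy) (hd i j l) (hd j i l)]
    rfl
  have h2 : christoffel s G k i j = fun z => (1 / 2 : ℝ) * ∑ l, (G z)⁻¹ k l *
      (dJet s G z i j l + dJet s G z j i l - dJet s G z l i j) := rfl
  rw [h2, partialWithin_mul (hs y hy) (differentiableWithinAt_const _)
    (DifferentiableWithinAt.fun_sum fun l _ => (hid k l).fun_mul (hb l)),
    partialWithin_sum (hs y hy) fun l _ => (hid k l).fun_mul (hb l)]
  have h3 : partialWithin s m (fun _ => (1 / 2 : ℝ)) y = 0 := by simp [partialWithin]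
  rw [h3, mul_zero, add_zero, christoffelJetLow, christoffelJetTop, ← mul_add,
    ← Finset.sum_add_distrib]
  congr 1
  refine Finset.sum_congr rfl fun l _ => ?_
  rw [partialWithin_mul (hs y hy) (hid k l) (hb l), h1, partialWithin_inv (hs y hy) hy hG1 hdet]
  ring

/-- The scalar curvature is affine in the second derivatives of the metric. -/
theorem scalar_eq_jet (hs : UniqueDiffOn ℝ s) (hy : y ∈ s)
    (hG : ∀ i j, ContDiffWithinAt ℝ 2 (fun z => G z i j) s y) (hdet : (G y).det ≠ 0) :
    scalar s G y = scalarLow (G y) (dJet s G y) + scalarTop (G y) (ddJet s G y) := by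
  simp only [scalar, scalarLow, scalarTop, ricci, partialWithin_christoffel_eq_jet hs hy hG hdet,
    christoffel_eq_jet]
  rw [← Finset.sum_add_distrib]
  refine Finset.sum_congr rfl fun i _ => ?_
  rw [← Finset.sum_add_distrib]
  refine Finset.sum_congr rfl fun j _ => ?_
  rw [← mul_add]
  congr 1
  have : ∀ a b c d : ℝ, a + b - (c + d) = (a - c) + (b - d) := fun a b c d => by ring
  simp only [this, Finset.sum_add_distrib]
  ring

/-- The symbol of the scalar curvature: the contribution of the second derivative in the direction
of the zeroth coordinate. -/
lemma scalarTop_zero_zero [NeZero n] {A S : Matrix (Fin n) (Fin n) ℝ} (hA : IsMetric A) :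
    scalarTop A (fun m k i j => (if m = 0 then 1 else 0) * (if k = 0 then 1 else 0) * S i j) =
      ∑ i, ∑ j, (A⁻¹ i 0 * A⁻¹ j 0 - A⁻¹ 0 0 * A⁻¹ i j) * S i j := by
  have hAs : ∀ i j, A⁻¹ i j = A⁻¹ j i := fun i j => hA.inv_isSymm.apply j i
  -- Among the second derivatives only `∂₀∂₀` occurs, which leaves one term of the sum over `k`.
  have h1 : ∀ i j, ∑ k, christoffelJetTop A (fun m k i j => (if m = 0 then 1 else 0) *
      (if k = 0 then 1 else 0) * S i j) k k i j =
      (1 / 2) * ((if i = 0 then 1 else 0) * ∑ l, A⁻¹ 0 l * S j l +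
        (if j = 0 then 1 else 0) * ∑ l, A⁻¹ 0 l * S i l - A⁻¹ 0 0 * S i j) := by
    intro i j
    rw [Finset.sum_eq_single 0]
    · simp only [christoffelJetTop, if_true, one_mul]
      congr 1
      simp only [mul_add, mul_sub, Finset.sum_add_distrib, Finset.sum_sub_distrib, Finset.mul_sum]
      congr 1
      · congr 1 <;> exact Finset.sum_congr rfl fun l _ => by ring
      · simp [mul_comm]
    · intro k _ hk
      simp [christoffelJetTop, hk]
    · simp
  have h2 : ∀ i j, ∑ k, christoffelJetTop A (fun m k i j => (if m = 0 then 1 else 0) *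
      (if k = 0 then 1 else 0) * S i j) j k i k =
      (1 / 2) * ((if j = 0 then 1 else 0) * (if i = 0 then 1 else 0) *
        ∑ k, ∑ l, A⁻¹ k l * S k l) := by
    intro i j
    simp only [christoffelJetTop]
    rw [← Finset.mul_sum]
    congr 1
    have ha : ∑ k, ∑ l, A⁻¹ k l * ((if j = 0 then 1 else 0) * (if k = 0 then 1 else 0) * S i l) =
        (if j = 0 then 1 else 0) * ∑ l, A⁻¹ 0 l * S i l := by
      rw [Finset.sum_eq_single 0 (fun k _ hk => by simp [hk]) (by simp), Finset.mul_sum]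
      exact Finset.sum_congr rfl fun l _ => by simp
    have hb : ∑ k, ∑ l, A⁻¹ k l * ((if j = 0 then 1 else 0) * (if l = 0 then 1 else 0) * S i k) =
        (if j = 0 then 1 else 0) * ∑ l, A⁻¹ 0 l * S i l := by
      rw [Finset.sum_comm, Finset.sum_eq_single 0 (fun k _ hk => by simp [hk]) (by simp),
        Finset.mul_sum]
      exact Finset.sum_congr rfl fun l _ => by rw [hAs l 0]; simp
    have hc : ∑ k, ∑ l, A⁻¹ k l * ((if j = 0 then 1 else 0) * (if i = 0 then 1 else 0) * S k l) =
        (if j = 0 then 1 else 0) * (if i = 0 then 1 else 0) * ∑ k, ∑ l, A⁻¹ k l * S k l := by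
      simp only [Finset.mul_sum]
      exact Finset.sum_congr rfl fun k _ => Finset.sum_congr rfl fun l _ => by ring
    simp only [mul_add, mul_sub, Finset.sum_add_distrib, Finset.sum_sub_distrib]
    simp only [← mul_assoc] at ha hb hc ⊢
    rw [ha, hb, hc]
    ring
  simp only [scalarTop, Finset.sum_sub_distrib, h1, h2]
  have e1 : ∑ i, ∑ j, A⁻¹ i j * ((if i = 0 then 1 else 0) * ∑ l, A⁻¹ 0 l * S j l) =
      ∑ i, ∑ j, A⁻¹ i 0 * A⁻¹ j 0 * S i j := by
    rw [Finset.sum_eq_single 0 (fun k _ hk => by simp [hk]) (by simp)]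
    simp only [if_true, one_mul, Finset.mul_sum]
    exact Finset.sum_congr rfl fun i _ => Finset.sum_congr rfl fun j _ => by
      rw [hAs 0 i, hAs 0 j]; ring
  have e2 : ∑ i, ∑ j, A⁻¹ i j * ((if j = 0 then 1 else 0) * ∑ l, A⁻¹ 0 l * S i l) =
      ∑ i, ∑ j, A⁻¹ i 0 * A⁻¹ j 0 * S i j := by
    refine Finset.sum_congr rfl fun i _ => ?_
    rw [Finset.sum_eq_single 0 (fun k _ hk => by simp [hk]) (by simp)]
    simp only [if_true, one_mul, Finset.mul_sum]
    exact Finset.sum_congr rfl fun j _ => by rw [hAs 0 j]; ring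
  have e3 : ∑ i, ∑ j, A⁻¹ i j * ((if j = 0 then 1 else 0) * (if i = 0 then 1 else 0) *
      ∑ k, ∑ l, A⁻¹ k l * S k l) = ∑ i, ∑ j, A⁻¹ 0 0 * A⁻¹ i j * S i j := by
    rw [Finset.sum_eq_single 0 (fun k _ hk => by simp [hk]) (by simp),
      Finset.sum_eq_single 0 (fun k _ hk => by simp [hk]) (by simp)]
    simp only [if_true, one_mul, Finset.mul_sum]
    exact Finset.sum_congr rfl fun i _ => Finset.sum_congr rfl fun j _ => by ring
  have e4 : ∀ i j, A⁻¹ i j * ((1 / 2) * ((if i = 0 then 1 else 0) * ∑ l, A⁻¹ 0 l * S j l +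
        (if j = 0 then 1 else 0) * ∑ l, A⁻¹ 0 l * S i l - A⁻¹ 0 0 * S i j) -
        (1 / 2) * ((if j = 0 then 1 else 0) * (if i = 0 then 1 else 0) *
        ∑ k, ∑ l, A⁻¹ k l * S k l)) =
      (1 / 2) * (A⁻¹ i j * ((if i = 0 then 1 else 0) * ∑ l, A⁻¹ 0 l * S j l)) +
      (1 / 2) * (A⁻¹ i j * ((if j = 0 then 1 else 0) * ∑ l, A⁻¹ 0 l * S i l)) -
      (1 / 2) * (A⁻¹ 0 0 * A⁻¹ i j * S i j) -
      (1 / 2) * (A⁻¹ i j * ((if j = 0 then 1 else 0) * (if i = 0 then 1 else 0) *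
        ∑ k, ∑ l, A⁻¹ k l * S k l)) := fun i j => by ring
  simp only [e4, Finset.sum_sub_distrib, Finset.sum_add_distrib, ← Finset.mul_sum]
  rw [e1, e2, e3]
  simp only [sub_mul, Finset.sum_sub_distrib]
  ring

end

end LocalRiem

end

/-! ### Perturbations that depend on the normal coordinate -/

section

namespace LocalRiem

variable {n : ℕ} [NeZero n]

section Family

variable {Q S : Coord n → Matrix (Fin n) (Fin n) ℝ} {y : Coord n} {f : ℝ → ℝ}

/-- The first derivatives of `Q + f(y₀) S`, where `a` and `b` stand for the values of `f` and
`f'`. -/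
def famD (Q S : Coord n → Matrix (Fin n) (Fin n) ℝ) (y : Coord n) (a b : ℝ) (k i j : Fin n) : ℝ :=
  dJet (halfSpace n) Q y k i j + a * dJet (halfSpace n) S y k i j +
    (if k = 0 then 1 else 0) * b * S y i j

/-- The second derivatives of `Q + f(y₀) S` without the term that contains `f''`, where `a` and `b`
stand for the values of `f` and `f'`. -/
def famDD (Q S : Coord n → Matrix (Fin n) (Fin n) ℝ) (y : Coord n) (a b : ℝ)
    (m k i j : Fin n) : ℝ :=
  ddJet (halfSpace n) Q y m k i j + a * ddJet (halfSpace n) S y m k i j +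
    b * ((if m = 0 then 1 else 0) * dJet (halfSpace n) S y k i j +
      (if k = 0 then 1 else 0) * dJet (halfSpace n) S y m i j)

lemma hasFDerivAt_zeroth (hf : Differentiable ℝ f) (y : Coord n) :
    HasFDerivAt (fun z : Coord n => f (z 0))
      (deriv f (y 0) • (EuclideanSpace.proj 0 : Coord n →L[ℝ] ℝ)) y :=
  (hf (y 0)).hasDerivAt.comp_hasFDerivAt (f := fun z : Coord n => z 0) y
    (EuclideanSpace.proj 0 : Coord n →L[ℝ] ℝ).hasFDerivAt

lemma partialWithin_zeroth (hf : Differentiable ℝ f) (hy : y ∈ halfSpace n) (k : Fin n) :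
    partialWithin (halfSpace n) k (fun z => f (z 0)) y =
      (if k = 0 then 1 else 0) * deriv f (y 0) := by
  rw [partialWithin, (hasFDerivAt_zeroth hf y).hasFDerivWithinAt.fderivWithin
    (uniqueDiff_halfSpace y hy)]
  have hp : ∀ (k : Fin n) (x : Coord n), (EuclideanSpace.proj k : Coord n →L[ℝ] ℝ) x = x k :=
    fun _ _ => rfl
  simp only [smul_apply, hp, PiLp.single_apply, smul_eq_mul]
  simp [mul_comm, eq_comm]

lemma dJet_fam (hf : Differentiable ℝ f) (hy : y ∈ halfSpace n)
    (hQ : ∀ i j, DifferentiableWithinAt ℝ (fun z => Q z i j) (halfSpace n) y)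
    (hS : ∀ i j, DifferentiableWithinAt ℝ (fun z => S z i j) (halfSpace n) y) (k i j : Fin n) :
    dJet (halfSpace n) (fun z => Q z + f (z 0) • S z) y k i j =
      famD Q S y (f (y 0)) (deriv f (y 0)) k i j := by
  have hu := uniqueDiff_halfSpace y hy
  have hfd := (hasFDerivAt_zeroth hf y).differentiableAt.differentiableWithinAt (s := halfSpace n)
  simp only [dJet, Matrix.add_apply, Matrix.smul_apply, smul_eq_mul]
  rw [partialWithin_add hu (hQ i j) (hfd.fun_mul (hS i j)), partialWithin_mul hu hfd (hS i j),
    partialWithin_zeroth hf hy, famD, dJet, dJet]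
  ring

lemma ddJet_fam (hf : ContDiff ℝ 2 f) (hy : y ∈ halfSpace n)
    (hQ : ∀ i j, ContDiffWithinAt ℝ 2 (fun z => Q z i j) (halfSpace n) y)
    (hS : ∀ i j, ContDiffWithinAt ℝ 2 (fun z => S z i j) (halfSpace n) y) (m k i j : Fin n) :
    ddJet (halfSpace n) (fun z => Q z + f (z 0) • S z) y m k i j =
      famDD Q S y (f (y 0)) (deriv f (y 0)) m k i j +
        deriv (deriv f) (y 0) * ((if m = 0 then 1 else 0) * (if k = 0 then 1 else 0) * S y i j) :=
    by
  have hu := uniqueDiff_halfSpace y hy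
  have hf1 : Differentiable ℝ f := hf.differentiable (by norm_num)
  have hf2 : Differentiable ℝ (deriv f) := by
    have : ContDiff ℝ (1 + 1) f := by norm_num; exact hf
    exact (contDiff_succ_iff_deriv.1 this).2.2.differentiable (by norm_num)
  have hev : ∀ᶠ z in 𝓝[halfSpace n] y, z ∈ halfSpace n ∧ (∀ i j, ContDiffWithinAt ℝ 2
      (fun z => Q z i j) (halfSpace n) z) ∧ ∀ i j, ContDiffWithinAt ℝ 2
      (fun z => S z i j) (halfSpace n) z := by
    have h1 := fun i j => (hQ i j).eventually (by simp)
    have h2 := fun i j => (hS i j).eventually (by simp)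
    rw [insert_eq_of_mem hy] at h1 h2
    filter_upwards [self_mem_nhdsWithin, eventually_all.2 fun i => eventually_all.2 (h1 i),
      eventually_all.2 fun i => eventually_all.2 (h2 i)] with z a b c
    exact ⟨a, b, c⟩
  have h1 : (fun z => dJet (halfSpace n) (fun z => Q z + f (z 0) • S z) z k i j) =ᶠ[𝓝[halfSpace n] y]
      fun z => dJet (halfSpace n) Q z k i j + (f (z 0) * dJet (halfSpace n) S z k i j +
        (if k = 0 then 1 else 0) * (deriv f (z 0) * S z i j)) := by
    filter_upwards [hev] with z hz
    rw [dJet_fam hf1 hz.1 (fun i j => (hz.2.1 i j).differentiableWithinAt (by norm_num))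
      (fun i j => (hz.2.2 i j).differentiableWithinAt (by norm_num)), famD]
    ring
  have hfd := (hasFDerivAt_zeroth hf1 y).differentiableAt.differentiableWithinAt (s := halfSpace n)
  have hfd' := (hasFDerivAt_zeroth hf2 y).differentiableAt.differentiableWithinAt
    (s := halfSpace n)
  have hdQ : DifferentiableWithinAt ℝ (fun z => dJet (halfSpace n) Q z k i j) (halfSpace n) y :=
    (contDiffWithinAt_partialWithin (m := 1) uniqueDiff_halfSpace hy (hQ i j) (by norm_num)
      k).differentiableWithinAt (by norm_num)
  have hdS : DifferentiableWithinAt ℝ (fun z => dJet (halfSpace n) S z k i j) (halfSpace n) y :=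
    (contDiffWithinAt_partialWithin (m := 1) uniqueDiff_halfSpace hy (hS i j) (by norm_num)
      k).differentiableWithinAt (by norm_num)
  have hSd : DifferentiableWithinAt ℝ (fun z => S z i j) (halfSpace n) y :=
    (hS i j).differentiableWithinAt (by norm_num)
  rw [ddJet, partialWithin_congr h1 hy, partialWithin_add hu hdQ ((hfd.fun_mul hdS).fun_add
    ((differentiableWithinAt_const _).fun_mul (hfd'.fun_mul hSd))),
    partialWithin_add hu (hfd.fun_mul hdS)
    ((differentiableWithinAt_const _).fun_mul (hfd'.fun_mul hSd)),
    partialWithin_mul hu hfd hdS, partialWithin_mul hu (differentiableWithinAt_const _)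
      (hfd'.fun_mul hSd), partialWithin_mul hu hfd' hSd, partialWithin_zeroth hf1 hy,
    partialWithin_zeroth hf2 hy, famDD]
  have h0 : partialWithin (halfSpace n) m (fun _ => (if k = 0 then 1 else 0 : ℝ)) y = 0 := by
    simp [partialWithin]
  rw [h0]
  simp only [ddJet, dJet]
  ring

/-- The scalar curvature of the family without the term that contains `f''`. -/
def famScalar (Q S : Coord n → Matrix (Fin n) (Fin n) ℝ) (y : Coord n) (a b : ℝ) : ℝ :=
  scalarLow (Q y + a • S y) (famD Q S y a b) + scalarTop (Q y + a • S y) (famDD Q S y a b)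

/-- The coefficient of `f''` in the scalar curvature of the family. -/
def famSymbol (Q S : Coord n → Matrix (Fin n) (Fin n) ℝ) (y : Coord n) (a : ℝ) : ℝ :=
  scalarTop (Q y + a • S y)
    fun m k i j => (if m = 0 then 1 else 0) * (if k = 0 then 1 else 0) * S y i j

/-- The scalar curvature of `Q + f(y₀) S` is affine in the second derivative of `f`, with
coefficient `famSymbol`. -/
lemma scalar_fam (hf : ContDiff ℝ 2 f) (hy : y ∈ halfSpace n)
    (hQ : ∀ i j, ContDiffWithinAt ℝ 2 (fun z => Q z i j) (halfSpace n) y)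
    (hS : ∀ i j, ContDiffWithinAt ℝ 2 (fun z => S z i j) (halfSpace n) y)
    (hdet : (Q y + f (y 0) • S y).det ≠ 0) :
    scalar (halfSpace n) (fun z => Q z + f (z 0) • S z) y =
      famScalar Q S y (f (y 0)) (deriv f (y 0)) +
        deriv (deriv f) (y 0) * famSymbol Q S y (f (y 0)) := by
  have hf1 : Differentiable ℝ f := hf.differentiable (by norm_num)
  have hB : ∀ i j, ContDiffWithinAt ℝ 2 (fun z => (Q z + f (z 0) • S z) i j) (halfSpace n) y := by
    intro i j
    have : ContDiffWithinAt ℝ 2 (fun z : Coord n => f (z 0)) (halfSpace n) y :=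
      (hf.comp (EuclideanSpace.proj 0 : Coord n →L[ℝ] ℝ).contDiff).contDiffWithinAt
    exact (hQ i j).add (this.mul (hS i j))
  rw [scalar_eq_jet uniqueDiff_halfSpace hy hB hdet]
  have h1 : dJet (halfSpace n) (fun z => Q z + f (z 0) • S z) y =
      famD Q S y (f (y 0)) (deriv f (y 0)) := by
    funext k i j
    exact dJet_fam hf1 hy (fun i j => (hQ i j).differentiableWithinAt (by norm_num))
      (fun i j => (hS i j).differentiableWithinAt (by norm_num)) k i j
  have h2 : ddJet (halfSpace n) (fun z => Q z + f (z 0) • S z) y = fun m k i j =>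
      famDD Q S y (f (y 0)) (deriv f (y 0)) m k i j + deriv (deriv f) (y 0) *
        ((if m = 0 then 1 else 0) * (if k = 0 then 1 else 0) * S y i j) := by
    funext m k i j
    exact ddJet_fam hf hy hQ hS m k i j
  rw [h1, h2, scalarTop_add_smul, famScalar, famSymbol]
  ring

end Family

section Regularity

variable {Q S : Coord n → Matrix (Fin n) (Fin n) ℝ} {E : Type*} [NormedAddCommGroup E]
  [NormedSpace ℝ E] {t : Set E} {x : E} {Y : E → Coord n} {a b : E → ℝ} {r k : WithTop ℕ∞}

lemma contDiffWithinAt_fam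
    (hY : ContDiffWithinAt ℝ r Y t x) (hYm : MapsTo Y t (halfSpace n))
    (ha : ContDiffWithinAt ℝ r a t x)
    (hQ : ∀ i j, ContDiffWithinAt ℝ r (fun z => Q z i j) (halfSpace n) (Y x))
    (hS : ∀ i j, ContDiffWithinAt ℝ r (fun z => S z i j) (halfSpace n) (Y x)) (i j : Fin n) :
    ContDiffWithinAt ℝ r (fun z => (Q (Y z) + a z • S (Y z)) i j) t x :=
  ((hQ i j).comp x hY hYm).add (ha.mul ((hS i j).comp x hY hYm))

lemma contDiffWithinAt_famD
    (hY : ContDiffWithinAt ℝ r Y t x) (hYm : MapsTo Y t (halfSpace n)) (hYx : Y x ∈ halfSpace n)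
    (ha : ContDiffWithinAt ℝ r a t x) (hb : ContDiffWithinAt ℝ r b t x) (hk : r + 1 ≤ k)
    (hQ : ∀ i j, ContDiffWithinAt ℝ k (fun z => Q z i j) (halfSpace n) (Y x))
    (hS : ∀ i j, ContDiffWithinAt ℝ k (fun z => S z i j) (halfSpace n) (Y x)) (l i j : Fin n) :
    ContDiffWithinAt ℝ r (fun z => famD Q S (Y z) (a z) (b z) l i j) t x := by
  have hQ' := contDiffWithinAt_partialWithin uniqueDiff_halfSpace hYx (hQ i j) hk l
  have hS' := contDiffWithinAt_partialWithin uniqueDiff_halfSpace hYx (hS i j) hk l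
  exact ((hQ'.comp x hY hYm).add (ha.mul (hS'.comp x hY hYm))).add
    ((contDiffWithinAt_const.mul hb).mul
      (((hS i j).of_le (le_self_add.trans hk)).comp x hY hYm))

lemma contDiffWithinAt_famDD
    (hY : ContDiffWithinAt ℝ r Y t x) (hYm : MapsTo Y t (halfSpace n)) (hYx : Y x ∈ halfSpace n)
    (ha : ContDiffWithinAt ℝ r a t x) (hb : ContDiffWithinAt ℝ r b t x) (hk : r + 1 + 1 ≤ k)
    (hQ : ∀ i j, ContDiffWithinAt ℝ k (fun z => Q z i j) (halfSpace n) (Y x))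
    (hS : ∀ i j, ContDiffWithinAt ℝ k (fun z => S z i j) (halfSpace n) (Y x)) (m l i j : Fin n) :
    ContDiffWithinAt ℝ r (fun z => famDD Q S (Y z) (a z) (b z) m l i j) t x := by
  have hQ' := contDiffWithinAt_partialWithin uniqueDiff_halfSpace hYx
    (contDiffWithinAt_partialWithin uniqueDiff_halfSpace hYx (hQ i j) hk l) le_rfl m
  have hS' := contDiffWithinAt_partialWithin uniqueDiff_halfSpace hYx
    (contDiffWithinAt_partialWithin uniqueDiff_halfSpace hYx (hS i j) hk l) le_rfl m
  have hS1 := fun l => (contDiffWithinAt_partialWithin (m := r) uniqueDiff_halfSpace hYx (hS i j)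
    (le_self_add.trans hk) l).comp x hY hYm
  exact ((hQ'.comp x hY hYm).add (ha.mul (hS'.comp x hY hYm))).add
    (hb.mul ((contDiffWithinAt_const.mul (hS1 l)).add (contDiffWithinAt_const.mul (hS1 m))))

lemma contDiffWithinAt_famScalar
    (hY : ContDiffWithinAt ℝ r Y t x) (hYm : MapsTo Y t (halfSpace n)) (hYx : Y x ∈ halfSpace n)
    (ha : ContDiffWithinAt ℝ r a t x) (hb : ContDiffWithinAt ℝ r b t x) (hk : r + 1 + 1 ≤ k)
    (hQ : ∀ i j, ContDiffWithinAt ℝ k (fun z => Q z i j) (halfSpace n) (Y x))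
    (hS : ∀ i j, ContDiffWithinAt ℝ k (fun z => S z i j) (halfSpace n) (Y x))
    (hdet : (Q (Y x) + a x • S (Y x)).det ≠ 0) :
    ContDiffWithinAt ℝ r (fun z => famScalar Q S (Y z) (a z) (b z)) t x := by
  have hrk : r ≤ k := (le_self_add.trans le_self_add).trans hk
  have h0 := contDiffWithinAt_fam hY hYm ha (fun i j => (hQ i j).of_le hrk)
    (fun i j => (hS i j).of_le hrk)
  exact (contDiffWithinAt_scalarLow h0 hdet
    (contDiffWithinAt_famD hY hYm hYx ha hb (le_self_add.trans hk) hQ hS)).add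
    (contDiffWithinAt_scalarTop h0 hdet (contDiffWithinAt_famDD hY hYm hYx ha hb hk hQ hS))

lemma contDiffWithinAt_famSymbol
    (hY : ContDiffWithinAt ℝ r Y t x) (hYm : MapsTo Y t (halfSpace n))
    (ha : ContDiffWithinAt ℝ r a t x)
    (hQ : ∀ i j, ContDiffWithinAt ℝ r (fun z => Q z i j) (halfSpace n) (Y x))
    (hS : ∀ i j, ContDiffWithinAt ℝ r (fun z => S z i j) (halfSpace n) (Y x))
    (hdet : (Q (Y x) + a x • S (Y x)).det ≠ 0) :
    ContDiffWithinAt ℝ r (fun z => famSymbol Q S (Y z) (a z)) t x :=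
  contDiffWithinAt_scalarTop (contDiffWithinAt_fam hY hYm ha hQ hS) hdet
    fun _ _ i j => contDiffWithinAt_const.mul ((hS i j).comp x hY hYm)

end Regularity

/-- The function `u(r) = r³ / (3 δ²)`. On `[0, δ]` it is small together with `δ` and `u'(δ) = 1`,
while `u''` is large compared with `r`, `u` and `u'`. -/
def bump (δ r : ℝ) : ℝ := r ^ 3 / (3 * δ ^ 2)

lemma contDiff_bump (δ : ℝ) {k : WithTop ℕ∞} : ContDiff ℝ k (bump δ) :=
  (contDiff_id.pow 3).div_const _

lemma deriv_bump (δ : ℝ) : deriv (bump δ) = fun r => r ^ 2 / δ ^ 2 := by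
  funext r
  have h : HasDerivAt (fun r : ℝ => r ^ 3 / (3 * δ ^ 2)) (3 * r ^ 2 / (3 * δ ^ 2)) r := by
    simpa using (hasDerivAt_pow 3 r).div_const (3 * δ ^ 2)
  rw [show bump δ = fun r => r ^ 3 / (3 * δ ^ 2) from rfl, h.deriv, mul_div_mul_left _ _ (by norm_num : (3 : ℝ) ≠ 0)]

lemma deriv_deriv_bump (δ r : ℝ) : deriv (deriv (bump δ)) r = 2 * r / δ ^ 2 := by
  rw [deriv_bump]
  have h : HasDerivAt (fun r : ℝ => r ^ 2 / δ ^ 2) (2 * r / δ ^ 2) r := by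
    simpa using (hasDerivAt_pow 2 r).div_const (δ ^ 2)
  exact h.deriv

lemma bump_nonneg {δ r : ℝ} (hr : 0 ≤ r) : 0 ≤ bump δ r := by unfold bump; positivity

lemma bump_le {δ r : ℝ} (hδ : 0 < δ) (hr : r ∈ Icc 0 δ) : bump δ r ≤ r := by
  have h0 := hr.1
  unfold bump
  rw [div_le_iff₀ (by positivity)]
  have h2 : r ^ 2 ≤ δ ^ 2 := pow_le_pow_left₀ hr.1 hr.2 2
  nlinarith [mul_nonneg h0 (sub_nonneg.2 h2), mul_nonneg h0 (sq_nonneg δ)]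

/-- If the symbol is positive, then the term with `u''` dominates the change of all the other
terms of the scalar curvature, once `δ` is small. -/
theorem eventually_scalar_fam_nonneg {Q S : Coord n → Matrix (Fin n) (Fin n) ℝ} {y₀ : Coord n}
    (h0 : y₀ 0 = 0)
    (hQ : ∀ i j, ContDiffWithinAt ℝ 3 (fun z => Q z i j) (halfSpace n) y₀)
    (hS : ∀ i j, ContDiffWithinAt ℝ 3 (fun z => S z i j) (halfSpace n) y₀)
    (hdet : (Q y₀).det ≠ 0) (hsymb : 0 < famSymbol Q S y₀ 0)
    (hR : ∀ᶠ y in 𝓝[halfSpace n] y₀, y 0 = 0 → 0 ≤ scalar (halfSpace n) Q y) :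
    ∀ᶠ z : ℝ × Coord n in 𝓝 (0, y₀), 0 < z.1 → z.2 0 = 0 → ∀ r ∈ Ioc 0 z.1,
      0 ≤ scalar (halfSpace n) (fun y => Q y + bump z.1 (y 0) • S y) (setZero r z.2) := by
  have hyH : y₀ ∈ halfSpace n := mem_halfSpace.2 h0.ge
  set c := famSymbol Q S y₀ 0 / 2 with hc
  have hc0 : 0 < c := half_pos hsymb
  have hfst : MapsTo (Prod.fst : Coord n × ℝ → Coord n) (halfSpace n ×ˢ univ) (halfSpace n) :=
    fun x hx => hx.1
  -- a neighbourhood on which everything is controlled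
  have hev : ∀ᶠ x : Coord n × ℝ in 𝓝[halfSpace n ×ˢ univ] (y₀, (0 : ℝ)),
      (∀ i j, ContDiffWithinAt ℝ 3 (fun z => Q z i j) (halfSpace n) x.1) ∧
      (∀ i j, ContDiffWithinAt ℝ 3 (fun z => S z i j) (halfSpace n) x.1) ∧
      (Q x.1 + x.2 • S x.1).det ≠ 0 ∧ c < famSymbol Q S x.1 x.2 ∧
      (x.1 0 = 0 → 0 ≤ scalar (halfSpace n) Q x.1) := by
    have ht : Tendsto (Prod.fst : Coord n × ℝ → Coord n) (𝓝[halfSpace n ×ˢ univ] (y₀, (0 : ℝ)))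
        (𝓝[halfSpace n] y₀) :=
      continuousWithinAt_fst.tendsto_nhdsWithin hfst
    have h1 := fun i j => (hQ i j).eventually (by simp)
    have h2 := fun i j => (hS i j).eventually (by simp)
    rw [insert_eq_of_mem hyH] at h1 h2
    have hdet0 : (Q y₀ + (0 : ℝ) • S y₀).det ≠ 0 := by rwa [zero_smul, add_zero]
    have h3 : ContDiffWithinAt ℝ 0 (fun x : Coord n × ℝ => (Q x.1 + x.2 • S x.1).det)
        (halfSpace n ×ˢ univ) (y₀, 0) :=
      contDiffWithinAt_det (contDiffWithinAt_fam (Y := Prod.fst) (a := Prod.snd)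
        contDiffWithinAt_fst hfst contDiffWithinAt_snd
        (fun i j => (hQ i j).of_le (by norm_num)) (fun i j => (hS i j).of_le (by norm_num)))
    have h4 : ContDiffWithinAt ℝ 0 (fun x : Coord n × ℝ => famSymbol Q S x.1 x.2)
        (halfSpace n ×ˢ univ) (y₀, 0) :=
      contDiffWithinAt_famSymbol (Y := Prod.fst) (a := Prod.snd)
        contDiffWithinAt_fst hfst contDiffWithinAt_snd
        (fun i j => (hQ i j).of_le (by norm_num)) (fun i j => (hS i j).of_le (by norm_num)) hdet0
    have h5 := h3.continuousWithinAt.eventually_ne hdet0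
    have h6 := h4.continuousWithinAt.tendsto.eventually
      (lt_mem_nhds (show c < famSymbol Q S y₀ 0 from half_lt_self hsymb))
    filter_upwards [ht.eventually (eventually_all.2 fun i => eventually_all.2 (h1 i)),
      ht.eventually (eventually_all.2 fun i => eventually_all.2 (h2 i)), h5, h6,
      ht.eventually hR] with x a b c d e
    exact ⟨a, b, c, d, e⟩
  obtain ⟨ρ', hρ', hball⟩ := Metric.mem_nhdsWithin_iff.1 hev
  set ρ := ρ' / 2 with hρ
  have hρ0 : 0 < ρ := half_pos hρ'
  set B : Set (Coord n) := Metric.closedBall y₀ ρ ∩ halfSpace n with hB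
  set s : Set (Coord n × ℝ × ℝ) := B ×ˢ (Icc (-ρ) ρ ×ˢ Icc 0 1) with hs
  have hgood : ∀ y ∈ B, ∀ a ∈ Icc (-ρ) ρ, (y, a) ∈ Metric.ball (y₀, (0 : ℝ)) ρ' ∩
      (halfSpace n ×ˢ univ) := by
    intro y hy a ha
    refine ⟨?_, hy.2, mem_univ _⟩
    rw [Metric.mem_ball, Prod.dist_eq, max_lt_iff]
    constructor
    · exact (Metric.mem_closedBall.1 hy.1).trans_lt (half_lt_self hρ')
    · simp only [Real.dist_eq, sub_zero]
      exact (abs_le.2 ha).trans_lt (half_lt_self hρ')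
  have hlip : ∃ K, LipschitzOnWith K (fun x : Coord n × ℝ × ℝ => famScalar Q S x.1 x.2.1 x.2.2) s := by
    have hconv : Convex ℝ s := ((convex_closedBall _ _).inter convex_halfSpace).prod
      ((convex_Icc _ _).prod (convex_Icc _ _))
    have hcomp : IsCompact s := ((isCompact_closedBall _ _).inter_right
      (𝓡∂ n).isClosed_range).prod (isCompact_Icc.prod isCompact_Icc)
    refine ContDiffOn.exists_lipschitzOnWith (n := 1) (fun x hx => ?_) (by norm_num) hconv hcomp
    have hx' := hball (hgood x.1 hx.1 x.2.1 hx.2.1)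
    refine contDiffWithinAt_famScalar (k := 3) (Y := Prod.fst) contDiffWithinAt_fst
      (fun z hz => hz.1.2) hx.1.2 (contDiffWithinAt_fst.comp x contDiffWithinAt_snd
      (mapsTo_univ _ _)) (contDiffWithinAt_snd.comp x contDiffWithinAt_snd (mapsTo_univ _ _))
      (by norm_num) hx'.1 hx'.2.1 hx'.2.2.1
  -- The remaining part of the scalar curvature is a Lipschitz function of the point and of the
  -- values of `u` and of its derivative. All of these change by at most `r / δ` from the foot
  -- point.
  obtain ⟨K, hK⟩ := hlip
  have hcont : Tendsto (fun z : ℝ × Coord n => dist z.2 y₀ + z.1) (𝓝 (0, y₀)) (𝓝 0) := by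
    have : Continuous fun z : ℝ × Coord n => dist z.2 y₀ + z.1 := by fun_prop
    have := this.tendsto (0, y₀)
    simpa using this
  have hcont' : Tendsto (fun z : ℝ × Coord n => K * z.1) (𝓝 (0, y₀)) (𝓝 0) := by
    have : Continuous fun z : ℝ × Coord n => K * z.1 := by fun_prop
    have := this.tendsto (0, y₀)
    simpa using this
  filter_upwards [hcont.eventually (gt_mem_nhds hρ0), hcont'.eventually (gt_mem_nhds hc0),
    hcont.eventually (gt_mem_nhds one_pos)] with z hz1 hz2 hz3 hδ hq r hr
  obtain ⟨δ, q⟩ := z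
  simp only at hz1 hz2 hz3 hδ hq hr ⊢
  have hdq : 0 ≤ dist q y₀ := dist_nonneg
  have hqH : q ∈ halfSpace n := mem_halfSpace.2 hq.ge
  have hqB : q ∈ B := ⟨Metric.mem_closedBall.2 (by linarith), hqH⟩
  have hdist : dist (setZero r q) q = r := by
    rw [dist_eq_norm, setZero, hq, add_sub_cancel_left, sub_zero, norm_smul, PiLp.norm_single,
      norm_one, mul_one, Real.norm_of_nonneg hr.1.le]
  have hyB : setZero r q ∈ B := by
    refine ⟨Metric.mem_closedBall.2 ?_, mem_halfSpace.2 (by rw [setZero_zero]; exact hr.1.le)⟩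
    have := dist_triangle (setZero r q) q y₀
    have := hr.2
    linarith
  have hr' : r ∈ Icc 0 δ := ⟨hr.1.le, hr.2⟩
  have hb0 : 0 ≤ bump δ r := bump_nonneg hr.1.le
  have hb1 : bump δ r ≤ r := bump_le hδ hr'
  have hbρ : bump δ r ∈ Icc (-ρ) ρ := ⟨by linarith, by have := hr.2; linarith⟩
  have hd1 : r ^ 2 / δ ^ 2 ≤ r / δ := by
    rw [div_le_div_iff₀ (by positivity) hδ]
    have := mul_nonneg (mul_nonneg hr.1.le hδ.le) (sub_nonneg.2 hr.2)
    nlinarith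
  have hr1 : r / δ ≤ 1 := (div_le_one hδ).2 hr.2
  have hd0 : 0 ≤ r ^ 2 / δ ^ 2 := by positivity
  have hrδ : r ≤ r / δ := by
    rw [le_div_iff₀ hδ]
    have := mul_nonneg hr.1.le (show 0 ≤ 1 - δ by linarith)
    nlinarith
  have hy1 := hball (hgood _ hyB _ hbρ)
  have hq1 := hball (hgood q hqB 0 ⟨by linarith, hρ0.le⟩)
  have hz0 : setZero r q 0 = r := setZero_zero _ _
  have hsc := scalar_fam (Q := Q) (S := S) (y := setZero r q) (f := bump δ) (contDiff_bump δ)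
    hyB.2 (fun i j => (hy1.1 i j).of_le (by norm_num))
    (fun i j => (hy1.2.1 i j).of_le (by norm_num)) (by rw [hz0]; exact hy1.2.2.1)
  rw [hsc, hz0, deriv_deriv_bump, deriv_bump]
  -- the value at the foot point on the boundary is the scalar curvature of `Q`
  have hfoot : famScalar Q S q 0 0 = scalar (halfSpace n) Q q := by
    have hz : ContDiff ℝ 2 (fun _ : ℝ => (0 : ℝ)) := contDiff_const
    have := scalar_fam (Q := Q) (S := S) (y := q) hz hqH
      (fun i j => (hq1.1 i j).of_le (by norm_num))
      (fun i j => (hq1.2.1 i j).of_le (by norm_num)) hq1.2.2.1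
    simpa using this.symm
  have h0' : 0 ≤ famScalar Q S q 0 0 := hfoot ▸ hq1.2.2.2.2 hq
  have hl := hK.dist_le_mul (setZero r q, bump δ r, r ^ 2 / δ ^ 2)
    ⟨hyB, hbρ, hd0, hd1.trans hr1⟩ (q, 0, 0) ⟨hqB, ⟨by linarith, hρ0.le⟩, le_rfl, zero_le_one⟩
  have hdd : dist (setZero r q, bump δ r, r ^ 2 / δ ^ 2) (q, (0 : ℝ), (0 : ℝ)) ≤ r / δ := by
    rw [Prod.dist_eq, Prod.dist_eq]
    refine max_le (hdist.trans_le hrδ) (max_le ?_ ?_)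
    · simp only [Real.dist_eq, sub_zero, abs_of_nonneg hb0]; exact hb1.trans hrδ
    · simp only [Real.dist_eq, sub_zero, abs_of_nonneg hd0]; exact hd1
  have hl2 : famScalar Q S q 0 0 - K * (r / δ) ≤
      famScalar Q S (setZero r q) (bump δ r) (r ^ 2 / δ ^ 2) := by
    have h1 := hl.trans (mul_le_mul_of_nonneg_left hdd K.2)
    rw [Real.dist_eq] at h1
    have := neg_abs_le (famScalar Q S (setZero r q) (bump δ r) (r ^ 2 / δ ^ 2) -
      famScalar Q S q 0 0)
    simp only at h1
    linarith
  have hL : c ≤ famSymbol Q S (setZero r q) (bump δ r) := hy1.2.2.2.1.le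
  have h2 : 2 * r / δ ^ 2 * c ≤ 2 * r / δ ^ 2 * famSymbol Q S (setZero r q) (bump δ r) :=
    mul_le_mul_of_nonneg_left hL (by have := hr.1; positivity)
  -- The change `K r / δ` is dominated by the term `2 r c / δ²` with the second derivative of `u`,
  -- once `K δ ≤ c`.
  have h3 : K * (r / δ) ≤ 2 * r / δ ^ 2 * c := by
    have e1 : (K : ℝ) * (r / δ) = r / δ ^ 2 * (K * δ) := by field_simp
    have e2 : 2 * r / δ ^ 2 * c = r / δ ^ 2 * (2 * c) := by ring
    rw [e1, e2]
    have := hr.1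
    exact mul_le_mul_of_nonneg_left (by linarith) (by positivity)
  linarith

end LocalRiem

end

/-! ### Reflection of metrics -/

section

namespace LocalRiem

variable {n : ℕ} [NeZero n] {G : Coord n → Matrix (Fin n) (Fin n) ℝ} {y : Coord n}

lemma bil_scaleZero (A : Matrix (Fin n) (Fin n) ℝ) (m : ℝ) (u v : Coord n) :
    bil A (scaleZero m u) (scaleZero m v) =
      ∑ a, ∑ b, m ^ zeroCount a b * A a b * u a * v b := by
  have h : ∀ (w : Coord n) (a : Fin n), scaleZero m w a = (if a = 0 then m else 1) * w a := by
    intro w a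
    by_cases ha : a = 0
    · subst ha; simp
    · simp [scaleZero_of_ne m w ha, ha]
  refine Finset.sum_congr rfl fun a _ => Finset.sum_congr rfl fun b _ => ?_
  rw [h, h, zeroCount, pow_add]
  split_ifs <;> ring

/-- The metric obtained by reflecting a metric `G` across the boundary of the half space: the sum
of the pullbacks of `G` under the scalings of the zeroth coordinate, with the coefficients of the
Hestenes reflection. -/
def reflMetric (G : Coord n → Matrix (Fin n) (Fin n) ℝ) (y : Coord n) :
    Matrix (Fin n) (Fin n) ℝ :=
  Matrix.of fun a b =>
    ∑ j, reflCoeff j * reflScale j ^ zeroCount a b * G (scaleZero (reflScale j) y) a b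

/-- The extension of the metric `G` across the boundary of the half space. -/
def reflExtMetric (G : Coord n → Matrix (Fin n) (Fin n) ℝ) (y : Coord n) :
    Matrix (Fin n) (Fin n) ℝ :=
  Matrix.of fun a b => reflExt (zeroCount a b) (fun z => G z a b) y

lemma bil_reflMetric (u v : Coord n) : bil (reflMetric G y) u v =
    ∑ j, reflCoeff j * bil (G (scaleZero (reflScale j) y)) (scaleZero (reflScale j) u)
      (scaleZero (reflScale j) v) := by
  simp only [bil_scaleZero]
  simp only [bil, reflMetric, Matrix.of_apply, Finset.mul_sum, Finset.sum_mul]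
  rw [Finset.sum_comm' (t' := Finset.univ) (s' := fun _ => Finset.univ) (by simp)]
  conv_rhs => rw [Finset.sum_comm]; enter [2, a]; rw [Finset.sum_comm]
  conv_lhs => rw [Finset.sum_comm]
  refine Finset.sum_congr rfl fun a _ => Finset.sum_congr rfl fun b _ =>
    Finset.sum_congr rfl fun j _ => ?_
  ring

lemma reflExtMetric_of_mem (hy : y ∈ halfSpace n) : reflExtMetric G y = G y := by
  ext a b
  exact reflExt_of_mem (f := fun z => G z a b) hy

lemma bil_reflExtMetric_of_nonpos (hy : y 0 ≤ 0) (u v : Coord n) : bil (reflExtMetric G y) u v =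
    ∑ j, reflCoeff j * bil (G (scaleZero (-reflScale j) y)) (scaleZero (-reflScale j) u)
      (scaleZero (-reflScale j) v) := by
  have h : ∀ a b, reflExtMetric G y a b = ∑ j, reflCoeff j * (-reflScale j) ^ zeroCount a b *
      G (scaleZero (-reflScale j) y) a b := fun a b =>
    reflExt_of_nonpos (f := fun z => G z a b) ((zeroCount_le a b).trans (by norm_num)) hy
  simp only [bil_scaleZero]
  simp only [bil, h, Finset.mul_sum, Finset.sum_mul]
  conv_rhs => rw [Finset.sum_comm]; enter [2, a]; rw [Finset.sum_comm]
  refine Finset.sum_congr rfl fun a _ => Finset.sum_congr rfl fun b _ =>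
    Finset.sum_congr rfl fun j _ => ?_
  ring

/-- The reflected metric is the pullback of the extended metric under the reflection. -/
lemma bil_reflMetric_eq (hy : y ∈ halfSpace n) (u v : Coord n) : bil (reflMetric G y) u v =
    bil (reflExtMetric G (scaleZero (-1) y)) (scaleZero (-1) u) (scaleZero (-1) v) := by
  have h : scaleZero (-1) y 0 ≤ 0 := by
    rw [scaleZero_zero]; have := mem_halfSpace.1 hy; linarith
  rw [bil_reflMetric, bil_reflExtMetric_of_nonpos h]
  simp only [scaleZero_scaleZero, neg_mul_neg, mul_one]

/-- On the boundary, the reflected metric is the image of the given one under the reflection of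
vectors. -/
lemma bil_reflMetric_of_zero (hy : y 0 = 0) (u v : Coord n) :
    bil (reflMetric G y) u v = bil (G y) (scaleZero (-1) u) (scaleZero (-1) v) := by
  have hH : y ∈ halfSpace n := mem_halfSpace.2 hy.ge
  rw [bil_reflMetric_eq hH, scaleZero_of_eq_zero _ hy, reflExtMetric_of_mem hH]

lemma scaleZero_injective {m : ℝ} (hm : m ≠ 0) :
    Function.Injective (scaleZero m : Coord n → Coord n) := by
  intro u v h
  have := congrArg (scaleZero m⁻¹) h
  simpa only [scaleZero_scaleZero, inv_mul_cancel₀ hm, scaleZero_one] using this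

/-- A form that is the pullback of a metric under the reflection is a metric. -/
lemma isMetric_of_reflect {A B : Matrix (Fin n) (Fin n) ℝ} (hB : IsMetric B)
    (h : ∀ u v, bil A u v = bil B (scaleZero (-1) u) (scaleZero (-1) v)) : IsMetric A where
  isSymm := by
    refine matrix_eq_of_bil_eq fun u v => ?_
    have : ∀ u v, bil A u v = bil A v u := fun u v => by rw [h, h, bil_comm hB.isSymm]
    rw [this u v]
    simp only [bil, Matrix.transpose_apply]
    rw [Finset.sum_comm]
    exact Finset.sum_congr rfl fun a _ => Finset.sum_congr rfl fun b _ => by ring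
  pos v hv := by
    rw [h]
    refine hB.pos _ fun h0 => hv (scaleZero_injective (by norm_num : (-1 : ℝ) ≠ 0) ?_)
    rw [h0, map_zero]

/-- A reflection preserves the length of the differential of the zeroth coordinate. -/
lemma inv_zero_zero_of_reflect {A B : Matrix (Fin n) (Fin n) ℝ} (hA : IsMetric A) (hB : IsMetric B)
    (h : ∀ u v, bil A u v = bil B (scaleZero (-1) u) (scaleZero (-1) v)) :
    A⁻¹ 0 0 = B⁻¹ 0 0 := by
  have hc : (WithLp.toLp 2 fun k => A⁻¹ k 0 : Coord n) =
      -scaleZero (-1) (WithLp.toLp 2 fun k => B⁻¹ k 0) := by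
    refine bil_congr_right hA.det_ne_zero hA.isSymm fun w => ?_
    rw [bil_inv_col hA.det_ne_zero hA.isSymm, h, map_neg, scaleZero_scaleZero, neg_mul_neg,
      one_mul, scaleZero_one, ← neg_one_smul ℝ, bil_smul_left,
      bil_inv_col hB.det_ne_zero hB.isSymm, scaleZero_zero]
    ring
  have := congrArg (fun v : Coord n => v 0) hc
  simpa using this

section Boundary

lemma contDiffWithinAt_comp_scaleZero {k : WithTop ℕ∞} {f : Coord n → ℝ} {m : ℝ} (hm : 0 ≤ m)
    (hf : ContDiffWithinAt ℝ k f (halfSpace n) (scaleZero m y)) :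
    ContDiffWithinAt ℝ k (fun z => f (scaleZero m z)) (halfSpace n) y :=
  hf.comp y (scaleZero m).contDiff.contDiffWithinAt (mapsTo_scaleZero hm)

lemma contDiffWithinAt_reflMetric {k : WithTop ℕ∞}
    (hG : ∀ i j l, ContDiffWithinAt ℝ k (fun z => G z i j) (halfSpace n)
      (scaleZero (reflScale l) y)) (i j : Fin n) :
    ContDiffWithinAt ℝ k (fun z => reflMetric G z i j) (halfSpace n) y := by
  simp only [reflMetric, Matrix.of_apply]
  exact ContDiffWithinAt.sum fun l _ => contDiffWithinAt_const.mul
    (contDiffWithinAt_comp_scaleZero (reflScale_pos l).le (hG i j l))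

variable (h0 : y 0 = 0)
  (hG : ∀ i j, ContDiffWithinAt ℝ 4 (fun z => G z i j) (halfSpace n) y)
  (hGm : ∀ᶠ z in 𝓝[halfSpace n] y, IsMetric (G z))

include h0 hG

lemma contDiffAt_reflExtMetric (i j : Fin n) :
    ContDiffAt ℝ 2 (fun z => reflExtMetric G z i j) y := by
  have hk := zeroCount_le i j
  exact contDiffAt_reflExt 2 (zeroCount i j) (by omega) h0 ((hG i j).of_le (by norm_num))

include hGm

lemma eventually_isSymm_reflExtMetric : ∀ᶠ z in 𝓝 y, (reflExtMetric G z).IsSymm := by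
  filter_upwards [eventually_scaleZero_neg h0 hGm] with z hz
  rcases le_total 0 (z 0) with h | h
  · rw [reflExtMetric_of_mem (mem_halfSpace.2 h)]
    exact (hz.1 (mem_halfSpace.2 h)).isSymm
  · ext i j
    have hk := fun i j : Fin n => (zeroCount_le i j).trans (show 2 ≤ 4 by norm_num)
    simp only [Matrix.transpose_apply, reflExtMetric, Matrix.of_apply, reflExt_of_nonpos (hk _ _) h,
      zeroCount_comm j i]
    exact Finset.sum_congr rfl fun l _ => by rw [(hz.2 h l).isSymm.apply]

/-- Regularity, positivity and symmetry of the reflected metric at a boundary point. -/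
lemma reflect_data :
    (∀ i j, ContDiffWithinAt ℝ 2 (fun z => reflMetric G z i j) (halfSpace n) y) ∧
    IsMetric (reflMetric G y) ∧ ∀ᶠ z in 𝓝[halfSpace n] y, (reflMetric G z).IsSymm := by
  have hyH : y ∈ halfSpace n := mem_halfSpace.2 h0.ge
  refine ⟨contDiffWithinAt_reflMetric fun i j l => ?_,
    isMetric_of_reflect (hGm.self_of_nhdsWithin hyH) fun u v => bil_reflMetric_of_zero h0 u v, ?_⟩
  · rw [scaleZero_of_eq_zero _ h0]
    exact (hG i j).of_le (by norm_num)
  · have : ∀ j, Tendsto (scaleZero (reflScale j)) (𝓝[halfSpace n] y) (𝓝[halfSpace n] y) := by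
      intro j
      have := (scaleZero (n := n) (reflScale j)).continuous.continuousWithinAt.tendsto_nhdsWithin
        (x := y) (mapsTo_scaleZero (reflScale_pos j).le)
      rwa [scaleZero_of_eq_zero _ h0] at this
    filter_upwards [eventually_all.2 fun j => (this j).eventually hGm] with z hz
    ext a b
    simp only [Matrix.transpose_apply, reflMetric, Matrix.of_apply, zeroCount_comm b a]
    exact Finset.sum_congr rfl fun l _ => by rw [(hz l).isSymm.apply]

/-- On the boundary, the reflected metric has the scalar curvature of the given one, because both
are pullbacks of one metric of class `C²` defined on both sides of the boundary. -/
lemma scalar_reflMetric : scalar (halfSpace n) (reflMetric G) y = scalar (halfSpace n) G y := by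
  have hyH : y ∈ halfSpace n := mem_halfSpace.2 h0.ge
  have hGy : IsMetric (G y) := hGm.self_of_nhdsWithin hyH
  obtain ⟨hQ, hQm, hQs⟩ := reflect_data h0 hG hGm
  have hEs := eventually_isSymm_reflExtMetric h0 hG hGm
  have hE : ∀ i j, ContDiffWithinAt ℝ 2 (fun z => reflExtMetric G z i j) univ y := fun i j =>
    (contDiffAt_reflExtMetric h0 hG i j).contDiffWithinAt
  have hsy : scaleZero (-1) y = y := scaleZero_of_eq_zero _ h0
  have h1 : scalar (halfSpace n) (reflMetric G) y =
      scalar univ (reflExtMetric G) (scaleZero (-1) y) := by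
    refine scalar_pullback uniqueDiff_halfSpace hyH halfSpace_subset_closure_interior
      uniqueDiffOn_univ (scaleZero (-1)).contDiff.contDiffWithinAt (mapsTo_univ _ _) ?_
      hQm.det_ne_zero hQs hQ ?_ ?_
    · filter_upwards [self_mem_nhdsWithin] with z hz u v
      rw [(scaleZero (-1)).fderivWithin (uniqueDiff_halfSpace z hz)]
      exact bil_reflMetric_eq hz u v
    · rw [hsy, nhdsWithin_univ]; exact hEs
    · rw [hsy]; exact hE
  have h2 : scalar (halfSpace n) G y = scalar univ (reflExtMetric G) (id y) := by
    refine scalar_pullback uniqueDiff_halfSpace hyH halfSpace_subset_closure_interior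
      uniqueDiffOn_univ contDiff_id.contDiffWithinAt (mapsTo_univ _ _) ?_
      hGy.det_ne_zero (hGm.mono fun z h => h.isSymm) (fun i j => (hG i j).of_le (by norm_num)) ?_ hE
    · filter_upwards [self_mem_nhdsWithin] with z hz u v
      rw [fderivWithin_id (uniqueDiff_halfSpace z hz), id, reflExtMetric_of_mem hz]
      rfl
    · rw [id, nhdsWithin_univ]; exact hEs
  rw [h1, h2, hsy, id]

/-- On the boundary, a reflection changes the sign of the second fundamental form. -/
lemma chr_reflMetric {u v : Coord n} (hu : u 0 = 0) (hv : v 0 = 0) :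
    chr (halfSpace n) (reflMetric G) y u v 0 = -chr (halfSpace n) G y u v 0 := by
  have hyH : y ∈ halfSpace n := mem_halfSpace.2 h0.ge
  have hGy : IsMetric (G y) := hGm.self_of_nhdsWithin hyH
  obtain ⟨hQ, hQm, hQs⟩ := reflect_data h0 hG hGm
  have hEs := eventually_isSymm_reflExtMetric h0 hG hGm
  have hE : ∀ i j, DifferentiableWithinAt ℝ (fun z => reflExtMetric G z i j) univ y := fun i j =>
    ((contDiffAt_reflExtMetric h0 hG i j).differentiableAt (by norm_num)).differentiableWithinAt
  have hsy : scaleZero (-1) y = y := scaleZero_of_eq_zero _ h0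
  have hEG : reflExtMetric G y = G y := reflExtMetric_of_mem hyH
  have hfd : ∀ z ∈ halfSpace n, ∀ m : ℝ,
      fderivWithin ℝ (scaleZero m) (halfSpace n) z = scaleZero m :=
    fun z hz m => (scaleZero m).fderivWithin (uniqueDiff_halfSpace z hz)
  have hsec : ∀ m : ℝ,
      fderivWithin ℝ (fderivWithin ℝ (scaleZero m) (halfSpace n)) (halfSpace n) y = 0 := by
    intro m
    rw [fderivWithin_congr (fun z hz => hfd z hz m) (hfd y hyH m), fderivWithin_const_apply]
  -- Both metrics are pullbacks of the extended one, for `m = -1` and `m = 1`; the linear maps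
  -- have no second derivatives, so the Christoffel symbols transform as tensors.
  have key : ∀ (m : ℝ) (A : Coord n → Matrix (Fin n) (Fin n) ℝ), m ≠ 0 →
      (∀ z ∈ halfSpace n, ∀ u v, bil (A z) u v =
        bil (reflExtMetric G (scaleZero m z)) (scaleZero m u) (scaleZero m v)) →
      IsMetric (A y) → (∀ᶠ z in 𝓝[halfSpace n] y, (A z).IsSymm) →
      m * chr (halfSpace n) A y u v 0 = chr univ (reflExtMetric G) y u v 0 := by
    intro m A hm hA hAm hAs
    have hmy : scaleZero m y = y := scaleZero_of_eq_zero _ h0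
    have := chr_pullback (s' := univ) (T := scaleZero m) (A := A) (B := reflExtMetric G)
      uniqueDiff_halfSpace hyH
      (halfSpace_subset_closure_interior hyH) (scaleZero m).contDiff.contDiffWithinAt
      (mapsTo_univ _ _) (by
        filter_upwards [self_mem_nhdsWithin] with z hz u v
        rw [hfd z hz]
        exact hA z hz u v) hAm.det_ne_zero hAs (by rw [hmy, hEG]; exact hGy.det_ne_zero)
      (by rw [hmy, hEG]; exact hGy.isSymm) (by rw [hmy]; exact hE)
      (by
        rw [hfd y hyH]
        exact fun w => ⟨scaleZero m⁻¹ w, by rw [scaleZero_scaleZero, mul_inv_cancel₀ hm,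
          scaleZero_one]⟩) u v
    rw [hsec, hfd y hyH, hmy, scaleZero_of_eq_zero _ hu, scaleZero_of_eq_zero _ hv] at this
    have := congrArg (fun w : Coord n => w 0) this
    simpa using this
  have h1 := key (-1) _ (by norm_num) (fun z hz u v => bil_reflMetric_eq hz u v) hQm hQs
  have h2 := key 1 G (by norm_num) (fun z hz u v => by
    rw [scaleZero_one, scaleZero_one, scaleZero_one, reflExtMetric_of_mem hz]) hGy
    (hGm.mono fun z h => h.isSymm)
  linarith

end Boundary

end LocalRiem

end

/-! ### The perturbation on the collar -/

section

namespace LocalRiem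

variable {n : ℕ} [NeZero n]

section LinearAlgebra

variable {A S : Matrix (Fin n) (Fin n) ℝ}

/-- The block of the components tangential to the boundary. -/
def block (A : Matrix (Fin n) (Fin n) ℝ) : Matrix {i : Fin n // i ≠ 0} {i : Fin n // i ≠ 0} ℝ :=
  Matrix.of fun c d => A c d

/-- The inverse of the tangential block, as a Schur complement. -/
lemma inv_block_mul_block (hA : IsMetric A) :
    (Matrix.of fun a b : {i : Fin n // i ≠ 0} => A⁻¹ a b - A⁻¹ a 0 * A⁻¹ b 0 / A⁻¹ 0 0) *
      block A = 1 := by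
  have h0 := (hA.inv_diag_pos 0).ne'
  ext a c
  have h1 : ∀ i : Fin n, ∑ b, A⁻¹ i b * A b c = if i = c then 1 else 0 := fun i => by
    rw [← Matrix.mul_apply, hA.inv_mul, Matrix.one_apply]
  have h2 := Fintype.sum_eq_add_sum_subtype_ne
    (fun b => (A⁻¹ a b - A⁻¹ a 0 * A⁻¹ b 0 / A⁻¹ 0 0) * A b c) 0
  have h3 : ∑ b, (A⁻¹ a b - A⁻¹ a 0 * A⁻¹ b 0 / A⁻¹ 0 0) * A b c = if a.1 = c.1 then 1 else 0 := by
    have : ∀ b, (A⁻¹ a b - A⁻¹ a 0 * A⁻¹ b 0 / A⁻¹ 0 0) * A b c =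
        A⁻¹ a b * A b c - A⁻¹ a 0 / A⁻¹ 0 0 * (A⁻¹ 0 b * A b c) := fun b => by
      rw [hA.inv_isSymm.apply 0 b]; ring
    simp only [this, Finset.sum_sub_distrib, ← Finset.mul_sum, h1]
    rw [if_neg (Ne.symm c.2), mul_zero, sub_zero]
  rw [Matrix.mul_apply, Matrix.one_apply]
  simp only [Matrix.of_apply, block]
  rw [h3, mul_div_cancel_right₀ _ h0, sub_self, zero_mul, zero_add] at h2
  rw [← h2]
  simp [Subtype.ext_iff]

lemma inv_block_apply (hA : IsMetric A) (a b : {i : Fin n // i ≠ 0}) :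
    (block A)⁻¹ a b = A⁻¹ a b - A⁻¹ a 0 * A⁻¹ b 0 / A⁻¹ 0 0 := by
  rw [Matrix.inv_eq_left_inv (inv_block_mul_block hA), Matrix.of_apply]

/-- The trace of the induced metric is the dimension of the boundary. -/
lemma sum_inv_block_self (hA : IsMetric A) : ∑ a, ∑ b, (block A)⁻¹ a b * A a b = (n : ℝ) - 1 := by
  have h : (block A)⁻¹ * block A = 1 := by
    rw [Matrix.inv_eq_left_inv (inv_block_mul_block hA), inv_block_mul_block hA]
  have h2 := congrArg Matrix.trace h
  rw [Matrix.trace_one, Matrix.trace] at h2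
  simp only [Matrix.diag_apply, Matrix.mul_apply] at h2
  have hc : ((Fintype.card {i : Fin n // i ≠ 0} : ℕ) : ℝ) = (n : ℝ) - 1 := by
    rw [Fintype.card_subtype_compl, Fintype.card_fin, Fintype.card_subtype_eq,
      Nat.cast_sub (NeZero.one_le), Nat.cast_one]
  rw [← hc, ← h2]
  refine Finset.sum_congr rfl fun a _ => Finset.sum_congr rfl fun b _ => ?_
  rw [← hA.isSymm.apply a b]
  rfl

/-- For a tangential tensor `S`, the expression that multiplies the second normal derivative in the
scalar curvature is, up to a factor, the trace of `S` with respect to the induced metric. -/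
lemma sum_tangential (hA : IsMetric A) (hS : ∀ a b, a = 0 ∨ b = 0 → S a b = 0) :
    ∑ i, ∑ j, (A⁻¹ i 0 * A⁻¹ j 0 - A⁻¹ 0 0 * A⁻¹ i j) * S i j =
      -(A⁻¹ 0 0 * ∑ a : {i : Fin n // i ≠ 0}, ∑ b : {i : Fin n // i ≠ 0},
        (block A)⁻¹ a b * S a b) := by
  have h0 := (hA.inv_diag_pos 0).ne'
  rw [Fintype.sum_eq_add_sum_subtype_ne _ 0, Finset.mul_sum, ← Finset.sum_neg_distrib]
  simp only [hS 0 _ (Or.inl rfl), mul_zero, Finset.sum_const_zero, zero_add]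
  refine Finset.sum_congr rfl fun a _ => ?_
  rw [Fintype.sum_eq_add_sum_subtype_ne _ 0, hS _ 0 (Or.inr rfl), mul_zero, zero_add,
    Finset.mul_sum, ← Finset.sum_neg_distrib]
  refine Finset.sum_congr rfl fun b _ => ?_
  rw [inv_block_apply hA]
  field_simp
  ring

/-- Positivity on a subspace is an open condition. -/
lemma eventually_bil_pos {X : Type*} {l : Filter X} {F : X → Matrix (Fin n) (Fin n) ℝ}
    {A : Matrix (Fin n) (Fin n) ℝ} {V : Set (Coord n)} (hV : IsClosed V)
    (hVs : ∀ (c : ℝ), ∀ v ∈ V, c • v ∈ V)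
    (hF : ∀ i j, Tendsto (fun x => F x i j) l (𝓝 (A i j)))
    (hA : ∀ v ∈ V, v ≠ 0 → 0 < bil A v v) :
    ∀ᶠ x in l, ∀ v ∈ V, v ≠ 0 → 0 < bil (F x) v v := by
  have hF' : Tendsto F l (𝓝 A) := tendsto_pi_nhds.2 fun i => tendsto_pi_nhds.2 fun j => hF i j
  have hc : Continuous fun p : Matrix (Fin n) (Fin n) ℝ × Coord n => bil p.1 p.2 p.2 := by
    unfold bil
    have h1 : ∀ i j, Continuous fun p : Matrix (Fin n) (Fin n) ℝ × Coord n => p.1 i j := fun i j =>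
      continuous_fst.matrix_elem i j
    fun_prop
  have hK : IsCompact (Metric.sphere (0 : Coord n) 1 ∩ V) :=
    (isCompact_sphere _ _).inter_right hV
  have h : ∀ᶠ M in 𝓝 A, ∀ v ∈ Metric.sphere (0 : Coord n) 1 ∩ V, 0 < bil M v v := by
    refine hK.eventually_forall_of_forall_eventually fun v hv => ?_
    have hv0 : v ≠ 0 := by
      rintro rfl
      simpa using hv.1
    exact hc.continuousAt.eventually (lt_mem_nhds (hA v hv.2 hv0))
  filter_upwards [hF'.eventually h] with x hx v hv hv0
  have hn := norm_pos_iff.2 hv0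
  have := hx (‖v‖⁻¹ • v) ⟨by simp [norm_smul, hn.ne'], hVs _ v hv⟩
  rw [bil_smul_left, bil_smul_right] at this
  have hi := inv_pos.2 hn
  exact (mul_pos_iff_of_pos_left hi).1 ((mul_pos_iff_of_pos_left hi).1 this)

end LinearAlgebra

section Tensor

variable {G : Coord n → Matrix (Fin n) (Fin n) ℝ} {y : Coord n} {lam : ℝ}

/-- The tensor `2 N (λ h - Θ)` on the boundary, where `N` is the inverse of the length of the
differential of the zeroth coordinate, extended constantly along the lines normal to the boundary.
-/
def collarTensor (lam : ℝ) (G : Coord n → Matrix (Fin n) (Fin n) ℝ) (y : Coord n) :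
    Matrix (Fin n) (Fin n) ℝ :=
  Matrix.of fun a b => if a = 0 ∨ b = 0 then 0 else
    2 * (Real.sqrt ((G (setZero 0 y))⁻¹ 0 0))⁻¹ * (lam * G (setZero 0 y) a b -
      (Real.sqrt ((G (setZero 0 y))⁻¹ 0 0))⁻¹ *
        christoffel (halfSpace n) G 0 a b (setZero 0 y))

/-- The metric on the collar: the reflected metric plus a tangential perturbation. The zeroth
coordinate is `δ - t`, where `t` is the collar parameter of the extended manifold, so that `0` is the
seam and `δ` is the new boundary. -/
def collarFamily (lam δ : ℝ) (G : Coord n → Matrix (Fin n) (Fin n) ℝ) (y : Coord n) :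
    Matrix (Fin n) (Fin n) ℝ :=
  reflMetric G y + bump δ (y 0) • collarTensor lam G y

lemma collarTensor_normal {a b : Fin n} (h : a = 0 ∨ b = 0) : collarTensor lam G y a b = 0 :=
  if_pos h

lemma mapsTo_setZero {s : ℝ} (hs : 0 ≤ s) :
    MapsTo (setZero s) (halfSpace n) (halfSpace n) := fun _ _ =>
  mem_halfSpace.2 (by rw [setZero_zero]; exact hs)

lemma contDiff_setZero_const {s : ℝ} {k : WithTop ℕ∞} :
    ContDiff ℝ k (setZero s : Coord n → Coord n) :=
  (contDiff_setZero.comp (contDiff_const.prodMk contDiff_id)).of_le le_top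

lemma contDiffWithinAt_collarTensor {k m : WithTop ℕ∞}
    (hG : ∀ i j, ContDiffWithinAt ℝ k (fun z => G z i j) (halfSpace n) (setZero 0 y))
    (hGm : IsMetric (G (setZero 0 y))) (hmk : m + 1 ≤ k) (a b : Fin n) :
    ContDiffWithinAt ℝ m (fun z => collarTensor lam G z a b) (halfSpace n) y := by
  by_cases h : a = 0 ∨ b = 0
  · simp only [collarTensor_normal h]
    exact contDiffWithinAt_const
  have hH : setZero 0 y ∈ halfSpace n := mem_halfSpace.2 (by rw [setZero_zero])
  have hk : m ≤ k := le_self_add.trans hmk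
  have hN : ContDiffWithinAt ℝ m (fun z => (Real.sqrt ((G z)⁻¹ 0 0))⁻¹) (halfSpace n)
      (setZero 0 y) :=
    ((contDiffWithinAt_inv (fun i j => (hG i j).of_le hk) hGm.det_ne_zero 0 0).sqrt
      (hGm.inv_diag_pos 0).ne').inv (Real.sqrt_pos.2 (hGm.inv_diag_pos 0)).ne'
  have hΓ := contDiffWithinAt_christoffel (m := m) uniqueDiff_halfSpace hH hG hGm.det_ne_zero
    hmk 0 a b
  have := (contDiffWithinAt_const (c := (2 : ℝ))).mul hN |>.mul
    ((contDiffWithinAt_const (c := lam)).mul ((hG a b).of_le hk) |>.sub (hN.mul hΓ))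
  have := this.comp y contDiff_setZero_const.contDiffWithinAt (mapsTo_setZero le_rfl)
  simp only [collarTensor, Matrix.of_apply, if_neg h]
  exact this

lemma collarTensor_isSymm (hG : ∀ᶠ z in 𝓝[halfSpace n] (setZero 0 y), (G z).IsSymm) :
    (collarTensor lam G y).IsSymm := by
  have hH : setZero 0 y ∈ halfSpace n := mem_halfSpace.2 (by rw [setZero_zero])
  ext a b
  have h1 : christoffel (halfSpace n) G 0 b a (setZero 0 y) =
      christoffel (halfSpace n) G 0 a b (setZero 0 y) := by
    rw [← chr_stdVec, chr_symm hH hG, chr_stdVec]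
  simp only [Matrix.transpose_apply, collarTensor, Matrix.of_apply, h1,
    (hG.self_of_nhdsWithin hH).apply a b, or_comm (a := b = 0)]

/-- The tensor is tangential, hence insensitive to scalings in the normal direction. -/
lemma bil_collarTensor_scaleZero (m : ℝ) (u v : Coord n) :
    bil (collarTensor lam G y) (scaleZero m u) (scaleZero m v) =
      bil (collarTensor lam G y) u v := by
  rw [bil_scaleZero]
  refine Finset.sum_congr rfl fun a _ => Finset.sum_congr rfl fun b _ => ?_
  by_cases h : a = 0 ∨ b = 0
  · simp [collarTensor_normal h]
  · rw [not_or] at h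
    simp [zeroCount, h.1, h.2]

end Tensor

end LocalRiem

end

/-! ### Thin collars -/

section

namespace LocalRiem

variable {n : ℕ} [NeZero n]

/-- What has to hold along the normal line through the boundary point `q` in order that the metric
`collarFamily` on the collar of width `δ` has the required properties. -/
structure IsGoodCollar (lam lam' ε δ : ℝ) (G : Coord n → Matrix (Fin n) (Fin n) ℝ)
    (q : Coord n) : Prop where
  isMetric : ∀ r ∈ Icc 0 δ, IsMetric (collarFamily lam δ G (setZero r q))
  scalar_nonneg : ∀ r ∈ Ioc 0 δ, 0 ≤ scalar (halfSpace n) (collarFamily lam δ G) (setZero r q)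
  second : ∀ v : Coord n, v 0 = 0 → v ≠ 0 →
    lam' * Real.sqrt ((collarFamily lam δ G (setZero δ q))⁻¹ 0 0) *
      bil (collarFamily lam δ G (setZero δ q)) v v <
        -chr (halfSpace n) (collarFamily lam δ G) (setZero δ q) v v 0
  length : ∀ r ∈ Icc 0 δ, δ ^ 2 * collarFamily lam δ G (setZero r q) 0 0 < ε ^ 2

lemma dist_setZero {r : ℝ} (hr : 0 ≤ r) {q : Coord n} (hq : q 0 = 0) :
    dist (setZero r q) q = r := by
  rw [dist_eq_norm, setZero, hq, add_sub_cancel_left, sub_zero, norm_smul, PiLp.norm_single,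
    norm_one, mul_one, Real.norm_of_nonneg hr]

/-- The points of the collar, together with the values of `bump`, tend to the boundary point. -/
lemma eventually_forall_Icc {y₀ : Coord n} {P : Coord n × ℝ → Prop}
    (h : ∀ᶠ x in 𝓝[halfSpace n ×ˢ univ] (y₀, (0 : ℝ)), P x) :
    ∀ᶠ z : ℝ × Coord n in 𝓝 (0, y₀), 0 < z.1 → z.2 0 = 0 → ∀ r ∈ Icc 0 z.1,
      P (setZero r z.2, bump z.1 r) := by
  obtain ⟨ρ, hρ, hball⟩ := Metric.mem_nhdsWithin_iff.1 h
  have hcont : Tendsto (fun z : ℝ × Coord n => dist z.2 y₀ + z.1) (𝓝 (0, y₀)) (𝓝 0) := by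
    have : Continuous fun z : ℝ × Coord n => dist z.2 y₀ + z.1 := by fun_prop
    have := this.tendsto (0, y₀)
    simpa using this
  filter_upwards [hcont.eventually (gt_mem_nhds hρ)] with z hz hδ hq r hr
  refine hball ⟨?_, mem_halfSpace.2 (by rw [setZero_zero]; exact hr.1), mem_univ _⟩
  have h0 : 0 ≤ dist z.2 y₀ := dist_nonneg
  have h1 := dist_setZero hr.1 hq
  have h2 := dist_triangle (setZero r z.2) z.2 y₀
  have h3 := bump_le hδ hr
  have h4 := hr.2
  rw [Metric.mem_ball, Prod.dist_eq, max_lt_iff, Real.dist_eq, sub_zero,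
    abs_of_nonneg (bump_nonneg hr.1)]
  constructor <;> linarith

section Estimate

variable {G : Coord n → Matrix (Fin n) (Fin n) ℝ} {y₀ : Coord n} {lam : ℝ} (h0 : y₀ 0 = 0)
  (hG : ∀ i j, ContDiffWithinAt ℝ 4 (fun z => G z i j) (halfSpace n) y₀)
  (hGm : ∀ᶠ z in 𝓝[halfSpace n] y₀, IsMetric (G z))

include h0 hG hGm

lemma collarTensor_apply {a b : Fin n} (ha : a ≠ 0) (hb : b ≠ 0) : collarTensor lam G y₀ a b =
    2 * (Real.sqrt ((G y₀)⁻¹ 0 0))⁻¹ * (lam * G y₀ a b -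
      (Real.sqrt ((G y₀)⁻¹ 0 0))⁻¹ * christoffel (halfSpace n) G 0 a b y₀) := by
  simp only [collarTensor, Matrix.of_apply, ha, hb, or_self, if_false, setZero_of_eq h0]

/-- The reflected metric has the same lapse on the boundary. -/
lemma inv_reflMetric_zero_zero : (reflMetric G y₀)⁻¹ 0 0 = (G y₀)⁻¹ 0 0 :=
  inv_zero_zero_of_reflect (reflect_data h0 hG hGm).2.1
    (hGm.self_of_nhdsWithin (mem_halfSpace.2 h0.ge)) fun u v => bil_reflMetric_of_zero h0 u v

lemma reflMetric_apply_of_ne {a b : Fin n} (ha : a ≠ 0) (hb : b ≠ 0) :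
    reflMetric G y₀ a b = G y₀ a b := by
  have h := bil_reflMetric_of_zero (G := G) h0 (stdVec a) (stdVec b)
  rwa [scaleZero_of_eq_zero _ (by simp [ha.symm]), scaleZero_of_eq_zero _ (by simp [hb.symm]),
    bil_stdVec, bil_stdVec] at h

/-- The symbol is a positive multiple of `tr Θ - (n - 1) λ`. -/
lemma famSymbol_pos (hmean : lam * ((n : ℝ) - 1) < meanCurv (halfSpace n) G y₀) :
    0 < famSymbol (reflMetric G) (collarTensor lam G) y₀ 0 := by
  have hH : y₀ ∈ halfSpace n := mem_halfSpace.2 h0.ge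
  have hGy := hGm.self_of_nhdsWithin hH
  have hQ := (reflect_data h0 hG hGm).2.1
  have hblock : block (reflMetric G y₀) = block (G y₀) := by
    ext a b
    exact reflMetric_apply_of_ne h0 hG hGm a.2 b.2
  set N := (Real.sqrt ((G y₀)⁻¹ 0 0))⁻¹ with hN
  have hNpos : 0 < N := inv_pos.2 (Real.sqrt_pos.2 (hGy.inv_diag_pos 0))
  rw [famSymbol, zero_smul, add_zero, scalarTop_zero_zero hQ,
    sum_tangential hQ fun a b h => collarTensor_normal h, hblock, Left.neg_pos_iff]
  refine mul_neg_of_pos_of_neg (hQ.inv_diag_pos 0) ?_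
  have hsum : ∑ a : {i : Fin n // i ≠ 0}, ∑ b : {i : Fin n // i ≠ 0},
      (block (G y₀))⁻¹ a b * collarTensor lam G y₀ a b =
      2 * N * (lam * ((n : ℝ) - 1) - meanCurv (halfSpace n) G y₀) := by
    rw [← sum_inv_block_self hGy, meanCurv, mul_sub, Finset.mul_sum, Finset.mul_sum,
      Finset.mul_sum, ← Finset.sum_sub_distrib]
    refine Finset.sum_congr rfl fun a _ => ?_
    rw [Finset.mul_sum, Finset.mul_sum, Finset.mul_sum, ← Finset.sum_sub_distrib]
    refine Finset.sum_congr rfl fun b _ => ?_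
    rw [collarTensor_apply h0 hG hGm a.2 b.2, secondForm_eq_chr uniqueDiff_halfSpace hH hGm
      (fun i j => (hG i j).of_le (by norm_num)) (by simp [b.2.symm]), chr_stdVec]
    simp only [block]
    rw [← hN, div_eq_mul_inv, ← hN]
    ring
  rw [hsum]
  exact mul_neg_of_pos_of_neg (by positivity) (by linarith)

/-- At the new boundary, in the limit `δ → 0`, the Christoffel symbols of the family are those of
a metric with second fundamental form `λ h`. -/
lemma christoffelJet_fam {a b : Fin n} (ha : a ≠ 0) (hb : b ≠ 0) :
    christoffelJet (reflMetric G y₀ + (0 : ℝ) • collarTensor lam G y₀)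
      (famD (reflMetric G) (collarTensor lam G) y₀ 0 1) 0 a b =
      -(lam * Real.sqrt ((G y₀)⁻¹ 0 0) * G y₀ a b) := by
  have hH : y₀ ∈ halfSpace n := mem_halfSpace.2 h0.ge
  have hGy := hGm.self_of_nhdsWithin hH
  have h1 : christoffelJet (reflMetric G y₀) (dJet (halfSpace n) (reflMetric G) y₀) 0 a b =
      -christoffel (halfSpace n) G 0 a b y₀ := by
    rw [← christoffel_eq_jet, ← chr_stdVec, ← chr_stdVec]
    exact chr_reflMetric h0 hG hGm (by simp [ha.symm]) (by simp [hb.symm])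
  have h2 : christoffelJet (reflMetric G y₀)
      (famD (reflMetric G) (collarTensor lam G) y₀ 0 1) 0 a b =
      christoffelJet (reflMetric G y₀) (dJet (halfSpace n) (reflMetric G) y₀) 0 a b -
        1 / 2 * ((reflMetric G y₀)⁻¹ 0 0 * collarTensor lam G y₀ a b) := by
    have : ∀ l, (reflMetric G y₀)⁻¹ 0 l * (famD (reflMetric G) (collarTensor lam G) y₀ 0 1 a b l +
        famD (reflMetric G) (collarTensor lam G) y₀ 0 1 b a l -
        famD (reflMetric G) (collarTensor lam G) y₀ 0 1 l a b) =
        (reflMetric G y₀)⁻¹ 0 l * (dJet (halfSpace n) (reflMetric G) y₀ a b l +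
          dJet (halfSpace n) (reflMetric G) y₀ b a l - dJet (halfSpace n) (reflMetric G) y₀ l a b) -
        if l = 0 then (reflMetric G y₀)⁻¹ 0 0 * collarTensor lam G y₀ a b else 0 := by
      intro l
      simp only [famD, ha, hb, if_false]
      split_ifs with hl
      · subst hl; ring
      · ring
    rw [christoffelJet, christoffelJet, Finset.sum_congr rfl fun l _ => this l,
      Finset.sum_sub_distrib, Finset.sum_ite_eq' Finset.univ]
    simp only [Finset.mem_univ, if_true]
    ring
  rw [zero_smul, add_zero, h2, h1, inv_reflMetric_zero_zero h0 hG hGm,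
    collarTensor_apply h0 hG hGm ha hb]
  have hs := Real.sqrt_pos.2 (hGy.inv_diag_pos 0)
  have hss := Real.mul_self_sqrt (hGy.inv_diag_pos 0).le
  set s := Real.sqrt ((G y₀)⁻¹ 0 0)
  rw [← hss]
  field_simp
  ring

/-- Near a boundary point of mean curvature larger than `(n - 1) λ`, all thin collars are good. -/
theorem eventually_isGoodCollar {lam' ε : ℝ} (hε : 0 < ε) (hlam : lam' < lam)
    (hmean : lam * ((n : ℝ) - 1) < meanCurv (halfSpace n) G y₀)
    (hR : ∀ᶠ y in 𝓝[halfSpace n] y₀, 0 ≤ scalar (halfSpace n) G y) :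
    ∀ᶠ z : ℝ × Coord n in 𝓝 (0, y₀), 0 < z.1 → z.2 0 = 0 →
      IsGoodCollar lam lam' ε z.1 G z.2 := by
  have hH : y₀ ∈ halfSpace n := mem_halfSpace.2 h0.ge
  have hGy := hGm.self_of_nhdsWithin hH
  obtain ⟨-, hQm, hQs⟩ := reflect_data h0 hG hGm
  set Q := reflMetric G with hQdef
  set S := collarTensor lam G with hSdef
  have hQ : ∀ i j, ContDiffWithinAt ℝ 3 (fun z => Q z i j) (halfSpace n) y₀ :=
    contDiffWithinAt_reflMetric fun i j l => by
      rw [scaleZero_of_eq_zero _ h0]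
      exact (hG i j).of_le (by norm_num)
  have hS : ∀ i j, ContDiffWithinAt ℝ 3 (fun z => S z i j) (halfSpace n) y₀ := fun i j => by
    refine contDiffWithinAt_collarTensor (k := 4) ?_ ?_ (by norm_num) i j
    · rwa [setZero_of_eq h0]
    · rwa [setZero_of_eq h0]
  have hSs : ∀ᶠ z in 𝓝[halfSpace n] y₀, (S z).IsSymm := by
    have ht : Tendsto (setZero 0) (𝓝[halfSpace n] y₀) (𝓝[halfSpace n] y₀) := by
      have := (contDiff_setZero_const (n := n) (s := 0) (k := 0)).continuous.continuousWithinAt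
        |>.tendsto_nhdsWithin (x := y₀) (mapsTo_setZero le_rfl)
      rwa [setZero_of_eq h0] at this
    have := ht.eventually (eventually_eventually_nhdsWithin.2 hGm)
    filter_upwards [this] with z hz
    exact collarTensor_isSymm (hz.mono fun w hw => hw.isSymm)
  -- all the conditions hold near `y₀`, by continuity
  have hfst : MapsTo (Prod.fst : Coord n × ℝ → Coord n) (halfSpace n ×ˢ univ) (halfSpace n) :=
    fun x hx => hx.1
  have ht : Tendsto (Prod.fst : Coord n × ℝ → Coord n) (𝓝[halfSpace n ×ˢ univ] (y₀, (0 : ℝ)))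
      (𝓝[halfSpace n] y₀) :=
    continuousWithinAt_fst.tendsto_nhdsWithin hfst
  have hfam : ∀ i j, ContDiffWithinAt ℝ 1 (fun x : Coord n × ℝ => (Q x.1 + x.2 • S x.1) i j)
      (halfSpace n ×ˢ univ) (y₀, 0) :=
    contDiffWithinAt_fam (Y := Prod.fst) (a := Prod.snd) contDiffWithinAt_fst hfst
      contDiffWithinAt_snd (fun i j => (hQ i j).of_le (by norm_num))
      fun i j => (hS i j).of_le (by norm_num)
  have hdet : (Q y₀ + (0 : ℝ) • S y₀).det ≠ 0 := by
    rw [zero_smul, add_zero]; exact hQm.det_ne_zero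
  have hchr : ∀ i j, ContDiffWithinAt ℝ 1 (fun x : Coord n × ℝ =>
      christoffelJet (Q x.1 + x.2 • S x.1) (famD Q S x.1 x.2 1) 0 i j)
      (halfSpace n ×ˢ univ) (y₀, 0) :=
    contDiffWithinAt_christoffelJet hfam hdet (contDiffWithinAt_famD (k := 3) (Y := Prod.fst)
      (a := Prod.snd) (b := fun _ => 1) contDiffWithinAt_fst hfst hH contDiffWithinAt_snd
      contDiffWithinAt_const (by norm_num) hQ hS) 0
  have hinv := contDiffWithinAt_inv hfam hdet 0 0
  have hmetric : ∀ᶠ x : Coord n × ℝ in 𝓝[halfSpace n ×ˢ univ] (y₀, (0 : ℝ)),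
      IsMetric (Q x.1 + x.2 • S x.1) := by
    have hpos := eventually_bil_pos (V := univ) isClosed_univ (fun _ _ _ => mem_univ _)
      (fun i j => (hfam i j).continuousWithinAt.tendsto) (fun v _ hv => by
        rw [zero_smul, add_zero]; exact hQm.pos v hv)
    filter_upwards [hpos, ht.eventually hQs, ht.eventually hSs] with x hx h1 h2
    exact ⟨h1.add (h2.smul _), fun v hv => hx v (mem_univ _) hv⟩
  -- The condition on the second fundamental form, as positivity of a form on tangential vectors
  -- which for `u = 0` and derivative `1` of `u` equals `(lam - lam') √g⁰⁰ h`.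
  have hsecond : ∀ᶠ x : Coord n × ℝ in 𝓝[halfSpace n ×ˢ univ] (y₀, (0 : ℝ)),
      ∀ v ∈ {v : Coord n | v 0 = 0}, v ≠ 0 → 0 < bil (Matrix.of fun i j =>
        -christoffelJet (Q x.1 + x.2 • S x.1) (famD Q S x.1 x.2 1) 0 i j -
          lam' * Real.sqrt ((Q x.1 + x.2 • S x.1)⁻¹ 0 0) * (Q x.1 + x.2 • S x.1) i j) v v := by
    refine eventually_bil_pos (A := Matrix.of fun i j =>
        -christoffelJet (Q y₀ + (0 : ℝ) • S y₀) (famD Q S y₀ 0 1) 0 i j -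
          lam' * Real.sqrt ((Q y₀ + (0 : ℝ) • S y₀)⁻¹ 0 0) * (Q y₀ + (0 : ℝ) • S y₀) i j)
      (isClosed_eq (by fun_prop) continuous_const) (fun c v hv => by
        simp only [mem_ofPred_eq] at hv ⊢
        simp [hv]) (fun i j => ?_) fun v hv hv0 => ?_
    · simp only [Matrix.of_apply]
      exact ((hchr i j).continuousWithinAt.tendsto.neg).sub
        ((hinv.continuousWithinAt.tendsto.sqrt.const_mul lam').mul
          (hfam i j).continuousWithinAt.tendsto)
    · have hs := Real.sqrt_pos.2 (hGy.inv_diag_pos 0)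
      have : bil (Matrix.of fun i j =>
          -christoffelJet (Q y₀ + (0 : ℝ) • S y₀) (famD Q S y₀ 0 1) 0 i j -
            lam' * Real.sqrt ((Q y₀ + (0 : ℝ) • S y₀)⁻¹ 0 0) * (Q y₀ + (0 : ℝ) • S y₀) i j) v v =
          (lam - lam') * Real.sqrt ((G y₀)⁻¹ 0 0) * bil (G y₀) v v := by
        rw [bil, bil, Finset.mul_sum]
        refine Finset.sum_congr rfl fun i _ => ?_
        rw [Finset.mul_sum]
        refine Finset.sum_congr rfl fun j _ => ?_
        by_cases hi : i = 0
        · rw [hi, show v 0 = 0 from hv]; ring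
        by_cases hj : j = 0
        · rw [hj, show v 0 = 0 from hv]; ring
        rw [Matrix.of_apply, christoffelJet_fam h0 hG hGm hi hj, zero_smul, add_zero,
          inv_reflMetric_zero_zero h0 hG hGm,
          show Q y₀ i j = G y₀ i j from reflMetric_apply_of_ne h0 hG hGm hi hj]
        ring
      rw [this]
      exact mul_pos (mul_pos (sub_pos.2 hlam) hs) (hGy.pos v hv0)
  have hlen : ∀ᶠ x : Coord n × ℝ in 𝓝[halfSpace n ×ˢ univ] (y₀, (0 : ℝ)),
      (Q x.1 + x.2 • S x.1) 0 0 < (Q y₀ + (0 : ℝ) • S y₀) 0 0 + 1 :=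
    (hfam 0 0).continuousWithinAt.tendsto.eventually (gt_mem_nhds (lt_add_one _))
  set c := (Q y₀ + (0 : ℝ) • S y₀) 0 0 + 1
  have hdiff : ∀ᶠ x : Coord n × ℝ in 𝓝[halfSpace n ×ˢ univ] (y₀, (0 : ℝ)),
      (∀ i j, ContDiffWithinAt ℝ 3 (fun z => Q z i j) (halfSpace n) x.1) ∧
      (∀ i j, ContDiffWithinAt ℝ 3 (fun z => S z i j) (halfSpace n) x.1) := by
    have h1 := fun i j => (hQ i j).eventually (by simp)
    have h2 := fun i j => (hS i j).eventually (by simp)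
    rw [insert_eq_of_mem hH] at h1 h2
    exact (ht.eventually (eventually_all.2 fun i => eventually_all.2 (h1 i))).and
      (ht.eventually (eventually_all.2 fun i => eventually_all.2 (h2 i)))
  have hδ2 : Tendsto (fun z : ℝ × Coord n => z.1 ^ 2 * c) (𝓝 (0, y₀)) (𝓝 0) := by
    have : Continuous fun z : ℝ × Coord n => z.1 ^ 2 * c := by fun_prop
    have := this.tendsto (0, y₀)
    simpa using this
  have hscal := eventually_scalar_fam_nonneg h0 hQ hS hQm.det_ne_zero
    (famSymbol_pos h0 hG hGm hmean) (by
      have h1 : ∀ᶠ z in 𝓝[halfSpace n] y₀,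
          ∀ i j, ContDiffWithinAt ℝ 4 (fun z => G z i j) (halfSpace n) z := by
        have h1 := fun i j => (hG i j).eventually (by simp)
        rw [insert_eq_of_mem hH] at h1
        exact eventually_all.2 fun i => eventually_all.2 (h1 i)
      filter_upwards [hR, h1, eventually_eventually_nhdsWithin.2 hGm] with y hy h1 h2 hy0
      rw [scalar_reflMetric hy0 h1 h2]
      exact hy)
  filter_upwards [hscal, eventually_forall_Icc hmetric, eventually_forall_Icc hsecond,
    eventually_forall_Icc hlen, eventually_forall_Icc hdiff,
    hδ2.eventually (gt_mem_nhds (show 0 < ε ^ 2 by positivity))] with z h1 h2 h3 h4 h5 h6 hδ hq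
  have hval : ∀ r, collarFamily lam z.1 G (setZero r z.2) =
      Q (setZero r z.2) + bump z.1 r • S (setZero r z.2) := fun r => by
    rw [collarFamily, setZero_zero]
  have hδm : z.1 ∈ Icc 0 z.1 := ⟨hδ.le, le_rfl⟩
  refine ⟨fun r hr => ?_, h1 hδ hq, fun v hv hv0 => ?_, fun r hr => ?_⟩
  · rw [hval]; exact h2 hδ hq r hr
  · have h := h3 hδ hq z.1 hδm v hv hv0
    have hc : chr (halfSpace n) (collarFamily lam z.1 G) (setZero z.1 z.2) v v 0 =
        ∑ i, ∑ j, christoffelJet (Q (setZero z.1 z.2) + bump z.1 z.1 • S (setZero z.1 z.2))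
          (famD Q S (setZero z.1 z.2) (bump z.1 z.1) 1) 0 i j * v i * v j := by
      have hdj : dJet (halfSpace n) (collarFamily lam z.1 G) (setZero z.1 z.2) =
          famD Q S (setZero z.1 z.2) (bump z.1 z.1) 1 := by
        funext k i j
        have := dJet_fam (Q := Q) (S := S) (f := bump z.1) (y := setZero z.1 z.2)
          ((contDiff_bump z.1 (k := 1)).differentiable (by norm_num))
          (mem_halfSpace.2 (by rw [setZero_zero]; exact hδ.le))
          (fun i j => ((h5 hδ hq z.1 hδm).1 i j).differentiableWithinAt (by norm_num))
          (fun i j => ((h5 hδ hq z.1 hδm).2 i j).differentiableWithinAt (by norm_num)) k i j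
        rw [setZero_zero, deriv_bump] at this
        beta_reduce at this
        rwa [div_self (by positivity)] at this
      rw [chr_apply]
      simp only [WithLp.ofLp_sum, Finset.sum_apply, PiLp.smul_apply, smul_eq_mul, chr_stdVec,
        christoffel_eq_jet, hdj, hval]
      exact Finset.sum_congr rfl fun i _ => Finset.sum_congr rfl fun j _ => by ring
    rw [hc, hval, ← sub_pos]
    refine h.trans_eq ?_
    rw [bil, bil, ← Finset.sum_neg_distrib, Finset.mul_sum, ← Finset.sum_sub_distrib]
    refine Finset.sum_congr rfl fun i _ => ?_
    rw [← Finset.sum_neg_distrib, Finset.mul_sum, ← Finset.sum_sub_distrib]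
    refine Finset.sum_congr rfl fun j _ => ?_
    rw [Matrix.of_apply]
    ring
  · rw [hval]
    refine lt_of_le_of_lt ?_ h6
    exact mul_le_mul_of_nonneg_left (h4 hδ hq r hr).le (by positivity)

end Estimate

end LocalRiem

end

/-! ### Shifts of the real line -/

section

/-- A diffeomorphism `χ` of the real line with inverse `ζ`, which is the translation by `δ` near
`0` and the identity beyond `b / 2`. It pushes a collar of width `b` inward by `δ`. -/
structure IsShift (b δ : ℝ) (χ ζ : ℝ → ℝ) : Prop where
  contDiff : ContDiff ℝ ∞ χ
  contDiff_inv : ContDiff ℝ ∞ ζ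
  strictMono : StrictMono χ
  left_inv : ∀ s, ζ (χ s) = s
  right_inv : ∀ r, χ (ζ r) = r
  apply_near : ∀ s, |s| ≤ b / 4 → χ s = s + δ
  apply_far : ∀ s, b / 2 ≤ s → χ s = s

/-- Adding a small multiple of a bump function to the identity gives a shift. -/
theorem exists_isShift {b : ℝ} (hb : 0 < b) :
    ∃ δ₀ > 0, ∀ δ ∈ Ioo 0 δ₀, ∃ χ ζ, IsShift b δ χ ζ := by
  let η : ContDiffBump (0 : ℝ) := ⟨b / 4, b / 2, by positivity, by linarith⟩
  have hη : ContDiff ℝ ∞ η := η.contDiff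
  have hdη : Continuous (deriv η) := hη.continuous_deriv (by simp)
  have hη1 : Differentiable ℝ η := hη.differentiable (by simp)
  obtain ⟨K, hK⟩ := (η.hasCompactSupport.deriv).exists_bound_of_continuous hdη
  refine ⟨(|K| + 1)⁻¹, by positivity, fun δ hδ => ?_⟩
  let χ : ℝ → ℝ := fun s => s + δ * η s
  have hχ : ContDiff ℝ ∞ χ := contDiff_id.add (contDiff_const.mul hη)
  have hd : ∀ s, HasDerivAt χ (1 + δ * deriv η s) s := fun s =>
    (hasDerivAt_id s).add ((hη1 s).hasDerivAt.const_mul δ)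
  have hpos : ∀ s, 0 < 1 + δ * deriv η s := by
    intro s
    have h1 : |deriv η s| ≤ |K| := (hK s).trans (le_abs_self K)
    have h2 : δ * (|K| + 1) < 1 := by
      have := mul_lt_mul_of_pos_right hδ.2 (show 0 < |K| + 1 by positivity)
      rwa [inv_mul_cancel₀ (by positivity)] at this
    have h3 := neg_abs_le (deriv η s)
    have h4 := mul_le_mul_of_nonneg_left (h3.trans' (neg_le_neg h1)) hδ.1.le
    nlinarith [hδ.1]
  have hmono : StrictMono χ := strictMono_of_deriv_pos fun s => by rw [(hd s).deriv]; exact hpos s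
  have hfar : ∀ s, b / 2 ≤ |s| → χ s = s := fun s hs => by
    have : η s = 0 := η.zero_of_le_dist (by rwa [Real.dist_eq, sub_zero])
    simp [χ, this]
  have hsurj : Function.Surjective χ := by
    refine hχ.continuous.surjective ?_ ?_
    · refine tendsto_id.congr' ?_
      filter_upwards [eventually_ge_atTop (b / 2)] with s hs
      exact (hfar s (hs.trans (le_abs_self s))).symm
    · refine tendsto_id.congr' ?_
      filter_upwards [eventually_le_atBot (-(b / 2))] with s hs
      exact (hfar s (by have := neg_le_abs s; linarith)).symm
  let E : ℝ ≃ₜ ℝ := (hmono.orderIsoOfSurjective χ hsurj).toHomeomorph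
  have hE : ∀ s, E s = χ s := fun s => rfl
  refine ⟨χ, E.symm, hχ, ?_, hmono, fun s => ?_, fun r => ?_, fun s hs => ?_, fun s hs => ?_⟩
  · exact E.contDiff_symm_deriv (fun s => (hpos s).ne') hd hχ
  · exact E.symm_apply_apply s
  · exact E.apply_symm_apply r
  · have : η s = 1 := η.one_of_mem_closedBall (by
      rw [Metric.mem_closedBall, Real.dist_eq, sub_zero]; exact hs)
    simp [χ, this]
  · exact hfar s (hs.trans (le_abs_self s))

namespace IsShift

variable {b δ : ℝ} {χ ζ : ℝ → ℝ} (h : IsShift b δ χ ζ)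
include h

lemma inv_strictMono : StrictMono ζ := fun r s hrs => by
  rw [← h.strictMono.lt_iff_lt, h.right_inv, h.right_inv]
  exact hrs

lemma inv_near {r : ℝ} (hr : |r - δ| ≤ b / 4) : ζ r = r - δ := by
  have := h.apply_near _ hr
  rw [sub_add_cancel] at this
  rw [← this, h.left_inv, this]

lemma inv_far {r : ℝ} (hr : b / 2 ≤ r) : ζ r = r := by
  have := h.apply_far _ hr
  rw [← this, h.left_inv, this]

lemma deriv_inv_pos (r : ℝ) : 0 < deriv ζ r := by
  refine lt_of_le_of_ne h.inv_strictMono.monotone.deriv_nonneg fun h0 => ?_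
  have h1 := ((h.contDiff.differentiable (by simp)) (ζ r)).hasDerivAt.comp r
    ((h.contDiff_inv.differentiable (by simp)) r).hasDerivAt
  rw [← h0, mul_zero] at h1
  have h2 : HasDerivAt (fun r : ℝ => r) 0 r := by
    rwa [show χ ∘ ζ = fun r => r from funext h.right_inv] at h1
  exact one_ne_zero ((hasDerivAt_id' r).unique h2)

lemma deriv_inv_near {r : ℝ} (hr : |r - δ| < b / 4) : deriv ζ r = 1 := by
  have : ζ =ᶠ[𝓝 r] fun s => s - δ := by
    have hc : Continuous fun s : ℝ => |s - δ| := by fun_prop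
    filter_upwards [hc.continuousAt.eventually (gt_mem_nhds hr)] with s hs
    exact h.inv_near hs.le
  rw [this.deriv_eq]
  simp

lemma deriv_inv_far {r : ℝ} (hr : b / 2 < r) : deriv ζ r = 1 := by
  have : ζ =ᶠ[𝓝 r] id := by
    filter_upwards [lt_mem_nhds hr] with s hs
    exact h.inv_far hs.le
  rw [this.deriv_eq, deriv_id]

end IsShift

/-- The truncation `max(r, 0)³ / (3 δ²)` of `bump`, a function of class `C²`. -/
def cutBump (δ r : ℝ) : ℝ := bump δ (max r 0)

lemma cutBump_of_nonpos {δ r : ℝ} (hr : r ≤ 0) : cutBump δ r = 0 := by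
  simp [cutBump, max_eq_right hr, bump]

lemma cutBump_of_nonneg {δ r : ℝ} (hr : 0 ≤ r) : cutBump δ r = bump δ r := by
  simp [cutBump, max_eq_left hr]

lemma hasDerivAt_max_pow (k : ℕ) (r : ℝ) :
    HasDerivAt (fun r : ℝ => max r 0 ^ (k + 2)) ((k + 2 : ℝ) * max r 0 ^ (k + 1)) r := by
  have hk : ∀ x : ℝ, HasDerivAt (fun r : ℝ => r ^ (k + 2)) ((k + 2 : ℝ) * x ^ (k + 1)) x :=
    fun x => by simpa using hasDerivAt_pow (k + 2) x
  rcases lt_trichotomy r 0 with hr | rfl | hr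
  · rw [max_eq_right hr.le, zero_pow (by omega), mul_zero]
    refine (hasDerivAt_const r (0 : ℝ)).congr_of_eventuallyEq ?_
    filter_upwards [gt_mem_nhds hr] with s hs
    rw [max_eq_right hs.le, zero_pow (by omega)]
  · rw [max_self, zero_pow (by omega), mul_zero]
    have h0 := hk 0
    rw [zero_pow (by omega), mul_zero, hasDerivAt_iff_isLittleO_nhds_zero] at h0
    rw [hasDerivAt_iff_isLittleO_nhds_zero]
    refine Asymptotics.IsBigO.trans_isLittleO (Asymptotics.isBigO_of_le _ fun s => ?_) h0
    simp only [zero_add, max_self, smul_zero, sub_zero, ne_eq, Nat.add_eq_zero_iff, OfNat.ofNat_ne_zero,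
      and_false, not_false_eq_true, zero_pow, norm_pow, Real.norm_eq_abs]
    refine pow_le_pow_left₀ (abs_nonneg _) ?_ _
    rw [abs_of_nonneg (le_max_right s 0)]
    exact max_le (le_abs_self s) (abs_nonneg s)
  · rw [max_eq_left hr.le]
    refine (hk r).congr_of_eventuallyEq ?_
    filter_upwards [lt_mem_nhds hr] with s hs
    rw [max_eq_left hs.le]

/-- The cut-off cubic is twice continuously differentiable at `0`. -/
lemma contDiff_cutBump (δ : ℝ) : ContDiff ℝ 2 (cutBump δ) := by
  have h1 : ContDiff ℝ 1 fun r : ℝ => max r 0 ^ 2 := by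
    rw [show (1 : WithTop ℕ∞) = 0 + 1 from (zero_add 1).symm, contDiff_succ_iff_deriv]
    refine ⟨fun r => (hasDerivAt_max_pow 0 r).differentiableAt, by simp, ?_⟩
    rw [show deriv (fun r : ℝ => max r 0 ^ 2) = fun r => ((0 : ℕ) + 2 : ℝ) * max r 0 ^ (0 + 1) from
      funext fun r => (hasDerivAt_max_pow 0 r).deriv, contDiff_zero]
    fun_prop
  have h2 : ContDiff ℝ 2 fun r : ℝ => max r 0 ^ 3 := by
    rw [show (2 : WithTop ℕ∞) = 1 + 1 from one_add_one_eq_two.symm, contDiff_succ_iff_deriv]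
    refine ⟨fun r => (hasDerivAt_max_pow 1 r).differentiableAt, by simp, ?_⟩
    rw [show deriv (fun r : ℝ => max r 0 ^ 3) = fun r => ((1 : ℕ) + 2 : ℝ) * max r 0 ^ (1 + 1) from
      funext fun r => (hasDerivAt_max_pow 1 r).deriv]
    exact contDiff_const.mul h1
  exact h2.div_const _

end

/-! ### The extended metric in collar coordinates -/

section

namespace LocalRiem

variable {n : ℕ} [NeZero n]

section Invariance

variable {B : Coord n → Matrix (Fin n) (Fin n) ℝ} {y : Coord n} (hy : 0 < y 0)
  (hBs : ∀ᶠ z in 𝓝[halfSpace n] y, (B z).IsSymm) (hBd : (B y).det ≠ 0)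
  (hB : ∀ i j, ContDiffWithinAt ℝ 2 (fun z => B z i j) (halfSpace n) y)

lemma nhdsWithin_halfSpace_eq (hy : 0 < y 0) : 𝓝[halfSpace n] y = 𝓝 y :=
  nhdsWithin_eq_nhds.2 (mem_nhds_halfSpace hy)

include hy hBs hBd hB

/-- At interior points, derivatives within the half space are derivatives. -/
lemma scalar_univ_eq : scalar (halfSpace n) B y = scalar univ B y := by
  have hyH : y ∈ halfSpace n := mem_halfSpace.2 hy.le
  refine scalar_pullback (T := id) uniqueDiff_halfSpace hyH halfSpace_subset_closure_interior
    uniqueDiffOn_univ contDiff_id.contDiffWithinAt (mapsTo_univ _ _) ?_ hBd hBs hB ?_ fun i j =>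
      ((hB i j).contDiffAt (mem_nhds_halfSpace hy)).contDiffWithinAt
  · filter_upwards [self_mem_nhdsWithin] with z hz u v
    rw [fderivWithin_id (uniqueDiff_halfSpace z hz)]
    rfl
  · rw [nhdsWithin_univ, id, ← nhdsWithin_halfSpace_eq hy]
    exact hBs

lemma chr_univ_eq (u v : Coord n) : chr (halfSpace n) B y u v = chr univ B y u v := by
  have hyH : y ∈ halfSpace n := mem_halfSpace.2 hy.le
  have hid : ∀ z ∈ halfSpace n, fderivWithin ℝ (id : Coord n → Coord n) (halfSpace n) z =
      ContinuousLinearMap.id ℝ _ := fun z hz => fderivWithin_id (uniqueDiff_halfSpace z hz)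
  have := chr_pullback (T := id) (A := B) (B := B) (s' := univ) uniqueDiff_halfSpace hyH
    (halfSpace_subset_closure_interior hyH) contDiff_id.contDiffWithinAt (mapsTo_univ _ _) (by
      filter_upwards [self_mem_nhdsWithin] with z hz u v
      rw [hid z hz]
      rfl) hBd hBs hBd (hBs.self_of_nhdsWithin hyH) (fun i j =>
      (((hB i j).contDiffAt (mem_nhds_halfSpace hy)).differentiableAt
        (by norm_num)).differentiableWithinAt) (by
      rw [hid y hyH]; exact Function.surjective_id) u v
  rw [fderivWithin_congr hid (hid y hyH), fderivWithin_const_apply, hid y hyH] at this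
  simpa using this

end Invariance

lemma hasFDerivAt_setZero_comp {f : ℝ → ℝ} {f' : ℝ} {y : Coord n} (hf : HasDerivAt f f' (y 0)) :
    HasFDerivAt (fun z : Coord n => setZero (f (z 0)) z) (scaleZero f' : Coord n →L[ℝ] Coord n)
      y := by
  have h1 : HasFDerivAt (fun z : Coord n => z 0) (EuclideanSpace.proj 0 : Coord n →L[ℝ] ℝ) y :=
    (EuclideanSpace.proj 0 : Coord n →L[ℝ] ℝ).hasFDerivAt
  have h2 := (hasFDerivAt_id y).add
    (((hf.comp_hasFDerivAt y h1).sub h1).smul_const (stdVec 0 : Coord n))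
  refine h2.congr_fderiv ?_
  ext v : 1
  rw [scaleZero_apply, setZero]
  simp

lemma contDiff_setZero_comp {f : ℝ → ℝ} {k : WithTop ℕ∞} (hf : ContDiff ℝ k f) :
    ContDiff ℝ k fun z : Coord n => setZero (f (z 0)) z :=
  (contDiff_setZero.of_le le_top).comp
    ((hf.comp (EuclideanSpace.proj 0 : Coord n →L[ℝ] ℝ).contDiff).prodMk contDiff_id)

/-- A metric of non-negative scalar curvature in coordinates whose domain `O` is a union of
segments `[0, w)` normal to the boundary. -/
structure IsCollarDomain (w : ℝ) (O : Set (Coord n)) (G : Coord n → Matrix (Fin n) (Fin n) ℝ) :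
    Prop where
  subset : O ⊆ halfSpace n
  mem_nhdsWithin : ∀ y ∈ O, O ∈ 𝓝[halfSpace n] y
  zero_lt : ∀ y ∈ O, y 0 < w
  setZero_mem : ∀ y ∈ O, ∀ s ∈ Ico 0 w, setZero s y ∈ O
  contDiff : ∀ y ∈ O, ∀ i j, ContDiffWithinAt ℝ ∞ (fun z => G z i j) (halfSpace n) y
  isMetric : ∀ y ∈ O, IsMetric (G y)
  scalar_nonneg : ∀ y ∈ O, 0 ≤ scalar (halfSpace n) G y

/-- The metric of the extended manifold in collar coordinates: the pullback of the extension of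
`G` under the shift of the zeroth coordinate, plus the perturbation on the new part of the collar.
-/
def shiftedMetric (ζ : ℝ → ℝ) (δ lam : ℝ) (G : Coord n → Matrix (Fin n) (Fin n) ℝ) (y : Coord n) :
    Matrix (Fin n) (Fin n) ℝ :=
  Matrix.of fun a b => deriv ζ (y 0) ^ zeroCount a b *
    reflExtMetric G (setZero (ζ (y 0)) y) a b + cutBump δ (δ - y 0) * collarTensor lam G y a b

section Shifted

variable {w b δ lam : ℝ} {χ ζ : ℝ → ℝ} {O : Set (Coord n)}
  {G : Coord n → Matrix (Fin n) (Fin n) ℝ} {y : Coord n}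

lemma bil_shiftedMetric (u v : Coord n) : bil (shiftedMetric ζ δ lam G y) u v =
    bil (reflExtMetric G (setZero (ζ (y 0)) y)) (scaleZero (deriv ζ (y 0)) u)
      (scaleZero (deriv ζ (y 0)) v) + cutBump δ (δ - y 0) * bil (collarTensor lam G y) u v := by
  rw [bil_scaleZero, bil, bil, Finset.mul_sum, ← Finset.sum_add_distrib]
  refine Finset.sum_congr rfl fun a _ => ?_
  rw [Finset.mul_sum, ← Finset.sum_add_distrib]
  refine Finset.sum_congr rfl fun b _ => ?_
  rw [shiftedMetric, Matrix.of_apply]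
  ring

lemma collarTensor_setZero (s : ℝ) :
    collarTensor lam G (setZero s y) = collarTensor lam G y := by
  simp only [collarTensor, setZero_setZero]

namespace IsCollarDomain

variable (h : IsCollarDomain w O G)
include h

lemma nonneg (hy : y ∈ O) : 0 ≤ y 0 := mem_halfSpace.1 (h.subset hy)

lemma pos (hy : y ∈ O) : 0 < w := (h.nonneg hy).trans_lt (h.zero_lt y hy)

lemma zero_mem (hy : y ∈ O) : setZero 0 y ∈ O := h.setZero_mem y hy 0 ⟨le_rfl, h.pos hy⟩

lemma eventually_isMetric (hy : y ∈ O) : ∀ᶠ z in 𝓝[halfSpace n] y, IsMetric (G z) := by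
  filter_upwards [h.mem_nhdsWithin y hy] with z hz
  exact h.isMetric z hz

lemma collarTensor_isSymm (hy : y ∈ O) : (collarTensor lam G y).IsSymm :=
  LocalRiem.collarTensor_isSymm ((h.eventually_isMetric (h.zero_mem hy)).mono fun _ hz => hz.isSymm)

lemma scale_mem (hy : y ∈ O) {s : ℝ} (hs : 0 ≤ s) (hs' : 5 * s < w) (j : Fin 5) :
    setZero (reflScale j * s) y ∈ O := by
  have h1 := reflScale_pos j
  have h2 := reflScale_le j
  exact h.setZero_mem y hy _ ⟨by positivity, by nlinarith⟩

lemma reflMetric_isSymm (hy : y ∈ O) (hyw : 5 * y 0 < w) : (reflMetric G y).IsSymm := by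
  ext i j
  simp only [Matrix.transpose_apply, reflMetric, Matrix.of_apply, zeroCount_comm j i]
  refine Finset.sum_congr rfl fun l _ => ?_
  rw [scaleZero_apply, (h.isMetric _ (h.scale_mem hy (h.nonneg hy) hyw l)).isSymm.apply]

lemma collarFamily_isSymm (hy : y ∈ O) (hyw : 5 * y 0 < w) : (collarFamily lam δ G y).IsSymm :=
  (h.reflMetric_isSymm hy hyw).add ((h.collarTensor_isSymm hy).smul _)

lemma reflExtMetric_isSymm (hy : y ∈ O) {s : ℝ} (hs : -w < 5 * s) (hs' : s < w) :
    (reflExtMetric G (setZero s y)).IsSymm := by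
  rcases le_total 0 s with h0 | h0
  · rw [reflExtMetric_of_mem (mem_halfSpace.2 (by rwa [setZero_zero]))]
    exact (h.isMetric _ (h.setZero_mem y hy s ⟨h0, hs'⟩)).isSymm
  · ext i j
    have hk := fun i j : Fin n => (zeroCount_le i j).trans (show 2 ≤ 4 by norm_num)
    have h0' : setZero s y 0 ≤ 0 := by rwa [setZero_zero]
    simp only [Matrix.transpose_apply, reflExtMetric, Matrix.of_apply,
      reflExt_of_nonpos (hk _ _) h0', zeroCount_comm j i]
    refine Finset.sum_congr rfl fun l _ => ?_
    have := h.scale_mem hy (s := -s) (by linarith) (by linarith) l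
    rw [scaleZero_apply, setZero_zero, setZero_setZero,
      show -reflScale l * s = reflScale l * -s by ring, (h.isMetric _ this).isSymm.apply]

lemma contDiffAt_reflExtMetric (hy : y ∈ O) {s : ℝ} (hs : -w < 5 * s) (hs' : s < w) (i j : Fin n) :
    ContDiffAt ℝ 2 (fun z => reflExtMetric G z i j) (setZero s y) := by
  have hz : setZero s y 0 = s := setZero_zero _ _
  rcases lt_trichotomy s 0 with h0 | h0 | h0
  · have hev : (fun z => reflExtMetric G z i j) =ᶠ[𝓝 (setZero s y)] fun z =>
        ∑ l, reflCoeff l * (-reflScale l) ^ zeroCount i j *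
          G (scaleZero (-reflScale l) z) i j := by
      filter_upwards [mem_nhds_lowerHalfSpace (hz.trans_lt h0)] with z hz
      exact reflExt_of_nonpos (f := fun z => G z i j)
        ((zeroCount_le i j).trans (by norm_num)) hz
    refine ContDiffAt.congr_of_eventuallyEq ?_ hev
    refine ContDiffAt.sum fun l _ => contDiffAt_const.mul ?_
    have hm := h.scale_mem hy (s := -s) (by linarith) (by linarith) l
    have he : scaleZero (-reflScale l) (setZero s y) = setZero (reflScale l * -s) y := by
      rw [scaleZero_apply, setZero_zero, setZero_setZero,
        show -reflScale l * s = reflScale l * -s by ring]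
    have hpos : 0 < setZero (reflScale l * -s) y 0 := by
      rw [setZero_zero]; exact mul_pos (reflScale_pos l) (by linarith)
    have := ((h.contDiff _ hm i j).contDiffAt (mem_nhds_halfSpace hpos)).of_le
      (show (2 : WithTop ℕ∞) ≤ ∞ from ENat.LEInfty.out)
    rw [← he] at this
    exact this.comp _ (scaleZero (-reflScale l)).contDiff.contDiffAt
  · have hm := h.setZero_mem y hy s ⟨h0.ge, hs'⟩
    exact LocalRiem.contDiffAt_reflExtMetric (hz.trans h0) (fun i j =>
      (h.contDiff _ hm i j).of_le ENat.LEInfty.out) i j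
  · have hm := h.setZero_mem y hy s ⟨h0.le, hs'⟩
    have hn : halfSpace n ∈ 𝓝 (setZero s y) := mem_nhds_halfSpace (h0.trans_eq hz.symm)
    refine (((h.contDiff _ hm i j).contDiffAt hn).of_le
      (show (2 : WithTop ℕ∞) ≤ ∞ from ENat.LEInfty.out)).congr_of_eventuallyEq ?_
    filter_upwards [hn] with z hz
    rw [reflExtMetric_of_mem hz]

lemma contDiffWithinAt_collarTensor (hy : y ∈ O) (i j : Fin n) :
    ContDiffWithinAt ℝ 2 (fun z => collarTensor lam G z i j) (halfSpace n) y :=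
  LocalRiem.contDiffWithinAt_collarTensor (h.contDiff _ (h.zero_mem hy))
    (h.isMetric _ (h.zero_mem hy))
    (by rw [two_add_one_eq_three]; exact ENat.LEInfty.out) i j

lemma contDiffWithinAt_collarFamily (hy : y ∈ O) (hyw : 5 * y 0 < w) (i j : Fin n) :
    ContDiffWithinAt ℝ 2 (fun z => collarFamily lam δ G z i j) (halfSpace n) y := by
  refine ContDiffWithinAt.add (contDiffWithinAt_reflMetric (fun i j l => ?_) i j)
    (ContDiffWithinAt.mul ?_ (h.contDiffWithinAt_collarTensor hy i j))
  · rw [scaleZero_apply]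
    exact (h.contDiff _ (h.scale_mem hy (h.nonneg hy) hyw l) i j).of_le
      ENat.LEInfty.out
  · exact ((contDiff_bump δ).comp
      (EuclideanSpace.proj 0 : Coord n →L[ℝ] ℝ).contDiff).contDiffWithinAt

end IsCollarDomain

end Shifted

end LocalRiem

end

/-! ### Curvature of the extended metric in collar coordinates -/

section

lemma IsShift.inv_zero {b δ : ℝ} {χ ζ : ℝ → ℝ} (hζ : IsShift b δ χ ζ) (hδ : |δ| ≤ b / 4) :
    ζ 0 = -δ := by
  rw [hζ.inv_near (by rwa [zero_sub, abs_neg]), zero_sub]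

namespace LocalRiem

variable {n : ℕ} [NeZero n] {b δ lam lam' ε : ℝ} {χ ζ : ℝ → ℝ} {O : Set (Coord n)}
  {G : Coord n → Matrix (Fin n) (Fin n) ℝ} {y : Coord n}

section Formulas

variable (hζ : IsShift b δ χ ζ) (hδ : 0 < δ) (hδb : 20 * δ < b)

include hζ hδ hδb

/-- On the new collar, the metric is the collar family seen through the flip `y ↦ δ - y 0`. -/
lemma bil_shiftedMetric_of_le (hy : 0 ≤ y 0) (hyδ : y 0 ≤ δ) (u v : Coord n) :
    bil (shiftedMetric ζ δ lam G y) u v = bil (collarFamily lam δ G (setZero (δ - y 0) y))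
      (scaleZero (-1) u) (scaleZero (-1) v) := by
  have h1 : |y 0 - δ| < b / 4 := by rw [abs_lt]; constructor <;> linarith
  have hH : setZero (δ - y 0) y ∈ halfSpace n :=
    mem_halfSpace.2 (by rw [setZero_zero]; linarith)
  rw [bil_shiftedMetric, hζ.inv_near h1.le, hζ.deriv_inv_near h1, scaleZero_one, scaleZero_one,
    collarFamily, bil_matrix_add, bil_matrix_smul, bil_reflMetric_eq hH,
    bil_collarTensor_scaleZero, collarTensor_setZero, setZero_zero,
    cutBump_of_nonneg (by linarith), scaleZero_apply (-1) (setZero _ _), setZero_zero,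
    setZero_setZero, scaleZero_scaleZero, scaleZero_scaleZero, neg_mul_neg, one_mul,
    scaleZero_one, scaleZero_one, neg_one_mul, neg_sub]

lemma inv_nonneg_of_le {r : ℝ} (hr : δ ≤ r) : 0 ≤ ζ r := by
  have h1 : ζ δ = 0 := by rw [hζ.inv_near (by rw [sub_self, abs_zero]; linarith), sub_self]
  rw [← h1]
  exact hζ.inv_strictMono.monotone hr

/-- Beyond the seam, the metric is the pullback of the given one under the inverse shift. -/
lemma bil_shiftedMetric_of_ge (hyδ : δ ≤ y 0) (u v : Coord n) :
    bil (shiftedMetric ζ δ lam G y) u v = bil (G (setZero (ζ (y 0)) y))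
      (scaleZero (deriv ζ (y 0)) u) (scaleZero (deriv ζ (y 0)) v) := by
  rw [bil_shiftedMetric, cutBump_of_nonpos (by linarith), zero_mul, add_zero,
    reflExtMetric_of_mem]
  exact mem_halfSpace.2 (by rw [setZero_zero]; exact inv_nonneg_of_le hζ hδ hδb hyδ)

lemma shiftedMetric_of_gt (hy : b / 2 < y 0) : shiftedMetric ζ δ lam G y = G y := by
  refine matrix_eq_of_bil_eq fun u v => ?_
  rw [bil_shiftedMetric_of_ge hζ hδ hδb (by linarith), hζ.inv_far hy.le, hζ.deriv_inv_far hy,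
    setZero_self, scaleZero_one, scaleZero_one]

end Formulas

namespace IsCollarDomain

variable (h : IsCollarDomain b O G) (hζ : IsShift b δ χ ζ) (hδ : 0 < δ) (hδb : 20 * δ < b)
  (hy : y ∈ O)

include h hζ hδ hδb hy

lemma inv_mem : -b < 5 * ζ (y 0) ∧ ζ (y 0) < b := by
  have h0 := h.nonneg hy
  have h1 := h.zero_lt y hy
  have h2 : ζ 0 = -δ := hζ.inv_zero (by rw [abs_of_pos hδ]; linarith)
  have h3 := hζ.inv_strictMono.monotone h0
  have h4 := hζ.inv_strictMono h1
  rw [show ζ b = b from hζ.inv_far (by linarith)] at h4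
  exact ⟨by linarith, h4⟩

lemma shiftedMetric_isSymm : (shiftedMetric ζ δ lam G y).IsSymm := by
  obtain ⟨h1, h2⟩ := h.inv_mem hζ hδ hδb hy
  ext i j
  simp only [Matrix.transpose_apply, shiftedMetric, Matrix.of_apply, zeroCount_comm j i,
    (h.reflExtMetric_isSymm hy h1 h2).apply i j, (h.collarTensor_isSymm hy).apply i j]

lemma contDiffWithinAt_shiftedMetric (i j : Fin n) :
    ContDiffWithinAt ℝ 2 (fun z => shiftedMetric ζ δ lam G z i j) (halfSpace n) y := by
  obtain ⟨h1, hlt⟩ := h.inv_mem hζ hδ hδb hy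
  have hp : ContDiff ℝ 2 fun z : Coord n => z 0 :=
    (EuclideanSpace.proj 0 : Coord n →L[ℝ] ℝ).contDiff
  have h2 : ContDiff ℝ 2 (deriv ζ) :=
    (hζ.contDiff_inv.of_le (m := 2 + 1)
      (by rw [two_add_one_eq_three]; exact ENat.LEInfty.out)).deriv'
  have hE : ContDiffAt ℝ 2 (fun z => reflExtMetric G (setZero (ζ (z 0)) z) i j) y :=
    ContDiffAt.comp (f := fun z : Coord n => setZero (ζ (z 0)) z) y
      (h.contDiffAt_reflExtMetric hy h1 hlt i j)
      (contDiff_setZero_comp (hζ.contDiff_inv.of_le ENat.LEInfty.out)).contDiffAt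
  refine ContDiffWithinAt.add
    (((h2.comp hp).pow _).contDiffWithinAt.mul hE.contDiffWithinAt)
    (ContDiffWithinAt.mul ?_ (h.contDiffWithinAt_collarTensor hy i j))
  exact ((contDiff_cutBump δ).comp (contDiff_const.sub hp)).contDiffWithinAt

lemma isMetric_shiftedMetric (hgood : IsGoodCollar lam lam' ε δ G (setZero 0 y)) :
    IsMetric (shiftedMetric ζ δ lam G y) := by
  have h0 := h.nonneg hy
  rcases le_total (y 0) δ with hyδ | hyδ
  · have := hgood.isMetric (δ - y 0) ⟨by linarith, by linarith⟩
    rw [setZero_setZero] at this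
    exact isMetric_of_reflect this (bil_shiftedMetric_of_le hζ hδ hδb h0 hyδ)
  · refine ⟨h.shiftedMetric_isSymm hζ hδ hδb hy, fun v hv => ?_⟩
    rw [bil_shiftedMetric_of_ge hζ hδ hδb hyδ]
    refine (h.isMetric _ (h.setZero_mem y hy _ ⟨inv_nonneg_of_le hζ hδ hδb hyδ,
      (h.inv_mem hζ hδ hδb hy).2⟩)).pos _ fun h0 => hv ?_
    refine scaleZero_injective (hζ.deriv_inv_pos (y 0)).ne' ?_
    rw [h0, map_zero]

omit hζ hy in
/-- The flip that exchanges the seam and the new boundary has the reflection as derivative. -/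
lemma fderivWithin_flip (z : Coord n) (hz : z ∈ halfSpace n) :
    fderivWithin ℝ (fun z : Coord n => setZero (δ - z 0) z) (halfSpace n) z =
      scaleZero (-1) :=
  (hasFDerivAt_setZero_comp (f := fun r => δ - r)
    ((hasDerivAt_id _).const_sub δ)).hasFDerivWithinAt.fderivWithin (uniqueDiff_halfSpace z hz)

/-- Facts on the collar metric at the reflected point, in the open half space. -/
lemma flip_data (hyδ : y 0 < δ) : setZero (δ - y 0) y ∈ O ∧
    (∀ᶠ z in 𝓝[halfSpace n] (setZero (δ - y 0) y), (collarFamily lam δ G z).IsSymm) ∧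
    ∀ i j, ContDiffWithinAt ℝ 2 (fun z => collarFamily lam δ G z i j) (halfSpace n)
      (setZero (δ - y 0) y) := by
  have h0 := h.nonneg hy
  have hm : setZero (δ - y 0) y ∈ O := h.setZero_mem y hy _ ⟨by linarith, by linarith⟩
  have hz : setZero (δ - y 0) y 0 = δ - y 0 := setZero_zero _ _
  refine ⟨hm, ?_, h.contDiffWithinAt_collarFamily hm (by rw [hz]; linarith)⟩
  have hc : Continuous fun z : Coord n => 5 * z 0 := by fun_prop
  have hlt : 5 * setZero (δ - y 0) y 0 < b := by rw [hz]; linarith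
  filter_upwards [h.mem_nhdsWithin _ hm,
    nhdsWithin_le_nhds (hc.continuousAt.eventually (gt_mem_nhds hlt))] with z hz1 hz2
  exact h.collarFamily_isSymm hz1 hz2

lemma eventually_shiftedMetric_isSymm :
    ∀ᶠ z in 𝓝[halfSpace n] y, (shiftedMetric ζ δ lam G z).IsSymm := by
  filter_upwards [h.mem_nhdsWithin y hy] with z hz
  exact h.shiftedMetric_isSymm hζ hδ hδb hz

/-- Non-negativity on the new collar, by naturality under the flip. -/
lemma scalar_shiftedMetric_of_lt (hgood : IsGoodCollar lam lam' ε δ G (setZero 0 y))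
    (hyδ : y 0 < δ) : 0 ≤ scalar (halfSpace n) (shiftedMetric ζ δ lam G) y := by
  have h0 := h.nonneg hy
  have hA := h.isMetric_shiftedMetric hζ hδ hδb hy hgood
  obtain ⟨hm, hBs, hB⟩ := h.flip_data hζ hδ hδb hy (lam := lam) hyδ
  have hBm := hgood.isMetric (δ - y 0) ⟨by linarith, by linarith⟩
  have hBR := hgood.scalar_nonneg (δ - y 0) ⟨by linarith, by linarith⟩
  rw [setZero_setZero] at hBm hBR
  have hpos : 0 < setZero (δ - y 0) y 0 := by rw [setZero_zero]; linarith
  rw [scalar_univ_eq hpos hBs hBm.det_ne_zero hB] at hBR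
  refine hBR.trans_eq (Eq.symm ?_)
  have hBs' := hBs
  rw [nhdsWithin_halfSpace_eq hpos, ← nhdsWithin_univ] at hBs'
  refine scalar_pullback (T := fun z => setZero (δ - z 0) z) uniqueDiff_halfSpace
    (h.subset hy) halfSpace_subset_closure_interior uniqueDiffOn_univ
    (contDiff_setZero_comp (contDiff_const.sub contDiff_id)).contDiffWithinAt (mapsTo_univ _ _) ?_
    hA.det_ne_zero (h.eventually_shiftedMetric_isSymm hζ hδ hδb hy)
    (h.contDiffWithinAt_shiftedMetric hζ hδ hδb hy) hBs' fun i j =>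
      ((hB i j).contDiffAt (mem_nhds_halfSpace hpos)).contDiffWithinAt
  have hc : Continuous fun z : Coord n => z 0 := by fun_prop
  filter_upwards [self_mem_nhdsWithin,
    nhdsWithin_le_nhds (hc.continuousAt.eventually (gt_mem_nhds hyδ))] with z hz1 hz2 u v
  rw [h.fderivWithin_flip hδ hδb z hz1]
  exact bil_shiftedMetric_of_le hζ hδ hδb (mem_halfSpace.1 hz1) hz2.le u v

/-- Non-negativity beyond the seam, by naturality under the inverse shift. -/
lemma scalar_shiftedMetric_of_gt (hyδ : δ < y 0) (hA : IsMetric (shiftedMetric ζ δ lam G y)) :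
    0 ≤ scalar (halfSpace n) (shiftedMetric ζ δ lam G) y := by
  have hζ0 : 0 < ζ (y 0) := by
    refine (inv_nonneg_of_le hζ hδ hδb le_rfl).trans_lt (hζ.inv_strictMono hyδ)
  have hm : setZero (ζ (y 0)) y ∈ O :=
    h.setZero_mem y hy _ ⟨hζ0.le, (h.inv_mem hζ hδ hδb hy).2⟩
  have hpos : 0 < setZero (ζ (y 0)) y 0 := by rwa [setZero_zero]
  have hBs : ∀ᶠ z in 𝓝[halfSpace n] (setZero (ζ (y 0)) y), (G z).IsSymm :=
    (h.eventually_isMetric hm).mono fun _ hz => hz.isSymm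
  have hB : ∀ i j, ContDiffWithinAt ℝ 2 (fun z => G z i j) (halfSpace n) (setZero (ζ (y 0)) y) :=
    fun i j => (h.contDiff _ hm i j).of_le ENat.LEInfty.out
  have hBR := h.scalar_nonneg _ hm
  rw [scalar_univ_eq hpos hBs (h.isMetric _ hm).det_ne_zero hB] at hBR
  refine hBR.trans_eq (Eq.symm ?_)
  rw [nhdsWithin_halfSpace_eq hpos, ← nhdsWithin_univ] at hBs
  refine scalar_pullback (T := fun z => setZero (ζ (z 0)) z) uniqueDiff_halfSpace
    (h.subset hy) halfSpace_subset_closure_interior uniqueDiffOn_univ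
    (contDiff_setZero_comp (hζ.contDiff_inv.of_le ENat.LEInfty.out)).contDiffWithinAt
    (mapsTo_univ _ _) ?_
    hA.det_ne_zero (h.eventually_shiftedMetric_isSymm hζ hδ hδb hy)
    (h.contDiffWithinAt_shiftedMetric hζ hδ hδb hy) hBs fun i j =>
      ((hB i j).contDiffAt (mem_nhds_halfSpace hpos)).contDiffWithinAt
  have hc : Continuous fun z : Coord n => z 0 := by fun_prop
  filter_upwards [self_mem_nhdsWithin,
    nhdsWithin_le_nhds (hc.continuousAt.eventually (lt_mem_nhds hyδ))] with z hz1 hz2 u v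
  have hd : HasDerivAt ζ (deriv ζ (z 0)) (z 0) :=
    ((hζ.contDiff_inv.differentiable (by simp)) _).hasDerivAt
  rw [(hasFDerivAt_setZero_comp hd).hasFDerivWithinAt.fderivWithin
    (uniqueDiff_halfSpace z hz1)]
  exact bil_shiftedMetric_of_ge hζ hδ hδb hz2.le u v

variable (hA : ∀ z ∈ O, IsMetric (shiftedMetric ζ δ lam G z))

include hA

/-- The extended metric has non-negative scalar curvature in collar coordinates. -/
theorem scalar_shiftedMetric_nonneg (hgood : IsGoodCollar lam lam' ε δ G (setZero 0 y)) :
    0 ≤ scalar (halfSpace n) (shiftedMetric ζ δ lam G) y := by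
  rcases lt_trichotomy (y 0) δ with hyδ | hyδ | hyδ
  · exact h.scalar_shiftedMetric_of_lt hζ hδ hδb hy hgood hyδ
  · -- at the seam, by continuity from the side of the original manifold
    have hc : ContinuousWithinAt (scalar (halfSpace n) (shiftedMetric ζ δ lam G)) (halfSpace n) y :=
      (contDiffWithinAt_scalar (m := 0) uniqueDiff_halfSpace (h.subset hy)
        (h.contDiffWithinAt_shiftedMetric hζ hδ hδb hy) (hA y hy).det_ne_zero
        (by norm_num)).continuousWithinAt
    have hγ : Tendsto (fun s : ℝ => setZero s y) (𝓝[>] δ) (𝓝[halfSpace n] y) := by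
      have h1 : Continuous fun s : ℝ => setZero s y :=
        continuous_setZero.comp (continuous_id.prodMk continuous_const)
      have h2 := h1.continuousWithinAt (s := Ioi δ) (x := δ)
      have h3 := h2.tendsto_nhdsWithin (t := halfSpace n) fun s hs =>
        mem_halfSpace.2 (by rw [setZero_zero]; exact hδ.le.trans (le_of_lt hs))
      rwa [setZero_of_eq hyδ] at h3
    refine ge_of_tendsto (hc.tendsto.comp hγ) ?_
    filter_upwards [Ioo_mem_nhdsGT (show δ < b by linarith)] with s hs
    have hm := h.setZero_mem y hy s ⟨hδ.le.trans hs.1.le, hs.2⟩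
    exact h.scalar_shiftedMetric_of_gt hζ hδ hδb hm (by rw [setZero_zero]; exact hs.1) (hA _ hm)
  · exact h.scalar_shiftedMetric_of_gt hζ hδ hδb hy hyδ (hA y hy)

/-- The second fundamental form of the new boundary exceeds the prescribed multiple of the metric.
The flip reverses the outer normal, which accounts for the sign in `IsGoodCollar.second`. -/
theorem secondForm_shiftedMetric (hgood : IsGoodCollar lam lam' ε δ G y) (hy0 : y 0 = 0)
    {v : Coord n} (hv : v 0 = 0) (hv0 : v ≠ 0) :
    lam' * bil (shiftedMetric ζ δ lam G y) v v <
      secondForm (halfSpace n) (shiftedMetric ζ δ lam G) y v v := by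
  have hyH := h.subset hy
  have hAe : ∀ᶠ z in 𝓝[halfSpace n] y, IsMetric (shiftedMetric ζ δ lam G z) := by
    filter_upwards [h.mem_nhdsWithin y hy] with z hz
    exact hA z hz
  have hA2 := h.contDiffWithinAt_shiftedMetric hζ hδ hδb hy (lam := lam)
  obtain ⟨hm, hBs, hB⟩ := h.flip_data hζ hδ hδb hy (lam := lam) (hy0.trans_lt hδ)
  have hBm := hgood.isMetric δ ⟨hδ.le, le_rfl⟩
  have hsec := hgood.second v hv hv0
  have hδ0 : δ - y 0 = δ := by rw [hy0, sub_zero]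
  rw [hδ0] at hm hBs hB
  have hpos : 0 < setZero δ y 0 := by rwa [setZero_zero]
  have hbil : ∀ u w, bil (shiftedMetric ζ δ lam G y) u w =
      bil (collarFamily lam δ G (setZero δ y)) (scaleZero (-1) u) (scaleZero (-1) w) :=
    fun u w => by rw [bil_shiftedMetric_of_le hζ hδ hδb hy0.ge (hy0.trans_le hδ.le), hδ0]
  have hsv : scaleZero (-1) v = v := scaleZero_of_eq_zero _ hv
  have hfd := fun z hz => h.fderivWithin_flip hδ hδb z hz
  have hBs' := hBs
  rw [nhdsWithin_halfSpace_eq hpos] at hBs'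
  have hchr := chr_pullback (s' := univ) (T := fun z => setZero (δ - z 0) z)
    (A := shiftedMetric ζ δ lam G) (B := collarFamily lam δ G) uniqueDiff_halfSpace hyH
    (halfSpace_subset_closure_interior hyH)
    (contDiff_setZero_comp (contDiff_const.sub contDiff_id)).contDiffWithinAt (mapsTo_univ _ _)
    (by
      have hc : Continuous fun z : Coord n => z 0 := by fun_prop
      filter_upwards [self_mem_nhdsWithin, nhdsWithin_le_nhds
        (hc.continuousAt.eventually (gt_mem_nhds (hy0.trans_lt hδ)))] with z hz1 hz2 u v
      rw [hfd z hz1]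
      exact bil_shiftedMetric_of_le hζ hδ hδb (mem_halfSpace.1 hz1) hz2.le u v)
    (hA y hy).det_ne_zero (h.eventually_shiftedMetric_isSymm hζ hδ hδb hy)
    (by rw [hδ0]; exact hBm.det_ne_zero) (by rw [hδ0]; exact hBm.isSymm)
    (fun i j => by
      rw [hδ0]
      exact (((hB i j).contDiffAt (mem_nhds_halfSpace hpos)).differentiableAt
        (by norm_num)).differentiableWithinAt)
    (by
      rw [hfd y hyH]
      exact fun w => ⟨scaleZero (-1) w, by
        rw [scaleZero_scaleZero, neg_mul_neg, one_mul, scaleZero_one]⟩) v v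
  rw [fderivWithin_congr hfd (hfd y hyH), fderivWithin_const_apply, hfd y hyH, hδ0, hsv,
    ← chr_univ_eq hpos hBs hBm.det_ne_zero hB] at hchr
  have hchr0 : -chr (halfSpace n) (shiftedMetric ζ δ lam G) y v v 0 =
      chr (halfSpace n) (collarFamily lam δ G) (setZero δ y) v v 0 := by
    have := congrArg (fun w : Coord n => w 0) hchr
    simpa using this
  rw [secondForm_eq_chr uniqueDiff_halfSpace hyH hAe (fun i j => (hA2 i j).of_le (by norm_num)) hv,
    inv_zero_zero_of_reflect (hA y hy) hBm hbil, hbil, hsv,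
    lt_div_iff₀ (Real.sqrt_pos.2 (hBm.inv_diag_pos 0))]
  rw [← hchr0, neg_neg] at hsec
  linarith

end IsCollarDomain

end LocalRiem

end

/-! ### Independence of the collar chart -/

section

open Set Filter Topology LocalRiem Chart

namespace LocalRiem

variable {n : ℕ} [NeZero n] {G : Coord n → Matrix (Fin n) (Fin n) ℝ} {y : Coord n} {lam : ℝ}

/-- The invariant form of the tensor on the collar. -/
lemma bil_collarTensor (hGm : ∀ᶠ z in 𝓝[halfSpace n] (setZero 0 y), IsMetric (G z))
    (hG : ∀ i j, ContDiffWithinAt ℝ 1 (fun z => G z i j) (halfSpace n) (setZero 0 y))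
    (u v : Coord n) : bil (collarTensor lam G y) u v =
      2 * (Real.sqrt ((G (setZero 0 y))⁻¹ 0 0))⁻¹ *
        (lam * bil (G (setZero 0 y)) (scaleZero 0 u) (scaleZero 0 v) -
          secondForm (halfSpace n) G (setZero 0 y) (scaleZero 0 u) (scaleZero 0 v)) := by
  have hH : setZero 0 y ∈ halfSpace n := mem_halfSpace.2 (by rw [setZero_zero])
  have hchr : ∀ u v : Coord n, chr (halfSpace n) G (setZero 0 y) u v 0 =
      bil (Matrix.of fun a b => christoffel (halfSpace n) G 0 a b (setZero 0 y)) u v := by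
    intro u v
    rw [chr_apply, bil]
    simp only [WithLp.ofLp_sum, Finset.sum_apply, PiLp.smul_apply, smul_eq_mul, chr_stdVec,
      Matrix.of_apply]
    exact Finset.sum_congr rfl fun i _ => Finset.sum_congr rfl fun j _ => by ring
  rw [secondForm_eq_chr uniqueDiff_halfSpace hH hGm hG (by simp), hchr, bil_scaleZero,
    bil_scaleZero, bil, div_eq_inv_mul, Finset.mul_sum, Finset.mul_sum,
    ← Finset.sum_sub_distrib, Finset.mul_sum]
  refine Finset.sum_congr rfl fun a _ => ?_
  rw [Finset.mul_sum, Finset.mul_sum, ← Finset.sum_sub_distrib, Finset.mul_sum]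
  refine Finset.sum_congr rfl fun b _ => ?_
  rw [Matrix.of_apply]
  by_cases ha : a = 0
  · subst ha
    rw [collarTensor_normal (Or.inl rfl)]
    simp [zeroCount]
  by_cases hb : b = 0
  · subst hb
    rw [collarTensor_normal (Or.inr rfl)]
    simp [zeroCount]
  simp only [collarTensor, Matrix.of_apply, zeroCount, ha, hb, or_self, if_false, add_zero, pow_zero]
  ring

lemma eq_scaleZero_add (m : ℝ) (v : Coord n) :
    scaleZero m v = scaleZero 0 v + (m * v 0) • stdVec 0 := by
  ext i
  by_cases hi : i = 0
  · subst hi; simp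
  · simp [scaleZero_of_ne _ _ hi, hi]

end LocalRiem

variable {n : ℕ} [NeZero n] {M : Type*} [TopologicalSpace M] [ChartedSpace (EuclideanHalfSpace n) M]
  [IsManifold (𝓡∂ n) ∞ M]

namespace Collar

variable {C : Set M} {K : Collar n C}

/-- The components of the given metric in a collar chart. -/
lemma IsCollarChart.isCollarDomain {e : OpenPartialHomeomorph M (EuclideanHalfSpace n)}
    (h : K.IsCollarChart e) (g : RMetric n ∞ M) (hR : ∀ x : M, 0 ≤ g.scalarCurvature x) :
    IsCollarDomain K.width (e.extend (𝓡∂ n)).target (comps g.inner e) where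
  subset := target_subset e
  mem_nhdsWithin _ hy := target_mem_nhdsWithin hy
  zero_lt _ hy := (h.zero_mem_Ico hy).2
  setZero_mem _ hy _ hs := (h.setZero_mem_target hy hs).1
  contDiff _ hy := g.contDiffWithinAt_comps le_rfl h.mem_maximalAtlas hy
  isMetric _ hy := g.isMetric_comps h.mem_maximalAtlas hy
  scalar_nonneg y hy := by
    have := hR ((e.extend (𝓡∂ n)).symm y)
    rwa [g.scalarCurvature_eq le_rfl ENat.LEInfty.out h.mem_maximalAtlas (symm_mem_source hy),
      (e.extend (𝓡∂ n)).right_inv hy] at this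

section Transition

variable {e e' : OpenPartialHomeomorph M (EuclideanHalfSpace n)} (h : K.IsCollarChart e)
  (h' : K.IsCollarChart e') {y : Coord n} (hy : y ∈ (e.extend (𝓡∂ n)).target)
  (hy' : (e.extend (𝓡∂ n)).symm y ∈ e'.source)

include h h' hy hy'

omit h h' in
lemma IsCollarChart.differentiableWithinAt_trans (h : K.IsCollarChart e) (h' : K.IsCollarChart e') :
    DifferentiableWithinAt ℝ (trans e e') (halfSpace n) y :=
  (contDiffWithinAt_trans h.mem_maximalAtlas h'.mem_maximalAtlas hy hy').differentiableWithinAt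
    (by simp)

/-- Changes of collar charts preserve the zeroth coordinate. -/
lemma IsCollarChart.fderivWithin_trans_zero (v : Coord n) :
    fderivWithin ℝ (trans e e') (halfSpace n) y v 0 = v 0 := by
  have hyH := target_subset e hy
  have hd := h.differentiableWithinAt_trans hy hy' h'
  have h1 : HasFDerivWithinAt (fun z => trans e e' z 0)
      ((EuclideanSpace.proj 0 : Coord n →L[ℝ] ℝ) ∘L fderivWithin ℝ (trans e e') (halfSpace n) y)
      (halfSpace n) y :=
    (EuclideanSpace.proj 0 : Coord n →L[ℝ] ℝ).hasFDerivAt.comp_hasFDerivWithinAt y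
      hd.hasFDerivWithinAt
  have h2 : HasFDerivWithinAt (fun z : Coord n => z 0) (EuclideanSpace.proj 0 : Coord n →L[ℝ] ℝ)
      (halfSpace n) y := (EuclideanSpace.proj 0 : Coord n →L[ℝ] ℝ).hasFDerivWithinAt
  have h3 : HasFDerivWithinAt (fun z => trans e e' z 0) (EuclideanSpace.proj 0 : Coord n →L[ℝ] ℝ)
      (halfSpace n) y := by
    refine h2.congr_of_eventuallyEq ?_ (h.trans_zero h' hy hy')
    filter_upwards [eventually_mem_source hy hy'] with z hz
    exact h.trans_zero h' hz.1 hz.2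
  have := congrArg (fun L : Coord n →L[ℝ] ℝ => L v) ((uniqueDiff_halfSpace y hyH).eq h1 h3)
  simpa using this

/-- The derivative of the relation between a change of collar charts and the translations along
the collar lines. -/
lemma IsCollarChart.fderivWithin_trans_scaleZero_zero {s : ℝ} (hs : s ∈ Ico 0 K.width)
    (v : Coord n) :
    fderivWithin ℝ (trans e e') (halfSpace n) (setZero s y) (scaleZero 0 v) =
      scaleZero 0 (fderivWithin ℝ (trans e e') (halfSpace n) y v) := by
  have hyH := target_subset e hy
  have hd := h.differentiableWithinAt_trans hy hy' h'
  have hys := (h.setZero_mem_target hy hs).1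
  have hds := h.differentiableWithinAt_trans hys (h.trans_setZero h' hy hy' hs).1 h'
  have hset : ∀ z : Coord n, HasFDerivAt (setZero s : Coord n → Coord n) (scaleZero 0) z :=
    fun z => hasFDerivAt_setZero_comp (f := fun _ => s) (hasDerivAt_const _ _)
  have h1 := hds.hasFDerivWithinAt.comp y (hset y).hasFDerivWithinAt (mapsTo_setZero hs.1)
  have h2 := (hset (trans e e' y)).comp_hasFDerivWithinAt y hd.hasFDerivWithinAt
  have h3 : HasFDerivWithinAt (trans e e' ∘ setZero s)
      (scaleZero 0 ∘L fderivWithin ℝ (trans e e') (halfSpace n) y) (halfSpace n) y := by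
    refine h2.congr_of_eventuallyEq ?_ (h.trans_setZero h' hy hy' hs).2
    filter_upwards [eventually_mem_source hy hy'] with z hz
    exact (h.trans_setZero h' hz.1 hz.2 hs).2
  have := congrArg (fun L : Coord n →L[ℝ] Coord n => L v)
    ((uniqueDiff_halfSpace y hyH).eq h1 h3)
  simpa using this

/-- Changes of collar charts preserve the direction of the collar lines. -/
lemma IsCollarChart.fderivWithin_trans_stdVec :
    fderivWithin ℝ (trans e e') (halfSpace n) y (stdVec 0) = stdVec 0 := by
  have h1 := h.fderivWithin_trans_scaleZero_zero h' hy hy' (h.zero_mem_Ico hy) (stdVec 0)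
  rw [setZero_self, scaleZero_stdVec_zero, zero_smul, map_zero] at h1
  have h2 := h.fderivWithin_trans_zero h' hy hy' (stdVec 0)
  have h3 := eq_scaleZero_add 1
    (fderivWithin ℝ (trans e e') (halfSpace n) y (stdVec 0))
  rw [← h1, scaleZero_one, h2, zero_add] at h3
  simpa using h3

/-- The differential of a change of collar charts commutes with scalings in the direction of the
collar lines. -/
lemma IsCollarChart.fderivWithin_trans_scaleZero (m : ℝ) (v : Coord n) :
    fderivWithin ℝ (trans e e') (halfSpace n) y (scaleZero m v) =
      scaleZero m (fderivWithin ℝ (trans e e') (halfSpace n) y v) := by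
  have h1 := h.fderivWithin_trans_scaleZero_zero h' hy hy' (h.zero_mem_Ico hy) v
  rw [setZero_self] at h1
  rw [eq_scaleZero_add m v, eq_scaleZero_add m (fderivWithin _ _ _ _ _),
    map_add, map_smul, h1,
    h.fderivWithin_trans_stdVec h' hy hy', h.fderivWithin_trans_zero h' hy hy']

/-- The differential of a change of collar charts is constant along the collar lines. -/
lemma IsCollarChart.fderivWithin_trans_setZero {s : ℝ} (hs : s ∈ Ico 0 K.width) :
    fderivWithin ℝ (trans e e') (halfSpace n) (setZero s y) =
      fderivWithin ℝ (trans e e') (halfSpace n) y := by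
  have hys := (h.setZero_mem_target hy hs).1
  have hys' := (h.trans_setZero h' hy hy' hs).1
  ext v : 1
  have hv := eq_scaleZero_add 1 v
  have hv' := eq_scaleZero_add 1 (fderivWithin ℝ (trans e e') (halfSpace n) y v)
  rw [scaleZero_one] at hv hv'
  rw [hv', hv, map_add, map_smul, h.fderivWithin_trans_scaleZero_zero h' hy hy' hs,
    h.fderivWithin_trans_stdVec h' hys hys', ← hv, h.fderivWithin_trans_zero h' hy hy']

variable (g : RMetric n ∞ M) (hR : ∀ x : M, 0 ≤ g.scalarCurvature x)

lemma IsCollarChart.bil_comps_setZero {s : ℝ} (hs : s ∈ Ico 0 K.width) (u v : Coord n) :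
    bil (comps g.inner e (setZero s y)) u v =
      bil (comps g.inner e' (setZero s (trans e e' y)))
        (fderivWithin ℝ (trans e e') (halfSpace n) y u)
        (fderivWithin ℝ (trans e e') (halfSpace n) y v) := by
  have := isPullbackAt_trans g.inner h.mem_maximalAtlas h'.mem_maximalAtlas
    (h.setZero_mem_target hy hs).1 (h.trans_setZero h' hy hy' hs).1 u v
  rwa [h.fderivWithin_trans_setZero h' hy hy' hs, (h.trans_setZero h' hy hy' hs).2] at this

/-- The Hestenes extension is invariant under changes of collar charts, because these commute with
scalings of the zeroth coordinate. -/
lemma IsCollarChart.bil_reflExtMetric_setZero {s : ℝ} (hs : -K.width < 5 * s)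
    (hs' : s < K.width) (u v : Coord n) :
    bil (reflExtMetric (comps g.inner e) (setZero s y)) u v =
      bil (reflExtMetric (comps g.inner e') (setZero s (trans e e' y)))
        (fderivWithin ℝ (trans e e') (halfSpace n) y u)
        (fderivWithin ℝ (trans e e') (halfSpace n) y v) := by
  rcases le_total 0 s with h0 | h0
  · rw [reflExtMetric_of_mem (mem_halfSpace.2 (by rwa [setZero_zero])),
      reflExtMetric_of_mem (mem_halfSpace.2 (by rwa [setZero_zero])),
      h.bil_comps_setZero h' hy hy' g ⟨h0, hs'⟩]
  · rw [bil_reflExtMetric_of_nonpos (by rwa [setZero_zero]),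
      bil_reflExtMetric_of_nonpos (by rwa [setZero_zero])]
    refine Finset.sum_congr rfl fun j _ => ?_
    have h1 := reflScale_pos j
    have h2 := reflScale_le j
    rw [scaleZero_apply _ (setZero s y), scaleZero_apply _ (setZero s _),
      setZero_zero, setZero_zero, setZero_setZero, setZero_setZero,
      h.bil_comps_setZero h' hy hy' g ⟨by nlinarith, by nlinarith⟩,
      h.fderivWithin_trans_scaleZero h' hy hy', h.fderivWithin_trans_scaleZero h' hy hy']

include hR in
/-- The tensor on the collar is invariant under changes of collar charts, because the second
fundamental form and the lapse are. -/
lemma IsCollarChart.bil_collarTensor_trans (lam : ℝ) (u v : Coord n) :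
    bil (collarTensor lam (comps g.inner e) y) u v =
      bil (collarTensor lam (comps g.inner e') (trans e e' y))
        (fderivWithin ℝ (trans e e') (halfSpace n) y u)
        (fderivWithin ℝ (trans e e') (halfSpace n) y v) := by
  have hw : (0 : ℝ) ∈ Ico 0 K.width := left_mem_Ico.2 K.width_pos
  have hD := h.isCollarDomain g hR
  have hD' := h'.isCollarDomain g hR
  have hy0 := (h.setZero_mem_target hy hw).1
  obtain ⟨hy0', hT⟩ := h.trans_setZero h' hy hy' hw
  have hTy : trans e e' y ∈ (e'.extend (𝓡∂ n)).target := apply_mem_target hy'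
  have hTy0 := (h'.setZero_mem_target hTy hw).1
  have hpb := preservesBoundary_trans h.mem_maximalAtlas h'.mem_maximalAtlas hy0 hy0'
  have hL := h.fderivWithin_trans_setZero h' hy hy' hw
  have hz : setZero 0 y 0 = 0 := setZero_zero _ _
  have hA := hD.eventually_isMetric hy0
  have hB := hD'.eventually_isMetric hTy0
  have hA1 : ∀ i j, ContDiffWithinAt ℝ 1 (fun z => comps g.inner e z i j) (halfSpace n)
      (setZero 0 y) := fun i j => (hD.contDiff _ hy0 i j).of_le ENat.LEInfty.out
  have hB1 : ∀ i j, ContDiffWithinAt ℝ 1 (fun z => comps g.inner e' z i j) (halfSpace n)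
      (setZero 0 (trans e e' y)) := fun i j =>
    (hD'.contDiff _ hTy0 i j).of_le ENat.LEInfty.out
  have hcd := contDiffWithinAt_trans h.mem_maximalAtlas h'.mem_maximalAtlas hy0 hy0'
  have hsec := secondForm_pullback (A := comps g.inner e) (B := comps g.inner e') hpb hz
    (hcd.of_le ENat.LEInfty.out)
    ((eventually_mem_source hy0 hy0').mono fun z hz =>
      isPullbackAt_trans g.inner h.mem_maximalAtlas h'.mem_maximalAtlas hz.1 hz.2)
    hA (by rwa [hT]) hA1 (by rwa [hT]) (v := scaleZero 0 u) (w := scaleZero 0 v)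
    (by simp) (by simp)
  have hinv := hpb.inv_zero_zero (A := comps g.inner e) (B := comps g.inner e') hz
    (hcd.differentiableWithinAt (by simp))
    (isPullbackAt_trans g.inner h.mem_maximalAtlas h'.mem_maximalAtlas hy0 hy0')
    (hD.isMetric _ hy0) (by rw [hT]; exact (hD'.isMetric _ hTy0).isSymm)
  have hone : (stdVec 0 : Coord n) 0 = 1 := by simp
  rw [hL, h.fderivWithin_trans_stdVec h' hy hy', hone, one_pow, one_mul, hT] at hinv
  rw [hL, hT] at hsec
  rw [bil_collarTensor hA hA1, bil_collarTensor hB hB1, hinv, hsec,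
    h.bil_comps_setZero h' hy hy' g hw]
  simp only [h.fderivWithin_trans_scaleZero h' hy hy']

include hR in
/-- The extended metric does not depend on the choice of the collar chart. -/
theorem IsCollarChart.isPullbackAt_shiftedMetric {δ lam : ℝ} {χ ζ : ℝ → ℝ}
    (hζ : IsShift K.width δ χ ζ) (hδ : 0 < δ) (hδb : 20 * δ < K.width) :
    IsPullbackAt (halfSpace n) (trans e e') (shiftedMetric ζ δ lam (comps g.inner e))
      (shiftedMetric ζ δ lam (comps g.inner e')) y := by
  intro u v
  obtain ⟨h1, h2⟩ := (h.isCollarDomain g hR).inv_mem hζ hδ hδb hy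
  rw [bil_shiftedMetric, bil_shiftedMetric, h.trans_zero h' hy hy',
    h.bil_reflExtMetric_setZero h' hy hy' g h1 h2, h.bil_collarTensor_trans h' hy hy' g hR]
  simp only [h.fderivWithin_trans_scaleZero h' hy hy']

end Transition

end Collar

end

/-! ### The extended metric on the manifold -/

section

open Set Filter Topology LocalRiem Chart

namespace LocalRiem

variable {n : ℕ} [NeZero n] {A B : Coord n → Matrix (Fin n) (Fin n) ℝ} {y : Coord n}

/-- The bilinear form of a matrix. -/
def bilForm (A : Matrix (Fin n) (Fin n) ℝ) : Coord n →L[ℝ] Coord n →L[ℝ] ℝ :=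
  ∑ i, ∑ j, A i j • (EuclideanSpace.proj i : Coord n →L[ℝ] ℝ).smulRight
    (EuclideanSpace.proj j : Coord n →L[ℝ] ℝ)

lemma bilForm_apply (A : Matrix (Fin n) (Fin n) ℝ) (u v : Coord n) :
    bilForm A u v = bil A u v := by
  simp only [bilForm, bil, FunLike.coe_sum, Finset.sum_apply,
    smul_apply, ContinuousLinearMap.smulRight_apply, PiLp.proj_apply,
    smul_eq_mul]
  exact Finset.sum_congr rfl fun i _ => Finset.sum_congr rfl fun j _ => by ring

/-- The unit ball of an inner product on a finite-dimensional space is bounded. -/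
lemma isVonNBounded_of_pos (F : Coord n →L[ℝ] Coord n →L[ℝ] ℝ) (hF : ∀ v, v ≠ 0 → 0 < F v v) :
    Bornology.IsVonNBounded ℝ {v : Coord n | F v v < 1} := by
  have hne : (Metric.sphere (0 : Coord n) 1).Nonempty := ⟨stdVec 0, by simp [PiLp.norm_single]⟩
  obtain ⟨v₀, hv₀, hmin⟩ := (isCompact_sphere (0 : Coord n) 1).exists_isMinOn hne
    (f := fun v => F v v) (F.continuous.clm_apply continuous_id).continuousOn
  have hv₀0 : v₀ ≠ 0 := by
    rintro rfl
    simp at hv₀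
  have hc := hF v₀ hv₀0
  rw [NormedSpace.isVonNBounded_iff]
  refine (Metric.isBounded_iff_subset_closedBall 0).2 ⟨(F v₀ v₀)⁻¹ + 1, fun v hv => ?_⟩
  rw [mem_closedBall_zero_iff]
  by_contra! hlt
  have hi : 0 < (F v₀ v₀)⁻¹ := inv_pos.2 hc
  have hn : 0 < ‖v‖ := by linarith
  have h1 : F v₀ v₀ ≤ F (‖v‖⁻¹ • v) (‖v‖⁻¹ • v) :=
    hmin (show ‖v‖⁻¹ • v ∈ Metric.sphere (0 : Coord n) 1 by simp [norm_smul, hn.ne'])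
  rw [map_smul, map_smul, smul_apply, smul_eq_mul, smul_eq_mul,
    ← mul_assoc, ← mul_inv, inv_mul_eq_div, le_div_iff₀ (by positivity)] at h1
  have h2 : F v v < 1 := hv
  have h3 : 1 < F v₀ v₀ * ‖v‖ := by
    have := mul_lt_mul_of_pos_left (show (F v₀ v₀)⁻¹ < ‖v‖ by linarith) hc
    rwa [mul_inv_cancel₀ hc.ne'] at this
  have h4 : F v₀ v₀ * ‖v‖ * 1 ≤ F v₀ v₀ * ‖v‖ * ‖v‖ :=
    mul_le_mul_of_nonneg_left (by linarith) (by linarith)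
  nlinarith

/-- The scalar curvature of germs, by naturality under the identity map. -/
lemma scalar_congr (hy : y ∈ halfSpace n) (h : A =ᶠ[𝓝[halfSpace n] y] B)
    (hAs : ∀ᶠ z in 𝓝[halfSpace n] y, (A z).IsSymm) (hAd : (A y).det ≠ 0)
    (hA : ∀ i j, ContDiffWithinAt ℝ 2 (fun z => A z i j) (halfSpace n) y) :
    scalar (halfSpace n) A y = scalar (halfSpace n) B y := by
  refine scalar_pullback (T := id) uniqueDiff_halfSpace hy halfSpace_subset_closure_interior
    uniqueDiff_halfSpace contDiff_id.contDiffWithinAt (mapsTo_id _) ?_ hAd hAs hA ?_ fun i j => ?_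
  · filter_upwards [self_mem_nhdsWithin, h] with z hz hz' u v
    rw [fderivWithin_id (uniqueDiff_halfSpace z hz), hz']
    rfl
  · filter_upwards [hAs, h] with z h1 h2
    rwa [← h2]
  · exact (hA i j).congr_of_eventuallyEq (h.mono fun z hz => by
      change B z i j = A z i j; rw [hz])
      (by rw [h.self_of_nhdsWithin hy])

/-- The second fundamental form of germs, by naturality under the identity map. -/
lemma secondForm_congr (hy : y 0 = 0) (h : A =ᶠ[𝓝[halfSpace n] y] B)
    (hAm : ∀ᶠ z in 𝓝[halfSpace n] y, IsMetric (A z))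
    (hA : ∀ i j, ContDiffWithinAt ℝ 1 (fun z => A z i j) (halfSpace n) y) {v w : Coord n}
    (hv : v 0 = 0) (hw : w 0 = 0) :
    secondForm (halfSpace n) A y v w = secondForm (halfSpace n) B y v w := by
  have hyH : y ∈ halfSpace n := mem_halfSpace.2 hy.ge
  have hid : ∀ z ∈ halfSpace n, fderivWithin ℝ (id : Coord n → Coord n) (halfSpace n) z =
      ContinuousLinearMap.id ℝ _ := fun z hz => fderivWithin_id (uniqueDiff_halfSpace z hz)
  have := secondForm_pullback (T := id) (A := A) (B := B) (y := y)
    ⟨mapsTo_id _, Eventually.of_forall fun z hz => hz⟩ hy contDiff_id.contDiffWithinAt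
    (by
      filter_upwards [self_mem_nhdsWithin, h] with z hz hz' u v
      rw [hid z hz, hz']
      rfl) hAm
    (by
      filter_upwards [hAm, h] with z h1 h2
      rwa [← h2]) hA
    (fun i j => (hA i j).congr_of_eventuallyEq (h.mono fun z hz => by
      change B z i j = A z i j; rw [hz])
      (by rw [h.self_of_nhdsWithin hyH])) hv hw
  rwa [hid y hyH] at this

end LocalRiem

variable {n : ℕ} [NeZero n] {M : Type*} [TopologicalSpace M] [ChartedSpace (EuclideanHalfSpace n) M]
  [IsManifold (𝓡∂ n) ∞ M]

namespace Chart

/-- The bilinear form at `x` with the components `A` in the chart `e`. -/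
def pullForm (A : Matrix (Fin n) (Fin n) ℝ) (e : OpenPartialHomeomorph M (EuclideanHalfSpace n))
    (x : M) : TangentSpace (𝓡∂ n) x →L[ℝ] TangentSpace (𝓡∂ n) x →L[ℝ] ℝ :=
  let L : Coord n →L[ℝ] Coord n := vecOf e x
  ((bilForm A).bilinearComp L L : Coord n →L[ℝ] Coord n →L[ℝ] ℝ)

lemma pullForm_apply (A : Matrix (Fin n) (Fin n) ℝ)
    (e : OpenPartialHomeomorph M (EuclideanHalfSpace n)) (x : M) (v w : TangentSpace (𝓡∂ n) x) :
    pullForm A e x v w = bil A (vecOf e x v) (vecOf e x w) := bilForm_apply _ _ _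

lemma comps_eq_of_apply {β : BilinField n M} {e : OpenPartialHomeomorph M (EuclideanHalfSpace n)}
    (he : e ∈ IsManifold.maximalAtlas (𝓡∂ n) ∞ M) {A : Matrix (Fin n) (Fin n) ℝ} {x : M}
    (hx : x ∈ e.source) (h : ∀ v w, β x v w = bil A (vecOf e x v) (vecOf e x w)) :
    comps β e (e.extend (𝓡∂ n) x) = A := by
  refine matrix_eq_of_bil_eq fun u v => ?_
  rw [bil_comps]
  refine (field_congr β (left_inv hx) _ _).trans ?_
  have := h (symmVec e (e.extend (𝓡∂ n) x) u : Coord n) (symmVec e (e.extend (𝓡∂ n) x) v : Coord n)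
  rwa [vecOf_symmVec he hx, vecOf_symmVec he hx] at this

end Chart

/-- A symmetric and positive definite field of bilinear forms of class `C^k` is a Riemannian
metric. -/
def RMetric.ofField {k : WithTop ℕ∞} (β : BilinField n M) (hs : ∀ x v w, β x v w = β x w v)
    (hp : ∀ x v, v ≠ 0 → 0 < β x v v) (hk : ∀ x, SmoothFieldAt k β x) : RMetric n k M where
  inner := β
  symm := hs
  pos := hp
  isVonNBounded x := isVonNBounded_of_pos (β x) (hp x)
  contMDiff := hk

namespace Collar

variable {C : Set M} (K : Collar n C)

open Classical in
/-- The field of bilinear forms that is the extended metric on the collar and the given one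
elsewhere. -/
def extField (g : RMetric n ∞ M) (ζ : ℝ → ℝ) (δ lam : ℝ) : BilinField n M := fun x =>
  if hx : ∃ e, K.IsCollarChart e ∧ x ∈ e.source then
    pullForm (shiftedMetric ζ δ lam (comps g.inner hx.choose) (hx.choose.extend (𝓡∂ n) x))
      hx.choose x
  else g.inner x

variable {K} (hC : IsBoundaryComponent n C) {g : RMetric n ∞ M}
  (hR : ∀ x : M, 0 ≤ g.scalarCurvature x) {δ lam lam' ε : ℝ} {χ ζ : ℝ → ℝ}
  (hζ : IsShift K.width δ χ ζ) (hδ : 0 < δ) (hδb : 20 * δ < K.width)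

include hR hζ hδ hδb

/-- Any collar chart may be used to compute the extended metric, since its components transform as
those of a tensor. -/
lemma extField_apply {e : OpenPartialHomeomorph M (EuclideanHalfSpace n)}
    (he : K.IsCollarChart e) {x : M} (hx : x ∈ e.source) (v w : TangentSpace (𝓡∂ n) x) :
    K.extField g ζ δ lam x v w =
      bil (shiftedMetric ζ δ lam (comps g.inner e) (e.extend (𝓡∂ n) x)) (vecOf e x v)
        (vecOf e x w) := by
  have hex : ∃ e, K.IsCollarChart e ∧ x ∈ e.source := ⟨e, he, hx⟩
  obtain ⟨he', hx'⟩ := hex.choose_spec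
  rw [extField, dif_pos hex, pullForm_apply]
  have := he.isPullbackAt_shiftedMetric he' (apply_mem_target hx) (by rwa [left_inv hx]) g hR
    (lam := lam) hζ hδ hδb (vecOf e x v) (vecOf e x w)
  rw [this, vecOf_trans he.mem_maximalAtlas he'.mem_maximalAtlas hx hx',
    vecOf_trans he.mem_maximalAtlas he'.mem_maximalAtlas hx hx', trans_apply, left_inv hx]

omit hR hζ hδ hδb in
lemma extField_of_notMem {x : M} (hx : x ∉ K.U) : K.extField g ζ δ lam x = g.inner x :=
  dif_neg fun ⟨_, he, hxe⟩ => hx (he.source_subset hxe)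

include hC in
lemma extField_of_lt {x : M} (hx : x ∈ K.U → K.width / 2 < K.t x) :
    K.extField g ζ δ lam x = g.inner x := by
  by_cases hxU : x ∈ K.U
  · obtain ⟨e, he, hxe⟩ := K.exists_isCollarChart_of_mem hC hxU
    ext v w
    rw [extField_apply hR hζ hδ hδb he hxe, shiftedMetric_of_gt hζ hδ hδb
      (by rw [he.extend_zero hxe]; exact hx hxU), ← apply_eq_bil g.inner he.mem_maximalAtlas hxe]
  · exact extField_of_notMem hxU

lemma comps_extField {e : OpenPartialHomeomorph M (EuclideanHalfSpace n)}
    (he : K.IsCollarChart e) {y : Coord n} (hy : y ∈ (e.extend (𝓡∂ n)).target) :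
    comps (K.extField g ζ δ lam) e y = shiftedMetric ζ δ lam (comps g.inner e) y := by
  have h1 := comps_eq_of_apply (β := K.extField g ζ δ lam) he.mem_maximalAtlas (symm_mem_source hy)
    (extField_apply hR hζ hδ hδb he (symm_mem_source hy))
  rwa [(e.extend (𝓡∂ n)).right_inv hy] at h1

omit hR hζ hδ hδb in
/-- The part of the collar where the metric is modified is compact, hence closed. -/
lemma isClosed_inner [T2Space M] (hCc : IsCompact C) :
    IsClosed {x | x ∈ K.U ∧ K.t x ≤ K.width / 2} := by
  have hw := K.width_pos
  have h : {x | x ∈ K.U ∧ K.t x ≤ K.width / 2} = K.κ '' (C ×ˢ Icc 0 (K.width / 2)) := by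
    ext x
    constructor
    · rintro ⟨hx, ht⟩
      exact ⟨(K.pr x, K.t x), ⟨K.pr_mem hx, (K.t_mem hx).1, ht⟩, K.κ_pr_t hx⟩
    · rintro ⟨⟨p, s⟩, ⟨hp, hs⟩, rfl⟩
      have hs' : s ∈ Ico 0 K.width := ⟨hs.1, hs.2.trans_lt (by linarith)⟩
      exact ⟨K.κ_mem hp hs', (K.t_κ hp hs').trans_le hs.2⟩
  rw [h]
  refine ((hCc.prod isCompact_Icc).image_of_continuousOn
    (K.contMDiffOn_κ.continuousOn.mono fun z hz => ⟨mem_univ _, hz.2.1, ?_⟩)).isClosed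
  exact lt_of_le_of_lt hz.2.2 (by linarith)

include hC in
lemma eventually_extField_eq [T2Space M] (hCc : IsCompact C) {x : M} (hx : x ∉ K.U) :
    ∀ᶠ z in 𝓝 x, K.extField g ζ δ lam z = g.inner z := by
  filter_upwards [(isClosed_inner (K := K) hCc).isOpen_compl.mem_nhds
    (show x ∈ {x | x ∈ K.U ∧ K.t x ≤ K.width / 2}ᶜ from fun h => hx h.1)] with z hz
  exact extField_of_lt hC hR hζ hδ hδb fun hzU => not_le.1 fun h => hz ⟨hzU, h⟩

include hC in
lemma smoothFieldAt_extField [T2Space M] (hCc : IsCompact C) (x : M) :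
    SmoothFieldAt 2 (K.extField g ζ δ lam) x := by
  by_cases hxU : x ∈ K.U
  · obtain ⟨e, he, hxe⟩ := K.exists_isCollarChart_of_mem hC hxU
    rw [smoothFieldAt_iff ENat.LEInfty.out _ he.mem_maximalAtlas hxe]
    intro i j
    have hy := apply_mem_target (n := n) hxe
    refine ((he.isCollarDomain g hR).contDiffWithinAt_shiftedMetric hζ hδ hδb hy
      (lam := lam) i j).congr_of_eventuallyEq ?_ (by rw [comps_extField hR hζ hδ hδb he hy])
    filter_upwards [target_mem_nhdsWithin hy] with z hz
    rw [comps_extField hR hζ hδ hδb he hz]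
  · have hg : SmoothFieldAt 2 (fun x => g.inner x) x := (g.contMDiff x).of_le ENat.LEInfty.out
    refine ContMDiffAt.congr_of_eventuallyEq hg ?_
    filter_upwards [eventually_extField_eq hC hR hζ hδ hδb (lam := lam) hCc hxU] with z hz
    rw [hz]

variable (hgood : ∀ p ∈ C, ∃ e, K.IsCollarChart e ∧ p ∈ e.source ∧
  IsGoodCollar lam lam' ε δ (comps g.inner e) (e.extend (𝓡∂ n) p))

omit hR hζ hδ hδb in
include hgood in
/-- A good chart at the foot point on the boundary contains the whole collar line. -/
lemma exists_good_chart {x : M} (hx : x ∈ K.U) : ∃ e, K.IsCollarChart e ∧ x ∈ e.source ∧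
    IsGoodCollar lam lam' ε δ (comps g.inner e) (setZero 0 (e.extend (𝓡∂ n) x)) := by
  obtain ⟨e, he, hpe, hg⟩ := hgood (K.pr x) (K.pr_mem hx)
  have hxe : x ∈ e.source := by
    have := he.κ_mem (K.pr_mem hx) hpe (K.t_mem hx)
    rwa [K.κ_pr_t hx] at this
  exact ⟨e, he, hxe, by rwa [← he.extend_pr hxe]⟩

include hgood in
lemma extField_pos (x : M) (v : TangentSpace (𝓡∂ n) x) (hv : v ≠ 0) :
    0 < K.extField g ζ δ lam x v v := by
  by_cases hxU : x ∈ K.U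
  · obtain ⟨e, he, hxe, hg⟩ := exists_good_chart hgood hxU
    rw [extField_apply hR hζ hδ hδb he hxe]
    refine ((he.isCollarDomain g hR).isMetric_shiftedMetric hζ hδ hδb
      (apply_mem_target hxe) hg).pos _ fun h0 => hv ?_
    refine vecOf_injective he.mem_maximalAtlas hxe ?_
    rw [h0, map_zero]
  · rw [extField_of_notMem hxU]
    exact g.pos x v hv

include hC in
lemma extField_symm (x : M) (v w : TangentSpace (𝓡∂ n) x) :
    K.extField g ζ δ lam x v w = K.extField g ζ δ lam x w v := by
  by_cases hxU : x ∈ K.U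
  · obtain ⟨e, he, hxe⟩ := K.exists_isCollarChart_of_mem hC hxU
    rw [extField_apply hR hζ hδ hδb he hxe, extField_apply hR hζ hδ hδb he hxe]
    exact bil_comm ((he.isCollarDomain g hR).shiftedMetric_isSymm hζ hδ hδb
      (apply_mem_target hxe)) _ _
  · rw [extField_of_notMem hxU]
    exact g.symm x v w

/-- The metric of the extended manifold. -/
def extMetric [T2Space M] (hCc : IsCompact C) : RMetric n 2 M :=
  RMetric.ofField (K.extField g ζ δ lam) (extField_symm hC hR hζ hδ hδb)
    (extField_pos hR hζ hδ hδb hgood) (smoothFieldAt_extField hC hR hζ hδ hδb hCc)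

end Collar

end

/-! ### Curvature of the extended metric and the choice of the width -/

section

open Set Filter Topology LocalRiem Chart

variable {n : ℕ} [NeZero n] {M : Type*} [TopologicalSpace M] [ChartedSpace (EuclideanHalfSpace n) M]
  [IsManifold (𝓡∂ n) ∞ M]

/-- The scalar curvature at a point depends only on the metric near that point. -/
lemma RMetric.scalarCurvature_congr {k k' : WithTop ℕ∞} (g : RMetric n k M) (g' : RMetric n k' M)
    (hk : k ≤ ∞) (hk2 : 2 ≤ k) (hk' : k' ≤ ∞) (hk2' : 2 ≤ k') {x : M}
    (h : ∀ᶠ z in 𝓝 x, g.inner z = g'.inner z) : g.scalarCurvature x = g'.scalarCurvature x := by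
  have hc : chartAt (EuclideanHalfSpace n) x ∈ IsManifold.maximalAtlas (𝓡∂ n) ∞ M :=
    IsManifold.chart_mem_maximalAtlas x
  have hx := mem_chart_source (EuclideanHalfSpace n) x
  have hy := apply_mem_target (n := n) hx
  rw [g.scalarCurvature_eq hk hk2 hc hx, g'.scalarCurvature_eq hk' hk2' hc hx]
  refine scalar_congr (target_subset _ hy) ?_ ?_ (g.isMetric_comps hc hy).det_ne_zero fun i j =>
    (g.contDiffWithinAt_comps hk hc hy i j).of_le hk2
  · have ht := (contMDiffWithinAt_symm hc hy).continuousWithinAt.tendsto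
    rw [left_inv hx] at ht
    filter_upwards [ht.eventually h] with z hz
    refine matrix_eq_of_bil_eq fun u v => ?_
    rw [bil_comps, bil_comps, hz]
  · filter_upwards [target_mem_nhdsWithin hy] with z hz
    exact (g.isMetric_comps hc hz).isSymm

namespace Collar

variable {C : Set M} {K : Collar n C} (hC : IsBoundaryComponent n C) {g : RMetric n ∞ M}
  (hR : ∀ x : M, 0 ≤ g.scalarCurvature x) {δ lam lam' ε : ℝ} {χ ζ : ℝ → ℝ}
  (hζ : IsShift K.width δ χ ζ) (hδ : 0 < δ) (hδb : 20 * δ < K.width)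
  (hgood : ∀ p ∈ C, ∃ e, K.IsCollarChart e ∧ p ∈ e.source ∧
    IsGoodCollar lam lam' ε δ (comps g.inner e) (e.extend (𝓡∂ n) p))
  [T2Space M] (hCc : IsCompact C)

lemma comps_extMetric {e : OpenPartialHomeomorph M (EuclideanHalfSpace n)}
    (he : K.IsCollarChart e) {y : Coord n} (hy : y ∈ (e.extend (𝓡∂ n)).target) :
    comps (extMetric hC hR hζ hδ hδb hgood hCc).inner e y =
      shiftedMetric ζ δ lam (comps g.inner e) y :=
  comps_extField hR hζ hδ hδb he hy

include hC hR hζ hδ hδb hgood hCc in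
lemma isMetric_shiftedMetric {e : OpenPartialHomeomorph M (EuclideanHalfSpace n)}
    (he : K.IsCollarChart e) {y : Coord n} (hy : y ∈ (e.extend (𝓡∂ n)).target) :
    IsMetric (shiftedMetric ζ δ lam (comps g.inner e) y) := by
  rw [← comps_extMetric hC hR hζ hδ hδb hgood hCc he hy]
  exact (extMetric hC hR hζ hδ hδb hgood hCc).isMetric_comps he.mem_maximalAtlas hy

/-- The extended metric has non-negative scalar curvature: in a collar chart on the collar, and as
the given metric elsewhere. -/
theorem scalarCurvature_extMetric (x : M) :
    0 ≤ (extMetric hC hR hζ hδ hδb hgood hCc).scalarCurvature x := by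
  by_cases hxU : x ∈ K.U
  · obtain ⟨e, he, hxe, hg⟩ := exists_good_chart hgood hxU
    have hy := apply_mem_target (n := n) hxe
    have hD := he.isCollarDomain g hR
    have hm := fun z hz => isMetric_shiftedMetric hC hR hζ hδ hδb hgood hCc he (y := z) hz
    rw [RMetric.scalarCurvature_eq _ ENat.LEInfty.out le_rfl he.mem_maximalAtlas hxe,
      ← scalar_congr (A := shiftedMetric ζ δ lam (comps g.inner e)) (target_subset _ hy) ?_
        (hD.eventually_shiftedMetric_isSymm hζ hδ hδb hy) (hm _ hy).det_ne_zero
        (hD.contDiffWithinAt_shiftedMetric hζ hδ hδb hy)]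
    · exact hD.scalar_shiftedMetric_nonneg hζ hδ hδb hy hm hg
    · filter_upwards [target_mem_nhdsWithin hy] with z hz
      exact (comps_extMetric hC hR hζ hδ hδb hgood hCc he hz).symm
  · rw [RMetric.scalarCurvature_congr _ g ENat.LEInfty.out le_rfl le_rfl ENat.LEInfty.out
      (eventually_extField_eq hC hR hζ hδ hδb hCc hxU)]
    exact hR x

/-- The second fundamental form of the new boundary, computed in a collar chart. -/
theorem secondFundamentalForm_extMetric {x : M} (hx : x ∈ C) {v : TangentSpace (𝓡∂ n) x}
    (hv : IsTangentToBoundary x v) (hv0 : v ≠ 0) :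
    lam' * (extMetric hC hR hζ hδ hδb hgood hCc).inner x v v <
      (extMetric hC hR hζ hδ hδb hgood hCc).secondFundamentalForm x v v := by
  obtain ⟨e, he, hxe, hg⟩ := hgood x hx
  have hy := apply_mem_target (n := n) hxe
  have hD := he.isCollarDomain g hR
  have hm := fun z hz => isMetric_shiftedMetric hC hR hζ hδ hδb hgood hCc he (y := z) hz
  have hb := hC.subset hx
  have hy0 : e.extend (𝓡∂ n) x 0 = 0 := by rw [he.extend_zero hxe, K.t_of_mem hx]
  have hv' := RMetric.isTangentToBoundary_iff he.mem_maximalAtlas hxe hb v hv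
  have hv0' : vecOf e x v ≠ 0 := fun h0 => hv0 (vecOf_injective he.mem_maximalAtlas hxe (by
    rw [h0, map_zero]))
  rw [RMetric.secondFundamentalForm_eq _ ENat.LEInfty.out one_le_two he.mem_maximalAtlas hxe hb
    hv hv, ← secondForm_congr (A := shiftedMetric ζ δ lam (comps g.inner e)) hy0 ?_ ?_
    (fun i j => (hD.contDiffWithinAt_shiftedMetric hζ hδ hδb hy i j).of_le one_le_two) hv' hv']
  · refine (le_of_eq ?_).trans_lt (hD.secondForm_shiftedMetric hζ hδ hδb hy hm hg hy0 hv' hv0')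
    congr 1
    exact extField_apply hR hζ hδ hδb he hxe v v
  · filter_upwards [target_mem_nhdsWithin hy] with z hz
    exact (comps_extMetric hC hR hζ hδ hδb hgood hCc he hz).symm
  · filter_upwards [target_mem_nhdsWithin hy] with z hz
    exact hm z hz

end Collar

section Choice

variable {C : Set M} {K : Collar n C} (hC : IsBoundaryComponent n C) {g : RMetric n ∞ M}

/-- The mean curvature may be computed in any collar chart that agrees with the preferred chart on
the boundary. -/
lemma RMetric.meanCurvature_eq {p : M} (hp : p ∈ C)
    {e : OpenPartialHomeomorph M (EuclideanHalfSpace n)}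
    (he : e ∈ IsManifold.maximalAtlas (𝓡∂ n) ∞ M) (hpe : p ∈ e.source)
    (heq : ∀ x ∈ C, x ∈ (chartAt (EuclideanHalfSpace n) p).source →
      e.extend (𝓡∂ n) x = (chartAt (EuclideanHalfSpace n) p).extend (𝓡∂ n) x)
    (hC : IsBoundaryComponent n C) :
    g.meanCurvature p = meanCurv (halfSpace n) (comps g.inner e) (e.extend (𝓡∂ n) p) := by
  set c := chartAt (EuclideanHalfSpace n) p with hcdef
  have hc : c ∈ IsManifold.maximalAtlas (𝓡∂ n) ∞ M := IsManifold.chart_mem_maximalAtlas p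
  have hpc : p ∈ c.source := mem_chart_source (EuclideanHalfSpace n) p
  have hy := apply_mem_target (n := n) hpc
  have hy' : (c.extend (𝓡∂ n)).symm (c.extend (𝓡∂ n) p) ∈ e.source := by rwa [left_inv hpc]
  have hye := apply_mem_target (n := n) hpe
  have hT : trans c e (c.extend (𝓡∂ n) p) = e.extend (𝓡∂ n) p := by rw [trans_apply, left_inv hpc]
  have hy0 : c.extend (𝓡∂ n) p 0 = 0 := (mem_boundary_iff hc hpc).1 (hC.subset hp)
  have hcd := contDiffWithinAt_trans hc he hy hy'
  have hid : ∀ᶠ z in 𝓝[halfSpace n] (c.extend (𝓡∂ n) p), z 0 = 0 → trans c e z = z := by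
    have ht := (contMDiffWithinAt_symm hc hy).continuousWithinAt.tendsto
    rw [left_inv hpc] at ht
    filter_upwards [ht.eventually (hC.eventually_mem hp), target_mem_nhdsWithin hy] with z h1 h2 h3
    have h4 := symm_mem_source h2
    rw [trans_apply, heq _ (h1 ((mem_boundary_iff hc h4).2 (by
      rwa [(c.extend (𝓡∂ n)).right_inv h2]))) h4, (c.extend (𝓡∂ n)).right_inv h2]
  -- The change of charts fixes the boundary, hence its derivative fixes tangential vectors.
  have hfd : ∀ v : Coord n, v 0 = 0 →
      fderivWithin ℝ (trans c e) (halfSpace n) (c.extend (𝓡∂ n) p) v = v := fun v hv =>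
    fderivWithin_eq_of_fixes_boundary hy0 (hcd.differentiableWithinAt (by simp)) hid hv
  have hpb := isPullbackAt_trans g.inner hc he hy hy'
  have hsec : ∀ a b : {i : Fin n // i ≠ 0},
      secondForm (halfSpace n) (comps g.inner c) (c.extend (𝓡∂ n) p) (stdVec a.1) (stdVec b.1) =
      secondForm (halfSpace n) (comps g.inner e) (e.extend (𝓡∂ n) p) (stdVec a.1) (stdVec b.1) := by
    intro a b
    have ha : (stdVec a.1 : Coord n) 0 = 0 := by simp [a.2.symm]
    have hb : (stdVec b.1 : Coord n) 0 = 0 := by simp [b.2.symm]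
    have := secondForm_pullback (A := comps g.inner c) (B := comps g.inner e)
      (preservesBoundary_trans hc he hy hy') hy0 (hcd.of_le ENat.LEInfty.out)
      ((eventually_mem_source hy hy').mono fun z hz => isPullbackAt_trans g.inner hc he hz.1 hz.2)
      (by
        filter_upwards [target_mem_nhdsWithin hy] with z hz
        exact g.isMetric_comps hc hz)
      (by
        rw [hT]
        filter_upwards [target_mem_nhdsWithin hye] with z hz
        exact g.isMetric_comps he hz)
      (fun i j => (g.contDiffWithinAt_comps le_rfl hc hy i j).of_le ENat.LEInfty.out)
      (fun i j => by
        rw [hT]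
        exact (g.contDiffWithinAt_comps le_rfl he hye i j).of_le ENat.LEInfty.out) ha hb
    rwa [hfd _ ha, hfd _ hb, hT] at this
  have hblock : block (comps g.inner c (c.extend (𝓡∂ n) p)) =
      block (comps g.inner e (e.extend (𝓡∂ n) p)) := by
    ext a b
    have := hpb (stdVec a.1) (stdVec b.1)
    rwa [hfd _ (by simp [a.2.symm]), hfd _ (by simp [b.2.symm]), hT, bil_stdVec, bil_stdVec] at this
  change meanCurv (halfSpace n) (g.components p) (c.extend (𝓡∂ n) p) = _
  rw [g.components_eq, meanCurv, meanCurv]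
  refine Finset.sum_congr rfl fun a _ => Finset.sum_congr rfl fun b _ => ?_
  rw [hsec]
  exact congrArg (fun X : Matrix {i : Fin n // i ≠ 0} {i : Fin n // i ≠ 0} ℝ => X⁻¹ a b * _) hblock

/-- All sufficiently thin collars are good, by compactness. -/
theorem Collar.eventually_good (hC : IsBoundaryComponent n C) (hCc : IsCompact C)
    (hR : ∀ x : M, 0 ≤ g.scalarCurvature x) {lam lam' ε : ℝ} (hε : 0 < ε) (hlam : lam' < lam)
    (hmean : ∀ p ∈ C, lam * ((n : ℝ) - 1) < g.meanCurvature p) :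
    ∀ᶠ δ in 𝓝[>] (0 : ℝ), ∀ p ∈ C, ∃ e, K.IsCollarChart e ∧ p ∈ e.source ∧
      IsGoodCollar lam lam' ε δ (comps g.inner e) (e.extend (𝓡∂ n) p) := by
  suffices hev : ∀ᶠ δ in 𝓝 (0 : ℝ), ∀ p ∈ C, p ∈ C → 0 < δ → ∃ e, K.IsCollarChart e ∧
      p ∈ e.source ∧ IsGoodCollar lam lam' ε δ (comps g.inner e) (e.extend (𝓡∂ n) p) by
    filter_upwards [nhdsWithin_le_nhds hev, self_mem_nhdsWithin] with δ hδ hpos p hp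
    exact hδ p hp hp hpos
  refine hCc.eventually_forall_of_forall_eventually fun p hp => ?_
  have hc : chartAt (EuclideanHalfSpace n) p ∈ IsManifold.maximalAtlas (𝓡∂ n) ∞ M :=
    IsManifold.chart_mem_maximalAtlas p
  obtain ⟨e, he, hsrc, heq⟩ := K.exists_isCollarChart hC hc
  have hpe : p ∈ e.source := hsrc p (K.subset_U hp) (by
    rw [K.pr_of_mem hp]; exact mem_chart_source (EuclideanHalfSpace n) p)
  have hy := apply_mem_target (n := n) hpe
  have hD := he.isCollarDomain g hR
  have h0 : ∀ {x}, x ∈ C → x ∈ e.source → e.extend (𝓡∂ n) x 0 = 0 := fun hx hxe => by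
    rw [he.extend_zero hxe, K.t_of_mem hx]
  have hm := hmean p hp
  rw [RMetric.meanCurvature_eq hp he.mem_maximalAtlas hpe heq hC] at hm
  have key := eventually_isGoodCollar (G := comps g.inner e) (h0 hp hpe)
    (fun i j => (hD.contDiff _ hy i j).of_le ENat.LEInfty.out) (hD.eventually_isMetric hy) hε hlam hm
    (by
      filter_upwards [hD.mem_nhdsWithin _ hy] with z hz
      exact hD.scalar_nonneg z hz)
  have ht : Tendsto (fun z : ℝ × M => (z.1, e.extend (𝓡∂ n) z.2)) (𝓝 (0, p))
      (𝓝 (0, e.extend (𝓡∂ n) p)) :=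
    (continuousAt_fst.prodMk ((e.continuousAt_extend hpe).comp continuousAt_snd)).tendsto
  filter_upwards [ht.eventually key,
    continuousAt_snd.eventually (e.open_source.mem_nhds hpe)] with z h1 h2 h3 h4
  exact ⟨e, he, h2, h1 h4 (h0 h3 h2)⟩

end Choice

end

/-! ### Sliding along the collar -/

section

open Set Filter Topology LocalRiem Chart

namespace IsShift

variable {b δ : ℝ} {χ ζ : ℝ → ℝ} (h : IsShift b δ χ ζ) (hδ : 0 < δ) (hδb : 20 * δ < b)
include h hδ hδb

lemma apply_zero : χ 0 = δ := by rw [h.apply_near 0 (by rw [abs_zero]; linarith), zero_add]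

lemma apply_mem {s : ℝ} (hs : s ∈ Ico 0 b) : χ s ∈ Ico δ b := by
  constructor
  · rw [← h.apply_zero hδ hδb]
    exact h.strictMono.monotone hs.1
  · rw [← h.apply_far b (by linarith)]
    exact h.strictMono hs.2

lemma inv_mem {r : ℝ} (hr : r ∈ Ico δ b) : ζ r ∈ Ico 0 b := by
  refine ⟨inv_nonneg_of_le h hδ hδb hr.1, ?_⟩
  rw [← h.inv_far (r := b) (by linarith)]
  exact h.inv_strictMono hr.2

omit hδ hδb in
lemma deriv_inv_mul (s : ℝ) : deriv ζ (χ s) * deriv χ s = 1 := by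
  have h1 := ((h.contDiff_inv.differentiable (by simp)) (χ s)).hasDerivAt.comp s
    ((h.contDiff.differentiable (by simp)) s).hasDerivAt
  rw [show ζ ∘ χ = fun s => s from funext h.left_inv] at h1
  exact h1.unique (hasDerivAt_id' s)

end IsShift

variable {n : ℕ} [NeZero n] {M : Type*} [TopologicalSpace M] [ChartedSpace (EuclideanHalfSpace n) M]
  [IsManifold (𝓡∂ n) ∞ M]

namespace Collar

variable {C : Set M} (K : Collar n C)

open Classical in
/-- The map that moves the points of the collar along the collar lines by `χ`, and fixes all
others. -/
def slide (χ : ℝ → ℝ) (x : M) : M := if x ∈ K.U then K.κ (K.pr x, χ (K.t x)) else x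

variable {K} {χ ζ : ℝ → ℝ} {δ : ℝ}

lemma slide_of_mem {x : M} (hx : x ∈ K.U) : K.slide χ x = K.κ (K.pr x, χ (K.t x)) := if_pos hx

lemma slide_of_notMem {x : M} (hx : x ∉ K.U) : K.slide χ x = x := if_neg hx

lemma slide_κ {p : M} {s : ℝ} (hp : p ∈ C) (hs : s ∈ Ico 0 K.width) :
    K.slide χ (K.κ (p, s)) = K.κ (p, χ s) := by
  rw [slide_of_mem (K.κ_mem hp hs), K.pr_κ hp hs, K.t_κ hp hs]

lemma slide_of_mem_boundaryComponent {p : M} (hp : p ∈ C) : K.slide χ p = K.κ (p, χ 0) := by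
  rw [slide_of_mem (K.subset_U hp), K.pr_of_mem hp, K.t_of_mem hp]

lemma slide_of_apply_eq {x : M} (hx : x ∈ K.U → χ (K.t x) = K.t x) : K.slide χ x = x := by
  by_cases hxU : x ∈ K.U
  · rw [slide_of_mem hxU, hx hxU, K.κ_pr_t hxU]
  · exact slide_of_notMem hxU

lemma eventually_slide_eq [T2Space M] (hCc : IsCompact C)
    (hχ : ∀ s, K.width / 2 ≤ s → χ s = s) {x : M} (hx : x ∉ K.U) :
    ∀ᶠ z in 𝓝 x, K.slide χ z = z := by
  filter_upwards [(isClosed_inner (K := K) hCc).isOpen_compl.mem_nhds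
    (show x ∈ {x | x ∈ K.U ∧ K.t x ≤ K.width / 2}ᶜ from fun h => hx h.1)] with z hz
  exact slide_of_apply_eq fun hzU => hχ _ (not_le.1 fun h => hz ⟨hzU, h⟩).le

lemma continuous_slide [T2Space M] (hCc : IsCompact C) (hχ : ∀ s, K.width / 2 ≤ s → χ s = s)
    (hc : Continuous χ) (hm : ∀ s ∈ Ico 0 K.width, χ s ∈ Ico 0 K.width) :
    Continuous (K.slide χ) := by
  refine continuous_iff_continuousAt.2 fun x => ?_
  by_cases hx : x ∈ K.U
  · have h1 : ContinuousOn (fun x => (K.pr x, χ (K.t x))) K.U :=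
      K.contMDiffOn_pr.continuousOn.prodMk (hc.comp_continuousOn K.contMDiffOn_t.continuousOn)
    have h2 := K.contMDiffOn_κ.continuousOn.comp h1 fun x hx => ⟨mem_univ _, hm _ (K.t_mem hx)⟩
    exact (h2.congr fun z hz => slide_of_mem hz).continuousAt (K.isOpen_U.mem_nhds hx)
  · exact continuousAt_id.congr
      ((eventually_slide_eq hCc hχ hx).mono fun z hz => hz.symm)

variable (h : IsShift K.width δ χ ζ) (hδ : 0 < δ) (hδb : 20 * δ < K.width)
include h hδ hδb

lemma slide_mem_U {x : M} (hx : x ∈ K.U) :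
    K.slide χ x ∈ K.U ∧ K.pr (K.slide χ x) = K.pr x ∧ K.t (K.slide χ x) = χ (K.t x) := by
  have h1 := h.apply_mem hδ hδb (K.t_mem hx)
  have h2 : χ (K.t x) ∈ Ico 0 K.width := ⟨hδ.le.trans h1.1, h1.2⟩
  rw [slide_of_mem hx]
  exact ⟨K.κ_mem (K.pr_mem hx) h2, K.pr_κ (K.pr_mem hx) h2, K.t_κ (K.pr_mem hx) h2⟩

lemma slide_mem_U_iff {x : M} : K.slide χ x ∈ K.U ↔ x ∈ K.U := by
  refine ⟨fun hx => by_contra fun hx' => hx' ?_, fun hx => (slide_mem_U h hδ hδb hx).1⟩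
  rwa [slide_of_notMem hx'] at hx

/-- The slide by the inverse shift, cut off at parameter `0` to be defined on all of `M`, is a
continuous left inverse. -/
lemma leftInverse_slide : Function.LeftInverse (K.slide fun r => max (ζ r) 0) (K.slide χ) := by
  intro x
  by_cases hx : x ∈ K.U
  · obtain ⟨h1, h2, h3⟩ := slide_mem_U h hδ hδb hx
    rw [slide_of_mem h1, h2, h3, h.left_inv, max_eq_left (K.t_mem hx).1, K.κ_pr_t hx]
  · rw [slide_of_notMem hx, slide_of_notMem hx]

lemma contMDiff_slide [T2Space M] (hCc : IsCompact C) :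
    ContMDiff (𝓡∂ n) (𝓡∂ n) ∞ (K.slide χ) := by
  intro x
  by_cases hx : x ∈ K.U
  · have h1 : ContMDiffOn (𝓡∂ n) ((𝓡∂ n).prod 𝓘(ℝ, ℝ)) ∞ (fun x => (K.pr x, χ (K.t x))) K.U :=
      K.contMDiffOn_pr.prodMk (h.contDiff.contMDiff.comp_contMDiffOn K.contMDiffOn_t)
    have h2 := K.contMDiffOn_κ.comp h1 fun x hx => by
      have := h.apply_mem hδ hδb (K.t_mem hx)
      exact ⟨mem_univ _, hδ.le.trans this.1, this.2⟩
    exact (h2.congr fun z hz => slide_of_mem hz).contMDiffAt (K.isOpen_U.mem_nhds hx)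
  · exact contMDiffAt_id.congr_of_eventuallyEq (eventually_slide_eq hCc h.apply_far hx)

lemma isEmbedding_slide [T2Space M] (hCc : IsCompact C) : IsEmbedding (K.slide χ) := by
  have hw := K.width_pos
  refine (leftInverse_slide h hδ hδb).isEmbedding
    (continuous_slide hCc (fun s hs => ?_) (h.contDiff_inv.continuous.max continuous_const)
      fun s hs => ⟨le_max_right _ _, max_lt ?_ hw⟩)
    (contMDiff_slide h hδ hδb hCc).continuous
  · rw [h.inv_far hs, max_eq_left (by linarith)]
  · rw [← h.inv_far (r := K.width) (by linarith)]
    exact h.inv_strictMono hs.2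

/-- In a collar chart, `slide χ` acts on the zeroth coordinate only. -/
lemma IsCollarChart.extend_slide {e : OpenPartialHomeomorph M (EuclideanHalfSpace n)}
    (he : K.IsCollarChart e) {x : M} (hx : x ∈ e.source) : K.slide χ x ∈ e.source ∧
      e.extend (𝓡∂ n) (K.slide χ x) =
        setZero (χ (e.extend (𝓡∂ n) x 0)) (e.extend (𝓡∂ n) x) := by
  have hxU := he.source_subset hx
  have h1 := h.apply_mem hδ hδb (K.t_mem hxU)
  have h2 : χ (K.t x) ∈ Ico 0 K.width := ⟨hδ.le.trans h1.1, h1.2⟩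
  have h3 := he.pr_mem hx
  rw [slide_of_mem hxU, he.extend_κ (K.pr_mem hxU) h3 h2, he.extend_pr hx, setZero_setZero,
    he.extend_zero hx]
  exact ⟨he.κ_mem (K.pr_mem hxU) h3 h2, rfl⟩

/-- The differential of the slide, in a collar chart. -/
lemma IsCollarChart.vecOf_mfderiv_slide [T2Space M] (hCc : IsCompact C)
    {e : OpenPartialHomeomorph M (EuclideanHalfSpace n)} (he : K.IsCollarChart e) {x : M}
    (hx : x ∈ e.source) (v : TangentSpace (𝓡∂ n) x) :
    vecOf e (K.slide χ x) (mfderiv (𝓡∂ n) (𝓡∂ n) (K.slide χ) x v) =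
      scaleZero (deriv χ (e.extend (𝓡∂ n) x 0)) (vecOf e x v) := by
  have hA := he.mem_maximalAtlas
  have h1 := mfderiv_comp x (mdifferentiableAt_extend hA (he.extend_slide h hδ hδb hx).1)
    ((contMDiff_slide h hδ hδb hCc).mdifferentiableAt (by simp) (x := x))
  have hF := hasFDerivAt_setZero_comp (y := e.extend (𝓡∂ n) x)
    ((h.contDiff.differentiable (by simp)) (e.extend (𝓡∂ n) x 0)).hasDerivAt
  have h2 := mfderiv_comp x hF.differentiableAt.mdifferentiableAt (mdifferentiableAt_extend hA hx)
  have h3 : e.extend (𝓡∂ n) ∘ K.slide χ =ᶠ[𝓝 x]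
      (fun z : Coord n => setZero (χ (z 0)) z) ∘ e.extend (𝓡∂ n) := by
    filter_upwards [e.open_source.mem_nhds hx] with z hz
    exact (he.extend_slide h hδ hδb hz).2
  rw [h3.mfderiv_eq, h2, mfderiv_eq_fderiv, hF.fderiv] at h1
  exact (congrArg (fun L : Coord n →L[ℝ] Coord n => L v) h1).symm

variable (hC : IsBoundaryComponent n C) {g : RMetric n ∞ M}
  (hR : ∀ x : M, 0 ≤ g.scalarCurvature x) {lam lam' ε : ℝ} [T2Space M] (hCc : IsCompact C)
include hC hR hCc

/-- The original manifold embeds isometrically, onto the complement of the new collar. -/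
lemma extField_slide (x : M) (v w : TangentSpace (𝓡∂ n) x) :
    K.extField g ζ δ lam (K.slide χ x) (mfderiv (𝓡∂ n) (𝓡∂ n) (K.slide χ) x v)
      (mfderiv (𝓡∂ n) (𝓡∂ n) (K.slide χ) x w) = g.inner x v w := by
  by_cases hx : x ∈ K.U
  · obtain ⟨e, he, hxe⟩ := K.exists_isCollarChart_of_mem hC hx
    obtain ⟨h1, h2⟩ := he.extend_slide h hδ hδb hxe
    have h3 := h.apply_mem hδ hδb (K.t_mem hx)
    rw [← he.extend_zero hxe] at h3
    rw [extField_apply hR h hδ hδb he h1, he.vecOf_mfderiv_slide h hδ hδb hCc hxe,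
      he.vecOf_mfderiv_slide h hδ hδb hCc hxe, h2,
      bil_shiftedMetric_of_ge h hδ hδb (by rw [setZero_zero]; exact h3.1), setZero_zero,
      h.left_inv, setZero_setZero, setZero_self, scaleZero_scaleZero,
      scaleZero_scaleZero, h.deriv_inv_mul, scaleZero_one, scaleZero_one]
    exact (apply_eq_bil g.inner he.mem_maximalAtlas hxe v w).symm
  · have hev := eventually_slide_eq hCc h.apply_far hx
    have hid : K.slide χ =ᶠ[𝓝 x] id := hev
    have h1 := hid.mfderiv_eq (I := 𝓡∂ n) (I' := 𝓡∂ n)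
    rw [mfderiv_id] at h1
    have h2 : ∀ v : TangentSpace (𝓡∂ n) x,
        (mfderiv (𝓡∂ n) (𝓡∂ n) (K.slide χ) x v : Coord n) = (v : Coord n) := fun v =>
      congrArg (fun L : Coord n →L[ℝ] Coord n => L v) h1
    have h3 := slide_of_notMem (χ := χ) hx
    refine (field_congr (K.extField g ζ δ lam) h3 _ _).trans ?_
    rw [extField_of_notMem hx]
    exact congrArg₂ (fun a b : Coord n => g.inner x (a : TangentSpace (𝓡∂ n) x)
      (b : TangentSpace (𝓡∂ n) x)) (h2 v) (h2 w)

end Collar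

end

/-! ### The extension and the length of the collar -/

section

open Set Filter Topology LocalRiem Chart

variable {n : ℕ} [NeZero n] {M : Type*} [TopologicalSpace M] [ChartedSpace (EuclideanHalfSpace n) M]
  [IsManifold (𝓡∂ n) ∞ M]

namespace Collar

variable {C : Set M} {K : Collar n C} {χ ζ : ℝ → ℝ} {δ : ℝ}
  (h : IsShift K.width δ χ ζ) (hδ : 0 < δ) (hδb : 20 * δ < K.width)
include h hδ hδb

lemma t_slide_ge {x : M} (hx : K.slide χ x ∈ K.U) : δ ≤ K.t (K.slide χ x) := by
  have hxU := (slide_mem_U_iff h hδ hδb).1 hx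
  rw [(slide_mem_U h hδ hδb hxU).2.2]
  exact (h.apply_mem hδ hδb (K.t_mem hxU)).1

lemma notMem_slide (x : M) : K.slide χ x ∉ C := fun hx => by
  have := t_slide_ge h hδ hδb (K.subset_U hx)
  rw [K.t_of_mem hx] at this
  linarith

/-- The region not covered by the interior of the embedded manifold is the closed collar of
width `δ`. -/
lemma compl_slide_image : (K.slide χ '' Cᶜ)ᶜ = {x | x ∈ K.U ∧ K.t x ≤ δ} := by
  ext x
  constructor
  · intro hx
    have hxU : x ∈ K.U := by
      by_contra hxU
      exact hx ⟨x, fun hxC => hxU (K.subset_U hxC), slide_of_notMem hxU⟩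
    refine ⟨hxU, ?_⟩
    by_contra! hlt
    have hs := h.inv_mem hδ hδb ⟨hlt.le, (K.t_mem hxU).2⟩
    refine hx ⟨K.κ (K.pr x, ζ (K.t x)), fun hmem => ?_, ?_⟩
    · have h1 := K.t_of_mem hmem
      rw [K.t_κ (K.pr_mem hxU) hs] at h1
      have h2 := h.right_inv (K.t x)
      rw [h1, h.apply_zero hδ hδb] at h2
      linarith
    · rw [slide_κ (K.pr_mem hxU) hs, h.right_inv, K.κ_pr_t hxU]
  · rintro ⟨hxU, ht⟩ ⟨z, hz, rfl⟩
    have hzU := (slide_mem_U_iff h hδ hδb).1 hxU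
    rw [(slide_mem_U h hδ hδb hzU).2.2, ← h.apply_zero hδ hδb, h.strictMono.le_iff_le] at ht
    have h0 : K.t z = 0 := le_antisymm ht (K.t_mem hzU).1
    have h1 := K.κ_pr_t hzU
    rw [h0, K.κ_zero] at h1
    exact hz (h1 ▸ K.pr_mem hzU)

/-- The slide fixes the other boundary components. -/
lemma boundary_eq_slide (hC : IsBoundaryComponent n C) :
    (𝓡∂ n).boundary M = K.slide χ '' ((𝓡∂ n).boundary M \ C) ∪ C := by
  have hfix : ∀ x ∈ (𝓡∂ n).boundary M \ C, K.slide χ x = x := fun x hx =>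
    slide_of_notMem fun hxU => hx.2 (K.mem_of_boundary hxU hx.1)
  rw [EqOn.image_eq (f₂ := id) hfix, image_id, sdiff_union_of_subset hC.subset]

omit h in
/-- The new collar is parametrized by `Φ (p, τ) = κ (p, δ (1 - τ))`, with inverse `x ↦ (pr x, 1 -
t x / δ)`. -/
lemma exists_parametrization : ∃ (Φ : M × ℝ → M) (Ψ : M → M × ℝ),
    ContMDiffOn ((𝓡∂ n).prod 𝓘(ℝ, ℝ)) (𝓡∂ n) ∞ Φ (C ×ˢ Icc (0 : ℝ) 1) ∧
    ContMDiffOn (𝓡∂ n) ((𝓡∂ n).prod 𝓘(ℝ, ℝ)) ∞ Ψ {x | x ∈ K.U ∧ K.t x ≤ δ} ∧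
    MapsTo Φ (C ×ˢ Icc (0 : ℝ) 1) {x | x ∈ K.U ∧ K.t x ≤ δ} ∧
    MapsTo Ψ {x | x ∈ K.U ∧ K.t x ≤ δ} (C ×ˢ Icc (0 : ℝ) 1) ∧
    InvOn Ψ Φ (C ×ˢ Icc (0 : ℝ) 1) {x | x ∈ K.U ∧ K.t x ≤ δ} ∧
    (∀ p, Φ (p, 0) = K.κ (p, δ)) ∧ C = Φ '' (C ×ˢ {(1 : ℝ)}) := by
  have hs : ∀ {τ : ℝ}, τ ∈ Icc (0 : ℝ) 1 → δ * (1 - τ) ∈ Ico 0 K.width ∧ δ * (1 - τ) ≤ δ := by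
    intro τ hτ
    have h1 : 0 ≤ 1 - τ := by linarith [hτ.2]
    have h2 : δ * (1 - τ) ≤ δ * 1 := mul_le_mul_of_nonneg_left (by linarith [hτ.1]) hδ.le
    exact ⟨⟨mul_nonneg hδ.le h1, by linarith⟩, by linarith⟩
  refine ⟨fun q => K.κ (q.1, δ * (1 - q.2)), fun x => (K.pr x, 1 - K.t x / δ), ?_, ?_, ?_, ?_,
    ⟨?_, ?_⟩, fun p => by simp, ?_⟩
  · have h1 : ContMDiff 𝓘(ℝ, ℝ) 𝓘(ℝ, ℝ) ∞ fun τ : ℝ => δ * (1 - τ) := by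
      rw [contMDiff_iff_contDiff]; fun_prop
    exact K.contMDiffOn_κ.comp (contMDiff_fst.prodMk (h1.comp contMDiff_snd)).contMDiffOn
      fun q hq => ⟨mem_univ _, (hs hq.2).1⟩
  · have h1 : ContMDiff 𝓘(ℝ, ℝ) 𝓘(ℝ, ℝ) ∞ fun s : ℝ => 1 - s / δ := by
      rw [contMDiff_iff_contDiff]; fun_prop
    exact (K.contMDiffOn_pr.prodMk (h1.comp_contMDiffOn K.contMDiffOn_t)).mono fun x hx => hx.1
  · intro q hq
    refine ⟨K.κ_mem hq.1 (hs hq.2).1, ?_⟩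
    rw [K.t_κ hq.1 (hs hq.2).1]
    exact (hs hq.2).2
  · rintro x ⟨hx, ht⟩
    have h1 : K.t x / δ ≤ 1 := (div_le_one hδ).2 ht
    have h2 : 0 ≤ K.t x / δ := div_nonneg (K.t_mem hx).1 hδ.le
    exact ⟨K.pr_mem hx, by linarith, by linarith⟩
  · rintro ⟨p, τ⟩ ⟨hp, hτ⟩
    simp only [K.pr_κ hp (hs hτ).1, K.t_κ hp (hs hτ).1]
    rw [mul_div_cancel_left₀ _ hδ.ne', sub_sub_cancel]
  · rintro x ⟨hx, -⟩
    simp only [sub_sub_cancel]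
    rw [mul_div_cancel₀ _ hδ.ne', K.κ_pr_t hx]
  · ext p
    constructor
    · exact fun hp => ⟨(p, 1), ⟨hp, rfl⟩, by simp [K.κ_zero]⟩
    · rintro ⟨⟨q, τ⟩, ⟨hq, hτ⟩, rfl⟩
      have : δ * (1 - τ) = 0 := by rw [show τ = 1 from hτ, sub_self, mul_zero]
      change K.κ (q, δ * (1 - τ)) ∈ C
      rw [this, K.κ_zero]
      exact hq

variable (hC : IsBoundaryComponent n C) {g : RMetric n ∞ M}
  (hR : ∀ x : M, 0 ≤ g.scalarCurvature x) {lam lam' ε : ℝ}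
  (hgood : ∀ p ∈ C, ∃ e, K.IsCollarChart e ∧ p ∈ e.source ∧
    IsGoodCollar lam lam' ε δ (comps g.inner e) (e.extend (𝓡∂ n) p))
  [T2Space M] (hCc : IsCompact C)

/-- The given manifold, moved inward along the collar, together with the new metric, is an
extension beyond `C` by a collar. -/
theorem isCollarExtension : IsCollarExtension g C (extMetric hC hR h hδ hδb hgood hCc)
    (K.slide χ) C where
  contMDiff := contMDiff_slide h hδ hδb hCc
  isometric := extField_slide h hδ hδb hC hR hCc
  injective_mfderiv x := by
    rw [injective_iff_map_eq_zero]
    intro v hv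
    by_contra hv0
    have h1 := extField_slide (lam := lam) h hδ hδb hC hR hCc x v v
    rw [hv] at h1
    have h2 := g.pos x v hv0
    rw [← h1, map_zero] at h2
    exact lt_irrefl _ h2
  isEmbedding := isEmbedding_slide h hδ hδb hCc
  isBoundaryComponent := hC
  disjoint_range := by
    rw [Set.disjoint_right]
    rintro _ ⟨x, rfl⟩
    exact notMem_slide h hδ hδb x
  boundary_eq := boundary_eq_slide h hδ hδb hC
  exists_collar := by
    obtain ⟨Φ, Ψ, h1, h2, h3, h4, h5, h6, h7⟩ := K.exists_parametrization hδ hδb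
    rw [compl_slide_image h hδ hδb]
    refine ⟨Φ, Ψ, h1, h2, h3, h4, h5, fun p hp => ?_, h7⟩
    rw [h6, slide_of_mem_boundaryComponent hp, h.apply_zero hδ hδb]

omit h hδ in
/-- In a collar chart, the collar lines are the lines in the direction of the zeroth axis. -/
lemma IsCollarChart.vecOf_mfderiv_κ {e : OpenPartialHomeomorph M (EuclideanHalfSpace n)}
    (he : K.IsCollarChart e) {p : M} (hp : p ∈ C) (hpe : p ∈ e.source) {s : ℝ} (hs : s ∈ Ioo 0 δ) :
    vecOf e (K.κ (p, s)) (mfderiv 𝓘(ℝ, ℝ) (𝓡∂ n) (fun s : ℝ => K.κ (p, s)) s (1 : ℝ)) =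
      stdVec 0 := by
  have hδ : 0 < δ := hs.1.trans hs.2
  have hnhds : Ioo 0 K.width ∈ 𝓝 s := Ioo_mem_nhds hs.1 (by linarith [hs.2])
  have h0 : ContMDiffOn 𝓘(ℝ, ℝ) (𝓡∂ n) ∞ (fun s : ℝ => K.κ (p, s)) (Ioo 0 K.width) :=
    K.contMDiffOn_κ.comp (contMDiff_const.prodMk contMDiff_id).contMDiffOn
      fun s hs => ⟨mem_univ _, hs.1.le, hs.2⟩
  have hmem := he.κ_mem hp hpe ⟨hs.1.le, hs.2.trans (show δ < K.width by linarith)⟩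
  have h1 := mfderiv_comp s (mdifferentiableAt_extend he.mem_maximalAtlas hmem)
    ((h0.contMDiffAt hnhds).mdifferentiableAt (by simp))
  have h2 : e.extend (𝓡∂ n) ∘ (fun s : ℝ => K.κ (p, s)) =ᶠ[𝓝 s]
      fun s => e.extend (𝓡∂ n) p + (s - e.extend (𝓡∂ n) p 0) • stdVec 0 := by
    filter_upwards [hnhds] with r hr
    rw [Function.comp_apply, he.extend_κ hp hpe ⟨hr.1.le, hr.2⟩]
    rfl
  have h3 : HasFDerivAt (fun s => e.extend (𝓡∂ n) p + (s - e.extend (𝓡∂ n) p 0) • stdVec 0)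
      (ContinuousLinearMap.toSpanSingleton ℝ (stdVec 0 : Coord n)) s := by
    have := (((hasDerivAt_id' s).sub_const (e.extend (𝓡∂ n) p 0)).smul_const
      (stdVec 0 : Coord n)).const_add (e.extend (𝓡∂ n) p)
    rw [one_smul] at this
    simpa using this.hasFDerivAt
  rw [h2.mfderiv_eq, mfderiv_eq_fderiv, h3.fderiv] at h1
  refine (congrArg (fun L : ℝ →L[ℝ] Coord n => L 1) h1).symm.trans ?_
  simp

/-- The collar lines of the new collar are short. -/
theorem riemDist_slide_le (hε : 0 < ε) {p : M} (hp : p ∈ C) :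
    (extMetric hC hR h hδ hδb hgood hCc).riemDist p (K.slide χ p) ≤ ENNReal.ofReal ε := by
  set g' := extMetric hC hR h hδ hδb hgood hCc with hg'
  let _ : Bundle.RiemannianBundle (fun x : M => TangentSpace (𝓡∂ n) x) := ⟨g'.toRiemannianMetric⟩
  change Manifold.riemannianEDist (𝓡∂ n) p (K.slide χ p) ≤ _
  obtain ⟨e, he, hpe, hgd⟩ := hgood p hp
  have hy := apply_mem_target (n := n) hpe
  have hy0 : e.extend (𝓡∂ n) p 0 = 0 := by rw [he.extend_zero hpe, K.t_of_mem hp]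
  rw [slide_of_mem_boundaryComponent hp, h.apply_zero hδ hδb]
  have hγ : ContMDiffOn 𝓘(ℝ, ℝ) (𝓡∂ n) 1 (fun s : ℝ => K.κ (p, s)) (Icc 0 δ) :=
    (K.contMDiffOn_κ.comp (contMDiff_const.prodMk contMDiff_id).contMDiffOn
      fun s hs => ⟨mem_univ _, hs.1, hs.2.trans_lt (show δ < K.width by linarith)⟩).of_le
      ENat.LEInfty.out
  refine (Manifold.riemannianEDist_le_pathELength hγ (K.κ_zero p) rfl hδ.le).trans ?_
  rw [Manifold.pathELength_eq_lintegral_mfderiv_Ioo]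
  have hb : ∀ s ∈ Ioo 0 δ,
      ‖mfderiv 𝓘(ℝ, ℝ) (𝓡∂ n) (fun s : ℝ => K.κ (p, s)) s (1 : ℝ)‖ₑ ≤ ENNReal.ofReal (ε / δ) := by
    intro s hs
    have hsw : s ∈ Ico 0 K.width := ⟨hs.1.le, hs.2.trans (by linarith)⟩
    set v : TangentSpace (𝓡∂ n) (K.κ (p, s)) :=
      mfderiv 𝓘(ℝ, ℝ) (𝓡∂ n) (fun s : ℝ => K.κ (p, s)) s (1 : ℝ) with hv
    -- The squared speed of the collar line is the component `0 0` of the collar family, which is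
    -- less than `ε² / δ²`.
    have h1 : ‖v‖ ^ 2 = g'.inner (K.κ (p, s)) v v := by
      rw [← real_inner_self_eq_norm_sq]
      rfl
    have h2 : g'.inner (K.κ (p, s)) v v =
        collarFamily lam δ (comps g.inner e) (setZero (δ - s) (e.extend (𝓡∂ n) p)) 0 0 := by
      refine (extField_apply hR h hδ hδb he (he.κ_mem hp hpe hsw) v v).trans ?_
      rw [he.vecOf_mfderiv_κ hδb hp hpe hs, he.extend_κ hp hpe hsw,
        bil_shiftedMetric_of_le h hδ hδb (by rw [setZero_zero]; exact hs.1.le)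
          (by rw [setZero_zero]; exact hs.2.le), setZero_zero, setZero_setZero,
        scaleZero_stdVec_zero, bil_smul_left, bil_smul_right, bil_stdVec]
      ring
    have h3 := hgd.length (δ - s) ⟨by linarith [hs.2], by linarith [hs.1]⟩
    rw [← h2, ← h1, ← mul_pow] at h3
    have h4 := abs_lt_of_sq_lt_sq h3 hε.le
    rw [← ofReal_norm]
    refine ENNReal.ofReal_le_ofReal ((le_div_iff₀ hδ).2 ?_)
    have := le_abs_self (δ * ‖v‖)
    linarith
  refine (MeasureTheory.setLIntegral_mono' measurableSet_Ioo hb).trans ?_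
  rw [MeasureTheory.setLIntegral_const, Real.volume_Ioo, sub_zero,
    ← ENNReal.ofReal_mul (by positivity), div_mul_cancel₀ _ hδ.ne']

end Collar

end

end

/-! ### Extension by a collar -/

theorem mainTheorem2 (n : ℕ) [NeZero n] (hn : 3 ≤ n)
    (M : Type u) [TopologicalSpace M] [T2Space M] [SecondCountableTopology M]
    [ChartedSpace (EuclideanHalfSpace n) M] [IsManifold (𝓡∂ n) ∞ M]
    (g : RMetric n ∞ M) (hR : ∀ x : M, 0 ≤ g.scalarCurvature x)
    (C : Set M) (hC : IsBoundaryComponent n C) (hCc : IsCompact C)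
    (θ₀ : ℝ) (hθ₀ : 0 < θ₀) (hθ : ∀ x ∈ C, θ₀ ≤ g.meanCurvature x)
    (ε : ℝ) (hε : 0 < ε) :
    ∃ (M' : Type u) (_ : TopologicalSpace M') (_ : T2Space M') (_ : SecondCountableTopology M')
      (_ : ChartedSpace (EuclideanHalfSpace n) M') (_ : IsManifold (𝓡∂ n) ∞ M')
      (g' : RMetric n 2 M') (φ : M → M') (S : Set M'),
      IsCollarExtension g C g' φ S ∧
      (∀ x : M', 0 ≤ g'.scalarCurvature x) ∧
      (∀ x ∈ S, ∀ v : TangentSpace (𝓡∂ n) x, IsTangentToBoundary x v → v ≠ 0 →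
        θ₀ / (2 * ((n : ℝ) - 1)) * g'.inner x v v < g'.secondFundamentalForm x v v) ∧
      (∀ x ∈ S, ∃ p ∈ C, g'.riemDist x (φ p) < ENNReal.ofReal ε) ∧
      (∀ p ∈ C, ∃ x ∈ S, g'.riemDist x (φ p) < ENNReal.ofReal ε) := by
  have hn1 : (0 : ℝ) < (n : ℝ) - 1 := by
    have : (3 : ℝ) ≤ n := by exact_mod_cast hn
    linarith
  obtain ⟨K⟩ := exists_collar hC hCc
  -- Any constant between `θ₀ / (2 (n - 1))` and `θ₀ / (n - 1)` can be prescribed as the slope.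
  have hlam : θ₀ / (2 * ((n : ℝ) - 1)) < 3 * θ₀ / (4 * ((n : ℝ) - 1)) := by
    rw [div_lt_div_iff₀ (by positivity) (by positivity)]
    nlinarith [mul_pos hθ₀ hn1]
  have hmean : ∀ p ∈ C, 3 * θ₀ / (4 * ((n : ℝ) - 1)) * ((n : ℝ) - 1) < g.meanCurvature p := by
    intro p hp
    have h1 : 3 * θ₀ / (4 * ((n : ℝ) - 1)) * ((n : ℝ) - 1) = 3 / 4 * θ₀ := by field_simp
    rw [h1]
    linarith [hθ p hp]
  obtain ⟨δ₀, hδ₀, hshift⟩ := exists_isShift K.width_pos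
  obtain ⟨δ, hgood, hδ, hδb, hδlt⟩ : ∃ δ, (∀ p ∈ C, ∃ e, K.IsCollarChart e ∧
      p ∈ e.source ∧ LocalRiem.IsGoodCollar (3 * θ₀ / (4 * ((n : ℝ) - 1)))
        (θ₀ / (2 * ((n : ℝ) - 1))) (ε / 2) δ (Chart.comps g.inner e) (e.extend (𝓡∂ n) p)) ∧
      0 < δ ∧ 20 * δ < K.width ∧ δ < δ₀ := by
    have h1 := Collar.eventually_good (K := K) hC hCc hR (half_pos hε) hlam hmean
    have h2 : ∀ᶠ δ in nhds (0 : ℝ), 20 * δ < K.width ∧ δ < δ₀ := by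
      have := K.width_pos
      filter_upwards [gt_mem_nhds (show (0 : ℝ) < K.width / 20 by positivity),
        gt_mem_nhds hδ₀] with δ h3 h4
      exact ⟨by linarith, h4⟩
    obtain ⟨δ, ⟨h4, h5, h6⟩, h7⟩ :=
      ((h1.and (h2.filter_mono nhdsWithin_le_nhds)).and self_mem_nhdsWithin).exists
    exact ⟨δ, h4, h7, h5, h6⟩
  obtain ⟨χ, ζ, hζ⟩ := hshift δ ⟨hδ, hδlt⟩
  have hdist : ∀ p ∈ C, (Collar.extMetric hC hR hζ hδ hδb hgood hCc).riemDist p (K.slide χ p) <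
      ENNReal.ofReal ε := fun p hp =>
    (Collar.riemDist_slide_le hζ hδ hδb hC hR hgood hCc (half_pos hε) hp).trans_lt
      ((ENNReal.ofReal_lt_ofReal_iff hε).2 (half_lt_self hε))
  -- The extended manifold is `M` itself, with the new metric; the given manifold is moved inward,
  -- and the new boundary component is the old set `C`.
  exact ⟨M, inferInstance, inferInstance, inferInstance, inferInstance, inferInstance,
    Collar.extMetric hC hR hζ hδ hδb hgood hCc, K.slide χ, C,
    Collar.isCollarExtension hζ hδ hδb hC hR hgood hCc,
    Collar.scalarCurvature_extMetric hC hR hζ hδ hδb hgood hCc,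
    fun x hx v hv hv0 =>
      Collar.secondFundamentalForm_extMetric hC hR hζ hδ hδb hgood hCc hx hv hv0,
    fun x hx => ⟨x, hx, hdist x hx⟩, fun p hp => ⟨p, hp, hdist p hp⟩⟩
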